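/- Let $k$ be an algebraically closed field of characteristic zero, $G_0=\mathrm{Spec}\,\mathcal O(G_0)$ an affine algebraic group over $k$ ($\mathcal O(G_0)$ a finitely generated commutative Hopf algebra), and $\mathfrak g=\mathfrak g_0\oplus\mathfrak g_1$ a finite-dimensional Lie superalgebra over $k$ such that $(G_0,\mathfrak g)$ is an algebraic super Harish-Chandra pair: $\mathfrak g_0$ is identified, as a Lie algebra, with $\mathrm{Lie}(G_0)$ (the left invariant derivations of $\mathcal O(G_0)$), and $G_0$ acts rationally on $\mathfrak g$ by automorphisms of Lie superalgebras, written $g.X$, so that on $\mathfrak g_0$ the action is the adjoint representation and its differential is the bracket $\mathfrak g_0\times\mathfrak g\to\mathfrak g$. The action extends to $\mathcal U(\mathfrak g)$ by algebra automorphisms. For $U\subset G_0$ open let $$\mathcal O_G(U)=\mathrm{Hom}_{\mathcal U(\mathfrak g_0)}\big(\mathcal U(\mathfrak g),\mathcal O_{G_0}(U)\big),\qquad f_1\cdot f_2=m\circ(f_1\otimes f_2)\circ\Delta_{\mathcal U(\mathfrak g)},$$ where $\mathcal U(\mathfrak g_0)$ acts on $\mathcal U(\mathfrak g)$ by left multiplication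 and on $\mathcal O_{G_0}(U)$ by left invariant differential operators, $\otimes$ of maps follows the Koszul sign rule, a map is even (odd) if it vanishes on the odd (even) part of $\mathcal U(\mathfrak g)$, and restrictions are induced by those of $\mathcal O_{G_0}$. Put $\mathcal O(G)=\mathcal O_G(G_0)=\mathrm{Hom}_{\mathcal U(\mathfrak g_0)}(\mathcal U(\mathfrak g),\mathcal O(G_0))$. Then: (1) $\mathcal O(G)$ is a commutative superalgebra and carries a structure of Hopf superalgebra whose comultiplication $\mu^*$, antipode $i^*$ and counit $e^*$ satisfy, for $f\in\mathcal O(G)$, $X,Y\in\mathcal U(\mathfrak g)$ and all points $g,h$ of $G_0$ with values in any commutative $k$-algebra, $$[\mu^*(f)(X,Y)](g,h)=\big[f\big((h^{-1}.X)\,Y\big)\big](gh),\qquad [i^*(f)(X)](g^{-1})=\big[f(g^{-1}.\overline X)\big](g),\qquad e^*(f)=[f(1)](e).$$ Here $\overline X$ is the antipode of the Hopf superalgebra $\mathcal U(\mathfrak g)$, an element $\sum a_i\otimes b_i\in\mathcal O(G)\otimes\mathcal O(G)$ is regarded as the map $\mathcal U(\mathfrak g)\otimes\mathcal U(\mathfrak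 g)\to\mathcal O(G_0)\otimes\mathcal O(G_0)$ with the Koszul sign rule, and $e$ is the identity of $G_0$. (2) $\mathcal O_G$ is the structure sheaf of the spectrum of $\mathcal O(G)$: let $\mathrm{Spec}\,\mathcal O(G)$ be the space $\mathrm{Spec}\,\mathcal O(G)_0$ with the sheaf of superalgebras whose sections are the functions $x\mapsto s(x)\in\mathcal O(G)_x$ that are locally fractions. There is an isomorphism of spaces with sheaves of superalgebras over $k$ $$(G_0,\mathcal O_G)\;\cong\;\mathrm{Spec}\,\mathcal O(G)$$ whose underlying homeomorphism sends $x\in G_0$ to the prime ideal $\{f\in\mathcal O(G)_0: f(1)\in x\}$ and which on sections is compatible with the canonical maps from $\mathcal O(G)$. Hence $(G_0,\mathcal O_G)$ is an affine supergroup scheme, namely the spectrum of the commutative Hopf superalgebra $\mathcal O(G)$. -/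

import Mathlib

open scoped TensorProduct DirectSum
open CategoryTheory TopologicalSpace Opposite AlgebraicGeometry

universe u

noncomputable section

set_option linter.unusedSectionVars false

namespace SHCP

section Parity

variable {k M : Type u} [Field k] [AddCommGroup M] [Module k M]

/-- The grading by `ZMod 2` attached to a linear involution `P` (characteristic zero):
the piece of parity `i` is the eigenspace of `P` for the eigenvalue `(-1) ^ i`. -/
def parityGrading (P : M →ₗ[k] M) (i : ZMod 2) : Submodule k M where
  carrier := {m | P m = ((-1 : ℤˣ) ^ i) • m}
  add_mem' {a b} ha hb := by
    simp only [Set.mem_ofPred_eq] at *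
    rw [map_add, ha, hb, smul_add]
  zero_mem' := by simp
  smul_mem' c x hx := by
    simp only [Set.mem_ofPred_eq] at *
    rw [map_smul, hx, smul_comm]

theorem mem_parityGrading {P : M →ₗ[k] M} {i : ZMod 2} {m : M} :
    m ∈ parityGrading P i ↔ P m = ((-1 : ℤˣ) ^ i) • m := Iff.rfl

theorem mem_parityGrading_zero {P : M →ₗ[k] M} {m : M} :
    m ∈ parityGrading P 0 ↔ P m = m := by
  rw [mem_parityGrading, uzpow_zero, one_smul]

theorem mem_parityGrading_one {P : M →ₗ[k] M} {m : M} :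
    m ∈ parityGrading P 1 ↔ P m = -m := by
  rw [mem_parityGrading, uzpow_one, Units.neg_smul, one_smul]

theorem zmod_two_sum {N : Type u} [AddCommMonoid N] (f : ZMod 2 → N) :
    ∑ i, f i = f 0 + f 1 := Fin.sum_univ_two f

theorem zmod_two_cases (i : ZMod 2) : i = 0 ∨ i = 1 := by
  revert i; decide

variable [CharZero k]

/-- The component of parity `i` of `m`, namely `(m + (-1) ^ i P m) / 2`. -/
def parityProj (P : M →ₗ[k] M) (i : ZMod 2) : M →ₗ[k] M :=
  (2⁻¹ : k) • (LinearMap.id + ((-1 : ℤˣ) ^ i) • P)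

theorem parityProj_apply (P : M →ₗ[k] M) (i : ZMod 2) (m : M) :
    parityProj P i m = (2⁻¹ : k) • (m + ((-1 : ℤˣ) ^ i) • P m) := rfl

theorem parityProj_mem {P : M →ₗ[k] M} (hP : ∀ m, P (P m) = m) (i : ZMod 2) (m : M) :
    parityProj P i m ∈ parityGrading P i := by
  rw [mem_parityGrading, parityProj_apply, map_smul, smul_comm, map_add, Units.smul_def,
    Units.smul_def, map_zsmul, hP, smul_add ((((-1 : ℤˣ) ^ i : ℤˣ)) : ℤ), smul_smul, ← Units.val_mul,
    ← uzpow_add, CharTwo.add_self_eq_zero, uzpow_zero, Units.val_one, one_smul, add_comm]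

/-- In characteristic zero a linear involution decomposes the space into its two eigenspaces. -/
@[reducible] def parityDecomposition (P : M →ₗ[k] M) (hP : ∀ m, P (P m) = m) :
    DirectSum.Decomposition (parityGrading P) :=
  DirectSum.Decomposition.ofLinearMap _
    (∑ i : ZMod 2, DirectSum.lof k (ZMod 2) (fun i => parityGrading P i) i ∘ₗ
      LinearMap.codRestrict (parityGrading P i) (parityProj P i) (parityProj_mem hP i))
    (by
      ext m
      simp only [LinearMap.comp_apply, LinearMap.sum_apply, map_sum, LinearMap.id_apply]
      simp only [DirectSum.coeLinearMap_lof, LinearMap.codRestrict_apply, parityProj_apply]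
      rw [zmod_two_sum, uzpow_zero, uzpow_one, one_smul, Units.neg_smul, one_smul, ← smul_add, ← sub_eq_add_neg,
        add_add_sub_cancel, ← two_smul k m, smul_smul, inv_mul_cancel₀ (two_ne_zero), one_smul])
    (by
      ext i x : 2
      obtain ⟨x, hx⟩ := x
      simp only [LinearMap.comp_apply, LinearMap.sum_apply, LinearMap.id_apply,
        DirectSum.coeLinearMap_lof]
      have h : ∀ j, LinearMap.codRestrict (parityGrading P j) (parityProj P j)
          (parityProj_mem hP j) x = if h : j = i then h ▸ ⟨x, hx⟩ else 0 := by
        intro j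
        apply Subtype.ext
        rw [LinearMap.codRestrict_apply, parityProj_apply, mem_parityGrading.1 hx, smul_smul,
          ← uzpow_add]
        split_ifs with hj
        · subst hj
          rw [CharTwo.add_self_eq_zero, uzpow_zero, one_smul, ← two_smul k x, smul_smul,
            inv_mul_cancel₀ (two_ne_zero), one_smul]
        · have : j + i = 1 := by clear * - hj; revert i j; decide
          rw [this, uzpow_one, Units.neg_smul, one_smul, add_neg_cancel, smul_zero]
          rfl
      rw [Finset.sum_eq_single i]
      · rw [h]; simp
      · intro j _ hj
        rw [h, dif_neg hj, map_zero]
      · simp)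

/-- The grading attached to an involutive algebra automorphism is an algebra grading. -/
@[reducible] def parityGradedAlgebra {R : Type u} [Ring R] [Algebra k R] (P : R →ₐ[k] R)
    (hP : ∀ m, P (P m) = m) : GradedAlgebra (parityGrading P.toLinearMap) where
  toDecomposition := parityDecomposition P.toLinearMap hP
  one_mem := by rw [mem_parityGrading_zero]; exact map_one P
  mul_mem i j a b ha hb := by
    rw [mem_parityGrading] at *
    simp only [AlgHom.toLinearMap_apply] at *
    rw [map_mul, ha, hb, smul_mul_smul_comm, uzpow_add]

end Parity

section LieSuperalgebra

/-- A Lie superalgebra structure on the super vector space `𝔤 = 𝓖 0 ⊕ 𝓖 1`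
over a field of characteristic zero. -/
class LieSuperalgebra (k : Type u) {𝔤 : Type u} [Field k] [AddCommGroup 𝔤] [Module k 𝔤]
    (𝓖 : ZMod 2 → Submodule k 𝔤) [DirectSum.Decomposition 𝓖] where
  bracket : 𝔤 →ₗ[k] 𝔤 →ₗ[k] 𝔤
  bracket_mem : ∀ {i j : ZMod 2} {x y : 𝔤}, x ∈ 𝓖 i → y ∈ 𝓖 j → bracket x y ∈ 𝓖 (i + j)
  bracket_skew : ∀ {i j : ZMod 2} {x y : 𝔤}, x ∈ 𝓖 i → y ∈ 𝓖 j →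
    bracket x y = -(((-1 : ℤˣ) ^ (i * j)) • bracket y x)
  bracket_jacobi : ∀ {i j : ZMod 2} {x y : 𝔤} (z : 𝔤), x ∈ 𝓖 i → y ∈ 𝓖 j →
    bracket x (bracket y z) =
      bracket (bracket x y) z + ((-1 : ℤˣ) ^ (i * j)) • bracket y (bracket x z)

variable (k : Type u) {𝔤 : Type u} [Field k] [CharZero k] [AddCommGroup 𝔤] [Module k 𝔤]
  (𝓖 : ZMod 2 → Submodule k 𝔤) [DirectSum.Decomposition 𝓖] [LieSuperalgebra k 𝓖]

/-- The even part `𝔤₀` of a Lie superalgebra. -/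
def EvenLie : Type u := ↥(𝓖 0)

instance : AddCommGroup (EvenLie k 𝓖) := inferInstanceAs (AddCommGroup ↥(𝓖 0))
instance : Module k (EvenLie k 𝓖) := inferInstanceAs (Module k ↥(𝓖 0))

/-- The inclusion `𝔤₀ → 𝔤`. -/
def EvenLie.incl : EvenLie k 𝓖 →ₗ[k] 𝔤 := (𝓖 0).subtype

theorem EvenLie.incl_injective : Function.Injective (EvenLie.incl k 𝓖) :=
  Subtype.val_injective

theorem EvenLie.incl_mem (x : EvenLie k 𝓖) : EvenLie.incl k 𝓖 x ∈ 𝓖 0 := Subtype.property _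

/-- The projection `𝔤 → 𝔤₀`. -/
def EvenLie.proj : 𝔤 →ₗ[k] EvenLie k 𝓖 :=
  DirectSum.component k (ZMod 2) (fun i => ↥(𝓖 i)) 0 ∘ₗ (DirectSum.decomposeLinearEquiv 𝓖).toLinearMap

instance : LieRing (EvenLie k 𝓖) where
  bracket x y := ⟨LieSuperalgebra.bracket 𝓖 (EvenLie.incl k 𝓖 x) (EvenLie.incl k 𝓖 y),
    LieSuperalgebra.bracket_mem x.2 y.2⟩
  add_lie x y z := EvenLie.incl_injective k 𝓖 <| by
    show LieSuperalgebra.bracket 𝓖 (EvenLie.incl k 𝓖 (x + y)) (EvenLie.incl k 𝓖 z) =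
      LieSuperalgebra.bracket 𝓖 (EvenLie.incl k 𝓖 x) (EvenLie.incl k 𝓖 z) +
      LieSuperalgebra.bracket 𝓖 (EvenLie.incl k 𝓖 y) (EvenLie.incl k 𝓖 z)
    rw [map_add, map_add, LinearMap.add_apply]
  lie_add x y z := EvenLie.incl_injective k 𝓖 <| by
    show LieSuperalgebra.bracket 𝓖 (EvenLie.incl k 𝓖 x) (EvenLie.incl k 𝓖 (y + z)) =
      LieSuperalgebra.bracket 𝓖 (EvenLie.incl k 𝓖 x) (EvenLie.incl k 𝓖 y) +
      LieSuperalgebra.bracket 𝓖 (EvenLie.incl k 𝓖 x) (EvenLie.incl k 𝓖 z)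
    rw [map_add, map_add]
  lie_self x := EvenLie.incl_injective k 𝓖 <| by
    show LieSuperalgebra.bracket 𝓖 (EvenLie.incl k 𝓖 x) (EvenLie.incl k 𝓖 x) = 0
    have h := LieSuperalgebra.bracket_skew (𝓖 := 𝓖) (EvenLie.incl_mem k 𝓖 x)
      (EvenLie.incl_mem k 𝓖 x)
    rw [mul_zero, uzpow_zero, one_smul, eq_neg_iff_add_eq_zero, ← two_smul k] at h
    exact (smul_eq_zero.1 h).resolve_left two_ne_zero
  leibniz_lie x y z := EvenLie.incl_injective k 𝓖 <| by
    have h := LieSuperalgebra.bracket_jacobi (𝓖 := 𝓖) (EvenLie.incl k 𝓖 z)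
      (EvenLie.incl_mem k 𝓖 x) (EvenLie.incl_mem k 𝓖 y)
    rw [mul_zero, uzpow_zero, one_smul] at h
    exact h

theorem EvenLie.incl_lie (x y : EvenLie k 𝓖) : EvenLie.incl k 𝓖 ⁅x, y⁆ =
    LieSuperalgebra.bracket 𝓖 (EvenLie.incl k 𝓖 x) (EvenLie.incl k 𝓖 y) := rfl

instance : LieAlgebra k (EvenLie k 𝓖) where
  lie_smul c x y := EvenLie.incl_injective k 𝓖 <| by
    rw [map_smul, EvenLie.incl_lie, EvenLie.incl_lie, map_smul, map_smul]

/-- The parity involution `x₀ + x₁ ↦ x₀ - x₁` of `𝔤`. -/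
def lieParity : 𝔤 →ₗ[k] 𝔤 :=
  DirectSum.toModule k (ZMod 2) 𝔤 (fun i => ((-1 : ℤˣ) ^ i) • (𝓖 i).subtype) ∘ₗ
    (DirectSum.decomposeLinearEquiv 𝓖).toLinearMap

variable {k} in
theorem lieParity_of_mem {i : ZMod 2} {x : 𝔤} (hx : x ∈ 𝓖 i) :
    lieParity k 𝓖 x = ((-1 : ℤˣ) ^ i) • x := by
  simp only [lieParity, LinearMap.comp_apply, LinearEquiv.coe_coe,
    DirectSum.decomposeLinearEquiv_apply]
  rw [DirectSum.decompose_of_mem 𝓖 hx, ← DirectSum.lof_eq_of k, DirectSum.toModule_lof]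
  rfl

end LieSuperalgebra

section Enveloping

variable (k : Type u) {𝔤 : Type u} [Field k] [CharZero k] [AddCommGroup 𝔤] [Module k 𝔤]
  (𝓖 : ZMod 2 → Submodule k 𝔤) [DirectSum.Decomposition 𝓖] [LieSuperalgebra k 𝓖]

/-- The relations `x y - (-1) ^ (|x| |y|) y x = [x, y]` defining `U(𝔤)`. -/
inductive EnvRel : TensorAlgebra k 𝔤 → TensorAlgebra k 𝔤 → Prop
  | lie_compat {i j : ZMod 2} {x y : 𝔤} (hx : x ∈ 𝓖 i) (hy : y ∈ 𝓖 j) :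
      EnvRel (TensorAlgebra.ι k x * TensorAlgebra.ι k y)
        (((-1 : ℤˣ) ^ (i * j)) • (TensorAlgebra.ι k y * TensorAlgebra.ι k x) +
          TensorAlgebra.ι k (LieSuperalgebra.bracket 𝓖 x y))

/-- The universal enveloping superalgebra `U(𝔤)`. -/
def Env : Type u := RingQuot (EnvRel k 𝓖)

instance : Ring (Env k 𝓖) := inferInstanceAs (Ring (RingQuot (EnvRel k 𝓖)))
instance : Algebra k (Env k 𝓖) := inferInstanceAs (Algebra k (RingQuot (EnvRel k 𝓖)))

/-- The quotient map from the tensor algebra. -/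
def Env.mk : TensorAlgebra k 𝔤 →ₐ[k] Env k 𝓖 := RingQuot.mkAlgHom k (EnvRel k 𝓖)

theorem Env.mk_surjective : Function.Surjective (Env.mk k 𝓖) :=
  RingQuot.mkAlgHom_surjective k (EnvRel k 𝓖)

/-- The canonical map `𝔤 → U(𝔤)`. -/
def Env.ι : 𝔤 →ₗ[k] Env k 𝓖 := (Env.mk k 𝓖).toLinearMap ∘ₗ TensorAlgebra.ι k

variable {k 𝓖} in
theorem Env.ι_mul_ι {i j : ZMod 2} {x y : 𝔤} (hx : x ∈ 𝓖 i) (hy : y ∈ 𝓖 j) :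
    Env.ι k 𝓖 x * Env.ι k 𝓖 y = ((-1 : ℤˣ) ^ (i * j)) • (Env.ι k 𝓖 y * Env.ι k 𝓖 x) +
      Env.ι k 𝓖 (LieSuperalgebra.bracket 𝓖 x y) := by
  have h := (show Env.mk k 𝓖 _ = Env.mk k 𝓖 _ from
    RingQuot.mkAlgHom_rel k (EnvRel.lie_compat (k := k) hx hy))
  simp only [Units.smul_def, map_add, map_mul, map_zsmul] at h ⊢
  exact h

section lift

variable {k 𝓖} {R : Type u} [Ring R] [Algebra k R]

/-- The universal property of `U(𝔤)`. -/
def Env.lift (f : 𝔤 →ₗ[k] R)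
    (hf : ∀ {i j : ZMod 2} {x y : 𝔤}, x ∈ 𝓖 i → y ∈ 𝓖 j →
      f x * f y = ((-1 : ℤˣ) ^ (i * j)) • (f y * f x) + f (LieSuperalgebra.bracket 𝓖 x y)) :
    Env k 𝓖 →ₐ[k] R :=
  RingQuot.liftAlgHom k ⟨TensorAlgebra.lift k f, by
    rintro _ _ ⟨hx, hy⟩
    simp only [Units.smul_def, map_add, map_mul, map_zsmul, TensorAlgebra.lift_ι_apply]
    exact hf hx hy⟩

@[simp] theorem Env.lift_ι (f : 𝔤 →ₗ[k] R) (hf) (x : 𝔤) :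
    Env.lift (𝓖 := 𝓖) f hf (Env.ι k 𝓖 x) = f x := by
  have h : Env.lift (𝓖 := 𝓖) f hf (Env.mk k 𝓖 (TensorAlgebra.ι k x)) =
      TensorAlgebra.lift k f (TensorAlgebra.ι k x) :=
    RingQuot.liftAlgHom_mkAlgHom_apply k _ _ _
  rw [TensorAlgebra.lift_ι_apply] at h
  exact h

end lift

variable {k 𝓖} in
/-- `U(𝔤)` is spanned by the iterated products of elements of `𝔤`. -/
theorem Env.induction_left {p : Env k 𝓖 → Prop} (one : p 1)
    (add : ∀ u v, p u → p v → p (u + v)) (smul : ∀ (c : k) u, p u → p (c • u))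
    (mul : ∀ {i : ZMod 2} {x : 𝔤} u, x ∈ 𝓖 i → p u → p (Env.ι k 𝓖 x * u)) (u : Env k 𝓖) :
    p u := by
  have mul' : ∀ (x : 𝔤) u, p u → p (Env.ι k 𝓖 x * u) := by
    intro x u hu
    classical
    induction x using DirectSum.Decomposition.inductionOn 𝓖 with
    | zero => rw [map_zero, zero_mul]; simpa using smul 0 1 one
    | homogeneous x => exact mul u x.2 hu
    | add x y hx hy => rw [map_add, add_mul]; exact add _ _ hx hy
  have key : ∀ t : TensorAlgebra k 𝔤, ∀ v, p v → p (Env.mk k 𝓖 t * v) := by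
    intro t
    induction t using TensorAlgebra.induction with
    | algebraMap r =>
      intro v hv
      rw [AlgHom.commutes, ← Algebra.smul_def]; exact smul r v hv
    | ι x => intro v hv; exact mul' x v hv
    | mul a b ha hb => intro v hv; rw [map_mul, mul_assoc]; exact ha _ (hb _ hv)
    | add a b ha hb => intro v hv; rw [map_add, add_mul]; exact add _ _ (ha _ hv) (hb _ hv)
  obtain ⟨t, rfl⟩ := Env.mk_surjective k 𝓖 u
  have := key t 1 one
  rwa [mul_one] at this

/-- The parity involution of `U(𝔤)`. -/
def Env.parity : Env k 𝓖 →ₐ[k] Env k 𝓖 :=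
  Env.lift (Env.ι k 𝓖 ∘ₗ lieParity k 𝓖) (fun {i j x y} hx hy => by
    simp only [LinearMap.comp_apply]
    rw [lieParity_of_mem 𝓖 hx, lieParity_of_mem 𝓖 hy,
      lieParity_of_mem 𝓖 (LieSuperalgebra.bracket_mem hx hy)]
    simp only [Units.smul_def, map_zsmul, smul_mul_smul_comm]
    rw [Env.ι_mul_ι hx hy]
    simp only [Units.smul_def, uzpow_add, Units.val_mul, smul_add, smul_smul]
    congr 2
    ring)

variable {k 𝓖} in
theorem Env.parity_ι {i : ZMod 2} {x : 𝔤} (hx : x ∈ 𝓖 i) :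
    Env.parity k 𝓖 (Env.ι k 𝓖 x) = ((-1 : ℤˣ) ^ i) • Env.ι k 𝓖 x := by
  rw [Env.parity, Env.lift_ι, LinearMap.comp_apply, lieParity_of_mem 𝓖 hx]
  simp only [Units.smul_def, map_zsmul]

theorem Env.parity_parity (u : Env k 𝓖) : Env.parity k 𝓖 (Env.parity k 𝓖 u) = u := by
  induction u using Env.induction_left with
  | one => simp
  | add u v hu hv => simp [hu, hv]
  | smul c u hu => simp [hu]
  | mul u hx hu =>
    rw [map_mul, map_mul, hu, Env.parity_ι hx]
    simp only [Units.smul_def, map_zsmul]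
    rw [Env.parity_ι hx]
    simp only [Units.smul_def, smul_smul, ← Units.val_mul, ← uzpow_add, CharTwo.add_self_eq_zero,
      uzpow_zero, Units.val_one, one_smul]

/-- The grading of `U(𝔤)` by parity. -/
def envGrading : ZMod 2 → Submodule k (Env k 𝓖) := parityGrading (Env.parity k 𝓖).toLinearMap

instance : GradedAlgebra (envGrading k 𝓖) :=
  parityGradedAlgebra (Env.parity k 𝓖) (Env.parity_parity k 𝓖)

variable {k 𝓖} in
theorem Env.ι_mem {i : ZMod 2} {x : 𝔤} (hx : x ∈ 𝓖 i) : Env.ι k 𝓖 x ∈ envGrading k 𝓖 i :=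
  Env.parity_ι hx

/-- The power `P ^ i` of the parity involution of `U(𝔤)`. -/
def Env.parityPow (i : ZMod 2) : Env k 𝓖 →ₗ[k] Env k 𝓖 :=
  if i = 0 then LinearMap.id else (Env.parity k 𝓖).toLinearMap

theorem Env.parityPow_zero : Env.parityPow k 𝓖 0 = LinearMap.id := if_pos rfl

theorem Env.parityPow_one : Env.parityPow k 𝓖 1 = (Env.parity k 𝓖).toLinearMap :=
  if_neg (by decide)

variable {k 𝓖} in
theorem Env.parityPow_of_mem {i j : ZMod 2} {u : Env k 𝓖} (hu : u ∈ envGrading k 𝓖 j) :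
    Env.parityPow k 𝓖 i u = ((-1 : ℤˣ) ^ (i * j)) • u := by
  rcases zmod_two_cases i with rfl | rfl
  · rw [Env.parityPow_zero, zero_mul, uzpow_zero, one_smul]; rfl
  · rw [Env.parityPow_one, one_mul]; exact hu

variable {k 𝓖} in
theorem Env.one_tmul_mul {i : ZMod 2} {y : Env k 𝓖} (hy : y ∈ envGrading k 𝓖 i) (a b : Env k 𝓖) :
    GradedTensorProduct.tmul k (𝒜 := envGrading k 𝓖) (ℬ := envGrading k 𝓖) 1 y *
      GradedTensorProduct.tmul k a b =
    GradedTensorProduct.tmul k (Env.parityPow k 𝓖 i a) (y * b) := by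
  induction a using DirectSum.Decomposition.inductionOn (envGrading k 𝓖) with
  | zero => simp [GradedTensorProduct.tmul]
  | homogeneous a =>
    rw [Env.parityPow_of_mem a.2]
    have := GradedTensorProduct.tmul_coe_mul_coe_tmul (R := k) (envGrading k 𝓖) (envGrading k 𝓖)
      1 ⟨y, hy⟩ a b
    rw [one_mul] at this
    rw [this]
    simp only [Units.smul_def, GradedTensorProduct.tmul, ← TensorProduct.smul_tmul', map_zsmul]
  | add a b ha hb =>
    simp only [GradedTensorProduct.tmul, TensorProduct.add_tmul, map_add, mul_add] at *
    rw [ha, hb]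

variable {k 𝓖} in
theorem Env.tmul_one_mul (y a b : Env k 𝓖) :
    GradedTensorProduct.tmul k (𝒜 := envGrading k 𝓖) (ℬ := envGrading k 𝓖) y 1 *
      GradedTensorProduct.tmul k a b =
    GradedTensorProduct.tmul k (y * a) b := by
  induction a using DirectSum.Decomposition.inductionOn (envGrading k 𝓖) with
  | zero => simp [GradedTensorProduct.tmul]
  | homogeneous a => exact GradedTensorProduct.tmul_one_mul_coe_tmul _ _ y a b
  | add a b ha hb =>
    simp only [GradedTensorProduct.tmul, TensorProduct.add_tmul, map_add, mul_add] at *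
    rw [ha, hb]

/-- The comultiplication of `U(𝔤)` with values in the super tensor product `U(𝔤) ⊗ U(𝔤)`:
the morphism of algebras with `x ↦ x ⊗ 1 + 1 ⊗ x` for `x` in `𝔤`. -/
def Env.comulAlg : Env k 𝓖 →ₐ[k] (envGrading k 𝓖 ᵍ⊗[k] envGrading k 𝓖) :=
  Env.lift ((GradedTensorProduct.includeLeft (envGrading k 𝓖) (envGrading k 𝓖)).toLinearMap ∘ₗ
      Env.ι k 𝓖 +
    (GradedTensorProduct.includeRight (envGrading k 𝓖) (envGrading k 𝓖)).toLinearMap ∘ₗ Env.ι k 𝓖)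
    (fun {i j x y} hx hy => by
      simp only [LinearMap.add_apply, LinearMap.comp_apply, AlgHom.toLinearMap_apply,
        GradedTensorProduct.includeLeft_apply, GradedTensorProduct.includeRight_apply]
      simp only [add_mul, mul_add, Env.tmul_one_mul, Env.one_tmul_mul (Env.ι_mem hx),
        Env.one_tmul_mul (Env.ι_mem hy), Env.parityPow_of_mem (Env.ι_mem hx),
        Env.parityPow_of_mem (Env.ι_mem hy), mul_one,
        Env.parityPow_of_mem (SetLike.GradedOne.one_mem (A := envGrading k 𝓖)), mul_zero,
        uzpow_zero, one_smul]
      rw [Env.ι_mul_ι hx hy]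
      simp only [GradedTensorProduct.tmul, Units.smul_def, TensorProduct.add_tmul,
        TensorProduct.tmul_add, ← TensorProduct.smul_tmul', TensorProduct.tmul_smul, map_add,
        map_zsmul, smul_add, smul_smul, ← Units.val_mul, ← uzpow_add, mul_comm j i,
        CharTwo.add_self_eq_zero, uzpow_zero, Units.val_one, one_smul]
      abel)

/-- The comultiplication of `U(𝔤)` as a linear map. -/
def Env.comul : Env k 𝓖 →ₗ[k] Env k 𝓖 ⊗[k] Env k 𝓖 :=
  (GradedTensorProduct.of k (envGrading k 𝓖) (envGrading k 𝓖)).symm.toLinearMap ∘ₗ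
    (Env.comulAlg k 𝓖).toLinearMap

/-- The counit of `U(𝔤)`: the morphism of algebras that vanishes on `𝔤`. -/
def Env.counit : Env k 𝓖 →ₐ[k] k := Env.lift 0 (fun _ _ => by simp)

theorem Env.comul_one : Env.comul k 𝓖 1 = 1 ⊗ₜ[k] 1 := by
  simp only [Env.comul, LinearMap.comp_apply, AlgHom.toLinearMap_apply, map_one]
  rfl

variable {k 𝓖} in
theorem Env.comul_ι_mul {i : ZMod 2} {x : 𝔤} (hx : x ∈ 𝓖 i) (u : Env k 𝓖) :
    Env.comul k 𝓖 (Env.ι k 𝓖 x * u) =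
      TensorProduct.map (LinearMap.mulLeft k (Env.ι k 𝓖 x)) LinearMap.id (Env.comul k 𝓖 u) +
      TensorProduct.map (Env.parityPow k 𝓖 i) (LinearMap.mulLeft k (Env.ι k 𝓖 x))
        (Env.comul k 𝓖 u) := by
  simp only [Env.comul, LinearMap.comp_apply, AlgHom.toLinearMap_apply, map_mul]
  generalize Env.comulAlg k 𝓖 u = t
  rw [Env.comulAlg, Env.lift_ι]
  simp only [LinearMap.add_apply, LinearMap.comp_apply, AlgHom.toLinearMap_apply,
        GradedTensorProduct.includeLeft_apply, GradedTensorProduct.includeRight_apply]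
  obtain ⟨t, rfl⟩ := (GradedTensorProduct.of k (envGrading k 𝓖) (envGrading k 𝓖)).surjective t
  induction t using TensorProduct.induction_on with
  | zero => simp
  | tmul a b =>
    have h1 := Env.tmul_one_mul (Env.ι k 𝓖 x) a b
    have h2 := Env.one_tmul_mul (Env.ι_mem hx) a b
    rw [add_mul]
    simp only [GradedTensorProduct.tmul] at h1 h2 ⊢
    rw [h1, h2]
    simp
  | add a b ha hb =>
    simp only [map_add, mul_add] at *
    simp only [LinearEquiv.coe_coe] at *
    rw [ha, hb]; abel

theorem Env.parity_parityPow (i : ZMod 2) (u : Env k 𝓖) :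
    Env.parity k 𝓖 (Env.parityPow k 𝓖 i u) = Env.parityPow k 𝓖 i (Env.parity k 𝓖 u) := by
  rcases zmod_two_cases i with rfl | rfl
  · rw [Env.parityPow_zero]; rfl
  · rw [Env.parityPow_one]; rfl

theorem Env.comul_parity (u : Env k 𝓖) : Env.comul k 𝓖 (Env.parity k 𝓖 u) =
    TensorProduct.map (Env.parity k 𝓖).toLinearMap (Env.parity k 𝓖).toLinearMap
      (Env.comul k 𝓖 u) := by
  induction u using Env.induction_left with
  | one => simp [Env.comul_one]
  | add u v hu hv => simp [hu, hv]
  | smul c u hu => simp [hu]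
  | @mul i x u hx hu =>
    rw [map_mul, Env.parity_ι hx, Units.smul_def, smul_mul_assoc, map_zsmul, Env.comul_ι_mul hx,
      Env.comul_ι_mul hx, hu]
    generalize Env.comul k 𝓖 u = t
    induction t using TensorProduct.induction_on with
    | zero => simp
    | tmul a b =>
      simp only [TensorProduct.map_tmul, LinearMap.mulLeft_apply, LinearMap.id_apply,
        AlgHom.toLinearMap_apply, map_mul, map_add, Env.parity_ι hx, Units.smul_def, smul_add,
        smul_mul_assoc, ← TensorProduct.smul_tmul', TensorProduct.tmul_smul, Env.parity_parityPow]
    | add a b ha hb =>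
      simp only [map_add, smul_add] at *
      rw [add_add_add_comm, ha, hb]; abel

theorem Env.comul_parityPow (i : ZMod 2) (u : Env k 𝓖) : Env.comul k 𝓖 (Env.parityPow k 𝓖 i u) =
    TensorProduct.map (Env.parityPow k 𝓖 i) (Env.parityPow k 𝓖 i) (Env.comul k 𝓖 u) := by
  rcases zmod_two_cases i with rfl | rfl
  · rw [Env.parityPow_zero]; simp
  · rw [Env.parityPow_one]; exact Env.comul_parity k 𝓖 u

theorem Env.counit_parityPow (i : ZMod 2) (u : Env k 𝓖) :
    Env.counit k 𝓖 (Env.parityPow k 𝓖 i u) = Env.counit k 𝓖 u := by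
  rcases zmod_two_cases i with rfl | rfl
  · rw [Env.parityPow_zero]; rfl
  · rw [Env.parityPow_one, AlgHom.toLinearMap_apply]
    induction u using Env.induction_left with
    | one => simp
    | add u v hu hv => simp [hu, hv]
    | smul c u hu => simp [hu]
    | @mul i x u hx hu =>
      rw [map_mul, Env.parity_ι hx, Units.smul_def, smul_mul_assoc, map_zsmul, map_mul, map_mul,
        Env.counit, Env.lift_ι]
      simp

/-- The coalgebra structure of `U(𝔤)`. -/
instance : Coalgebra k (Env k 𝓖) where
  comul := Env.comul k 𝓖
  counit := (Env.counit k 𝓖).toLinearMap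
  coassoc := by
    ext u
    simp only [LinearMap.comp_apply, LinearEquiv.coe_coe]
    induction u using Env.induction_left with
    | one => simp [Env.comul_one]
    | add u v hu hv => simp only [map_add, hu, hv]
    | smul c u hu => simp only [map_smul, hu]
    | @mul i x u hx hu =>
      have hA : ∀ t : Env k 𝓖 ⊗[k] Env k 𝓖,
          TensorProduct.assoc k _ _ _ (LinearMap.rTensor _ (Env.comul k 𝓖)
            (TensorProduct.map (LinearMap.mulLeft k (Env.ι k 𝓖 x)) LinearMap.id t +
            TensorProduct.map (Env.parityPow k 𝓖 i) (LinearMap.mulLeft k (Env.ι k 𝓖 x)) t)) =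
          (TensorProduct.map (LinearMap.mulLeft k (Env.ι k 𝓖 x)) LinearMap.id +
            TensorProduct.map (Env.parityPow k 𝓖 i)
              (TensorProduct.map (LinearMap.mulLeft k (Env.ι k 𝓖 x)) LinearMap.id +
              TensorProduct.map (Env.parityPow k 𝓖 i) (LinearMap.mulLeft k (Env.ι k 𝓖 x))) :
                (Env k 𝓖 ⊗[k] (Env k 𝓖 ⊗[k] Env k 𝓖)) →ₗ[k] (Env k 𝓖 ⊗[k] (Env k 𝓖 ⊗[k] Env k 𝓖)))
            (TensorProduct.assoc k _ _ _ (LinearMap.rTensor _ (Env.comul k 𝓖) t)) := by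
        intro t
        induction t using TensorProduct.induction_on with
        | zero => simp
        | add a b ha hb =>
          simp only [map_add] at *
          rw [← ha, ← hb]; abel
        | tmul a b =>
          simp only [TensorProduct.map_tmul, map_add, LinearMap.rTensor_tmul,
            LinearMap.mulLeft_apply, LinearMap.id_apply, Env.comul_ι_mul hx, Env.comul_parityPow]
          generalize Env.comul k 𝓖 a = s
          induction s using TensorProduct.induction_on with
          | zero => simp
          | add a b ha hb =>
            simp only [map_add, TensorProduct.add_tmul] at *
            rw [← ha, ← hb]; abel
          | tmul a c =>
            simp [TensorProduct.add_tmul, TensorProduct.tmul_add]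
            abel
      have hB : ∀ t : Env k 𝓖 ⊗[k] Env k 𝓖,
          LinearMap.lTensor _ (Env.comul k 𝓖)
            (TensorProduct.map (LinearMap.mulLeft k (Env.ι k 𝓖 x)) LinearMap.id t +
            TensorProduct.map (Env.parityPow k 𝓖 i) (LinearMap.mulLeft k (Env.ι k 𝓖 x)) t) =
          (TensorProduct.map (LinearMap.mulLeft k (Env.ι k 𝓖 x)) LinearMap.id +
            TensorProduct.map (Env.parityPow k 𝓖 i)
              (TensorProduct.map (LinearMap.mulLeft k (Env.ι k 𝓖 x)) LinearMap.id +
              TensorProduct.map (Env.parityPow k 𝓖 i) (LinearMap.mulLeft k (Env.ι k 𝓖 x))) :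
                (Env k 𝓖 ⊗[k] (Env k 𝓖 ⊗[k] Env k 𝓖)) →ₗ[k] (Env k 𝓖 ⊗[k] (Env k 𝓖 ⊗[k] Env k 𝓖)))
            (LinearMap.lTensor _ (Env.comul k 𝓖) t) := by
        intro t
        induction t using TensorProduct.induction_on with
        | zero => simp
        | add a b ha hb =>
          simp only [map_add] at *
          rw [← ha, ← hb]; abel
        | tmul a b =>
          simp [Env.comul_ι_mul hx]
      rw [Env.comul_ι_mul hx, hA, hB, hu]
  rTensor_counit_comp_comul := by
    ext u
    simp only [LinearMap.comp_apply, TensorProduct.mk_apply]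
    induction u using Env.induction_left with
    | one => simp [Env.comul_one]
    | add u v hu hv => simp only [map_add, hu, hv, TensorProduct.tmul_add]
    | smul c u hu => simp only [map_smul, hu, TensorProduct.tmul_smul]
    | @mul i x u hx hu =>
      have hA : ∀ t : Env k 𝓖 ⊗[k] Env k 𝓖,
          (Env.counit k 𝓖).toLinearMap.rTensor _
            (TensorProduct.map (LinearMap.mulLeft k (Env.ι k 𝓖 x)) LinearMap.id t +
            TensorProduct.map (Env.parityPow k 𝓖 i) (LinearMap.mulLeft k (Env.ι k 𝓖 x)) t) =
          TensorProduct.map LinearMap.id (LinearMap.mulLeft k (Env.ι k 𝓖 x))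
            ((Env.counit k 𝓖).toLinearMap.rTensor _ t) := by
        intro t
        induction t using TensorProduct.induction_on with
        | zero => simp
        | add a b ha hb =>
          simp only [map_add] at *
          rw [← ha, ← hb]; abel
        | tmul a b =>
          simp [Env.counit_parityPow, show Env.counit k 𝓖 (Env.ι k 𝓖 x) = 0 by simp [Env.counit]]
      rw [Env.comul_ι_mul hx, hA, hu]
      simp
  lTensor_counit_comp_comul := by
    ext u
    simp only [LinearMap.comp_apply, LinearMap.flip_apply, TensorProduct.mk_apply]
    induction u using Env.induction_left with
    | one => simp [Env.comul_one]
    | add u v hu hv => simp only [map_add, hu, hv, TensorProduct.add_tmul]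
    | smul c u hu => simp only [map_smul, hu, ← TensorProduct.smul_tmul']
    | @mul i x u hx hu =>
      have hA : ∀ t : Env k 𝓖 ⊗[k] Env k 𝓖,
          (Env.counit k 𝓖).toLinearMap.lTensor _
            (TensorProduct.map (LinearMap.mulLeft k (Env.ι k 𝓖 x)) LinearMap.id t +
            TensorProduct.map (Env.parityPow k 𝓖 i) (LinearMap.mulLeft k (Env.ι k 𝓖 x)) t) =
          TensorProduct.map (LinearMap.mulLeft k (Env.ι k 𝓖 x)) LinearMap.id
            ((Env.counit k 𝓖).toLinearMap.lTensor _ t) := by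
        intro t
        induction t using TensorProduct.induction_on with
        | zero => simp
        | add a b ha hb =>
          simp only [map_add] at *
          rw [← ha, ← hb]; abel
        | tmul a b =>
          simp [show Env.counit k 𝓖 (Env.ι k 𝓖 x) = 0 by simp [Env.counit]]
      rw [Env.comul_ι_mul hx, hA, hu]
      simp

theorem Env.parityPow_parityPow (i j : ZMod 2) (u : Env k 𝓖) :
    Env.parityPow k 𝓖 i (Env.parityPow k 𝓖 j u) = Env.parityPow k 𝓖 (i + j) u := by
  rcases zmod_two_cases i with rfl | rfl
  · rw [zero_add, Env.parityPow_zero]; rfl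
  · rcases zmod_two_cases j with rfl | rfl
    · rw [add_zero, Env.parityPow_zero]; rfl
    · rw [CharTwo.add_self_eq_zero, Env.parityPow_one, Env.parityPow_zero]
      exact Env.parity_parity k 𝓖 u

theorem Env.parityPow_mul (i : ZMod 2) (u v : Env k 𝓖) :
    Env.parityPow k 𝓖 i (u * v) = Env.parityPow k 𝓖 i u * Env.parityPow k 𝓖 i v := by
  rcases zmod_two_cases i with rfl | rfl
  · rw [Env.parityPow_zero]; rfl
  · rw [Env.parityPow_one]; exact map_mul (Env.parity k 𝓖) _ _

/-- Right multiplication by `x` with the sign of the super opposite algebra: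
`u ↦ -(-1) ^ (|x| |u|) u x` for homogeneous `x` and `u`. -/
def Env.antipodeOp : 𝔤 →ₗ[k] Module.End k (Env k 𝓖) :=
  -(DirectSum.toModule k (ZMod 2) (Module.End k (Env k 𝓖))
    (fun i => ((LinearMap.mul k (Env k 𝓖)).compl₁₂ (Env.parityPow k 𝓖 i)
      (Env.ι k 𝓖 ∘ₗ (𝓖 i).subtype)).flip) ∘ₗ (DirectSum.decomposeLinearEquiv 𝓖).toLinearMap)

variable {k 𝓖} in
theorem Env.antipodeOp_of_mem {i : ZMod 2} {x : 𝔤} (hx : x ∈ 𝓖 i) (u : Env k 𝓖) :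
    Env.antipodeOp k 𝓖 x u = -(Env.parityPow k 𝓖 i u * Env.ι k 𝓖 x) := by
  simp only [Env.antipodeOp, LinearMap.neg_apply, LinearMap.comp_apply, LinearEquiv.coe_coe,
    DirectSum.decomposeLinearEquiv_apply]
  rw [DirectSum.decompose_of_mem 𝓖 hx, ← DirectSum.lof_eq_of k, DirectSum.toModule_lof]
  rfl

/-- The antipode `u ↦ ū` of `U(𝔤)`. -/
def Env.antipode : Env k 𝓖 →ₗ[k] Env k 𝓖 :=
  LinearMap.applyₗ (1 : Env k 𝓖) ∘ₗ
    (Env.lift (𝓖 := 𝓖) (Env.antipodeOp k 𝓖) (fun {i j x y} hx hy => by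
      ext u
      have h := congrArg (fun t => Env.parityPow k 𝓖 (i + j) u * t) (Env.ι_mul_ι hx hy)
      simp only [mul_add] at h
      simp only [Module.End.mul_apply, LinearMap.add_apply, Units.smul_def, LinearMap.smul_apply,
        Env.antipodeOp_of_mem hx, Env.antipodeOp_of_mem hy,
        Env.antipodeOp_of_mem (LieSuperalgebra.bracket_mem hx hy), map_neg, neg_mul, neg_neg,
        Env.parityPow_mul, Env.parityPow_parityPow, Env.parityPow_of_mem (Env.ι_mem hx),
        Env.parityPow_of_mem (Env.ι_mem hy), smul_mul_assoc, mul_smul_comm, mul_assoc,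
        smul_smul] at h ⊢
      rw [mul_comm j i, add_comm j i, ← Units.val_mul, ← uzpow_add, CharTwo.add_self_eq_zero,
        uzpow_zero, Units.val_one, one_smul, h]
      abel)).toLinearMap

/-- The antipode is determined by `1̄ = 1` and by this rule. -/
theorem Env.antipode_one : Env.antipode k 𝓖 1 = 1 := by
  simp [Env.antipode]

variable {k 𝓖} in
/-- The antipode satisfies `(x u)‾ = (-1) ^ (|x| |u|) ū x̄` with `x̄ = -x` for `x` in `𝔤`. -/
theorem Env.antipode_ι_mul {i : ZMod 2} {x : 𝔤} (hx : x ∈ 𝓖 i) (u : Env k 𝓖) :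
    Env.antipode k 𝓖 (Env.ι k 𝓖 x * u) =
      -(Env.parityPow k 𝓖 i (Env.antipode k 𝓖 u) * Env.ι k 𝓖 x) := by
  simp only [Env.antipode, LinearMap.comp_apply, AlgHom.toLinearMap_apply, map_mul, Env.lift_ι]
  exact Env.antipodeOp_of_mem hx _

end Enveloping

section Coinduced

attribute [local instance 100] LieRing.ofAssociativeRing

variable {k 𝔤 : Type u} [Field k] [CharZero k] [AddCommGroup 𝔤] [Module k 𝔤]
  {𝓖 : ZMod 2 → Submodule k 𝔤} [DirectSum.Decomposition 𝓖] [LieSuperalgebra k 𝓖]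
  {B C : Type u} [CommRing B] [Algebra k B] [CommRing C] [Algebra k C]

/-- The component of parity `i` of an element of `U(𝔤)`. -/
def Env.proj (i : ZMod 2) : Env k 𝓖 →ₗ[k] Env k 𝓖 :=
  parityProj (Env.parity k 𝓖).toLinearMap i

/-- The tensor product of two linear maps from `U(𝔤)` to (purely even) algebras, with the Koszul
sign rule: `(f ⊗ g) (X ⊗ Y) = (-1) ^ (|g| |X|) f X ⊗ g Y`, extended linearly from homogeneous `g`
and `X`. As the target of `g` is even, the part of `g` of parity `i` is `g ∘ proj i`. -/
def koszulMap (f : Env k 𝓖 →ₗ[k] B) (g : Env k 𝓖 →ₗ[k] C) :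
    Env k 𝓖 ⊗[k] Env k 𝓖 →ₗ[k] B ⊗[k] C :=
  ∑ i : ZMod 2, TensorProduct.map (f ∘ₗ Env.parityPow k 𝓖 i) (g ∘ₗ Env.proj i)

/-- The product `f · g = m ∘ (f ⊗ g) ∘ Δ` of linear maps from `U(𝔤)` to `B`. -/
def convMul (f g : Env k 𝓖 →ₗ[k] B) : Env k 𝓖 →ₗ[k] B :=
  LinearMap.mul' k B ∘ₗ koszulMap f g ∘ₗ Coalgebra.comul

/-- The unit `u ↦ ε(u) 1`. -/
def convOne : Env k 𝓖 →ₗ[k] B := Algebra.linearMap k B ∘ₗ (Env.counit k 𝓖).toLinearMap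

/-- The map induced by the parity involution of `U(𝔤)` on the ordinary convolution algebra. -/
def convParity : WithConv (Env k 𝓖 →ₗ[k] B) →ₗ[k] WithConv (Env k 𝓖 →ₗ[k] B) where
  toFun f := WithConv.toConv (f.ofConv ∘ₗ (Env.parity k 𝓖).toLinearMap)
  map_add' _ _ := rfl
  map_smul' _ _ := rfl

theorem convParity_mul (f g : WithConv (Env k 𝓖 →ₗ[k] B)) :
    convParity (f * g) = convParity f * convParity g := by
  ext u
  show LinearMap.mul' k B (TensorProduct.map f.ofConv g.ofConv
    (Env.comul k 𝓖 (Env.parity k 𝓖 u))) = LinearMap.mul' k B (TensorProduct.map _ _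
      (Env.comul k 𝓖 u))
  rw [Env.comul_parity, ← LinearMap.comp_apply (TensorProduct.map _ _), ← TensorProduct.map_comp]
  rfl

theorem convParity_convParity (f : WithConv (Env k 𝓖 →ₗ[k] B)) :
    convParity (convParity f) = f := by
  ext u
  exact congrArg f.ofConv (Env.parity_parity k 𝓖 u)

theorem toConv_convMul (f g : Env k 𝓖 →ₗ[k] B) :
    WithConv.toConv (convMul f g) = (2⁻¹ : k) • (
      WithConv.toConv f * (WithConv.toConv g + convParity (WithConv.toConv g)) +
      convParity (WithConv.toConv f) * (WithConv.toConv g - convParity (WithConv.toConv g))) := by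
  have h0 : (g ∘ₗ Env.proj (0 : ZMod 2) : Env k 𝓖 →ₗ[k] B) =
      (2⁻¹ : k) • (g + g ∘ₗ (Env.parity k 𝓖).toLinearMap) := by
    ext u
    simp [Env.proj, parityProj_apply]
  have h1 : (g ∘ₗ Env.proj (1 : ZMod 2) : Env k 𝓖 →ₗ[k] B) =
      (2⁻¹ : k) • (g - g ∘ₗ (Env.parity k 𝓖).toLinearMap) := by
    ext u
    simp [Env.proj, parityProj_apply, sub_eq_add_neg]
  rw [smul_add, ← mul_smul_comm, ← mul_smul_comm]
  rw [convMul, koszulMap, zmod_two_sum, Env.parityPow_zero, Env.parityPow_one, LinearMap.comp_id,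
    h0, h1, LinearMap.add_comp, LinearMap.comp_add]
  rfl

theorem convMul_assoc (f g h : Env k 𝓖 →ₗ[k] B) :
    convMul (convMul f g) h = convMul f (convMul g h) := by
  apply WithConv.toConv_injective
  simp only [toConv_convMul, map_smul, map_add, map_sub, convParity_mul, convParity_convParity,
    smul_mul_assoc, mul_smul_comm, smul_smul, ← smul_add, ← smul_sub]
  congr 1
  generalize WithConv.toConv f = a
  generalize WithConv.toConv g = b
  generalize WithConv.toConv h = c
  generalize convParity a = a'
  generalize convParity b = b'
  generalize convParity c = c'
  noncomm_ring

theorem toConv_convOne : WithConv.toConv (convOne : Env k 𝓖 →ₗ[k] B) = 1 := rfl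

theorem convOne_comp_parity : (convOne : Env k 𝓖 →ₗ[k] B) ∘ₗ (Env.parity k 𝓖).toLinearMap =
    convOne := by
  ext u
  have := Env.counit_parityPow k 𝓖 1 u
  rw [Env.parityPow_one] at this
  simp only [convOne, LinearMap.comp_apply] at this ⊢
  exact congrArg _ this

theorem convOne_mul (f : Env k 𝓖 →ₗ[k] B) : convMul convOne f = f := by
  apply WithConv.toConv_injective
  rw [toConv_convMul]
  rw [show convParity (WithConv.toConv (convOne : Env k 𝓖 →ₗ[k] B)) = 1 from
    congrArg WithConv.toConv convOne_comp_parity, toConv_convOne, one_mul, one_mul,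
    add_add_sub_cancel, ← two_smul k, smul_smul, inv_mul_cancel₀ two_ne_zero, one_smul]

theorem convMul_one (f : Env k 𝓖 →ₗ[k] B) : convMul f convOne = f := by
  apply WithConv.toConv_injective
  rw [toConv_convMul]
  rw [show convParity (WithConv.toConv (convOne : Env k 𝓖 →ₗ[k] B)) = 1 from
    congrArg WithConv.toConv convOne_comp_parity, toConv_convOne, sub_self, mul_zero, add_zero,
    mul_add, mul_one, ← two_smul k, smul_smul, inv_mul_cancel₀ two_ne_zero, one_smul]

theorem convMul_comp_parity (f g : Env k 𝓖 →ₗ[k] B) :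
    convMul f g ∘ₗ (Env.parity k 𝓖).toLinearMap =
      convMul (f ∘ₗ (Env.parity k 𝓖).toLinearMap) (g ∘ₗ (Env.parity k 𝓖).toLinearMap) := by
  apply WithConv.toConv_injective
  have h := congrArg convParity (toConv_convMul f g)
  simp only [map_smul, map_add, map_sub, convParity_mul] at h
  rw [toConv_convMul]
  exact h

theorem convMul_add_left (f g h : Env k 𝓖 →ₗ[k] B) :
    convMul (f + g) h = convMul f h + convMul g h := by
  apply WithConv.toConv_injective
  rw [WithConv.toConv_add]
  simp only [toConv_convMul, WithConv.toConv_add, map_add, add_mul, ← smul_add]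
  congr 1
  abel

theorem convMul_add_right (f g h : Env k 𝓖 →ₗ[k] B) :
    convMul f (g + h) = convMul f g + convMul f h := by
  apply WithConv.toConv_injective
  rw [WithConv.toConv_add]
  simp only [toConv_convMul, WithConv.toConv_add, map_add, add_sub_add_comm, ← smul_add]
  congr 1
  noncomm_ring

theorem convMul_smul_left (c : k) (f g : Env k 𝓖 →ₗ[k] B) :
    convMul (c • f) g = c • convMul f g := by
  apply WithConv.toConv_injective
  rw [WithConv.toConv_smul]
  simp only [toConv_convMul, WithConv.toConv_smul, map_smul, smul_mul_assoc, ← smul_add]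
  rw [smul_comm]

theorem convMul_smul_right (c : k) (f g : Env k 𝓖 →ₗ[k] B) :
    convMul f (c • g) = c • convMul f g := by
  apply WithConv.toConv_injective
  rw [WithConv.toConv_smul]
  simp only [toConv_convMul, WithConv.toConv_smul, map_smul, mul_smul_comm, ← smul_add, ← smul_sub]
  rw [smul_comm]

theorem convMul_comp_left (φ : B →ₐ[k] C) (f g : Env k 𝓖 →ₗ[k] B) :
    φ.toLinearMap ∘ₗ convMul f g = convMul (φ.toLinearMap ∘ₗ f) (φ.toLinearMap ∘ₗ g) := by
  ext u
  simp only [convMul, LinearMap.comp_apply]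
  generalize (Coalgebra.comul u : Env k 𝓖 ⊗[k] Env k 𝓖) = t
  induction t using TensorProduct.induction_on with
  | zero => simp
  | tmul a b => simp [koszulMap]
  | add a b ha hb => simp only [map_add, ha, hb]

variable (k 𝓖) in
/-- The canonical map `U(𝔤₀) → U(𝔤)`. -/
def Env.ofEven : UniversalEnvelopingAlgebra k (EvenLie k 𝓖) →ₐ[k] Env k 𝓖 :=
  UniversalEnvelopingAlgebra.lift k
    { toLinearMap := Env.ι k 𝓖 ∘ₗ EvenLie.incl k 𝓖
      map_lie' := fun {x y} => by
        have h := Env.ι_mul_ι (EvenLie.incl_mem k 𝓖 x) (EvenLie.incl_mem k 𝓖 y)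
        rw [mul_zero, uzpow_zero, one_smul] at h
        rw [Ring.lie_def]
        exact (sub_eq_of_eq_add' h).symm }

/-- The action of `U(𝔤₀)` on an algebra `B` on which `𝔤₀` acts by derivations. -/
def envAct (θ : EvenLie k 𝓖 →ₗ⁅k⁆ Derivation k B B) :
    UniversalEnvelopingAlgebra k (EvenLie k 𝓖) →ₐ[k] Module.End k B :=
  UniversalEnvelopingAlgebra.lift k
    { toFun := fun x => (θ x : B →ₗ[k] B)
      map_add' := fun x y => by rw [map_add]; rfl
      map_smul' := fun c x => by rw [map_smul]; rfl
      map_lie' := fun {x y} => by rw [LieHom.map_lie]; rfl }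

/-- `Hom_{U(𝔤₀)} (U(𝔤), B)`: the `U(𝔤₀)`-linear maps, where `U(𝔤₀)` acts on `U(𝔤)` by left
multiplication. -/
def coindSubmodule (θ : EvenLie k 𝓖 →ₗ⁅k⁆ Derivation k B B) : Submodule k (Env k 𝓖 →ₗ[k] B) where
  carrier := {f | ∀ (z : UniversalEnvelopingAlgebra k (EvenLie k 𝓖)) (u : Env k 𝓖),
    f (Env.ofEven k 𝓖 z * u) = envAct θ z (f u)}
  add_mem' {f g} hf hg z u := by
    rw [LinearMap.add_apply, hf, hg, LinearMap.add_apply, map_add]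
  zero_mem' z u := by simp
  smul_mem' c f hf z u := by
    rw [LinearMap.smul_apply, hf, LinearMap.smul_apply, map_smul]

theorem mem_coindSubmodule_iff {θ : EvenLie k 𝓖 →ₗ⁅k⁆ Derivation k B B} {f : Env k 𝓖 →ₗ[k] B} :
    f ∈ coindSubmodule θ ↔ ∀ (x : EvenLie k 𝓖) (u : Env k 𝓖),
      f (Env.ι k 𝓖 (EvenLie.incl k 𝓖 x) * u) = θ x (f u) := by
  constructor
  · intro h x u
    have := h (UniversalEnvelopingAlgebra.ι k x) u
    rw [Env.ofEven, envAct, UniversalEnvelopingAlgebra.lift_ι_apply,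
      UniversalEnvelopingAlgebra.lift_ι_apply] at this
    exact this
  · intro h z
    obtain ⟨t, rfl⟩ : ∃ t, UniversalEnvelopingAlgebra.mkAlgHom k (EvenLie k 𝓖) t = z :=
      RingCon.mk'_surjective (UniversalEnvelopingAlgebra.ringCon k (EvenLie k 𝓖)) z
    induction t using TensorAlgebra.induction with
    | algebraMap r =>
      intro u
      simp only [AlgHom.commutes]
      rw [← Algebra.smul_def, map_smul]
      rfl
    | ι x =>
      intro u
      have := h x u
      have e1 : Env.ofEven k 𝓖 (UniversalEnvelopingAlgebra.mkAlgHom k (EvenLie k 𝓖)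
          (TensorAlgebra.ι k x)) = Env.ι k 𝓖 (EvenLie.incl k 𝓖 x) :=
        UniversalEnvelopingAlgebra.lift_ι_apply' k _ x
      have e2 : envAct θ (UniversalEnvelopingAlgebra.mkAlgHom k (EvenLie k 𝓖)
          (TensorAlgebra.ι k x)) = (θ x : B →ₗ[k] B) :=
        UniversalEnvelopingAlgebra.lift_ι_apply' k _ x
      rw [e1, e2]
      exact this
    | mul a b ha hb =>
      intro u
      rw [map_mul (UniversalEnvelopingAlgebra.mkAlgHom k (EvenLie k 𝓖)), map_mul (Env.ofEven k 𝓖),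
        mul_assoc, ha, hb, map_mul (envAct θ)]
      rfl
    | add a b ha hb =>
      intro u
      rw [map_add, map_add, add_mul, map_add, ha, hb, map_add]
      rfl

theorem parityPow_zero_mul {x : 𝔤} (hx : x ∈ 𝓖 0) (i : ZMod 2) (u : Env k 𝓖) :
    Env.parityPow k 𝓖 i (Env.ι k 𝓖 x * u) = Env.ι k 𝓖 x * Env.parityPow k 𝓖 i u := by
  rw [Env.parityPow_mul, Env.parityPow_of_mem (Env.ι_mem hx), mul_zero, uzpow_zero, one_smul]

theorem proj_zero_mul {x : 𝔤} (hx : x ∈ 𝓖 0) (i : ZMod 2) (u : Env k 𝓖) :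
    Env.proj i (Env.ι k 𝓖 x * u) = Env.ι k 𝓖 x * Env.proj i u := by
  have h := parityPow_zero_mul hx 1 u
  rw [Env.parityPow_one] at h
  simp only [Env.proj, parityProj_apply, h, Units.smul_def, mul_smul_comm, mul_add]

theorem comp_parity_mem {θ : EvenLie k 𝓖 →ₗ⁅k⁆ Derivation k B B} {f : Env k 𝓖 →ₗ[k] B}
    (hf : f ∈ coindSubmodule θ) : f ∘ₗ (Env.parity k 𝓖).toLinearMap ∈ coindSubmodule θ := by
  rw [mem_coindSubmodule_iff] at *
  intro x u
  have h := parityPow_zero_mul (EvenLie.incl_mem k 𝓖 x) 1 u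
  rw [Env.parityPow_one] at h
  simp only [LinearMap.comp_apply]
  rw [h, hf]

theorem convOne_mem (θ : EvenLie k 𝓖 →ₗ⁅k⁆ Derivation k B B) : convOne ∈ coindSubmodule θ := by
  rw [mem_coindSubmodule_iff]
  intro x u
  simp [convOne, Env.counit]

theorem convMul_mem {θ : EvenLie k 𝓖 →ₗ⁅k⁆ Derivation k B B} {f g : Env k 𝓖 →ₗ[k] B}
    (hf : f ∈ coindSubmodule θ) (hg : g ∈ coindSubmodule θ) : convMul f g ∈ coindSubmodule θ := by
  rw [mem_coindSubmodule_iff] at *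
  intro x u
  have hx := EvenLie.incl_mem k 𝓖 x
  simp only [convMul, LinearMap.comp_apply]
  rw [show (Coalgebra.comul (R := k) (Env.ι k 𝓖 (EvenLie.incl k 𝓖 x) * u)) = _ from
    Env.comul_ι_mul hx u, Env.parityPow_zero]
  rw [show (Coalgebra.comul (R := k) u) = Env.comul k 𝓖 u from rfl]
  generalize Env.comul k 𝓖 u = t
  induction t using TensorProduct.induction_on with
  | zero => simp
  | tmul a b =>
    simp only [koszulMap, LinearMap.sum_apply, TensorProduct.map_tmul, LinearMap.comp_apply,
      LinearMap.id_apply, LinearMap.mulLeft_apply, map_add, map_sum, LinearMap.mul'_apply,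
      parityPow_zero_mul hx, proj_zero_mul hx, hf, hg, Derivation.leibniz, smul_eq_mul]
    rw [← Finset.sum_add_distrib]
    refine Finset.sum_congr rfl fun i _ => ?_
    ring
  | add a b ha hb =>
    simp only [map_add] at *
    rw [← ha, ← hb]; abel

/-- The superalgebra `Hom_{U(𝔤₀)} (U(𝔤), B)`. -/
def Coind (θ : EvenLie k 𝓖 →ₗ⁅k⁆ Derivation k B B) : Type u := ↥(coindSubmodule θ)

namespace Coind

variable {θ : EvenLie k 𝓖 →ₗ⁅k⁆ Derivation k B B} {θ' : EvenLie k 𝓖 →ₗ⁅k⁆ Derivation k C C}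

instance : AddCommGroup (Coind θ) := inferInstanceAs (AddCommGroup ↥(coindSubmodule θ))
instance : Module k (Coind θ) := inferInstanceAs (Module k ↥(coindSubmodule θ))

variable (θ) in
/-- The underlying linear map. -/
def toLin : Coind θ →ₗ[k] (Env k 𝓖 →ₗ[k] B) := (coindSubmodule θ).subtype

theorem toLin_injective : Function.Injective (toLin θ) := Subtype.val_injective

theorem toLin_mem (f : Coind θ) : toLin θ f ∈ coindSubmodule θ := Subtype.property f

/-- The superalgebra product is `f · g = m ∘ (f ⊗ g) ∘ Δ`. -/
instance : Ring (Coind θ) where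
  __ := (inferInstance : AddCommGroup (Coind θ))
  mul f g := ⟨convMul (toLin θ f) (toLin θ g), convMul_mem f.2 g.2⟩
  one := ⟨convOne, convOne_mem θ⟩
  mul_assoc f g h := Subtype.ext (convMul_assoc _ _ _)
  one_mul f := Subtype.ext (convOne_mul _)
  mul_one f := Subtype.ext (convMul_one _)
  left_distrib f g h := Subtype.ext (convMul_add_right _ _ _)
  right_distrib f g h := Subtype.ext (convMul_add_left _ _ _)
  zero_mul f := Subtype.ext (by
    have := convMul_smul_left (0 : k) 0 (toLin θ f)
    rwa [zero_smul, zero_smul] at this)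
  mul_zero f := Subtype.ext (by
    have := convMul_smul_right (0 : k) (toLin θ f) 0
    rwa [zero_smul, zero_smul] at this)

instance : Algebra k (Coind θ) :=
  Algebra.ofModule (fun _ _ _ => Subtype.ext (convMul_smul_left _ _ _))
    (fun _ _ _ => Subtype.ext (convMul_smul_right _ _ _))

theorem toLin_mul (f g : Coind θ) : toLin θ (f * g) = convMul (toLin θ f) (toLin θ g) := rfl

theorem toLin_one : toLin θ 1 = convOne := rfl

variable (θ) in
/-- The parity involution `f ↦ f ∘ P`; a map is even (odd) if it vanishes on the odd (even) part
of `U(𝔤)`. -/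
def parity : Coind θ →ₐ[k] Coind θ :=
  AlgHom.ofLinearMap
    { toFun := fun f => (⟨toLin θ f ∘ₗ (Env.parity k 𝓖).toLinearMap, comp_parity_mem f.2⟩ : Coind θ)
      map_add' := fun _ _ => rfl
      map_smul' := fun _ _ => rfl }
    (Subtype.ext convOne_comp_parity) (fun _ _ => Subtype.ext (convMul_comp_parity _ _))

theorem parity_parity (f : Coind θ) : parity θ (parity θ f) = f :=
  Subtype.ext (LinearMap.ext fun u => congrArg (toLin θ f) (Env.parity_parity k 𝓖 u))

variable (θ) in
/-- The parity grading of `Hom_{U(𝔤₀)} (U(𝔤), B)`. -/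
def grading : ZMod 2 → Submodule k (Coind θ) := parityGrading (parity θ).toLinearMap

instance : GradedAlgebra (grading θ) := parityGradedAlgebra (parity θ) parity_parity

/-- Composition with a `𝔤₀`-equivariant algebra morphism. -/
def map (φ : B →ₐ[k] C) (hφ : ∀ x b, φ (θ x b) = θ' x (φ b)) : Coind θ →ₐ[k] Coind θ' :=
  AlgHom.ofLinearMap
    { toFun := fun f => (⟨φ.toLinearMap ∘ₗ toLin θ f, mem_coindSubmodule_iff.2 fun x u => by
        have := mem_coindSubmodule_iff.1 (toLin_mem f) x u
        simp only [LinearMap.comp_apply, AlgHom.toLinearMap_apply]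
        rw [this, hφ]⟩ : Coind θ')
      map_add' := fun f g => Subtype.ext (LinearMap.ext fun u => map_add φ _ _)
      map_smul' := fun c f => Subtype.ext (LinearMap.ext fun u => map_smul φ c _) }
    (Subtype.ext (LinearMap.ext fun u => φ.commutes _))
    (fun f g => Subtype.ext (convMul_comp_left φ _ _))

@[simp] theorem map_apply (φ : B →ₐ[k] C) (hφ : ∀ x b, φ (θ x b) = θ' x (φ b)) (f : Coind θ)
    (u : Env k 𝓖) : toLin θ' (map φ hφ f) u = φ (toLin θ f u) := rfl

theorem map_mem (φ : B →ₐ[k] C) (hφ : ∀ x b, φ (θ x b) = θ' x (φ b)) {i : ZMod 2} {f : Coind θ}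
    (hf : f ∈ grading θ i) : map φ hφ f ∈ grading θ' i := by
  have h : parity θ f = ((-1 : ℤˣ) ^ i) • f := hf
  have e : parity θ' (map φ hφ f) = map φ hφ (parity θ f) := rfl
  show parity θ' (map φ hφ f) = ((-1 : ℤˣ) ^ i) • map φ hφ f
  rw [e, h, Units.smul_def, Units.smul_def, map_zsmul]

end Coind

end Coinduced

section Group

variable (k A : Type u) [Field k] [CommRing A] [HopfAlgebra k A]

/-- The Lie algebra of the affine group `Spec A`: the left invariant derivations of `A`, that is
the derivations `D` with `Δ ∘ D = (id ⊗ D) ∘ Δ`, with the commutator bracket. -/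
def groupLie : LieSubalgebra k (Derivation k A A) where
  carrier := {D | ∀ f : A, Coalgebra.comul (R := k) (D f) =
    LinearMap.lTensor A (D : A →ₗ[k] A) (Coalgebra.comul f)}
  add_mem' {D E} hD hE f := by
    rw [Derivation.add_apply, map_add, hD, hE, ← LinearMap.add_apply, ← LinearMap.lTensor_add]
    rfl
  zero_mem' f := by
    rw [Derivation.zero_apply, map_zero]
    exact (LinearMap.congr_fun (LinearMap.lTensor_zero A) _).symm
  smul_mem' c D hD f := by
    rw [Derivation.smul_apply, map_smul, hD, ← LinearMap.smul_apply, ← LinearMap.lTensor_smul]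
    rfl
  lie_mem' {D E} hD hE f := by
    rw [Derivation.commutator_apply, map_sub, hD (E f), hE f, hE (D f), hD f]
    rw [← LinearMap.lTensor_comp_apply, ← LinearMap.lTensor_comp_apply, ← LinearMap.sub_apply,
      ← LinearMap.lTensor_sub]
    rfl

variable {k A}

/-- The tangent vector at the identity of a left invariant derivation: `f ↦ (D f)(e)`. -/
def tangentVector : groupLie k A →ₗ[k] A →ₗ[k] k where
  toFun D := Coalgebra.counit ∘ₗ ((D : Derivation k A A) : A →ₗ[k] A)
  map_add' _ _ := LinearMap.ext fun _ => map_add (Coalgebra.counit (R := k) (A := A)) _ _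
  map_smul' c _ := LinearMap.ext fun _ => map_smul (Coalgebra.counit (R := k) (A := A)) c _

/-- For a tangent vector `v` at `e` and a function `f`, the function
`g ↦ (Ad(g) v)(f) = v (x ↦ f (g x g⁻¹))` on the group, i.e. `∑ f₁ S(f₃) v(f₂)`. -/
def adjointFun (v : A →ₗ[k] k) : A →ₗ[k] A :=
  LinearMap.mul' k A ∘ₗ LinearMap.lTensor A
    (LinearMap.mul' k A ∘ₗ
      TensorProduct.map (Algebra.linearMap k A ∘ₗ v) (HopfAlgebra.antipode k (A := A)) ∘ₗ
      Coalgebra.comul) ∘ₗ Coalgebra.comul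

variable {R : Type u} [CommRing R] [Algebra k R]

/-- The product of two `R`-points of the group. -/
def ptMul (g h : A →ₐ[k] R) : A →ₐ[k] R :=
  (Algebra.TensorProduct.lift g h fun _ _ => Commute.all _ _).comp (Bialgebra.comulAlgHom k A)

/-- The inverse of an `R`-point of the group. -/
def ptInv (g : A →ₐ[k] R) : A →ₐ[k] R := g.comp (HopfAlgebra.antipodeAlgHom k A)

end Group

section Pair

variable (k A : Type u) {𝔤 : Type u} [Field k] [CharZero k] [AddCommGroup 𝔤] [Module k 𝔤]
  [CommRing A] [HopfAlgebra k A]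
  (𝓖 : ZMod 2 → Submodule k 𝔤) [DirectSum.Decomposition 𝓖] [LieSuperalgebra k 𝓖]

/-- The data making `(G₀, 𝔤)`, where `G₀ = Spec A` is an affine group and `𝔤` a Lie superalgebra,
into a super Harish-Chandra pair. The action of `G₀` on `𝔤` is given as a right comodule structure
`X ↦ ∑ X₀ ⊗ X₁`, so that `g.X = ∑ X₁(g) X₀`. -/
structure HarishChandraPair where
  /-- The identification of `𝔤₀` with the Lie algebra of `G₀`. -/
  lieEquiv : EvenLie k 𝓖 ≃ₗ⁅k⁆ groupLie k A
  /-- The action of `G₀` on `𝔤`. -/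
  coact : 𝔤 →ₗ[k] 𝔤 ⊗[k] A
  coact_coassoc : (TensorProduct.assoc k 𝔤 A A).toLinearMap ∘ₗ LinearMap.rTensor A coact ∘ₗ coact =
    LinearMap.lTensor 𝔤 Coalgebra.comul ∘ₗ coact
  coact_counit : (TensorProduct.rid k 𝔤).toLinearMap ∘ₗ LinearMap.lTensor 𝔤 Coalgebra.counit ∘ₗ
    coact = LinearMap.id
  /-- The action preserves parity. -/
  coact_mem : ∀ (i : ZMod 2) (x : 𝔤), x ∈ 𝓖 i →
    coact x ∈ LinearMap.range (LinearMap.rTensor A (𝓖 i).subtype)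
  /-- The action preserves the bracket. -/
  coact_bracket : ∀ x y : 𝔤, coact (LieSuperalgebra.bracket 𝓖 x y) =
    TensorProduct.map₂ (LieSuperalgebra.bracket 𝓖) (LinearMap.mul k A) (coact x) (coact y)
  /-- On `𝔤₀` the action is the adjoint action of `G₀` on its Lie algebra. -/
  coact_adjoint : ∀ (x : EvenLie k 𝓖) (f : A),
    TensorProduct.lid k A (LinearMap.rTensor A
      (tangentVector.flip f ∘ₗ (lieEquiv : EvenLie k 𝓖 →ₗ[k] groupLie k A) ∘ₗ EvenLie.proj k 𝓖)
      (coact (EvenLie.incl k 𝓖 x))) =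
      adjointFun (tangentVector (lieEquiv x)) f
  /-- The differential of the action is the bracket of `𝔤`. -/
  coact_differential : ∀ (x : EvenLie k 𝓖) (y : 𝔤),
    TensorProduct.rid k 𝔤 (LinearMap.lTensor 𝔤 (tangentVector (lieEquiv x)) (coact y)) =
      LieSuperalgebra.bracket 𝓖 (EvenLie.incl k 𝓖 x) y

namespace HarishChandraPair

variable {k A 𝓖} (P : HarishChandraPair k A 𝓖)

theorem comm_of_mem {i j : ZMod 2} {s t : 𝔤 ⊗[k] A}
    (hs : s ∈ LinearMap.range (LinearMap.rTensor A (𝓖 i).subtype))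
    (ht : t ∈ LinearMap.range (LinearMap.rTensor A (𝓖 j).subtype)) :
    LinearMap.rTensor A (Env.ι k 𝓖) s * LinearMap.rTensor A (Env.ι k 𝓖) t =
      ((-1 : ℤˣ) ^ (i * j)) •
        (LinearMap.rTensor A (Env.ι k 𝓖) t * LinearMap.rTensor A (Env.ι k 𝓖) s) +
      LinearMap.rTensor A (Env.ι k 𝓖)
        (TensorProduct.map₂ (LieSuperalgebra.bracket 𝓖) (LinearMap.mul k A) s t) := by
  obtain ⟨s, rfl⟩ := hs
  obtain ⟨t, rfl⟩ := ht
  induction s using TensorProduct.induction_on with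
  | zero => simp
  | add s s' hs hs' =>
    simp only [map_add, add_mul, mul_add, smul_add, LinearMap.add_apply, hs, hs']
    abel
  | tmul x a =>
    induction t using TensorProduct.induction_on with
    | zero => simp
    | add t t' ht ht' =>
      simp only [map_add, add_mul, mul_add, smul_add, ht, ht']
      abel
    | tmul y b =>
      simp only [LinearMap.rTensor_tmul, Submodule.coe_subtype, Algebra.TensorProduct.tmul_mul_tmul,
        TensorProduct.map₂_apply_tmul]
      rw [Env.ι_mul_ι x.2 y.2, mul_comm b a, TensorProduct.add_tmul, Units.smul_def,
        Units.smul_def, ← TensorProduct.smul_tmul']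
      rfl

/-- The action of `G₀` on `U(𝔤)` by algebra automorphisms extending the action on `𝔤`, as a right
comodule structure. -/
def coactEnv : Env k 𝓖 →ₐ[k] Env k 𝓖 ⊗[k] A :=
  Env.lift (LinearMap.rTensor A (Env.ι k 𝓖) ∘ₗ P.coact) fun hx hy => by
    simp only [LinearMap.comp_apply]
    rw [P.coact_bracket]
    exact comm_of_mem (P.coact_mem _ _ hx) (P.coact_mem _ _ hy)

variable {R : Type u} [CommRing R] [Algebra k R]

/-- The action `X ↦ g.X` of an `R`-point `g` of `G₀`, as a map `U(𝔤) → U(𝔤) ⊗ R`. -/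
def act (g : A →ₐ[k] R) : Env k 𝓖 →ₐ[k] Env k 𝓖 ⊗[k] R :=
  (Algebra.TensorProduct.map (AlgHom.id k (Env k 𝓖)) g).comp P.coactEnv

/-- The value at an `R`-point `g` of `f : U(𝔤) → A`, extended `R`-linearly to `U(𝔤) ⊗ R`:
`X ⊗ r ↦ f(X)(g) r`. -/
def evalAt (g : A →ₐ[k] R) (f : Env k 𝓖 →ₗ[k] A) : Env k 𝓖 ⊗[k] R →ₗ[k] R :=
  LinearMap.mul' k R ∘ₗ LinearMap.rTensor R (g.toLinearMap ∘ₗ f)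

/-- The action of `𝔤₀` on `A = 𝒪(G₀)` by left invariant derivations. -/
def der : EvenLie k 𝓖 →ₗ⁅k⁆ Derivation k A A :=
  (groupLie k A).incl.comp P.lieEquiv.toLieHom

end HarishChandraPair

/-- The linear map `Hom(U(𝔤), B) ⊗ Hom(U(𝔤), C) → Hom(U(𝔤) ⊗ U(𝔤), B ⊗ C)` with the Koszul sign
rule. -/
def koszulHom {B C : Type u} [CommRing B] [Algebra k B] [CommRing C] [Algebra k C] :
    (Env k 𝓖 →ₗ[k] B) ⊗[k] (Env k 𝓖 →ₗ[k] C) →ₗ[k]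
      (Env k 𝓖 ⊗[k] Env k 𝓖 →ₗ[k] B ⊗[k] C) :=
  TensorProduct.lift (LinearMap.mk₂ k koszulMap
    (fun f f' g => by
      simp only [koszulMap, LinearMap.add_comp, TensorProduct.map_add_left, Finset.sum_add_distrib])
    (fun c f g => by
      simp only [koszulMap, LinearMap.smul_comp, TensorProduct.map_smul_left, Finset.smul_sum])
    (fun f g g' => by
      simp only [koszulMap, LinearMap.add_comp, TensorProduct.map_add_right,
        Finset.sum_add_distrib])
    (fun c f g => by
      simp only [koszulMap, LinearMap.smul_comp, TensorProduct.map_smul_right, Finset.smul_sum]))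

end Pair

section Superalgebra

variable (k : Type u) {H : Type u} [Field k] [Ring H] [Algebra k H]
  (𝓗 : ZMod 2 → Submodule k H) [GradedAlgebra 𝓗]

/-- A superalgebra is (super)commutative if `x y = (-1) ^ (|x| |y|) y x`. -/
class SuperCommutative : Prop where
  mul_comm : ∀ {i j : ZMod 2} {x y : H}, x ∈ 𝓗 i → y ∈ 𝓗 j →
    x * y = ((-1 : ℤˣ) ^ (i * j)) • (y * x)

/-- A Hopf superalgebra structure on a superalgebra `H`: an even coalgebra structure for which
`Δ : H → H ⊗ H` (super tensor product of superalgebras) and `ε : H → k` are morphisms of algebras,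
with an even antipode. -/
structure HopfSuperalgebra extends Coalgebra k H where
  comul_one : comul (1 : H) = 1 ⊗ₜ[k] 1
  comul_mul : ∀ x y : H, GradedTensorProduct.of k 𝓗 𝓗 (comul (x * y)) =
    GradedTensorProduct.of k 𝓗 𝓗 (comul x) * GradedTensorProduct.of k 𝓗 𝓗 (comul y)
  comul_mem : ∀ {i : ZMod 2} {x : H}, x ∈ 𝓗 i →
    comul x ∈ ⨆ j : ZMod 2, LinearMap.range (TensorProduct.map (𝓗 j).subtype (𝓗 (i - j)).subtype)
  counit_one : counit (1 : H) = 1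
  counit_mul : ∀ x y : H, counit (x * y) = counit x * counit y
  counit_odd : ∀ {x : H}, x ∈ 𝓗 1 → counit x = 0
  antipode : H →ₗ[k] H
  antipode_mem : ∀ {i : ZMod 2} {x : H}, x ∈ 𝓗 i → antipode x ∈ 𝓗 i
  mul_antipode_rTensor_comul :
    LinearMap.mul' k H ∘ₗ antipode.rTensor H ∘ₗ comul = Algebra.linearMap k H ∘ₗ counit
  mul_antipode_lTensor_comul :
    LinearMap.mul' k H ∘ₗ antipode.lTensor H ∘ₗ comul = Algebra.linearMap k H ∘ₗ counit

end Superalgebra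

section Localization

variable {k A : Type u} [Field k] [CommRing A] [Algebra k A]

/-- The extension `a / s ↦ (s D a - a D s) / s²` of a derivation to a localization. -/
def derLocFun (D : Derivation k A A) (S : Submonoid A) (z : LocalizedModule S A) :
    LocalizedModule S A :=
  LocalizedModule.liftOn z
    (fun p => LocalizedModule.mk ((p.2 : A) * D p.1 - p.1 * D p.2) (p.2 * p.2))
    (by
      rintro ⟨m, s⟩ ⟨m', s'⟩ ⟨u, hu⟩
      have hE : (u : A) * ((s' : A) * m) = u * ((s : A) * m') := hu
      have hE' := congrArg D hE
      simp only [Derivation.leibniz, smul_eq_mul] at hE'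
      refine LocalizedModule.mk_eq.2 ⟨u * u, ?_⟩
      simp only [Submonoid.smul_def, smul_eq_mul, Submonoid.coe_mul]
      linear_combination ((u : A) * s * s') * hE' -
        ((s : A) * s' * D u + u * s' * D s + u * s * D s') * hE)

theorem derLocFun_mk (D : Derivation k A A) (S : Submonoid A) (m : A) (s : S) :
    derLocFun D S (LocalizedModule.mk m s) =
      LocalizedModule.mk ((s : A) * D m - m * D s) (s * s) :=
  LocalizedModule.liftOn_mk _ _ _

theorem derLocFun_add (D : Derivation k A A) (S : Submonoid A) (z w : LocalizedModule S A) :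
    derLocFun D S (z + w) = derLocFun D S z + derLocFun D S w := by
  induction z, w using LocalizedModule.induction_on₂ with
  | _ m m' s s' =>
    simp only [LocalizedModule.mk_add_mk, derLocFun_mk, Submonoid.smul_def, smul_eq_mul,
      Submonoid.coe_mul, map_add, Derivation.leibniz]
    refine LocalizedModule.mk_eq.2 ⟨1, ?_⟩
    simp only [Submonoid.smul_def, smul_eq_mul, Submonoid.coe_mul, Submonoid.coe_one]
    ring

theorem locMk_mul (S : Submonoid A) (m m' : A) (s s' : S) :
    LocalizedModule.mk m s * LocalizedModule.mk m' s' = LocalizedModule.mk (m * m') (s * s') :=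
  LocalizedModule.mk_mul_mk

theorem derLocFun_mul (D : Derivation k A A) (S : Submonoid A) (z w : LocalizedModule S A) :
    derLocFun D S (z * w) = z * derLocFun D S w + w * derLocFun D S z := by
  induction z, w using LocalizedModule.induction_on₂ with
  | _ m m' s s' =>
    simp only [locMk_mul, LocalizedModule.mk_add_mk, derLocFun_mk,
      Submonoid.smul_def, smul_eq_mul, Submonoid.coe_mul, Derivation.leibniz]
    refine LocalizedModule.mk_eq.2 ⟨1, ?_⟩
    simp only [Submonoid.smul_def, smul_eq_mul, Submonoid.coe_mul, Submonoid.coe_one]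
    ring

theorem derLocFun_smul (D : Derivation k A A) (S : Submonoid A) (c : k) (z : LocalizedModule S A) :
    derLocFun D S (algebraMap k A c • z) = algebraMap k A c • derLocFun D S z := by
  induction z using LocalizedModule.induction_on with
  | _ m s =>
    simp only [LocalizedModule.smul'_mk, derLocFun_mk, smul_eq_mul, Derivation.leibniz,
      Derivation.map_algebraMap]
    congr 1
    ring

theorem derLocFun_add_der (D E : Derivation k A A) (S : Submonoid A) (z : LocalizedModule S A) :
    derLocFun (D + E) S z = derLocFun D S z + derLocFun E S z := by
  induction z using LocalizedModule.induction_on with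
  | _ m s =>
    simp only [derLocFun_mk, LocalizedModule.mk_add_mk, Derivation.add_apply]
    refine LocalizedModule.mk_eq.2 ⟨1, ?_⟩
    simp only [Submonoid.smul_def, smul_eq_mul, Submonoid.coe_mul, Submonoid.coe_one]
    ring

theorem derLocFun_smul_der (c : k) (D : Derivation k A A) (S : Submonoid A)
    (z : LocalizedModule S A) :
    derLocFun (c • D) S z = algebraMap k A c • derLocFun D S z := by
  induction z using LocalizedModule.induction_on with
  | _ m s =>
    have h (a : A) : (c • D) a = algebraMap k A c * D a := by
      rw [Derivation.smul_apply, Algebra.smul_def]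
    rw [derLocFun_mk, derLocFun_mk, LocalizedModule.smul'_mk, h, h, smul_eq_mul]
    congr 1
    ring

theorem derLocFun_lie (D E : Derivation k A A) (S : Submonoid A) (z : LocalizedModule S A) :
    derLocFun ⁅D, E⁆ S z = derLocFun D S (derLocFun E S z) - derLocFun E S (derLocFun D S z) := by
  induction z using LocalizedModule.induction_on with
  | _ m s =>
    rw [sub_eq_add_neg]
    simp only [derLocFun_mk, ← LocalizedModule.mk_neg, LocalizedModule.mk_add_mk,
      Derivation.commutator_apply, map_sub, Derivation.leibniz, Submonoid.coe_mul,
      Submonoid.smul_def, smul_eq_mul]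
    refine LocalizedModule.mk_eq.2 ⟨1, ?_⟩
    simp only [Submonoid.smul_def, smul_eq_mul, Submonoid.coe_mul, Submonoid.coe_one]
    ring

end Localization

section Sections

variable {k R M N : Type u} [Field k] [CommRing R] [Algebra k R] [AddCommGroup M] [Module R M]

/-- The sections over `V` of the sheaf on `Spec R` associated with an `R`-module `M`: the functions
assigning to each `x ∈ V` an element of the localization `M_x`, which are locally fractions. -/
def Sec (R M : Type u) [CommRing R] [AddCommGroup M] [Module R M] (V : Opens (PrimeSpectrum R)) :
    Type u :=
  (structureSheafInType R M).obj.obj (op (V : Opens (PrimeSpectrum.Top R)))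

namespace Sec

variable {V W : Opens (PrimeSpectrum R)}

/-- The value of a section in the localization at a point. -/
def val (s : Sec R M V) (x : V) : LocalizedModule x.1.asIdeal.primeCompl M := s.1 x

theorem ext {s t : Sec R M V} (h : ∀ x, s.val x = t.val x) : s = t :=
  Subtype.ext (funext h)

theorem locally_frac (s : Sec R M V) (x : V) : ∃ (W : Opens (PrimeSpectrum R)) (hW : W ≤ V),
    x.1 ∈ W ∧ ∃ (m : M) (r : R), ∀ (y : PrimeSpectrum R) (hy : y ∈ W),
      ∃ hr : r ∈ y.asIdeal.primeCompl, s.val ⟨y, hW hy⟩ = LocalizedModule.mk m ⟨r, hr⟩ := by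
  obtain ⟨W, hW, i, m, r, h⟩ := s.2 x
  refine ⟨W, i.le, hW, m, r, fun y hy => ?_⟩
  exact h ⟨y, hy⟩

/-- A section given by its values, which are locally fractions. -/
def mk (f : ∀ x : V, LocalizedModule x.1.asIdeal.primeCompl M)
    (hf : ∀ x : V, ∃ (W : Opens (PrimeSpectrum R)) (hW : W ≤ V),
      x.1 ∈ W ∧ ∃ (m : M) (r : R), ∀ (y : PrimeSpectrum R) (hy : y ∈ W),
        ∃ hr : r ∈ y.asIdeal.primeCompl, f ⟨y, hW hy⟩ = LocalizedModule.mk m ⟨r, hr⟩) :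
    Sec R M V :=
  ⟨f, fun x => by
    obtain ⟨W, hW, hx, m, r, h⟩ := hf x
    exact ⟨W, hx, homOfLE hW, m, r, fun y => h y.1 y.2⟩⟩

@[simp] theorem val_mk (f : ∀ x : V, LocalizedModule x.1.asIdeal.primeCompl M) (hf) (x : V) :
    (mk f hf).val x = f x := rfl

/-- Restriction of sections. -/
def restrict (h : V ≤ W) (s : Sec R M W) : Sec R M V :=
  (structureSheafInType R M).obj.map
    (homOfLE (show (V : Opens (PrimeSpectrum.Top R)) ≤ W from h)).op s

@[simp] theorem restrict_val (h : V ≤ W) (s : Sec R M W) (x : V) :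
    (s.restrict h).val x = s.val ⟨x.1, h x.2⟩ := rfl

theorem exists_glue {ι : Type u} (U : ι → Opens (PrimeSpectrum R)) (s : ∀ i, Sec R M (U i))
    (hs : ∀ i j, (s i).restrict (inf_le_left : U i ⊓ U j ≤ U i) =
      (s j).restrict (inf_le_right : U i ⊓ U j ≤ U j)) :
    ∃! t : Sec R M (⨆ i, U i), ∀ i, t.restrict (le_iSup U i) = s i := by
  have key := TopCat.Sheaf.existsUnique_gluing (structureSheafInType R M)
    (U : ι → Opens (PrimeSpectrum.Top R))
  exact key s hs

instance : AddCommGroup (Sec R M V) := inferInstanceAs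
  (AddCommGroup ((structureSheafInType R M).obj.obj (op (V : Opens (PrimeSpectrum.Top R)))))

@[simp] theorem val_add (s t : Sec R M V) (x : V) : (s + t).val x = s.val x + t.val x := rfl
@[simp] theorem val_zero (x : V) : (0 : Sec R M V).val x = 0 := rfl

section Ring

variable {H : Type u} [Ring H] [Algebra R H]

instance : Mul (Sec R H V) where
  mul s t := mk (fun x => s.val x * t.val x) fun x => by
    obtain ⟨W, hW, hx, m, r, h⟩ := s.locally_frac x
    obtain ⟨W', hW', hx', m', r', h'⟩ := t.locally_frac x
    refine ⟨W ⊓ W', inf_le_left.trans hW, ⟨hx, hx'⟩, m * m', r * r', fun y hy => ?_⟩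
    obtain ⟨hr, e⟩ := h y hy.1
    obtain ⟨hr', e'⟩ := h' y hy.2
    exact ⟨mul_mem hr hr', by rw [e, e']; exact LocalizedModule.mk_mul_mk⟩

instance : One (Sec R H V) where
  one := mk (fun _ => 1) fun x => ⟨V, le_rfl, x.2, 1, 1, fun _ _ => ⟨one_mem _,
    OreLocalization.one_def⟩⟩

@[simp] theorem val_mul (s t : Sec R H V) (x : V) : (s * t).val x = s.val x * t.val x := rfl
@[simp] theorem val_one (x : V) : (1 : Sec R H V).val x = 1 := rfl

instance : Ring (Sec R H V) where
  __ := (inferInstance : AddCommGroup (Sec R H V))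
  __ := (inferInstance : Mul (Sec R H V))
  __ := (inferInstance : One (Sec R H V))
  mul_assoc a b c := ext fun x => by simp only [val_mul, mul_assoc]
  one_mul a := ext fun x => by simp only [val_mul, val_one, one_mul]
  mul_one a := ext fun x => by simp only [val_mul, val_one, mul_one]
  left_distrib a b c := ext fun x => by simp only [val_mul, val_add, mul_add]
  right_distrib a b c := ext fun x => by simp only [val_mul, val_add, add_mul]
  zero_mul a := ext fun x => by simp only [val_mul, val_zero, zero_mul]
  mul_zero a := ext fun x => by simp only [val_mul, val_zero, mul_zero]

/-- The section `m / 1`. -/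
def of (V : Opens (PrimeSpectrum R)) : H →+* Sec R H V where
  toFun m := mk (fun _ => LocalizedModule.mk m 1)
    fun x => ⟨V, le_rfl, x.2, m, 1, fun _ _ => ⟨one_mem _, rfl⟩⟩
  map_one' := ext fun x => OreLocalization.one_def.symm
  map_mul' a b := ext fun x => by
    simp only [val_mk, val_mul, LocalizedModule.mk_mul_mk, mul_one]
  map_zero' := ext fun x => LocalizedModule.zero_mk _
  map_add' a b := ext fun x => by
    simp only [val_mk, val_add, LocalizedModule.mk_add_mk, one_smul, mul_one]

@[simp] theorem of_val (m : H) (x : V) : (of (R := R) V m).val x = LocalizedModule.mk m 1 := rfl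

instance : Algebra k (Sec R H V) :=
  ((of V).comp ((algebraMap R H).comp (algebraMap k R))).toAlgebra' fun c s => ext fun x => by
    simp only [RingHom.comp_apply, val_mul, of_val]
    induction s.val x using LocalizedModule.induction_on with
    | _ m t => rw [LocalizedModule.mk_mul_mk, LocalizedModule.mk_mul_mk, Algebra.commutes,
        one_mul, mul_one]

theorem algebraMap_val (c : k) (x : V) : (algebraMap k (Sec R H V) c).val x =
    LocalizedModule.mk (algebraMap R H (algebraMap k R c)) 1 := rfl

theorem val_smul (c : k) (s : Sec R H V) (x : V) :
    (c • s).val x = algebraMap k R c • s.val x := by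
  rw [Algebra.smul_def, val_mul, algebraMap_val]
  induction s.val x using LocalizedModule.induction_on with
  | _ m t => rw [LocalizedModule.mk_mul_mk, LocalizedModule.smul'_mk, Algebra.smul_def, one_mul]

/-- Restriction of sections. -/
def res (h : V ≤ W) : Sec R H W →ₐ[k] Sec R H V where
  toFun s := s.restrict h
  map_one' := rfl
  map_mul' _ _ := rfl
  map_zero' := rfl
  map_add' _ _ := rfl
  commutes' _ := rfl

theorem res_apply (h : V ≤ W) (s : Sec R H W) : res (k := k) h s = s.restrict h := rfl

/-- The canonical morphism of algebras `m ↦ m / 1`. -/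
def ofAlg [Algebra k H] [IsScalarTower k R H] (V : Opens (PrimeSpectrum R)) : H →ₐ[k] Sec R H V where
  __ := of V
  commutes' c := by
    rw [IsScalarTower.algebraMap_apply k R H]
    rfl

theorem ofAlg_val [Algebra k H] [IsScalarTower k R H] (a : H) (x : V) :
    (ofAlg (k := k) (R := R) V a).val x = LocalizedModule.mk a 1 := rfl

/-- The endomorphism of sections induced by an `R`-linear algebra endomorphism. -/
def mapAlg (σ : H →ₐ[R] H) (V : Opens (PrimeSpectrum R)) : Sec R H V →ₐ[k] Sec R H V where
  toFun s := mk (fun x => LocalizedModule.map x.1.asIdeal.primeCompl σ.toLinearMap (s.val x))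
    fun x => by
      obtain ⟨W, hW, hx, m, r, h⟩ := s.locally_frac x
      refine ⟨W, hW, hx, σ m, r, fun y hy => ?_⟩
      obtain ⟨hr, e⟩ := h y hy
      exact ⟨hr, by rw [e, LocalizedModule.map_mk]; rfl⟩
  map_one' := ext fun x => by
    simp only [val_mk, val_one]
    rw [show (1 : LocalizedModule x.1.asIdeal.primeCompl H) = LocalizedModule.mk 1 1 from
      OreLocalization.one_def,
      LocalizedModule.map_mk]
    simp
  map_mul' s t := ext fun x => by
    simp only [val_mk, val_mul]
    induction s.val x, t.val x using LocalizedModule.induction_on₂ with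
    | _ m m' r r' =>
      rw [LocalizedModule.mk_mul_mk, LocalizedModule.map_mk, LocalizedModule.map_mk,
        LocalizedModule.map_mk, LocalizedModule.mk_mul_mk]
      simp
  map_zero' := ext fun x => by simp only [val_mk, val_zero, map_zero]
  map_add' s t := ext fun x => by simp only [val_mk, val_add, map_add]
  commutes' c := ext fun x => by
    rw [val_mk, algebraMap_val, LocalizedModule.map_mk]
    simp

theorem mapAlg_val (σ : H →ₐ[R] H) (s : Sec R H V) (x : V) : (mapAlg (k := k) σ V s).val x =
    LocalizedModule.map x.1.asIdeal.primeCompl σ.toLinearMap (s.val x) := rfl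

theorem mapAlg_mapAlg (σ : H →ₐ[R] H) (hσ : ∀ m, σ (σ m) = m) (s : Sec R H V) :
    mapAlg (k := k) σ V (mapAlg (k := k) σ V s) = s := ext fun x => by
  rw [mapAlg_val, mapAlg_val]
  induction s.val x using LocalizedModule.induction_on with
  | _ m r =>
    rw [LocalizedModule.map_mk, LocalizedModule.map_mk]
    simp [hσ]

end Ring

section Derivation

variable {A : Type u} [CommRing A] [Algebra k A] {V W : Opens (PrimeSpectrum A)}

instance : CommRing (Sec A A V) where
  __ := (inferInstance : Ring (Sec A A V))
  mul_comm s t := ext fun x => by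
    rw [val_mul, val_mul]
    induction s.val x, t.val x using LocalizedModule.induction_on₂ with
    | _ m m' r r' =>
      rw [LocalizedModule.mk_mul_mk, LocalizedModule.mk_mul_mk, mul_comm m, mul_comm r]

/-- The derivation of `Γ(Spec A, V)` induced by a derivation of `A`, given on stalks by the quotient
rule. -/
def der (V : Opens (PrimeSpectrum A)) (D : Derivation k A A) :
    Derivation k (Sec A A V) (Sec A A V) :=
  Derivation.mk'
    { toFun := fun s => mk (fun x => derLocFun D _ (s.val x)) fun x => by
        obtain ⟨W, hW, hx, a, t, h⟩ := s.locally_frac x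
        refine ⟨W, hW, hx, t * D a - a * D t, t * t, fun y hy => ?_⟩
        obtain ⟨ht, e⟩ := h y hy
        exact ⟨mul_mem ht ht, by rw [e]; exact derLocFun_mk D _ a ⟨t, ht⟩⟩
      map_add' := fun s t => ext fun x => derLocFun_add D _ _ _
      map_smul' := fun c s => ext fun x => by
        rw [RingHom.id_apply, val_smul, val_mk, val_mk, val_smul, derLocFun_smul] }
    (fun s t => ext fun x => derLocFun_mul D _ _ _)

theorem der_val (D : Derivation k A A) (s : Sec A A V) (x : V) :
    (der V D s).val x = derLocFun D _ (s.val x) := rfl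

/-- The action on sections of a Lie algebra of derivations of `A`. -/
def derHom {L : Type u} [LieRing L] [LieAlgebra k L] (θ : L →ₗ⁅k⁆ Derivation k A A)
    (V : Opens (PrimeSpectrum A)) : L →ₗ⁅k⁆ Derivation k (Sec A A V) (Sec A A V) where
  toFun x := der V (θ x)
  map_add' x y := Derivation.ext fun s => ext fun p => by
    rw [map_add, der_val, derLocFun_add_der]
    rfl
  map_smul' c x := Derivation.ext fun s => ext fun p => by
    rw [map_smul, der_val, derLocFun_smul_der, RingHom.id_apply, Derivation.smul_apply,
      val_smul]
    rfl
  map_lie' {x y} := Derivation.ext fun s => ext fun p => by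
    rw [LieHom.map_lie, der_val, derLocFun_lie]
    rfl

theorem res_der (h : V ≤ W) (D : Derivation k A A) (s : Sec A A W) :
    res (k := k) h (der W D s) = der V D (res (k := k) h s) := rfl

theorem ofAlg_der (D : Derivation k A A) (a : A) :
    ofAlg (k := k) (R := A) V (D a) = der V D (ofAlg (k := k) (R := A) V a) :=
  ext fun x => by
    rw [der_val, ofAlg_val, ofAlg_val, derLocFun_mk]
    simp

end Derivation

end Sec

end Sections

section EvenPart

variable {k H : Type u} [Field k] [Ring H] [Algebra k H]
  (𝓗 : ZMod 2 → Submodule k H) [GradedAlgebra 𝓗]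

/-- The even part of a superalgebra. -/
def EvenPart : Type u := ↥(𝓗 0)

instance : Ring (EvenPart 𝓗) := inferInstanceAs (Ring ↥(𝓗 0))

instance : Algebra k (EvenPart 𝓗) := inferInstanceAs (Algebra k ↥(𝓗 0))

/-- The inclusion of the even part. -/
def EvenPart.incl : EvenPart 𝓗 →ₐ[k] H where
  toFun x := Subtype.val (p := fun y => y ∈ 𝓗 0) x
  map_one' := rfl
  map_mul' _ _ := rfl
  map_zero' := rfl
  map_add' _ _ := rfl
  commutes' _ := rfl

theorem EvenPart.incl_mem (x : EvenPart 𝓗) : EvenPart.incl 𝓗 x ∈ 𝓗 0 := Subtype.property x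

theorem EvenPart.incl_injective : Function.Injective (EvenPart.incl 𝓗) := Subtype.val_injective

variable [SuperCommutative k 𝓗]

theorem EvenPart.incl_comm (x : EvenPart 𝓗) (y : H) :
    EvenPart.incl 𝓗 x * y = y * EvenPart.incl 𝓗 x := by
  induction y using DirectSum.Decomposition.inductionOn 𝓗 with
  | zero => simp
  | homogeneous y =>
    rw [SuperCommutative.mul_comm (EvenPart.incl_mem 𝓗 x) y.2, zero_mul, uzpow_zero, one_smul]
  | add y z hy hz => rw [mul_add, add_mul, hy, hz]

instance : CommRing (EvenPart 𝓗) where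
  __ := (inferInstance : Ring (EvenPart 𝓗))
  mul_comm x y := EvenPart.incl_injective 𝓗 (by
    rw [map_mul, map_mul, EvenPart.incl_comm])

instance : Algebra (EvenPart 𝓗) H :=
  (EvenPart.incl 𝓗).toRingHom.toAlgebra' fun x y => EvenPart.incl_comm 𝓗 x y

instance : IsScalarTower k (EvenPart 𝓗) H :=
  IsScalarTower.of_algebraMap_eq fun c => ((EvenPart.incl 𝓗).commutes c).symm

/-- The parity involution of a superalgebra: `1` on the even part and `-1` on the odd part. -/
def superSign : H →ₗ[k] H where
  toFun x := ∑ i : ZMod 2, ((-1 : ℤˣ) ^ i) • (DirectSum.decompose 𝓗 x i : H)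
  map_add' x y := by simp [Finset.sum_add_distrib]
  map_smul' c x := by
    simp only [DirectSum.decompose_smul, RingHom.id_apply, Finset.smul_sum]
    exact Finset.sum_congr rfl fun i _ => smul_comm _ _ _

theorem superSign_of_mem {i : ZMod 2} {x : H} (hx : x ∈ 𝓗 i) :
    superSign 𝓗 x = ((-1 : ℤˣ) ^ i) • x := by
  show ∑ j : ZMod 2, ((-1 : ℤˣ) ^ j) • (DirectSum.decompose 𝓗 x j : H) = _
  rw [Finset.sum_eq_single i]
  · rw [DirectSum.decompose_of_mem_same 𝓗 hx]
  · intro j _ hj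
    rw [DirectSum.decompose_of_mem_ne 𝓗 hx hj.symm, smul_zero]
  · simp

theorem superSign_mul (x y : H) : superSign 𝓗 (x * y) = superSign 𝓗 x * superSign 𝓗 y := by
  induction x using DirectSum.Decomposition.inductionOn 𝓗 with
  | zero => simp
  | add x z hx hz => rw [add_mul, map_add, hx, hz, map_add, add_mul]
  | @homogeneous i x =>
    induction y using DirectSum.Decomposition.inductionOn 𝓗 with
    | zero => simp
    | add y z hy hz => rw [mul_add, map_add, hy, hz, map_add, mul_add]
    | @homogeneous j y =>
      rw [superSign_of_mem 𝓗 (SetLike.mul_mem_graded x.2 y.2), superSign_of_mem 𝓗 x.2,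
        superSign_of_mem 𝓗 y.2, uzpow_add, smul_mul_smul_comm]

theorem superSign_superSign (x : H) : superSign 𝓗 (superSign 𝓗 x) = x := by
  induction x using DirectSum.Decomposition.inductionOn 𝓗 with
  | zero => simp
  | add x z hx hz => rw [map_add, map_add, hx, hz]
  | @homogeneous i x =>
    rw [superSign_of_mem 𝓗 x.2, Units.smul_def, map_zsmul, superSign_of_mem 𝓗 x.2,
      ← Units.smul_def, smul_smul, ← mul_uzpow]
    simp

/-- The parity involution of a commutative superalgebra, as a morphism of algebras over the even
part. -/
def superParity : H →ₐ[EvenPart 𝓗] H where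
  toFun := superSign 𝓗
  map_one' := by rw [superSign_of_mem 𝓗 (SetLike.one_mem_graded 𝓗), uzpow_zero, one_smul]
  map_mul' := superSign_mul 𝓗
  map_zero' := map_zero _
  map_add' := map_add _
  commutes' r := by
    show superSign 𝓗 (EvenPart.incl 𝓗 r) = EvenPart.incl 𝓗 r
    rw [superSign_of_mem 𝓗 (EvenPart.incl_mem 𝓗 r), uzpow_zero, one_smul]

theorem superParity_superParity (x : H) : superParity 𝓗 (superParity 𝓗 x) = x :=
  superSign_superSign 𝓗 x

end EvenPart

section Spaces

variable (k : Type u) [Field k]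

/-- A topological space with a sheaf of superalgebras over `k`. -/
structure SuperRingedSpace where
  carrier : Type u
  [top : TopologicalSpace carrier]
  /-- The superalgebra of sections over an open set. -/
  sec : Opens carrier → Type u
  [ring : ∀ V, Ring (sec V)]
  [algebra : ∀ V, Algebra k (sec V)]
  /-- The parity grading. -/
  par : ∀ V, ZMod 2 → Submodule k (sec V)
  [graded : ∀ V, GradedAlgebra (par V)]
  /-- Restriction of sections. -/
  res : ∀ {V W : Opens carrier}, V ≤ W → sec W →ₐ[k] sec V
  res_mem : ∀ {V W : Opens carrier} (h : V ≤ W) {i : ZMod 2} {s : sec W}, s ∈ par W i →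
    res h s ∈ par V i
  res_refl : ∀ {V : Opens carrier} (s : sec V), res le_rfl s = s
  res_trans : ∀ {V W Z : Opens carrier} (h : V ≤ W) (h' : W ≤ Z) (s : sec Z),
    res h (res h' s) = res (h.trans h') s
  exists_glue : ∀ {ι : Type u} (U : ι → Opens carrier) (s : ∀ i, sec (U i)),
    (∀ i j, res (inf_le_left : U i ⊓ U j ≤ U i) (s i) =
      res (inf_le_right : U i ⊓ U j ≤ U j) (s j)) →
    ∃! t : sec (⨆ i, U i), ∀ i, res (le_iSup U i) t = s i

namespace SuperRingedSpace

attribute [instance] top ring algebra graded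

variable {k}

/-- An isomorphism of spaces with sheaves of superalgebras: a homeomorphism together with
isomorphisms `Γ(Y, V) ≃ Γ(X, base⁻¹ V)` of superalgebras compatible with restriction. -/
structure Iso (X Y : SuperRingedSpace k) where
  base : X.carrier ≃ₜ Y.carrier
  sec : ∀ V : Opens Y.carrier, Y.sec V ≃ₐ[k] X.sec (Opens.comap (base : C(X.carrier, Y.carrier)) V)
  sec_mem : ∀ (V : Opens Y.carrier) {i : ZMod 2} {s : Y.sec V}, s ∈ Y.par V i →
    sec V s ∈ X.par _ i
  sec_res : ∀ {V W : Opens Y.carrier} (h : V ≤ W) (s : Y.sec W),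
    sec V (Y.res h s) =
      X.res (OrderHomClass.mono (Opens.comap (base : C(X.carrier, Y.carrier))) h) (sec W s)

end SuperRingedSpace

variable {k} [CharZero k] {H : Type u} [Ring H] [Algebra k H] (𝓗 : ZMod 2 → Submodule k H) [GradedAlgebra 𝓗]
  [SuperCommutative k 𝓗]

/-- The spectrum of a commutative superalgebra `H`: the spectrum of the even part `H₀`, with the
sheaf associated with the `H₀`-algebra `H`. -/
def superSpec : SuperRingedSpace k where
  carrier := PrimeSpectrum (EvenPart 𝓗)
  sec V := Sec (EvenPart 𝓗) H V
  par V := parityGrading (Sec.mapAlg (k := k) (superParity 𝓗) V).toLinearMap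
  graded V := parityGradedAlgebra (Sec.mapAlg (k := k) (superParity 𝓗) V)
    (Sec.mapAlg_mapAlg _ (superParity_superParity 𝓗))
  res h := Sec.res h
  res_mem {V W} h {i s} hs := by
    have e : Sec.mapAlg (k := k) (superParity 𝓗) W s = ((-1 : ℤˣ) ^ i) • s := hs
    have e' : Sec.mapAlg (k := k) (superParity 𝓗) V (Sec.res (k := k) h s) =
      Sec.res (k := k) h (Sec.mapAlg (k := k) (superParity 𝓗) W s) := rfl
    show Sec.mapAlg (k := k) (superParity 𝓗) V (Sec.res (k := k) h s) =
      ((-1 : ℤˣ) ^ i) • Sec.res (k := k) h s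
    rw [e', e, Units.smul_def, Units.smul_def, map_zsmul]
  res_refl _ := rfl
  res_trans _ _ _ := rfl
  exists_glue U s hs := Sec.exists_glue U s hs

end Spaces

section PairSpace

variable {k A 𝔤 : Type u} [Field k] [CharZero k] [AddCommGroup 𝔤] [Module k 𝔤]
  [CommRing A] [HopfAlgebra k A]
  {𝓖 : ZMod 2 → Submodule k 𝔤} [DirectSum.Decomposition 𝓖] [LieSuperalgebra k 𝓖]

theorem Coind.exists_glue (θ : EvenLie k 𝓖 →ₗ⁅k⁆ Derivation k A A) {ι : Type u}
    (U : ι → Opens (PrimeSpectrum A)) (s : ∀ i, Coind (Sec.derHom θ (U i)))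
    (hs : ∀ i j u, (toLin _ (s i) u).restrict (inf_le_left : U i ⊓ U j ≤ U i) =
      (toLin _ (s j) u).restrict (inf_le_right : U i ⊓ U j ≤ U j)) :
    ∃! t : Coind (Sec.derHom θ (⨆ i, U i)), ∀ i u,
      (toLin _ t u).restrict (le_iSup U i) = toLin _ (s i) u := by
  have key := fun u => Sec.exists_glue U (fun i => toLin _ (s i) u) (fun i j => hs i j u)
  choose t ht using fun u => (key u).exists
  have huniq : ∀ u (a b : Sec A A (⨆ i, U i)), (∀ i, a.restrict (le_iSup U i) = toLin _ (s i) u) →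
    (∀ i, b.restrict (le_iSup U i) = toLin _ (s i) u) → a = b := fun u a b ha hb =>
      (key u).unique ha hb
  have hadd : ∀ u v, t (u + v) = t u + t v := fun u v => huniq (u + v) _ _ (ht _) fun i => by
    rw [map_add, ← ht u i, ← ht v i]
    rfl
  have hsmul : ∀ (c : k) u, t (c • u) = c • t u := fun c u => huniq (c • u) _ _ (ht _) fun i => by
    rw [map_smul, ← ht u i]
    exact map_smul (Sec.res (k := k) (le_iSup U i)) c (t u)
  let T : Env k 𝓖 →ₗ[k] Sec A A (⨆ i, U i) :=
    { toFun := t, map_add' := hadd, map_smul' := hsmul }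
  have hT : T ∈ coindSubmodule (Sec.derHom θ (⨆ i, U i)) := by
    rw [mem_coindSubmodule_iff]
    intro x u
    refine huniq _ _ _ (ht _) fun i => ?_
    rw [mem_coindSubmodule_iff.1 (toLin_mem (s i)) x u, ← ht u i]
    rfl
  refine ⟨⟨T, hT⟩, fun i u => ht u i, fun t' ht' => ?_⟩
  exact toLin_injective (LinearMap.ext fun u => huniq u _ _ (fun i => ht' i u) (ht u))

namespace HarishChandraPair

variable (P : HarishChandraPair k A 𝓖)

/-- The space `(G₀, 𝒪_G)` with `𝒪_G(V) = Hom_{U(𝔤₀)} (U(𝔤), 𝒪_{G₀}(V))`. -/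
def space : SuperRingedSpace k where
  carrier := PrimeSpectrum A
  sec V := Coind (Sec.derHom P.der V)
  par V := Coind.grading (Sec.derHom P.der V)
  res h := Coind.map (Sec.res h) fun x b => Sec.res_der h (P.der x) b
  res_mem h _ _ hs := Coind.map_mem _ _ hs
  res_refl _ := rfl
  res_trans _ _ _ := rfl
  exists_glue U s hs := by
    obtain ⟨t, ht, hu⟩ := Coind.exists_glue P.der U s fun i j u =>
      LinearMap.congr_fun (congrArg (Coind.toLin _) (hs i j)) u
    refine ⟨t, fun i => Coind.toLin_injective (LinearMap.ext fun u => ht i u), fun t' ht' => ?_⟩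
    exact hu t' fun i u => LinearMap.congr_fun (congrArg (Coind.toLin _) (ht' i)) u

/-- The canonical map from `𝒪(G) = Hom_{U(𝔤₀)} (U(𝔤), 𝒪(G₀))` to the sections of `𝒪_G` over `V`,
composing a map with `𝒪(G₀) → 𝒪_{G₀}(V)`. -/
def toSec (V : Opens (PrimeSpectrum A)) : Coind P.der →ₐ[k] Coind (Sec.derHom P.der V) :=
  Coind.map (Sec.ofAlg V) fun x b => Sec.ofAlg_der (P.der x) b

end HarishChandraPair

end PairSpace

end SHCP

end

/-! Let `B` be `A`, a localization of `A`, or a ring of sections, and consider `Coind` over `B`. An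
element `f` is determined by its components, the multilinear maps (v₁, …, vₙ) ↦ f(vₙ ⋯ v₁) on the
odd part. The relation vw + wv = [v, w] says that exchanging two neighbouring arguments of the
component of degree n + 2 changes its sign, up to a term given by the component of degree n. For a
fixed lower component these corrected exchanges are affine involutions. They satisfy the Coxeter
relations of a symmetric group: the braid relation is the Jacobi identity, and distant exchanges
commute because the lower component satisfies the relations itself. In characteristic zero such
involutions have a common fixed point, so a component can always be extended by two degrees
(`exists_fixed_of_coxeter`, `Multi.exists_good`). A compatible sequence carries an action of U(𝔤),
hence comes from an element of `Coind` (`Coind.comp_ofSeq`). Thus every alternating map is the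
leading component of some element (`Coind.exists_comp_eq`), and an element whose components vanish
up to degree dim 𝔤₁ is zero. This takes the place of a Poincaré–Birkhoff–Witt theorem.

Multiplication by `g` scales the leading component of `f` by g(1) (`Coind.comp_mul`). Three facts
follow by induction on the degree: evaluation at 1 is surjective with nilpotent kernel, so the
spectra of `A` and of the even part of 𝒪(G) are homeomorphic; an element is a unit when its value at
1 is; and localizing 𝒪(G) at the even elements whose value at 1 lies in `S` gives `Coind` over S⁻¹A
(`isLocalizedModule_toLocLin`). The last fact identifies the stalks. Finitely many components
suffice, so germs spread out to neighbourhoods and the sections agree (`Coind.secEquiv`).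
Supercommutativity is also checked on components.

For the Hopf structure, right translation by points of G₀ gives a coaction λ of `A` on 𝒪(G), where
λ(f) at (g, h) sends X to f(h⁻¹.X)(gh). The comultiplication μ is characterized by (1 ⊗ ev_Y) μ(f) =
(P^|Y| ⊗ 1) λ(Y f). Both maps exist because finitely many values determine an element of `Coind`, so
that W ⊗ Coind is Hom_{U(𝔤₀)}(U(𝔤), W ⊗ B). The needed 𝔤₀-linearity is the calculus of left and
right invariant vector fields, linked by the adjoint representation. Multiplicativity and
coassociativity use one principle, `Coind.eq_zero_of_invariant`: defects that vanish at 1 and are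
permuted by translations are zero. Each identity is thereby reduced to one with fewer copies of
𝒪(G), and finally to the Hopf algebra `A`. The antipode axioms are computed on X ⊗ Y and reduced to
those of U(𝔤). -/

set_option linter.unusedSectionVars false

noncomputable section

namespace SHCP

/-! ### Common fixed points of affine Coxeter involutions -/

section FixedPoint

variable {k X : Type u} [Field k] [CharZero k] [AddCommGroup X] [Module k X]

/-- The orbit `x, T₀ x, T₁ T₀ x, …`. -/
def coxeterOrbit (T : ℕ → X → X) (x : X) : ℕ → X
  | 0 => x
  | j + 1 => T j (coxeterOrbit T x j)

/-- Affine involutions satisfying the Coxeter relations of the symmetric group have a common fixed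
point, obtained by averaging; it can be chosen in a prescribed coset stable under them. -/
theorem exists_fixed_of_coxeter (n : ℕ) (D : ℕ → X →ₗ[k] X) (c : ℕ → X)
    (K : Submodule k X) (x₀ : X)
    (hK : ∀ p < n, ∀ x, x - x₀ ∈ K → D p x + c p - x₀ ∈ K)
    (hinv : ∀ p < n, ∀ x, D p (D p x + c p) + c p = x)
    (hcomm : ∀ p q, p + 2 ≤ q → q < n → ∀ x,
      D p (D q x + c q) + c p = D q (D p x + c p) + c q)
    (hbraid : ∀ p, p + 1 < n → ∀ x,
      D p (D (p + 1) (D p x + c p) + c (p + 1)) + c p =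
        D (p + 1) (D p (D (p + 1) x + c (p + 1)) + c p) + c (p + 1)) :
    ∃ x, x - x₀ ∈ K ∧ ∀ p < n, D p x + c p = x := by
  induction n generalizing D c with
  | zero => exact ⟨x₀, by simp, fun p hp => absurd hp (Nat.not_lt_zero p)⟩
  | succ n ih =>
    -- Fix a point under the parabolic subgroup generated by the involutions 1, …, n. Its translates
    -- under coset representatives are the n + 2 points of the orbit `y`.
    obtain ⟨x, hxK, hx⟩ := ih (fun p => D (p + 1)) (fun p => c (p + 1))
      (fun p hp => hK (p + 1) (by omega)) (fun p hp => hinv (p + 1) (by omega))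
      (fun p q h hq => hcomm (p + 1) (q + 1) (by omega) (by omega))
      (fun p hp => hbraid (p + 1) (by omega))
    let T : ℕ → X → X := fun p x => D p x + c p
    let y := coxeterOrbit T x
    have hy : ∀ j, y (j + 1) = D j (y j) + c j := fun j => rfl
    -- The involution `p` moves only `y p` and `y (p + 1)`, which it exchanges.
    have hP : ∀ j, (∀ p, p + 1 < j → j ≤ n + 1 → D p (y j) + c p = y j) ∧
        (∀ p, j < p → p < n + 1 → D p (y j) + c p = y j) := by
      intro j
      induction j with
      | zero =>
        refine ⟨fun p hp => absurd hp (by omega), fun p hp hpn => ?_⟩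
        obtain ⟨p, rfl⟩ := Nat.exists_eq_succ_of_ne_zero hp.ne'
        exact hx p (by omega)
      | succ j ihj =>
        refine ⟨fun p hp hj => ?_, fun p hp hpn => ?_⟩
        · rcases Nat.lt_or_ge (p + 1) j with h | h
          · rw [hy, hcomm p j (by omega) (by omega), ihj.1 p h (by omega)]
          · obtain rfl : j = p + 1 := by omega
            -- Here y(p+2) = T(p+1) T(p) y(p). The braid relation moves T(p+1) to the right, where
            -- it fixes y(p).
            rw [hy, hy, hbraid p (by omega)]
            congr 3
            -- The induction hypothesis concerns `y (p + 1)`, so the fact needed about `y p` is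
            -- obtained by a separate induction that uses commutation only.
            have hjp : D (p + 1) (y p) + c (p + 1) = y p := by
              have : ∀ q, (∀ p, q < p → p < n + 1 → D p (y q) + c p = y q) := by
                intro q
                induction q with
                | zero =>
                  intro p hp hpn
                  obtain ⟨p, rfl⟩ := Nat.exists_eq_succ_of_ne_zero hp.ne'
                  exact hx p (by omega)
                | succ q ihq =>
                  intro p hp hpn
                  rw [hy, ← hcomm q p (by omega) (by omega), ihq p (by omega) hpn]
              exact this p (p + 1) (by omega) (by omega)
            rw [hjp]
        · rw [hy, ← hcomm j p (by omega) (by omega), ihj.2 p (by omega) hpn]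
    have hyK : ∀ j, j ≤ n + 1 → y j - x₀ ∈ K := by
      intro j
      induction j with
      | zero => exact fun _ => hxK
      | succ j ihj => exact fun h => hK j (by omega) _ (ihj (by omega))
    have hN : ((n + 2 : ℕ) : k) ≠ 0 := Nat.cast_ne_zero.2 (by omega)
    refine ⟨((n + 2 : ℕ) : k)⁻¹ • ∑ j ∈ Finset.range (n + 2), y j, ?_, fun p hp => ?_⟩
    · have : ((n + 2 : ℕ) : k)⁻¹ • ∑ j ∈ Finset.range (n + 2), y j - x₀ =
          ((n + 2 : ℕ) : k)⁻¹ • ∑ j ∈ Finset.range (n + 2), (y j - x₀) := by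
        rw [Finset.sum_sub_distrib, Finset.sum_const, Finset.card_range, smul_sub,
          ← Nat.cast_smul_eq_nsmul k (n + 2) x₀, smul_smul, inv_mul_cancel₀ hN, one_smul]
      rw [this]
      exact K.smul_mem _ (K.sum_mem fun j hj => hyK j (by
        have := Finset.mem_range.1 hj; omega))
    · have key : ∀ j ∈ Finset.range (n + 2), D p (y j) + c p = y (Equiv.swap p (p + 1) j) := by
        intro j hj
        have hj := Finset.mem_range.1 hj
        rcases eq_or_ne j p with rfl | h1
        · rw [Equiv.swap_apply_left, hy]
        · rcases eq_or_ne j (p + 1) with rfl | h2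
          · rw [Equiv.swap_apply_right, hy, hinv p hp]
          · rw [Equiv.swap_apply_of_ne_of_ne h1 h2]
            rcases Nat.lt_or_ge p j with h | h
            · exact (hP j).1 p (by omega) (by omega)
            · exact (hP j).2 p (by omega) hp
      have hsum : ∑ j ∈ Finset.range (n + 2), (D p (y j) + c p) =
          ∑ j ∈ Finset.range (n + 2), y j := by
        rw [Finset.sum_congr rfl key]
        refine Finset.sum_equiv (Equiv.swap p (p + 1)) (fun j => ?_) fun j _ => rfl
        simp only [Finset.mem_range]
        rcases eq_or_ne j p with rfl | h1
        · rw [Equiv.swap_apply_left]; omega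
        · rcases eq_or_ne j (p + 1) with rfl | h2
          · rw [Equiv.swap_apply_right]; omega
          · rw [Equiv.swap_apply_of_ne_of_ne h1 h2]
      -- An affine map commutes with averages: the n + 2 copies of `c p`, divided by n + 2, give
      -- back `c p`.
      conv_rhs => rw [← hsum, Finset.sum_add_distrib, Finset.sum_const, Finset.card_range, smul_add,
        ← Nat.cast_smul_eq_nsmul k (n + 2) (c p), smul_smul, inv_mul_cancel₀ hN, one_smul]
      rw [map_smul, map_sum]

end FixedPoint

/-! ### Multilinear maps with values in a Lie module, and their corrected exchanges -/

section Tower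

variable (k L : Type u) [Field k] [LieRing L] [LieAlgebra k L]

/-- A bundled module over a Lie algebra. -/
structure LieMod where
  carrier : Type u
  [acg : AddCommGroup carrier]
  [mod : Module k carrier]
  [lrm : LieRingModule L carrier]
  [lm : LieModule k L carrier]

attribute [instance] LieMod.acg LieMod.mod LieMod.lrm LieMod.lm

/-- A symmetric equivariant bracket on a module over a Lie algebra, satisfying the Jacobi
identity: the odd part of a Lie superalgebra as seen from the even part. -/
structure OddBracket (V : Type u) [AddCommGroup V] [Module k V] [LieRingModule L V]
    [LieModule k L V] where
  toFun : V →ₗ[k] V →ₗ[k] L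
  symm : ∀ v w, toFun v w = toFun w v
  equivariant : ∀ (z : L) v w, ⁅z, toFun v w⁆ = toFun ⁅z, v⁆ w + toFun v ⁅z, w⁆
  jacobi : ∀ u v w, ⁅toFun u v, w⁆ + ⁅toFun v w, u⁆ + ⁅toFun u w, v⁆ = 0

variable {k L} (V : Type u) [AddCommGroup V] [Module k V] [LieRingModule L V] [LieModule k L V]

/-- The multilinear maps `Vⁿ → M`, in curried form. -/
def LieMod.multi (M : LieMod k L) : ℕ → LieMod k L
  | 0 => M
  | n + 1 => ⟨V →ₗ[k] (LieMod.multi M n).carrier⟩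

/-- The multilinear maps `Vⁿ → M`, in curried form. -/
abbrev Multi (M : LieMod k L) (n : ℕ) : Type u := (LieMod.multi V M n).carrier

namespace Multi

variable {V} {M N : LieMod k L} {n : ℕ}

/-- Evaluation of a multilinear map at its first argument. -/
def app : Multi V M (n + 1) ≃ₗ[k] (V →ₗ[k] Multi V M n) := LinearEquiv.refl k _

theorem app_lie (z : L) (F : Multi V M (n + 1)) (v : V) :
    app ⁅z, F⁆ v = ⁅z, app F v⁆ - app F ⁅z, v⁆ :=
  LieHom.lie_apply (R := k) (L := L) F z v

@[ext] theorem ext {F G : Multi V M (n + 1)} (h : ∀ v, app F v = app G v) : F = G :=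
  app.injective (LinearMap.ext h)

/-- The Lie action as a bilinear map. -/
def lieAct (M : LieMod k L) : L →ₗ[k] M.carrier →ₗ[k] M.carrier :=
  LinearMap.mk₂ k (fun x m => ⁅x, m⁆) add_lie smul_lie lie_add (fun c x m => lie_smul c x m)

variable (b : OddBracket k L V)

/-- The exchange of the first two arguments, corrected by the bracket. -/
def swapHead (n : ℕ) : Multi V M n × Multi V M (n + 2) →ₗ[k] Multi V M (n + 2) where
  toFun f := app.symm (app.symm.toLinearMap ∘ₗ
    (b.toFun.compr₂ ((lieAct (LieMod.multi V M n)).flip f.1) -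
      (app.toLinearMap ∘ₗ app f.2).flip))
  map_add' f g := by
    ext v w
    simp
    abel
  map_smul' c f := by
    ext v w
    simp [smul_sub]

/-- The exchange of the arguments `p` and `p + 1`, corrected by the bracket. -/
def swapAt : (n p : ℕ) → Multi V M n × Multi V M (n + 2) →ₗ[k] Multi V M (n + 2)
  | n, 0 => swapHead b n
  -- Exchanges are meaningful only for p ≤ n; outside this range the default leaves `F` unchanged.
  | 0, _ + 1 => LinearMap.snd k _ _
  | n + 1, p + 1 =>
    { toFun := fun f => app.symm (swapAt n p ∘ₗ (app f.1).prod (app f.2))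
      map_add' := fun f g => by
        ext1 v
        exact (congrArg (swapAt n p) (Prod.ext rfl rfl)).trans
          (map_add (swapAt n p) (app f.1 v, app f.2 v) (app g.1 v, app g.2 v))
      map_smul' := fun c f => by
        ext1 v
        exact (congrArg (swapAt n p) (Prod.ext rfl rfl)).trans
          (map_smul (swapAt n p) c (app f.1 v, app f.2 v)) }

theorem swapAt_zero : swapAt b (M := M) n 0 = swapHead b n := by
  cases n <;> rfl

theorem swapAt_zero_apply (f : Multi V M n) (F : Multi V M (n + 2)) (v w : V) :
    app (app (swapAt b n 0 (f, F)) v) w = ⁅b.toFun v w, f⁆ - app (app F w) v := by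
  rw [swapAt_zero]; rfl

theorem swapAt_succ_apply (p : ℕ) (f : Multi V M (n + 1)) (F : Multi V M (n + 3)) (v : V) :
    app (swapAt b (n + 1) (p + 1) (f, F)) v = swapAt b n p (app f v, app F v) := rfl

/-- Equivariance of the odd bracket makes every exchange a morphism of Lie modules. Hence the
relations are stable under the Lie algebra, which is what the commutation of distant exchanges
needs. -/
theorem swapAt_lie (n p : ℕ) (z : L) (f : Multi V M n) (F : Multi V M (n + 2)) :
    ⁅z, swapAt b n p (f, F)⁆ = swapAt b n p (⁅z, f⁆, ⁅z, F⁆) := by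
  induction p generalizing n with
  | zero =>
    ext v w
    simp only [app_lie, swapAt_zero_apply, lie_sub, LinearMap.sub_apply, map_sub]
    rw [leibniz_lie z (b.toFun v w) f, b.equivariant z v w, add_lie]
    abel
  | succ p ih =>
    cases n with
    | zero => rfl
    | succ n =>
      ext1 v
      rw [app_lie, swapAt_succ_apply, swapAt_succ_apply, swapAt_succ_apply, ih, ← map_sub]
      simp only [app_lie]
      rfl

theorem swapAt_involutive (n p : ℕ) (f : Multi V M n) (F : Multi V M (n + 2)) :
    swapAt b n p (f, swapAt b n p (f, F)) = F := by
  induction p generalizing n with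
  | zero =>
    ext v w
    rw [swapAt_zero_apply, swapAt_zero_apply, b.symm w v, sub_sub_cancel]
  | succ p ih =>
    cases n with
    | zero => rfl
    | succ n =>
      ext1 v
      rw [swapAt_succ_apply, swapAt_succ_apply, ih]

/-- The relation between the components of degrees `n` and `n + 2` of a linear map on the
enveloping algebra. -/
def Good (n : ℕ) (f : Multi V M n) (F : Multi V M (n + 2)) : Prop :=
  ∀ p ≤ n, swapAt b n p (f, F) = F

/-- The component of degree `n` satisfies the relations with a component of degree `n - 2`. -/
def PreGood : (n : ℕ) → Multi V M n → Prop
  | 0, _ => True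
  | 1, _ => True
  | n + 2, F => ∃ f, Good b n f F

theorem Good.app {f : Multi V M (n + 1)} {F : Multi V M (n + 3)} (h : Good b (n + 1) f F) (v : V) :
    Good b n (app f v) (app F v) := fun p hp => by
  have := h (p + 1) (by omega)
  rw [← swapAt_succ_apply, this]

theorem PreGood.app {F : Multi V M (n + 1)} (h : PreGood b (n + 1) F) (v : V) :
    PreGood b n (app F v) := by
  match n, F, h with
  | 0, _, _ => trivial
  | 1, _, _ => trivial
  | n + 2, F, ⟨f, hf⟩ => exact ⟨_, hf.app b v⟩

/-- The condition at the first two arguments is exactly the defining relation vw + wv = [v, w] of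
two odd elements. -/
theorem good_zero_iff {f : Multi V M n} {F : Multi V M (n + 2)} :
    swapAt b n 0 (f, F) = F ↔ ∀ v w, Multi.app (Multi.app F v) w + Multi.app (Multi.app F w) v =
      ⁅b.toFun v w, f⁆ := by
  constructor
  · intro h v w
    have h' := congrArg (fun G => Multi.app (Multi.app G v) w) h
    simp only [swapAt_zero_apply] at h'
    rw [← h', sub_add_cancel]
  · intro h
    ext v w
    rw [swapAt_zero_apply, ← h, add_sub_cancel_right]

theorem Good.lie {f : Multi V M n} {F : Multi V M (n + 2)} (h : Good b n f F) (z : L) :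
    Good b n ⁅z, f⁆ ⁅z, F⁆ := fun p hp => by
  rw [← swapAt_lie, h p hp]

/-- The two orders differ by the correction terms, in which the lower component `f` occurs with its
own arguments exchanged. They agree because `f` satisfies the relations with a component two degrees
below. -/
theorem swapAt_comm (n p q : ℕ) (hpq : p + 2 ≤ q) (hq : q ≤ n) (f : Multi V M n)
    (hf : PreGood b n f) (F : Multi V M (n + 2)) :
    swapAt b n p (f, swapAt b n q (f, F)) = swapAt b n q (f, swapAt b n p (f, F)) := by
  induction p generalizing n q with
  | zero =>
    obtain ⟨q, rfl⟩ : ∃ r, q = r + 2 := ⟨q - 2, by omega⟩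
    obtain ⟨n, rfl⟩ : ∃ r, n = r + 2 := ⟨n - 2, by omega⟩
    obtain ⟨g, hg⟩ := hf
    ext1 v
    ext1 w
    rw [swapAt_zero_apply, swapAt_succ_apply, swapAt_succ_apply, swapAt_succ_apply,
      swapAt_succ_apply, swapAt_zero_apply]
    have h0 := (good_zero_iff b).1 (hg 0 (by omega)) v w
    have h1 := hg.lie b (b.toFun v w) q (by omega)
    rw [← h0] at h1
    -- Split the pair so that its first summand is ([v, w]·g, [v, w]·f), which exchange `q` fixes
    -- because the pair (g, f) is good and goodness is stable under the Lie action.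
    have e : ((app (app f v) w, ⁅b.toFun v w, f⁆ - app (app F w) v) :
        Multi V M n × Multi V M (n + 2)) =
        (app (app f v) w + app (app f w) v, ⁅b.toFun v w, f⁆) -
          (app (app f w) v, app (app F w) v) := by
      rw [Prod.mk_sub_mk, add_sub_cancel_right]
    rw [e, map_sub, h1]
  | succ p ih =>
    obtain ⟨q, rfl⟩ : ∃ r, q = r + 1 := ⟨q - 1, by omega⟩
    obtain ⟨n, rfl⟩ : ∃ r, n = r + 1 := ⟨n - 1, by omega⟩
    ext1 v
    simp only [swapAt_succ_apply]
    exact ih n q (by omega) (by omega) _ (hf.app b v) _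

/-- The two sides of the braid relation differ by `f` applied to the Jacobi sum of three odd
vectors. No relation on `f` is needed here. -/
theorem swapAt_braid (n p : ℕ) (hp : p + 1 ≤ n) (f : Multi V M n) (F : Multi V M (n + 2)) :
    swapAt b n p (f, swapAt b n (p + 1) (f, swapAt b n p (f, F))) =
      swapAt b n (p + 1) (f, swapAt b n p (f, swapAt b n (p + 1) (f, F))) := by
  induction p generalizing n with
  | zero =>
    obtain ⟨n, rfl⟩ : ∃ r, n = r + 1 := ⟨n - 1, by omega⟩
    ext1 u
    ext1 v
    ext1 w
    simp only [swapAt_zero_apply, swapAt_succ_apply, map_sub, LinearMap.sub_apply, app_lie]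
    have h : app f ⁅b.toFun u v, w⁆ + app f ⁅b.toFun v w, u⁆ + app f ⁅b.toFun u w, v⁆ = 0 := by
      rw [← map_add, ← map_add, b.jacobi, map_zero]
    refine sub_eq_zero.1 (neg_eq_zero.1 (Eq.trans ?_ h))
    abel
  | succ p ih =>
    obtain ⟨n, rfl⟩ : ∃ r, n = r + 1 := ⟨n - 1, by omega⟩
    ext1 v
    simp only [swapAt_succ_apply]
    exact ih n (by omega) _ _

/-- Extension of a linear map satisfying the relations by one more degree. -/
theorem exists_good [CharZero k] (n : ℕ) (f : Multi V M n) (hf : PreGood b n f)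
    (K : Submodule k (Multi V M (n + 2))) (F₀ : Multi V M (n + 2))
    (hK : ∀ p ≤ n, ∀ F, F - F₀ ∈ K → swapAt b n p (f, F) - F₀ ∈ K) :
    ∃ F, F - F₀ ∈ K ∧ Good b n f F := by
  -- With `f` held fixed, the exchange is affine in `F`: its linear part is the exchange with lower
  -- component zero, its constant part the value at F = 0.
  have e : ∀ p F, (swapAt b n p ∘ₗ LinearMap.inr k _ _) F + swapAt b n p (f, 0) =
      swapAt b n p (f, F) := fun p F => by
    rw [LinearMap.comp_apply, LinearMap.inr_apply, ← map_add, Prod.mk_add_mk, zero_add, add_zero]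
  obtain ⟨F, h1, h2⟩ := exists_fixed_of_coxeter (k := k) (n + 1)
    (fun p => swapAt b n p ∘ₗ LinearMap.inr k _ _) (fun p => swapAt b n p (f, 0)) K F₀
    (fun p hp F hF => by rw [e]; exact hK p (by omega) F hF)
    (fun p hp F => by rw [e, e, swapAt_involutive])
    (fun p q hpq hq F => by simp only [e]; exact swapAt_comm b n p q hpq (by omega) f hf F)
    (fun p hp F => by simp only [e]; exact swapAt_braid b n p (by omega) f F)
  exact ⟨F, h1, fun p hp => by rw [← e]; exact h2 p (by omega)⟩

/-- The relations with a vanishing component of degree `n - 2`: alternating maps. -/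
def Alternating : (n : ℕ) → Multi V M n → Prop
  | 0, _ => True
  | 1, _ => True
  | n + 2, F => Good b n 0 F

theorem Alternating.preGood {F : Multi V M n} (h : Alternating b n F) : PreGood b n F := by
  match n, F, h with
  | 0, _, _ => trivial
  | 1, _, _ => trivial
  | n + 2, F, h => exact ⟨_, h⟩

theorem Alternating.app {F : Multi V M (n + 1)} (h : Alternating b (n + 1) F) (v : V) :
    Alternating b n (app F v) := by
  match n, F, h with
  | 0, _, _ => trivial
  | 1, _, _ => trivial
  | n + 2, F, h => exact Good.app b h v

theorem alternating_zero (n : ℕ) : Alternating b n (0 : Multi V M n) := by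
  match n with
  | 0 => trivial
  | 1 => trivial
  | n + 2 => exact fun p _ => map_zero (swapAt b n p)

theorem Alternating.app_app {F : Multi V M (n + 2)} (h : Alternating b (n + 2) F) (v w : V) :
    Multi.app (Multi.app F v) w = -Multi.app (Multi.app F w) v := by
  have := (good_zero_iff b).1 (h 0 (Nat.zero_le _)) v w
  rw [lie_zero] at this
  exact eq_neg_of_add_eq_zero_left this

/-- An alternating map vanishes if its degree exceeds the number of basis vectors. -/
theorem Alternating.eq_zero [CharZero k] {ι : Type*} [DecidableEq ι] (e : Module.Basis ι k V)
    (F : Multi V M n) (h : Alternating b n F) (S : Finset ι) (hS : S.card < n)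
    (hF : ∀ (m : ℕ) (hm : n = m + 1), ∀ i ∉ S, Multi.app (hm ▸ F) (e i) = 0) : F = 0 := by
  induction n generalizing S with
  | zero => exact absurd hS (Nat.not_lt_zero _)
  | succ n ih =>
    have hF := hF n rfl
    refine Multi.app.injective (e.ext fun i => ?_)
    rw [map_zero, LinearMap.zero_apply]
    by_cases hi : i ∈ S
    -- Fixing `e i` as first argument leaves an alternating map that vanishes off S \ {i}: on `e i`
    -- because 2 is invertible, on the vectors outside `S` by antisymmetry.
    · refine ih _ (h.app b _) (S.erase i) ?_ ?_
      · rw [Finset.card_erase_of_mem hi]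
        have := Finset.card_pos.2 ⟨i, hi⟩
        omega
      · rintro m rfl j hj
        rw [h.app_app b]
        by_cases hj' : j ∈ S
        · obtain rfl : j = i := by
            by_contra hne
            exact hj (Finset.mem_erase.2 ⟨hne, hj'⟩)
          have h' := h.app_app b (e j) (e j)
          have h2 : (2 : k) • Multi.app (Multi.app F (e j)) (e j) = 0 := by
            rw [two_smul]
            exact add_eq_zero_iff_eq_neg.2 h'
          rw [(smul_eq_zero.1 h2).resolve_left two_ne_zero, neg_zero]
        · rw [hF j hj', map_zero, LinearMap.zero_apply, neg_zero]
    · exact hF i hi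

theorem Alternating.eq_zero_of_finrank_lt [CharZero k] [FiniteDimensional k V]
    (hn : Module.finrank k V < n) (F : Multi V M n) (h : Alternating b n F) : F = 0 := by
  refine h.eq_zero b (Module.finBasis k V) F Finset.univ ?_ ?_
  · rwa [Finset.card_univ, Fintype.card_fin]
  · exact fun m hm i hi => absurd (Finset.mem_univ i) hi

/-- Every alternating map is the first nonzero component of a linear map satisfying all
relations. -/
theorem exists_good_sequence [CharZero k] (r : ℕ) (G : Multi V M r) (hG : Alternating b r G) :
    ∃ f : ∀ n, Multi V M n, (∀ n, Good b n (f n) (f (n + 2))) ∧ (∀ n < r, f n = 0) ∧ f r = G := by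
  classical
  let T : ∀ n, Multi V M n := Function.update 0 r G
  have hT : ∀ n, Alternating b n (T n) := by
    intro n
    rcases eq_or_ne n r with rfl | h
    · rwa [show T n = G from Function.update_self _ _ _]
    · rw [show T n = 0 from Function.update_of_ne h _ _]
      exact alternating_zero b n
  -- A vanishing component is followed by the prescribed value, so that `G` enters at degree r; a
  -- nonvanishing one is extended by averaging.
  have step : ∀ (n : ℕ) (f : Multi V M n), PreGood b n f →
      ∃ F, Good b n f F ∧ (f = 0 → F = T (n + 2)) := by
    intro n f hf
    by_cases h : f = 0
    · exact ⟨T (n + 2), by rw [h]; exact hT (n + 2), fun _ => rfl⟩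
    · obtain ⟨F, -, hF⟩ := exists_good b n f hf ⊤ 0 fun _ _ _ _ => trivial
      exact ⟨F, hF, fun h' => absurd h' h⟩
  choose next h1 h2 using step
  -- The recursion goes from degree n to n + 2, so the state consists of two consecutive components
  -- with their relations.
  let X : ℕ → Type u := fun n =>
    {x : Multi V M n × Multi V M (n + 1) // PreGood b n x.1 ∧ PreGood b (n + 1) x.2}
  let s : ∀ n, X n := fun n => Nat.rec ⟨(T 0, T 1), trivial, trivial⟩
    (fun n x => ⟨(x.1.2, next n x.1.1 x.2.1), x.2.2, ⟨_, h1 n x.1.1 x.2.1⟩⟩) n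
  have hgood : ∀ n, Good b n (s n).1.1 (s (n + 2)).1.1 := fun n => h1 n _ _
  have hzero : ∀ n, (s n).1.1 = 0 → (s (n + 2)).1.1 = T (n + 2) := fun n => h2 n _ _
  -- The clause `hzero` makes the sequence follow `T` through degree r inclusive, since `T` vanishes
  -- in all smaller degrees.
  have hlt : ∀ n, (∀ m < n, T m = 0) → (s n).1.1 = T n := by
    intro n
    induction n using Nat.strong_induction_on with
    | _ n ih =>
      match n with
      | 0 => exact fun _ => rfl
      | 1 => exact fun _ => rfl
      | n + 2 =>
        intro h
        refine hzero n ?_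
        rw [ih n (by omega) fun m hm => h m (by omega), h n (by omega)]
  have hTlt : ∀ m < r, T m = 0 := fun m hm => Function.update_of_ne hm.ne _ _
  refine ⟨fun n => (s n).1.1, hgood, fun n hn => ?_, ?_⟩
  · show (s n).1.1 = 0
    rw [hlt n fun m hm => hTlt m (by omega), hTlt n hn]
  · show (s r).1.1 = G
    rw [hlt r hTlt]
    exact Function.update_self _ _ _

variable (V) in
/-- Composition of a multilinear map with a linear map. -/
def mapRange (φ : M.carrier →ₗ[k] N.carrier) : (n : ℕ) → Multi V M n →ₗ[k] Multi V N n
  | 0 => φ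
  | n + 1 => Multi.app.symm.toLinearMap ∘ₗ
      LinearMap.compRight k (mapRange φ n) ∘ₗ Multi.app.toLinearMap

theorem mapRange_app (φ : M.carrier →ₗ[k] N.carrier) (F : Multi V M (n + 1)) (v : V) :
    app (mapRange V φ (n + 1) F) v = mapRange V φ n (app F v) := rfl

/-- With lower component zero the correction term disappears, so φ need not be equivariant for the
Lie algebra. This matters because scaling by an element of `B` is not. -/
theorem mapRange_swapAt (φ : M.carrier →ₗ[k] N.carrier) (n p : ℕ) (F : Multi V M (n + 2)) :
    mapRange V φ (n + 2) (swapAt b n p (0, F)) = swapAt b n p (0, mapRange V φ (n + 2) F) := by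
  induction p generalizing n with
  | zero =>
    ext v w
    simp only [mapRange_app, swapAt_zero_apply, lie_zero, zero_sub, map_neg]
  | succ p ih =>
    cases n with
    | zero => rfl
    | succ n =>
      ext1 v
      rw [mapRange_app, swapAt_succ_apply, swapAt_succ_apply, map_zero, map_zero,
        LinearMap.zero_apply, LinearMap.zero_apply, ih]
      rfl

/-- If the image of a multilinear map is alternating, it is the image of an alternating map. -/
theorem exists_alternating [CharZero k] (φ : M.carrier →ₗ[k] N.carrier) (n : ℕ)
    (F : Multi V M n) (h : Alternating b n (mapRange V φ n F)) :
    ∃ G, Alternating b n G ∧ mapRange V φ n G = mapRange V φ n F := by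
  match n, F, h with
  | 0, F, _ => exact ⟨F, trivial, rfl⟩
  | 1, F, _ => exact ⟨F, trivial, rfl⟩
  | n + 2, F, h =>
    -- The averaging stays inside the coset of `F` modulo the maps killed by φ: the exchanges
    -- preserve that coset because the image of `F` is already alternating.
    obtain ⟨G, h1, h2⟩ := exists_good b n 0 (alternating_zero b n).preGood
      (LinearMap.ker (mapRange V φ (n + 2))) F fun p hp G hG => by
        rw [LinearMap.mem_ker, map_sub, sub_eq_zero] at hG ⊢
        rw [mapRange_swapAt, hG]
        exact h p hp
    exact ⟨G, h2, sub_eq_zero.1 (by rw [← map_sub]; exact h1)⟩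

end Multi

end Tower

end SHCP

end

noncomputable section

namespace SHCP

/-! ### The odd part of a Lie superalgebra as a module over the even part -/

section OddPart

variable (k : Type u) {𝔤 : Type u} [Field k] [CharZero k] [AddCommGroup 𝔤] [Module k 𝔤]
  (𝓖 : ZMod 2 → Submodule k 𝔤) [DirectSum.Decomposition 𝓖] [LieSuperalgebra k 𝓖]

/-- The odd part `𝔤₁` of a Lie superalgebra. -/
def OddPart : Type u := ↥(𝓖 1)

instance : AddCommGroup (OddPart k 𝓖) := inferInstanceAs (AddCommGroup ↥(𝓖 1))
instance : Module k (OddPart k 𝓖) := inferInstanceAs (Module k ↥(𝓖 1))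
instance [FiniteDimensional k 𝔤] : FiniteDimensional k (OddPart k 𝓖) :=
  inferInstanceAs (FiniteDimensional k ↥(𝓖 1))

/-- The inclusion `𝔤₁ → 𝔤`. -/
def OddPart.incl : OddPart k 𝓖 →ₗ[k] 𝔤 := (𝓖 1).subtype

theorem OddPart.incl_injective : Function.Injective (OddPart.incl k 𝓖) :=
  Subtype.val_injective

theorem OddPart.incl_mem (x : OddPart k 𝓖) : OddPart.incl k 𝓖 x ∈ 𝓖 1 := Subtype.property _

/-- The projection `𝔤 → 𝔤₁`. -/
def OddPart.proj : 𝔤 →ₗ[k] OddPart k 𝓖 :=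
  DirectSum.component k (ZMod 2) (fun i => ↥(𝓖 i)) 1 ∘ₗ (DirectSum.decomposeLinearEquiv 𝓖).toLinearMap

variable {k 𝓖} in
theorem EvenLie.proj_incl (x : EvenLie k 𝓖) : EvenLie.proj k 𝓖 (EvenLie.incl k 𝓖 x) = x := by
  apply EvenLie.incl_injective
  exact DirectSum.decompose_of_mem_same 𝓖 (EvenLie.incl_mem k 𝓖 x)

variable {k 𝓖} in
theorem OddPart.proj_incl (x : OddPart k 𝓖) : OddPart.proj k 𝓖 (OddPart.incl k 𝓖 x) = x := by
  apply OddPart.incl_injective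
  exact DirectSum.decompose_of_mem_same 𝓖 (OddPart.incl_mem k 𝓖 x)

variable {k 𝓖} in
theorem EvenLie.proj_odd (x : OddPart k 𝓖) : EvenLie.proj k 𝓖 (OddPart.incl k 𝓖 x) = 0 := by
  apply EvenLie.incl_injective
  exact DirectSum.decompose_of_mem_ne 𝓖 (OddPart.incl_mem k 𝓖 x) (by decide)

variable {k 𝓖} in
theorem OddPart.proj_even (x : EvenLie k 𝓖) : OddPart.proj k 𝓖 (EvenLie.incl k 𝓖 x) = 0 := by
  apply OddPart.incl_injective
  exact DirectSum.decompose_of_mem_ne 𝓖 (EvenLie.incl_mem k 𝓖 x) (by decide)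

variable {k 𝓖} in
theorem exists_incl_of_mem {i : ZMod 2} {x : 𝔤} (hx : x ∈ 𝓖 i) :
    (i = 0 ∧ ∃ z, EvenLie.incl k 𝓖 z = x) ∨ (i = 1 ∧ ∃ v, OddPart.incl k 𝓖 v = x) := by
  rcases zmod_two_cases i with rfl | rfl
  · exact Or.inl ⟨rfl, ⟨x, hx⟩, rfl⟩
  · exact Or.inr ⟨rfl, ⟨x, hx⟩, rfl⟩

theorem LieSuperalgebra.bracket_even_even {x y z : 𝔤} (hx : x ∈ 𝓖 0) {j : ZMod 2}
    (hy : y ∈ 𝓖 j) : LieSuperalgebra.bracket 𝓖 x (LieSuperalgebra.bracket 𝓖 y z) =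
      LieSuperalgebra.bracket 𝓖 (LieSuperalgebra.bracket 𝓖 x y) z +
        LieSuperalgebra.bracket 𝓖 y (LieSuperalgebra.bracket 𝓖 x z) := by
  have := LieSuperalgebra.bracket_jacobi z hx hy
  rwa [zero_mul, uzpow_zero, one_smul] at this

instance : LieRingModule (EvenLie k 𝓖) (OddPart k 𝓖) where
  bracket z v := ⟨LieSuperalgebra.bracket 𝓖 (EvenLie.incl k 𝓖 z) (OddPart.incl k 𝓖 v), by
    have := LieSuperalgebra.bracket_mem (EvenLie.incl_mem k 𝓖 z) (OddPart.incl_mem k 𝓖 v)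
    rwa [zero_add] at this⟩
  add_lie x y v := OddPart.incl_injective k 𝓖 <| by
    show LieSuperalgebra.bracket 𝓖 (EvenLie.incl k 𝓖 (x + y)) (OddPart.incl k 𝓖 v) =
      LieSuperalgebra.bracket 𝓖 (EvenLie.incl k 𝓖 x) (OddPart.incl k 𝓖 v) +
      LieSuperalgebra.bracket 𝓖 (EvenLie.incl k 𝓖 y) (OddPart.incl k 𝓖 v)
    rw [map_add, map_add, LinearMap.add_apply]
  lie_add x v w := OddPart.incl_injective k 𝓖 <| by
    show LieSuperalgebra.bracket 𝓖 (EvenLie.incl k 𝓖 x) (OddPart.incl k 𝓖 (v + w)) =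
      LieSuperalgebra.bracket 𝓖 (EvenLie.incl k 𝓖 x) (OddPart.incl k 𝓖 v) +
      LieSuperalgebra.bracket 𝓖 (EvenLie.incl k 𝓖 x) (OddPart.incl k 𝓖 w)
    rw [map_add, map_add]
  leibniz_lie x y v := OddPart.incl_injective k 𝓖 <|
    LieSuperalgebra.bracket_even_even k 𝓖 (EvenLie.incl_mem k 𝓖 x) (EvenLie.incl_mem k 𝓖 y)

variable {k 𝓖} in
theorem OddPart.incl_lie (z : EvenLie k 𝓖) (v : OddPart k 𝓖) : OddPart.incl k 𝓖 ⁅z, v⁆ =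
    LieSuperalgebra.bracket 𝓖 (EvenLie.incl k 𝓖 z) (OddPart.incl k 𝓖 v) := rfl

instance : LieModule k (EvenLie k 𝓖) (OddPart k 𝓖) where
  smul_lie c x v := OddPart.incl_injective k 𝓖 <| by
    rw [map_smul, OddPart.incl_lie, OddPart.incl_lie, map_smul, map_smul, LinearMap.smul_apply]
  lie_smul c x v := OddPart.incl_injective k 𝓖 <| by
    rw [map_smul, OddPart.incl_lie, OddPart.incl_lie, map_smul, map_smul]

/-- The bracket `𝔤₁ × 𝔤₁ → 𝔤₀`. -/
def oddBracketMap : OddPart k 𝓖 →ₗ[k] OddPart k 𝓖 →ₗ[k] EvenLie k 𝓖 :=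
  ((LieSuperalgebra.bracket 𝓖).compl₁₂ (OddPart.incl k 𝓖) (OddPart.incl k 𝓖)).compr₂
    (EvenLie.proj k 𝓖)

variable {k 𝓖} in
theorem incl_oddBracketMap (v w : OddPart k 𝓖) :
    EvenLie.incl k 𝓖 (oddBracketMap k 𝓖 v w) =
      LieSuperalgebra.bracket 𝓖 (OddPart.incl k 𝓖 v) (OddPart.incl k 𝓖 w) := by
  have h := LieSuperalgebra.bracket_mem (OddPart.incl_mem k 𝓖 v) (OddPart.incl_mem k 𝓖 w)
  rw [CharTwo.add_self_eq_zero] at h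
  exact DirectSum.decompose_of_mem_same 𝓖 h

/-- The odd part of a Lie superalgebra with its bracket to the even part. -/
def oddBracket : OddBracket k (EvenLie k 𝓖) (OddPart k 𝓖) where
  toFun := oddBracketMap k 𝓖
  symm v w := EvenLie.incl_injective k 𝓖 <| by
    rw [incl_oddBracketMap, incl_oddBracketMap,
      LieSuperalgebra.bracket_skew (OddPart.incl_mem k 𝓖 v) (OddPart.incl_mem k 𝓖 w), mul_one,
      uzpow_one, Units.neg_smul, one_smul, neg_neg]
  equivariant z v w := EvenLie.incl_injective k 𝓖 <| by
    rw [map_add, EvenLie.incl_lie]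
    simp only [incl_oddBracketMap, OddPart.incl_lie]
    exact LieSuperalgebra.bracket_even_even k 𝓖 (EvenLie.incl_mem k 𝓖 z) (OddPart.incl_mem k 𝓖 v)
  jacobi u v w := OddPart.incl_injective k 𝓖 <| by
    simp only [map_add, OddPart.incl_lie, incl_oddBracketMap, map_zero]
    have hm : ∀ a b : OddPart k 𝓖, LieSuperalgebra.bracket 𝓖 (OddPart.incl k 𝓖 a)
        (OddPart.incl k 𝓖 b) ∈ 𝓖 0 := fun a b => by
      rw [← incl_oddBracketMap]; exact EvenLie.incl_mem k 𝓖 _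
    have h := LieSuperalgebra.bracket_jacobi (OddPart.incl k 𝓖 w) (OddPart.incl_mem k 𝓖 u)
      (OddPart.incl_mem k 𝓖 v)
    rw [mul_one, uzpow_one, Units.neg_smul, one_smul,
      LieSuperalgebra.bracket_skew (OddPart.incl_mem k 𝓖 u) (hm v w),
      LieSuperalgebra.bracket_skew (OddPart.incl_mem k 𝓖 v) (hm u w), mul_zero, uzpow_zero,
      one_smul, one_smul, neg_neg] at h
    rw [add_right_comm, ← h, neg_add_cancel]

end OddPart

/-! ### Right translations and evaluation at 1 on the coinduced superalgebra -/

section Translation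

variable {k 𝔤 : Type u} [Field k] [CharZero k] [AddCommGroup 𝔤] [Module k 𝔤]
  {𝓖 : ZMod 2 → Submodule k 𝔤} [DirectSum.Decomposition 𝓖] [LieSuperalgebra k 𝓖]
  {B C : Type u} [CommRing B] [Algebra k B] [CommRing C] [Algebra k C]

theorem Env.tmul_mul_ι_tmul_one {i : ZMod 2} {y : Env k 𝓖} (hy : y ∈ envGrading k 𝓖 i)
    (a b : Env k 𝓖) :
    GradedTensorProduct.tmul k (𝒜 := envGrading k 𝓖) (ℬ := envGrading k 𝓖) a b *
      GradedTensorProduct.tmul k y 1 =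
    GradedTensorProduct.tmul k (a * y) (Env.parityPow k 𝓖 i b) := by
  induction b using DirectSum.Decomposition.inductionOn (envGrading k 𝓖) with
  | zero => simp [GradedTensorProduct.tmul]
  | @homogeneous j b =>
    rw [Env.parityPow_of_mem b.2]
    have := GradedTensorProduct.tmul_coe_mul_coe_tmul (R := k) (envGrading k 𝓖) (envGrading k 𝓖)
      a b ⟨y, hy⟩ 1
    rw [mul_one] at this
    rw [this, mul_comm i j]
    simp only [Units.smul_def, GradedTensorProduct.tmul, TensorProduct.tmul_smul, map_zsmul]
  | add b c hb hc =>
    simp only [GradedTensorProduct.tmul, TensorProduct.tmul_add, map_add, add_mul] at *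
    rw [hb, hc]

theorem Env.tmul_mul_one_tmul (y a b : Env k 𝓖) :
    GradedTensorProduct.tmul k (𝒜 := envGrading k 𝓖) (ℬ := envGrading k 𝓖) a b *
      GradedTensorProduct.tmul k 1 y =
    GradedTensorProduct.tmul k a (b * y) := by
  induction b using DirectSum.Decomposition.inductionOn (envGrading k 𝓖) with
  | zero => simp [GradedTensorProduct.tmul]
  | @homogeneous j b => exact GradedTensorProduct.tmul_coe_mul_one_tmul _ _ a b y
  | add b c hb hc =>
    simp only [GradedTensorProduct.tmul, TensorProduct.tmul_add, map_add, add_mul] at *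
    rw [hb, hc]

/-- Right-handed counterpart of `Env.comul_ι_mul`. The sign now falls on the second tensor factor,
which `x` passes on its way to the first. -/
theorem Env.comul_mul_ι {i : ZMod 2} {x : 𝔤} (hx : x ∈ 𝓖 i) (u : Env k 𝓖) :
    Env.comul k 𝓖 (u * Env.ι k 𝓖 x) =
      TensorProduct.map (LinearMap.mulRight k (Env.ι k 𝓖 x)) (Env.parityPow k 𝓖 i)
        (Env.comul k 𝓖 u) +
      TensorProduct.map LinearMap.id (LinearMap.mulRight k (Env.ι k 𝓖 x))
        (Env.comul k 𝓖 u) := by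
  simp only [Env.comul, LinearMap.comp_apply, AlgHom.toLinearMap_apply, map_mul]
  generalize Env.comulAlg k 𝓖 u = t
  rw [Env.comulAlg, Env.lift_ι]
  simp only [LinearMap.add_apply, LinearMap.comp_apply, AlgHom.toLinearMap_apply,
        GradedTensorProduct.includeLeft_apply, GradedTensorProduct.includeRight_apply]
  obtain ⟨t, rfl⟩ := (GradedTensorProduct.of k (envGrading k 𝓖) (envGrading k 𝓖)).surjective t
  induction t using TensorProduct.induction_on with
  | zero => simp
  | tmul a b =>
    have h1 := Env.tmul_mul_ι_tmul_one (Env.ι_mem hx) a b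
    have h2 := Env.tmul_mul_one_tmul (Env.ι k 𝓖 x) a b
    rw [mul_add]
    simp only [GradedTensorProduct.tmul] at h1 h2 ⊢
    rw [h1, h2]
    simp
  | add a b ha hb =>
    simp only [map_add, add_mul] at *
    simp only [LinearEquiv.coe_coe] at *
    rw [ha, hb]; abel

variable {θ : EvenLie k 𝓖 →ₗ⁅k⁆ Derivation k B B}

namespace Coind

variable (θ) in
/-- The action of `U(𝔤)` on `Hom_{U(𝔤₀)} (U(𝔤), B)` by right translations. -/
def translate : Env k 𝓖 →ₐ[k] Module.End k (Coind θ) :=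
  AlgHom.ofLinearMap
    (LinearMap.mk₂ k
      (fun u f => (⟨toLin θ f ∘ₗ LinearMap.mulRight k u, mem_coindSubmodule_iff.2 fun x v => by
        simp only [LinearMap.comp_apply, LinearMap.mulRight_apply, mul_assoc]
        exact mem_coindSubmodule_iff.1 (toLin_mem f) x _⟩ : Coind θ))
      (fun u v f => Subtype.ext (LinearMap.ext fun w => by
        show toLin θ f (w * (u + v)) = toLin θ f (w * u) + toLin θ f (w * v)
        rw [mul_add, map_add]))
      (fun c u f => Subtype.ext (LinearMap.ext fun w => by
        show toLin θ f (w * (c • u)) = c • toLin θ f (w * u)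
        rw [mul_smul_comm, map_smul]))
      (fun u f g => rfl)
      (fun c u f => rfl))
    (LinearMap.ext fun f => Subtype.ext (LinearMap.ext fun w => congrArg (toLin θ f) (mul_one w)))
    (fun u v => LinearMap.ext fun f => Subtype.ext (LinearMap.ext fun w =>
      congrArg (toLin θ f) (mul_assoc w u v).symm))

theorem translate_apply (u : Env k 𝓖) (f : Coind θ) (w : Env k 𝓖) :
    toLin θ (translate θ u f) w = toLin θ f (w * u) := rfl

theorem ext {f g : Coind θ} (h : ∀ u, toLin θ f u = toLin θ g u) : f = g :=
  toLin_injective (LinearMap.ext h)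

variable (θ) in
/-- The power `P ^ i` of the parity involution. -/
def parityPow (i : ZMod 2) : Coind θ →ₐ[k] Coind θ :=
  if i = 0 then AlgHom.id k _ else parity θ

theorem parityPow_apply (i : ZMod 2) (f : Coind θ) (u : Env k 𝓖) :
    toLin θ (parityPow θ i f) u = toLin θ f (Env.parityPow k 𝓖 i u) := by
  rcases zmod_two_cases i with rfl | rfl
  · rw [parityPow, if_pos rfl, Env.parityPow_zero]; rfl
  · rw [parityPow, if_neg (by decide), Env.parityPow_one]; rfl

theorem even_of_ι {z : EvenLie k 𝓖} (f : Coind θ) (u : Env k 𝓖) :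
    toLin θ f (Env.ι k 𝓖 (EvenLie.incl k 𝓖 z) * u) = θ z (toLin θ f u) :=
  mem_coindSubmodule_iff.1 (toLin_mem f) z u

end Coind

theorem Env.proj_mem (j : ZMod 2) (u : Env k 𝓖) : Env.proj j u ∈ envGrading k 𝓖 j :=
  parityProj_mem (Env.parity_parity k 𝓖) j u

theorem Env.proj_parityPow (i j : ZMod 2) (u : Env k 𝓖) :
    Env.proj j (Env.parityPow k 𝓖 i u) = ((-1 : ℤˣ) ^ (i * j)) • Env.proj j u := by
  rw [← Env.parityPow_of_mem (Env.proj_mem j u)]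
  rcases zmod_two_cases i with rfl | rfl
  · rw [Env.parityPow_zero]; rfl
  · rw [Env.parityPow_one]
    show Env.proj j (Env.parity k 𝓖 u) = Env.parity k 𝓖 (Env.proj j u)
    simp only [Env.proj, parityProj_apply, map_smul, map_add, Units.smul_def, map_zsmul,
      AlgHom.toLinearMap_apply]

theorem Env.proj_mul_of_mem {i : ZMod 2} {x : Env k 𝓖} (hx : x ∈ envGrading k 𝓖 i) (j : ZMod 2)
    (u : Env k 𝓖) : Env.proj (j + i) (u * x) = Env.proj j u * x := by
  have h : Env.parity k 𝓖 x = ((-1 : ℤˣ) ^ i) • x := hx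
  simp only [Env.proj, parityProj_apply, AlgHom.toLinearMap_apply, map_mul, h, mul_smul_comm,
    smul_smul, smul_mul_assoc, add_mul]
  rw [uzpow_add, mul_assoc, ← uzpow_add, CharTwo.add_self_eq_zero, uzpow_zero, mul_one]

theorem Env.sum_proj (u : Env k 𝓖) : Env.proj 0 u + Env.proj 1 u = u := by
  simp only [Env.proj, parityProj_apply, uzpow_zero, one_smul, uzpow_one, Units.neg_smul]
  rw [← smul_add, ← sub_eq_add_neg, add_add_sub_cancel, ← two_smul k u, smul_smul,
    inv_mul_cancel₀ two_ne_zero, one_smul]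

namespace Coind

/-- Right translations by elements of `𝔤` are superderivations. -/
theorem translate_mul {i : ZMod 2} {x : 𝔤} (hx : x ∈ 𝓖 i) (f g : Coind θ) :
    translate θ (Env.ι k 𝓖 x) (f * g) =
      translate θ (Env.ι k 𝓖 x) f * g + parityPow θ i f * translate θ (Env.ι k 𝓖 x) g := by
  apply ext
  intro u
  rw [translate_apply, toLin_mul, map_add, LinearMap.add_apply, toLin_mul, toLin_mul]
  simp only [convMul, LinearMap.comp_apply]
  rw [show (Coalgebra.comul (R := k) (u * Env.ι k 𝓖 x)) = _ from Env.comul_mul_ι hx u,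
    show (Coalgebra.comul (R := k) u) = Env.comul k 𝓖 u from rfl]
  generalize Env.comul k 𝓖 u = t
  induction t using TensorProduct.induction_on with
  | zero => simp
  | add a b ha hb =>
    simp only [map_add] at *
    rw [add_add_add_comm, ha, hb]; abel
  | tmul a b =>
    simp only [TensorProduct.map_tmul, map_add, LinearMap.mulRight_apply, LinearMap.id_apply,
      koszulMap, LinearMap.sum_apply, LinearMap.comp_apply, map_sum, LinearMap.mul'_apply,
      translate_apply, parityPow_apply]
    congr 1
    -- The parity power in the first factor and the one in the second factor each contribute
    -- (-1)^(ij), and these signs cancel.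
    · refine Finset.sum_congr rfl fun j _ => ?_
      rw [Env.parityPow_mul, Env.parityPow_of_mem (Env.ι_mem hx), Env.proj_parityPow,
        Units.smul_def, Units.smul_def, mul_smul_comm, map_zsmul, map_zsmul, smul_mul_smul_comm,
        ← Units.val_mul, mul_comm j i, ← uzpow_add, CharTwo.add_self_eq_zero, uzpow_zero,
        Units.val_one, one_smul]
    -- Multiplying the second argument by `x` shifts its parity by `i`, so the Koszul sum is
    -- reindexed by this shift.
    · rw [← Equiv.sum_comp (Equiv.addRight i)]
      refine Finset.sum_congr rfl fun j _ => ?_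
      rw [Equiv.coe_addRight, Env.proj_mul_of_mem (Env.ι_mem hx), Env.parityPow_parityPow,
        add_comm i j]

variable (θ) in
/-- Evaluation at `1`, the restriction to the underlying even group. -/
def evalOne : Coind θ →ₐ[k] B :=
  AlgHom.ofLinearMap (LinearMap.applyₗ 1 ∘ₗ toLin θ)
    (by simp [toLin_one, convOne])
    (fun f g => by
      show toLin θ (f * g) 1 = toLin θ f 1 * toLin θ g 1
      rw [toLin_mul]
      simp only [convMul, LinearMap.comp_apply]
      rw [show (Coalgebra.comul (R := k) (1 : Env k 𝓖)) = _ from Env.comul_one k 𝓖]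
      simp only [koszulMap, LinearMap.sum_apply, TensorProduct.map_tmul, map_sum,
        LinearMap.mul'_apply, LinearMap.comp_apply]
      have h : ∀ i, Env.parityPow k 𝓖 i 1 = 1 := fun i => by
        rcases zmod_two_cases i with rfl | rfl
        · rw [Env.parityPow_zero]; rfl
        · rw [Env.parityPow_one]; exact map_one (Env.parity k 𝓖)
      simp only [h]
      rw [← Finset.mul_sum, ← map_sum, zmod_two_sum, Env.sum_proj])

theorem evalOne_apply (f : Coind θ) : evalOne θ f = toLin θ f 1 := rfl

end Coind

end Translation

end SHCP

end

noncomputable section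

namespace SHCP

/-! ### Components on odd vectors, and the construction of elements from them -/

section Components

variable {k 𝔤 : Type u} [Field k] [CharZero k] [AddCommGroup 𝔤] [Module k 𝔤]
  {𝓖 : ZMod 2 → Submodule k 𝔤} [DirectSum.Decomposition 𝓖] [LieSuperalgebra k 𝓖]
  {B C : Type u} [CommRing B] [Algebra k B] [CommRing C] [Algebra k C]
  (θ : EvenLie k 𝓖 →ₗ⁅k⁆ Derivation k B B)

/-- The action of `𝔤₀` on `B` through derivations. -/
@[reducible] def derLieRingModule : LieRingModule (EvenLie k 𝓖) B where
  bracket z b := θ z b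
  add_lie x y b := by
    show θ (x + y) b = θ x b + θ y b
    rw [map_add]; rfl
  lie_add x b c := map_add (θ x) b c
  leibniz_lie x y b := by
    show θ x (θ y b) = θ ⁅x, y⁆ b + θ y (θ x b)
    rw [LieHom.map_lie, Derivation.commutator_apply, sub_add_cancel]

/-- An algebra on which `𝔤₀` acts by derivations, as a module over `𝔤₀`. -/
def derMod : LieMod k (EvenLie k 𝓖) :=
  letI := derLieRingModule θ
  { carrier := B
    lm :=
    { smul_lie := fun c x b => by
        show θ (c • x) b = c • θ x b
        rw [map_smul]; rfl
      lie_smul := fun c x b => (θ x).map_smul c b } }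

/-- Multiplication by an element of `B`. -/
def derMod.scale (b : B) : (derMod θ).carrier →ₗ[k] (derMod θ).carrier := LinearMap.mulLeft k b

/-- The multilinear maps `𝔤₁ⁿ → B`. -/
abbrev Comp (n : ℕ) : Type u := Multi (OddPart k 𝓖) (derMod θ) n

namespace Coind

/-- The component of degree `n` of `f`: the multilinear map `(v₁, …, vₙ) ↦ f(vₙ ⋯ v₁)` on the odd
part. -/
def comp : (n : ℕ) → Coind θ →ₗ[k] Comp θ n
  | 0 => (evalOne θ).toLinearMap
  | n + 1 =>
    { toFun := fun f => Multi.app.symm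
        (comp n ∘ₗ (translate θ).toLinearMap.flip f ∘ₗ Env.ι k 𝓖 ∘ₗ OddPart.incl k 𝓖)
      map_add' := fun f g => by
        ext1 v
        simp
      map_smul' := fun c f => by
        ext1 v
        simp }

variable {θ}

theorem comp_zero_apply (f : Coind θ) : comp θ 0 f = toLin θ f 1 := rfl

theorem comp_succ_app (n : ℕ) (f : Coind θ) (v : OddPart k 𝓖) :
    Multi.app (comp θ (n + 1) f) v =
      comp θ n (translate θ (Env.ι k 𝓖 (OddPart.incl k 𝓖 v)) f) := rfl

theorem translate_even_odd (z : EvenLie k 𝓖) (v : OddPart k 𝓖) (f : Coind θ) :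
    translate θ (Env.ι k 𝓖 (OddPart.incl k 𝓖 v)) (translate θ (Env.ι k 𝓖 (EvenLie.incl k 𝓖 z)) f) =
      translate θ (Env.ι k 𝓖 (EvenLie.incl k 𝓖 z)) (translate θ (Env.ι k 𝓖 (OddPart.incl k 𝓖 v)) f)
        - translate θ (Env.ι k 𝓖 (OddPart.incl k 𝓖 ⁅z, v⁆)) f := by
  have h := Env.ι_mul_ι (EvenLie.incl_mem k 𝓖 z) (OddPart.incl_mem k 𝓖 v)
  rw [zero_mul, uzpow_zero, one_smul, ← OddPart.incl_lie] at h
  rw [← Module.End.mul_apply, ← Module.End.mul_apply, ← map_mul (translate θ), ← map_mul (translate θ), h, map_add,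
    LinearMap.add_apply, add_sub_cancel_right]

theorem translate_odd_odd (v w : OddPart k 𝓖) (f : Coind θ) :
    translate θ (Env.ι k 𝓖 (OddPart.incl k 𝓖 v)) (translate θ (Env.ι k 𝓖 (OddPart.incl k 𝓖 w)) f) +
      translate θ (Env.ι k 𝓖 (OddPart.incl k 𝓖 w)) (translate θ (Env.ι k 𝓖 (OddPart.incl k 𝓖 v)) f) =
        translate θ (Env.ι k 𝓖 (EvenLie.incl k 𝓖 (oddBracketMap k 𝓖 v w))) f := by
  have h := Env.ι_mul_ι (OddPart.incl_mem k 𝓖 v) (OddPart.incl_mem k 𝓖 w)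
  rw [mul_one, uzpow_one, Units.neg_smul, one_smul, ← incl_oddBracketMap] at h
  rw [← Module.End.mul_apply, ← Module.End.mul_apply, ← map_mul (translate θ), ← map_mul (translate θ), h, map_add, map_neg,
    LinearMap.add_apply, LinearMap.neg_apply, neg_add_cancel_comm]

/-- Moving `z` to the left past the odd vectors produces the commutator terms of the action on
multilinear maps; once it is leftmost, U(𝔤₀)-linearity turns it into the derivation of `B`. -/
theorem comp_translate_even (n : ℕ) (z : EvenLie k 𝓖) (f : Coind θ) :
    comp θ n (translate θ (Env.ι k 𝓖 (EvenLie.incl k 𝓖 z)) f) = ⁅z, comp θ n f⁆ := by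
  induction n generalizing f with
  | zero =>
    show toLin θ f (1 * Env.ι k 𝓖 (EvenLie.incl k 𝓖 z)) = θ z (toLin θ f 1)
    rw [one_mul, ← even_of_ι, mul_one]
  | succ n ih =>
    ext1 v
    rw [Multi.app_lie, comp_succ_app, comp_succ_app, comp_succ_app, translate_even_odd, map_sub, ih]

/-- The first exchange is the anticommutation relation of translations; a later one is a first
exchange for a translate of `f`. -/
theorem comp_good (n : ℕ) (f : Coind θ) :
    Multi.Good (oddBracket k 𝓖) n (comp θ n f) (comp θ (n + 2) f) := by
  intro p hp
  induction p generalizing n f with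
  | zero =>
    rw [Multi.good_zero_iff]
    intro v w
    simp only [comp_succ_app]
    rw [← map_add, add_comm, translate_odd_odd, comp_translate_even]
    rfl
  | succ p ih =>
    obtain ⟨n, rfl⟩ : ∃ r, n = r + 1 := ⟨n - 1, by omega⟩
    ext1 v
    exact ih n (translate θ _ f) (by omega)

/-- Elements with all components zero are stable under translation by even and by odd vectors, hence
by all of U(𝔤); and f(u) is the component of degree 0 of the translate by `u`. -/
theorem eq_zero_of_comp_eq_zero {f : Coind θ} (h : ∀ n, comp θ n f = 0) : f = 0 := by
  have key : ∀ u, ∀ n, comp θ n (translate θ u f) = 0 := by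
    intro u
    induction u using Env.induction_left with
    | one => intro n; rw [map_one]; exact h n
    | add u v hu hv => intro n; rw [map_add, LinearMap.add_apply, map_add, hu, hv, add_zero]
    | smul c u hu => intro n; rw [map_smul, LinearMap.smul_apply, map_smul, hu, smul_zero]
    | @mul i x u hx hu =>
      intro n
      rw [map_mul, Module.End.mul_apply]
      rcases exists_incl_of_mem hx with ⟨rfl, z, rfl⟩ | ⟨rfl, v, rfl⟩
      · rw [comp_translate_even, hu, lie_zero]
      · rw [← comp_succ_app, hu, map_zero, LinearMap.zero_apply]
  apply ext
  intro u
  have := key u 0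
  rw [comp_zero_apply, translate_apply, one_mul] at this
  exact this

variable (θ) in
/-- The sequences of multilinear maps satisfying the relations of `U(𝔤)`. -/
def goodSeq : Submodule k (∀ n, Comp θ n) where
  carrier := {f | ∀ n, Multi.Good (oddBracket k 𝓖) n (f n) (f (n + 2))}
  add_mem' {f g} hf hg n p hp := by
    have := congrArg₂ (· + ·) (hf n p hp) (hg n p hp)
    simp only [← map_add] at this
    exact this
  zero_mem' n p _ := map_zero (Multi.swapAt (oddBracket k 𝓖) n p)
  smul_mem' c f hf n p hp := by
    have := congrArg (c • ·) (hf n p hp)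
    simp only [← map_smul] at this
    exact this

variable (θ) in
/-- The action of `𝔤₀` on sequences. -/
def seqEven : EvenLie k 𝓖 →ₗ[k] Module.End k (goodSeq θ) :=
  LinearMap.mk₂ k (fun z f => (⟨fun n => ⁅z, f.1 n⁆, fun n => (f.2 n).lie _ z⟩ : goodSeq θ))
    (fun x y f => Subtype.ext (funext fun n => add_lie x y (f.1 n)))
    (fun c x f => Subtype.ext (funext fun n => smul_lie c x (f.1 n)))
    (fun x f g => Subtype.ext (funext fun n => lie_add x (f.1 n) (g.1 n)))
    (fun c x f => Subtype.ext (funext fun n => lie_smul c x (f.1 n)))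

variable (θ) in
/-- The action of `𝔤₁` on sequences. -/
def seqOdd : OddPart k 𝓖 →ₗ[k] Module.End k (goodSeq θ) :=
  LinearMap.mk₂ k
    (fun v f => (⟨fun n => Multi.app (f.1 (n + 1)) v, fun n => (f.2 (n + 1)).app _ v⟩ : goodSeq θ))
    (fun x y f => Subtype.ext (funext fun n => map_add (Multi.app (f.1 (n + 1))) x y))
    (fun c x f => Subtype.ext (funext fun n => map_smul (Multi.app (f.1 (n + 1))) c x))
    (fun _ _ _ => rfl)
    (fun _ _ _ => rfl)

theorem seqOdd_apply (v : OddPart k 𝓖) (f : goodSeq θ) (n : ℕ) :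
    (seqOdd θ v f).1 n = Multi.app (f.1 (n + 1)) v := rfl

theorem seqEven_seqEven (x y : EvenLie k 𝓖) :
    seqEven θ x * seqEven θ y = seqEven θ y * seqEven θ x + seqEven θ ⁅x, y⁆ := by
  refine LinearMap.ext fun f => Subtype.ext (funext fun n => ?_)
  show ⁅x, ⁅y, f.1 n⁆⁆ = ⁅y, ⁅x, f.1 n⁆⁆ + ⁅⁅x, y⁆, f.1 n⁆
  rw [leibniz_lie x y, add_comm]

theorem seqEven_seqOdd (x : EvenLie k 𝓖) (v : OddPart k 𝓖) :
    seqEven θ x * seqOdd θ v = seqOdd θ v * seqEven θ x + seqOdd θ ⁅x, v⁆ := by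
  refine LinearMap.ext fun f => Subtype.ext (funext fun n => ?_)
  show ⁅x, Multi.app (f.1 (n + 1)) v⁆ = Multi.app ⁅x, f.1 (n + 1)⁆ v + Multi.app (f.1 (n + 1)) ⁅x, v⁆
  rw [Multi.app_lie, sub_add_cancel]

/-- An odd vector acts by filling the first argument, so the anticommutator is governed by the first
exchange alone. The other exchanges make the sequences stable under this action. -/
theorem seqOdd_seqOdd (v w : OddPart k 𝓖) :
    seqOdd θ v * seqOdd θ w = -(seqOdd θ w * seqOdd θ v) + seqEven θ (oddBracketMap k 𝓖 v w) := by
  refine LinearMap.ext fun f => Subtype.ext (funext fun n => ?_)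
  show Multi.app (Multi.app (f.1 (n + 2)) w) v = -Multi.app (Multi.app (f.1 (n + 2)) v) w +
    ⁅oddBracketMap k 𝓖 v w, f.1 n⁆
  have := (Multi.good_zero_iff _).1 (f.2 n 0 (Nat.zero_le _)) v w
  rw [show oddBracketMap k 𝓖 v w = (oddBracket k 𝓖).toFun v w from rfl, ← this, neg_add_cancel_left]

variable (θ) in
/-- The action of `𝔤` on sequences. -/
def seqLie : 𝔤 →ₗ[k] Module.End k (goodSeq θ) :=
  seqEven θ ∘ₗ EvenLie.proj k 𝓖 + seqOdd θ ∘ₗ OddPart.proj k 𝓖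

theorem seqLie_even (z : EvenLie k 𝓖) : seqLie θ (EvenLie.incl k 𝓖 z) = seqEven θ z := by
  rw [seqLie, LinearMap.add_apply, LinearMap.comp_apply, LinearMap.comp_apply, EvenLie.proj_incl,
    OddPart.proj_even, map_zero, add_zero]

theorem seqLie_odd (v : OddPart k 𝓖) : seqLie θ (OddPart.incl k 𝓖 v) = seqOdd θ v := by
  rw [seqLie, LinearMap.add_apply, LinearMap.comp_apply, LinearMap.comp_apply, OddPart.proj_incl,
    EvenLie.proj_odd, map_zero, zero_add]

theorem mul_eq_neg_one_smul_add {R : Type*} [Ring R] {a b c : R} (h : a * b = -(b * a) + c) :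
    a * b = ((-1 : ℤˣ) ^ (1 * 1 : ZMod 2)) • (b * a) + c := by
  rw [mul_one, uzpow_one, Units.neg_smul, one_smul, h]

theorem mul_eq_add_neg {R : Type*} [Ring R] {a b c : R} (h : b * a = a * b + c) :
    a * b = b * a + -c := by
  rw [h, add_neg_cancel_right]

variable (θ) in
/-- The action of `U(𝔤)` on sequences. -/
def seqEnv : Env k 𝓖 →ₐ[k] Module.End k (goodSeq θ) :=
  Env.lift (𝓖 := 𝓖) (R := Module.End k (goodSeq θ)) (seqLie θ) fun {i j x y} hx hy => by
    rcases exists_incl_of_mem hx with ⟨rfl, x, rfl⟩ | ⟨rfl, x, rfl⟩ <;>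
    rcases exists_incl_of_mem hy with ⟨rfl, y, rfl⟩ | ⟨rfl, y, rfl⟩
    · rw [← EvenLie.incl_lie, seqLie_even, seqLie_even, seqLie_even, seqEven_seqEven, mul_zero,
        uzpow_zero, one_smul]
    · rw [← OddPart.incl_lie, seqLie_even, seqLie_odd, seqLie_odd, seqEven_seqOdd, zero_mul,
        uzpow_zero, one_smul]
    · rw [LieSuperalgebra.bracket_skew (OddPart.incl_mem k 𝓖 x) (EvenLie.incl_mem k 𝓖 y),
        ← OddPart.incl_lie, mul_zero, uzpow_zero, one_smul, one_smul, map_neg, seqLie_even,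
        seqLie_odd, seqLie_odd]
      exact mul_eq_add_neg (seqEven_seqOdd y x)
    · rw [← incl_oddBracketMap, seqLie_even, seqLie_odd, seqLie_odd]
      exact mul_eq_neg_one_smul_add (seqOdd_seqOdd x y)

variable (θ) in
/-- The linear map on `U(𝔤)` with given components. -/
def ofSeq (f : goodSeq θ) : Coind θ :=
  ⟨(LinearMap.proj 0 ∘ₗ (goodSeq θ).subtype) ∘ₗ (seqEnv θ).toLinearMap.flip f,
    mem_coindSubmodule_iff.2 fun x u => by
      show ((seqEnv θ (Env.ι k 𝓖 (EvenLie.incl k 𝓖 x) * u)) f).1 0 = θ x ((seqEnv θ u f).1 0)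
      rw [map_mul, seqEnv, Env.lift_ι, seqLie_even]
      rfl⟩

theorem translate_ofSeq (u : Env k 𝓖) (f : goodSeq θ) :
    translate θ u (ofSeq θ f) = ofSeq θ (seqEnv θ u f) := by
  apply ext
  intro w
  show ((seqEnv θ (w * u)) f).1 0 = _
  rw [map_mul]
  rfl

/-- Reading off degree 0 after acting by U(𝔤) intertwines the action on sequences with translation,
so filling arguments one by one recovers each term. -/
theorem comp_ofSeq (n : ℕ) (f : goodSeq θ) : comp θ n (ofSeq θ f) = f.1 n := by
  induction n generalizing f with
  | zero =>
    show ((seqEnv θ 1) f).1 0 = _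
    rw [map_one]
    rfl
  | succ n ih =>
    ext1 v
    rw [comp_succ_app, translate_ofSeq, ih, seqEnv, Env.lift_ι, seqLie_odd, seqOdd_apply]

/-- Every alternating multilinear map is the leading component of an element of
`Hom_{U(𝔤₀)} (U(𝔤), B)`. -/
theorem exists_comp_eq (r : ℕ) (G : Comp θ r) (hG : Multi.Alternating (oddBracket k 𝓖) r G) :
    ∃ f : Coind θ, (∀ n < r, comp θ n f = 0) ∧ comp θ r f = G := by
  obtain ⟨f, h1, h2, h3⟩ := Multi.exists_good_sequence _ r G hG
  refine ⟨ofSeq θ ⟨f, h1⟩, fun n hn => ?_, ?_⟩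
  · rw [comp_ofSeq]; exact h2 n hn
  · rw [comp_ofSeq]; exact h3

theorem exists_evalOne_eq (b : B) : ∃ f : Coind θ, parity θ f = f ∧ evalOne θ f = b := by
  obtain ⟨f, -, hf⟩ := exists_comp_eq (θ := θ) 0 b trivial
  have hf : evalOne θ f = b := hf
  have hp : evalOne θ (parity θ f) = evalOne θ f :=
    congrArg (toLin θ f) (map_one (Env.parity k 𝓖))
  -- Averaging with the parity involution gives an even lift without changing the value at 1.
  refine ⟨(2⁻¹ : k) • (f + parity θ f), ?_, ?_⟩
  · rw [map_smul, map_add, parity_parity, add_comm]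
  · rw [map_smul, map_add, hp, hf, ← two_smul k b, smul_smul, inv_mul_cancel₀ two_ne_zero, one_smul]

/-- Once the lower components vanish, the correction terms in the exchange relations vanish too. -/
theorem comp_alternating (r : ℕ) (f : Coind θ) (hf : ∀ n < r, comp θ n f = 0) :
    Multi.Alternating (oddBracket k 𝓖) r (comp θ r f) := by
  match r with
  | 0 => trivial
  | 1 => trivial
  | r + 2 =>
    have := comp_good r f
    rw [hf r (by omega)] at this
    exact this

/-- Beyond degree dim 𝔤₁ the first possibly nonzero component would be an alternating map in too
many arguments. Every induction on the degree therefore stops after finitely many steps. -/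
theorem eq_zero_of_comp_eq_zero_of_le [FiniteDimensional k 𝔤] {f : Coind θ}
    (h : ∀ n ≤ Module.finrank k (OddPart k 𝓖), comp θ n f = 0) : f = 0 := by
  refine eq_zero_of_comp_eq_zero fun n => ?_
  induction n using Nat.strong_induction_on with
  | _ n ih =>
    rcases Nat.lt_or_ge (Module.finrank k (OddPart k 𝓖)) n with hn | hn
    · exact (comp_alternating n f ih).eq_zero_of_finrank_lt _ hn
    · exact h n hn

theorem evalOne_parityPow (i : ZMod 2) (f : Coind θ) :
    evalOne θ (parityPow θ i f) = evalOne θ f := by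
  rw [evalOne_apply, parityPow_apply, evalOne_apply]
  rcases zmod_two_cases i with rfl | rfl
  · rw [Env.parityPow_zero]; rfl
  · rw [Env.parityPow_one]; exact congrArg _ (map_one (Env.parity k 𝓖))

/-- Multiplication by `g` acts on the leading component of `f` by `g(1)`. -/
theorem comp_mul (r : ℕ) (g f : Coind θ) (hf : ∀ n < r, comp θ n f = 0) :
    comp θ r (g * f) = Multi.mapRange (OddPart k 𝓖)
      (derMod.scale θ (evalOne θ g)) r (comp θ r f) := by
  induction r generalizing g f with
  | zero => exact map_mul (evalOne θ) g f
  | succ r ih =>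
    ext1 v
    -- Of the two Leibniz terms, the one differentiating `g` still contains `f` and its component of
    -- degree r is zero. In the other, the parity twist of `g` does not affect g(1).
    rw [Multi.mapRange_app, comp_succ_app, translate_mul (OddPart.incl_mem k 𝓖 v), map_add,
      ih _ f (fun n hn => hf n (by omega)), hf r (by omega), map_zero, zero_add, ih, comp_succ_app,
      evalOne_parityPow]
    intro n hn
    rw [← comp_succ_app, hf (n + 1) (by omega), map_zero, LinearMap.zero_apply]

theorem comp_mul_eq_zero (r : ℕ) (g f : Coind θ) (hf : ∀ n < r, comp θ n f = 0) :
    ∀ n < r, comp θ n (g * f) = 0 := fun n hn => by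
  rw [comp_mul n g f fun m hm => hf m (by omega), hf n hn, map_zero]

/-- Each further factor `f` multiplies the leading component by f(1) = 0 and so removes one more
component. -/
theorem pow_eq_zero_of_evalOne [FiniteDimensional k 𝔤] {f : Coind θ} (h : evalOne θ f = 0) :
    f ^ (Module.finrank k (OddPart k 𝓖) + 1) = 0 := by
  have key : ∀ r, ∀ n < r, comp θ n (f ^ r) = 0 := by
    intro r
    induction r with
    | zero => exact fun n hn => absurd hn (Nat.not_lt_zero n)
    | succ r ih =>
      intro n hn
      rw [pow_succ']
      rcases Nat.lt_succ_iff_lt_or_eq.1 hn with hn | rfl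
      · exact comp_mul_eq_zero r _ _ ih n hn
      · rw [comp_mul n _ _ ih, h]
        have : ∀ (m : ℕ) (F : Comp θ m),
            Multi.mapRange (OddPart k 𝓖) (derMod.scale θ 0) m F = 0 := by
          intro m
          induction m with
          | zero => exact fun F => zero_mul (M₀ := B) F
          | succ m ihm => exact fun F => Multi.ext fun v => ihm _
        exact this _ _
  exact eq_zero_of_comp_eq_zero_of_le fun n hn => key _ n (by omega)

/-- An element is invertible if its value at `1` is. -/
theorem isUnit_of_evalOne [FiniteDimensional k 𝔤] {f : Coind θ} (h : IsUnit (evalOne θ f)) :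
    IsUnit f := by
  obtain ⟨b, hb⟩ := h.exists_right_inv
  obtain ⟨g, -, hg⟩ := exists_evalOne_eq (θ := θ) b
  -- An element with value 1 at 1 is one plus a nilpotent. This applies to f g and to g f, giving
  -- inverses of `f` on both sides.
  have key : ∀ x : Coind θ, evalOne θ x = 1 → IsUnit x := fun x hx => by
    have : IsNilpotent (x - 1) := ⟨_, pow_eq_zero_of_evalOne (by rw [map_sub, hx, map_one, sub_self])⟩
    simpa using this.isUnit_add_one
  have h1 : IsUnit (f * g) := key _ (by rw [map_mul, hg, hb])
  have h2 : IsUnit (g * f) := key _ (by rw [map_mul, hg, mul_comm, hb])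
  obtain ⟨c, hc⟩ := h1.exists_right_inv
  obtain ⟨d, hd⟩ := h2.exists_left_inv
  rw [mul_assoc] at hc
  rw [← mul_assoc] at hd
  exact isUnit_iff_exists.2 ⟨g * c, hc, by rw [← left_inv_eq_right_inv hd hc, hd]⟩

end Coind

end Components

end SHCP

end

noncomputable section

namespace SHCP

/-! ### Change of coefficients for multilinear maps -/

namespace Multi

variable {k L : Type u} [Field k] [LieRing L] [LieAlgebra k L]
  {V : Type u} [AddCommGroup V] [Module k V] [LieRingModule L V] [LieModule k L V]
  {M N N' : LieMod k L}

theorem mapRange_comp (ψ : N.carrier →ₗ[k] N'.carrier) (φ : M.carrier →ₗ[k] N.carrier) (n : ℕ)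
    (F : Multi V M n) :
    mapRange V (ψ ∘ₗ φ) n F = mapRange V ψ n (mapRange V φ n F) := by
  induction n with
  | zero => rfl
  | succ n ih => exact ext fun v => ih _

theorem mapRange_eq_zero_imp {φ : M.carrier →ₗ[k] N.carrier} {ψ : M.carrier →ₗ[k] N'.carrier}
    (h : ∀ m, φ m = 0 → ψ m = 0) (n : ℕ) (F : Multi V M n) (hF : mapRange V φ n F = 0) :
    mapRange V ψ n F = 0 := by
  induction n with
  | zero => exact h F hF
  | succ n ih =>
    refine ext fun v => ?_
    rw [mapRange_app, map_zero, LinearMap.zero_apply]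
    refine ih _ ?_
    rw [← mapRange_app, hF, map_zero, LinearMap.zero_apply]

/-- If every element killed by `φ` is killed by a member of a directed family of linear maps, the
same holds for multilinear maps. -/
theorem exists_mapRange_eq_zero [FiniteDimensional k V] {ι : Type*} [Nonempty ι]
    (φ : M.carrier →ₗ[k] N.carrier) (N' : ι → LieMod k L)
    (ψ : ∀ i, M.carrier →ₗ[k] (N' i).carrier)
    (hdir : ∀ i j, ∃ l, (∀ m, ψ i m = 0 → ψ l m = 0) ∧ ∀ m, ψ j m = 0 → ψ l m = 0)
    (h : ∀ m, φ m = 0 → ∃ i, ψ i m = 0) (n : ℕ) (F : Multi V M n) (hF : mapRange V φ n F = 0) :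
    ∃ i, mapRange V (ψ i) n F = 0 := by
  induction n with
  | zero => exact h F hF
  | succ n ih =>
    let e := Module.finBasis k V
    -- A first argument has finitely many basis values; directedness provides one index killing all
    -- of them.
    have key : ∀ s : Finset (Fin (Module.finrank k V)),
        ∃ i, ∀ j ∈ s, mapRange V (ψ i) n (app F (e j)) = 0 := by
      intro s
      induction s using Finset.induction_on with
      | empty => exact ⟨Classical.arbitrary ι, fun j hj => absurd hj (Finset.notMem_empty j)⟩
      | insert a s _ ihs =>
        obtain ⟨i, hi⟩ := ihs
        obtain ⟨i', hi'⟩ := ih (app F (e a)) (by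
          rw [← mapRange_app, hF, map_zero, LinearMap.zero_apply])
        obtain ⟨l, h1, h2⟩ := hdir i i'
        refine ⟨l, fun j hj => ?_⟩
        rcases Finset.mem_insert.1 hj with rfl | hj
        · exact mapRange_eq_zero_imp h2 n _ hi'
        · exact mapRange_eq_zero_imp h1 n _ (hi j hj)
    obtain ⟨i, hi⟩ := key Finset.univ
    refine ⟨i, app.injective (e.ext fun j => ?_)⟩
    rw [mapRange_app, hi j (Finset.mem_univ j), map_zero, LinearMap.zero_apply]

end Multi

/-! ### Supercommutativity of the coinduced superalgebra -/

section SuperCommutative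

variable {k 𝔤 : Type u} [Field k] [CharZero k] [AddCommGroup 𝔤] [Module k 𝔤]
  {𝓖 : ZMod 2 → Submodule k 𝔤} [DirectSum.Decomposition 𝓖] [LieSuperalgebra k 𝓖]
  {B C : Type u} [CommRing B] [Algebra k B] [CommRing C] [Algebra k C]
  {θ : EvenLie k 𝓖 →ₗ⁅k⁆ Derivation k B B} {θ' : EvenLie k 𝓖 →ₗ⁅k⁆ Derivation k C C}

variable (θ θ') in
/-- An algebra morphism as a linear map. -/
def derMod.hom (φ : B →ₐ[k] C) : (derMod θ).carrier →ₗ[k] (derMod θ').carrier := φ.toLinearMap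

namespace Coind

theorem mem_grading {i : ZMod 2} {f : Coind θ} :
    f ∈ grading θ i ↔ parity θ f = ((-1 : ℤˣ) ^ i) • f := Iff.rfl

theorem parityPow_of_mem {i j : ZMod 2} {f : Coind θ} (hf : f ∈ grading θ j) :
    parityPow θ i f = ((-1 : ℤˣ) ^ (i * j)) • f := by
  rcases zmod_two_cases i with rfl | rfl
  · rw [parityPow, if_pos rfl, zero_mul, uzpow_zero, one_smul]; rfl
  · rw [parityPow, if_neg (by decide), one_mul]; exact hf

theorem translate_parityPow (i : ZMod 2) (u : Env k 𝓖) (f : Coind θ) :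
    translate θ u (parityPow θ i f) = parityPow θ i (translate θ (Env.parityPow k 𝓖 i u) f) :=
  ext fun w => by
    rw [translate_apply, parityPow_apply, parityPow_apply, translate_apply, Env.parityPow_mul]

theorem parity_eq_parityPow : parity θ = parityPow θ 1 := (if_neg (by decide)).symm

theorem translate_mem {i j : ZMod 2} {u : Env k 𝓖} (hu : u ∈ envGrading k 𝓖 i) {f : Coind θ}
    (hf : f ∈ grading θ j) : translate θ u f ∈ grading θ (i + j) := by
  rw [mem_grading, parity_eq_parityPow] at hf ⊢
  have h : parityPow θ 1 (translate θ u f) =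
      translate θ (Env.parityPow k 𝓖 1 u) (parityPow θ 1 f) := by
    rw [translate_parityPow, Env.parityPow_parityPow, CharTwo.add_self_eq_zero,
      Env.parityPow_zero]
    rfl
  rw [h, hf, Env.parityPow_of_mem hu, one_mul, Units.smul_def, Units.smul_def, map_zsmul,
    map_zsmul, LinearMap.smul_apply, ← Units.smul_def, ← Units.smul_def, smul_smul, ← uzpow_add,
    add_comm j i]

theorem evalOne_odd {f : Coind θ} (hf : f ∈ grading θ 1) : evalOne θ f = 0 := by
  have h := evalOne_parityPow 1 f
  rw [← parity_eq_parityPow, mem_grading.1 hf, uzpow_one, Units.neg_smul, one_smul, map_neg,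
    neg_eq_iff_add_eq_zero, ← two_smul k] at h
  exact (smul_eq_zero.1 h).resolve_left two_ne_zero

/-- Translation by an odd vector is a superderivation, so it turns a supercommutator into a sum of
supercommutators, and the degree drops by one. In degree 0 the target is commutative and odd
elements have value zero at 1. -/
theorem comp_supercomm (n : ℕ) {i j : ZMod 2} {f g : Coind θ} (hf : f ∈ grading θ i)
    (hg : g ∈ grading θ j) : comp θ n (f * g - ((-1 : ℤˣ) ^ (i * j)) • (g * f)) = 0 := by
  induction n generalizing i j f g with
  | zero =>
    show evalOne θ (f * g - ((-1 : ℤˣ) ^ (i * j)) • (g * f)) = 0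
    rw [map_sub, Units.smul_def, map_zsmul, map_mul, map_mul, mul_comm (evalOne θ g)]
    rcases zmod_two_cases i with rfl | rfl
    · rw [zero_mul, uzpow_zero, Units.val_one, one_smul, sub_self]
    · rw [evalOne_odd hf, zero_mul, smul_zero, sub_zero]
  | succ n ih =>
    refine Multi.ext fun v => ?_
    have hv := OddPart.incl_mem k 𝓖 v
    have h1 := ih (translate_mem (Env.ι_mem hv) hf) hg
    have h2 := ih hf (translate_mem (Env.ι_mem hv) hg)
    rw [comp_succ_app, map_zero, LinearMap.zero_apply, map_sub, Units.smul_def, map_zsmul,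
      translate_mul hv, translate_mul hv, parityPow_of_mem hf, parityPow_of_mem hg]
    generalize translate θ (Env.ι k 𝓖 (OddPart.incl k 𝓖 v)) f = f' at *
    generalize translate θ (Env.ι k 𝓖 (OddPart.incl k 𝓖 v)) g = g' at *
    rw [Units.smul_def] at h1 h2
    rw [Units.smul_def, Units.smul_def]
    -- The signs are those of the supercommutators of (f', g) and (f, g'), where f' and g' have the
    -- opposite parities; the four parity cases are checked directly.
    have e : f' * g + (((-1 : ℤˣ) ^ (1 * i) : ℤˣ) : ℤ) • f * g' -
        (((-1 : ℤˣ) ^ (i * j) : ℤˣ) : ℤ) • (g' * f + (((-1 : ℤˣ) ^ (1 * j) : ℤˣ) : ℤ) • g * f') =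
        (f' * g - (((-1 : ℤˣ) ^ ((1 + i) * j) : ℤˣ) : ℤ) • (g * f')) +
          (((-1 : ℤˣ) ^ i : ℤˣ) : ℤ) • (f * g' - (((-1 : ℤˣ) ^ (i * (1 + j)) : ℤˣ) : ℤ) • (g' * f)) := by
      rcases zmod_two_cases i with rfl | rfl <;> rcases zmod_two_cases j with rfl | rfl <;>
        simp [CharTwo.add_self_eq_zero] <;> abel
    rw [e, map_add, map_zsmul, h1, h2, smul_zero, add_zero]

instance : SuperCommutative k (grading θ) where
  mul_comm hf hg := sub_eq_zero.1 (eq_zero_of_comp_eq_zero fun n => comp_supercomm n hf hg)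

theorem mem_grading_zero {f : Coind θ} : f ∈ grading θ 0 ↔ parity θ f = f := by
  rw [mem_grading, uzpow_zero, one_smul]

theorem even_mul_comm {f : Coind θ} (hf : parity θ f = f) (g : Coind θ) : f * g = g * f :=
  EvenPart.incl_comm (grading θ) (⟨f, mem_grading_zero.2 hf⟩ : ↥(grading θ 0)) g

theorem comp_map (φ : B →ₐ[k] C) (hφ : ∀ x b, φ (θ x b) = θ' x (φ b)) (n : ℕ) (f : Coind θ) :
    comp θ' n (map φ hφ f) =
      Multi.mapRange (OddPart k 𝓖) (derMod.hom θ θ' φ) n (comp θ n f) := by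
  induction n generalizing f with
  | zero => rfl
  | succ n ih =>
    refine Multi.ext fun v => ?_
    rw [Multi.mapRange_app, comp_succ_app, comp_succ_app, ← ih]
    rfl

theorem parity_map (φ : B →ₐ[k] C) (hφ : ∀ x b, φ (θ x b) = θ' x (φ b)) (f : Coind θ) :
    parity θ' (map φ hφ f) = map φ hφ (parity θ f) := rfl

end Coind

end SuperCommutative

/-! ### Localization of the coinduced superalgebra -/

section Localization

variable {k A 𝔤 : Type u} [Field k] [CharZero k] [AddCommGroup 𝔤] [Module k 𝔤]
  {𝓖 : ZMod 2 → Submodule k 𝔤} [DirectSum.Decomposition 𝓖] [LieSuperalgebra k 𝓖]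
  [CommRing A] [Algebra k A] (θ : EvenLie k 𝓖 →ₗ⁅k⁆ Derivation k A A) (S : Submonoid A)

/-- The extension of a derivation to a localization. -/
def locDer (D : Derivation k A A) :
    Derivation k (LocalizedModule S A) (LocalizedModule S A) :=
  Derivation.mk'
    { toFun := derLocFun D S
      map_add' := derLocFun_add D S
      map_smul' := fun c z => by
        rw [RingHom.id_apply, ← algebraMap_smul A c z, derLocFun_smul, algebraMap_smul] }
    (derLocFun_mul D S)

/-- The action of `𝔤₀` on a localization. -/
def locDerHom : EvenLie k 𝓖 →ₗ⁅k⁆ Derivation k (LocalizedModule S A) (LocalizedModule S A) where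
  toFun x := locDer S (θ x)
  map_add' x y := Derivation.ext fun z => by
    show derLocFun (θ (x + y)) S z = derLocFun (θ x) S z + derLocFun (θ y) S z
    rw [map_add, derLocFun_add_der]
  map_smul' c x := Derivation.ext fun z => by
    show derLocFun (θ (c • x)) S z = c • derLocFun (θ x) S z
    rw [map_smul, derLocFun_smul_der, algebraMap_smul]
  map_lie' {x y} := Derivation.ext fun z => by
    rw [Derivation.commutator_apply]
    show derLocFun (θ ⁅x, y⁆) S z = derLocFun (θ x) S (derLocFun (θ y) S z) -
      derLocFun (θ y) S (derLocFun (θ x) S z)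
    rw [LieHom.map_lie, derLocFun_lie]

/-- The localization map. -/
def locHom : A →ₐ[k] LocalizedModule S A := IsScalarTower.toAlgHom k A (LocalizedModule S A)

theorem locHom_apply (a : A) : locHom (k := k) S a = LocalizedModule.mk a 1 := rfl

theorem locHom_der (x : EvenLie k 𝓖) (a : A) :
    locHom (k := k) S (θ x a) = locDerHom θ S x (locHom (k := k) S a) := by
  show _ = derLocFun (θ x) S (locHom (k := k) S a)
  rw [locHom_apply, locHom_apply, derLocFun_mk]
  simp

namespace Coind

/-- The localization map `Hom_{U(𝔤₀)} (U(𝔤), A) → Hom_{U(𝔤₀)} (U(𝔤), S⁻¹ A)`. -/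
def toLoc : Coind θ →ₐ[k] Coind (locDerHom θ S) := map (locHom S) (locHom_der θ S)

variable {θ S}

theorem evalOne_toLoc (f : Coind θ) :
    evalOne (locDerHom θ S) (toLoc θ S f) = locHom (k := k) S (evalOne θ f) := rfl

theorem isUnit_toLoc [FiniteDimensional k 𝔤] {f : Coind θ} (hf : evalOne θ f ∈ S) :
    IsUnit (toLoc θ S f) :=
  isUnit_of_evalOne (by
    rw [evalOne_toLoc]
    exact IsLocalization.map_units (LocalizedModule S A) (⟨_, hf⟩ : S))

theorem exists_scale_eq_zero [FiniteDimensional k 𝔤] (n : ℕ) (F : Comp θ n)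
    (hF : Multi.mapRange (OddPart k 𝓖)
      (derMod.hom θ (locDerHom θ S) (locHom S)) n F = 0) :
    ∃ a ∈ S, Multi.mapRange (OddPart k 𝓖) (derMod.scale θ a) n F = 0 := by
  obtain ⟨⟨a, ha⟩, h⟩ := Multi.exists_mapRange_eq_zero (ι := S)
    (derMod.hom θ (locDerHom θ S) (locHom S)) (fun _ => derMod θ)
    (fun a => derMod.scale θ (a : A))
    (fun a b => ⟨a * b, fun (m : A) (hm : (a : A) * m = 0) =>
        show ((a * b : S) : A) * m = 0 by rw [Submonoid.coe_mul, mul_right_comm, hm, zero_mul],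
      fun (m : A) (hm : (b : A) * m = 0) =>
        show ((a * b : S) : A) * m = 0 by rw [Submonoid.coe_mul, mul_assoc, hm, mul_zero]⟩)
    (fun m hm => by
      have hm : algebraMap A (LocalizedModule S A) m = 0 := hm
      obtain ⟨c, hc⟩ := (IsLocalization.map_eq_zero_iff S (LocalizedModule S A) m).1 hm
      exact ⟨c, hc⟩) n F hF
  exact ⟨a, ha, h⟩

theorem mapRange_locHom_scale (n : ℕ) (a : A) (F : Comp θ n) :
    Multi.mapRange (OddPart k 𝓖) (derMod.hom θ (locDerHom θ S) (locHom S)) n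
      (Multi.mapRange (OddPart k 𝓖) (derMod.scale θ a) n F) =
    Multi.mapRange (OddPart k 𝓖) (derMod.scale (locDerHom θ S) (locHom (k := k) S a)) n
      (Multi.mapRange (OddPart k 𝓖) (derMod.hom θ (locDerHom θ S) (locHom S)) n F) := by
  rw [← Multi.mapRange_comp, ← Multi.mapRange_comp]
  congr 1
  congr 1
  exact LinearMap.ext fun m => map_mul (locHom (k := k) S) a m

/-- Finite dimensionality of the odd part gives a common denominator for the values on all tuples of
basis vectors. -/
theorem exists_mapRange_locHom_eq [FiniteDimensional k 𝔤] (n : ℕ) (F : Comp (locDerHom θ S) n) :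
    ∃ a ∈ S, ∃ G : Comp θ n, Multi.mapRange (OddPart k 𝓖)
      (derMod.hom θ (locDerHom θ S) (locHom S)) n G =
      Multi.mapRange (OddPart k 𝓖) (derMod.scale (locDerHom θ S) (locHom (k := k) S a)) n F := by
  induction n with
  | zero =>
    obtain ⟨⟨m, s⟩, h⟩ := IsLocalization.surj S (S := LocalizedModule S A) F
    exact ⟨s, s.2, m, h.symm.trans (mul_comm (G := LocalizedModule S A) _ _)⟩
  | succ n ih =>
    classical
    let e := Module.finBasis k (OddPart k 𝓖)
    choose a ha G hG using fun i => ih (Multi.app F (e i))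
    -- Bringing to a common denominator: the numerator at `e i` is multiplied by the denominators of
    -- all the other basis vectors.
    refine ⟨∏ i, a i, S.prod_mem fun i _ => ha i, Multi.app.symm (e.constr k fun i =>
      Multi.mapRange (OddPart k 𝓖) (derMod.scale θ (∏ j ∈ Finset.univ.erase i, a j)) n (G i)), ?_⟩
    refine Multi.app.injective (e.ext fun i => ?_)
    rw [Multi.mapRange_app, Multi.mapRange_app, LinearEquiv.apply_symm_apply, Module.Basis.constr_basis,
      mapRange_locHom_scale, hG, ← Multi.mapRange_comp]
    congr 1
    congr 1
    refine LinearMap.ext fun m => ?_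
    show locHom (k := k) S _ * (locHom (k := k) S (a i) * (show LocalizedModule S A from m)) =
      locHom (k := k) S _ * (show LocalizedModule S A from m)
    rw [← mul_assoc, ← map_mul, Finset.prod_erase_mul _ _ (Finset.mem_univ i)]

/-- The leading component of `f` becomes zero after localizing, so some `a` in `S` kills it; an even
lift of `a` then kills that component of the product. After dim 𝔤₁ + 1 steps nothing is left. -/
theorem exists_even_mul_eq_zero [FiniteDimensional k 𝔤] {f : Coind θ} (hf : toLoc θ S f = 0) :
    ∃ t : Coind θ, parity θ t = t ∧ evalOne θ t ∈ S ∧ t * f = 0 := by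
  have key : ∀ r, ∃ t : Coind θ, parity θ t = t ∧ evalOne θ t ∈ S ∧ ∀ n < r, comp θ n (t * f) = 0 := by
    intro r
    induction r with
    | zero =>
      exact ⟨1, map_one _, by rw [map_one]; exact S.one_mem, fun n hn => absurd hn (Nat.not_lt_zero n)⟩
    | succ r ih =>
      obtain ⟨t, ht, hS, h⟩ := ih
      have h0 := comp_map (locHom S) (locHom_der θ S) r (t * f)
      have h1 : map (locHom S) (locHom_der θ S) (t * f) = 0 := by
        show toLoc θ S (t * f) = 0
        rw [map_mul, hf, mul_zero]
      rw [h1, map_zero] at h0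
      obtain ⟨a, ha, h2⟩ := exists_scale_eq_zero r _ h0.symm
      obtain ⟨t', ht', hev⟩ := exists_evalOne_eq (θ := θ) a
      refine ⟨t' * t, by rw [map_mul, ht, ht'], by rw [map_mul, hev]; exact S.mul_mem ha hS,
        fun n hn => ?_⟩
      rw [mul_assoc]
      rcases Nat.lt_succ_iff_lt_or_eq.1 hn with hn | rfl
      · exact comp_mul_eq_zero r _ _ h n hn
      · rw [comp_mul n _ _ h, hev, h2]
  obtain ⟨t, h1, h2, h3⟩ := key (Module.finrank k (OddPart k 𝓖) + 1)
  exact ⟨t, h1, h2, eq_zero_of_comp_eq_zero_of_le fun n hn => h3 n (by omega)⟩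

/-- Successive approximation: the leading component of the error tF - h is cleared of denominators,
lifted to an element over `A`, and subtracted. The error then begins one degree higher. -/
theorem exists_even_mul_eq_toLoc [FiniteDimensional k 𝔤] (F : Coind (locDerHom θ S)) :
    ∃ t h : Coind θ, parity θ t = t ∧ evalOne θ t ∈ S ∧ toLoc θ S t * F = toLoc θ S h := by
  have key : ∀ r, ∃ t h : Coind θ, parity θ t = t ∧ evalOne θ t ∈ S ∧
      ∀ n < r, comp (locDerHom θ S) n (toLoc θ S t * F - toLoc θ S h) = 0 := by
    intro r
    induction r with
    | zero =>
      exact ⟨1, 0, map_one _, by rw [map_one]; exact S.one_mem,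
        fun n hn => absurd hn (Nat.not_lt_zero n)⟩
    | succ r ih =>
      obtain ⟨t, h, ht, hS, H⟩ := ih
      obtain ⟨a, ha, G, hG⟩ := exists_mapRange_locHom_eq r
        (comp (locDerHom θ S) r (toLoc θ S t * F - toLoc θ S h))
      obtain ⟨t', ht', hev⟩ := exists_evalOne_eq (θ := θ) a
      have e1 := comp_mul r (toLoc θ S t') _ H
      rw [evalOne_toLoc, hev, ← hG] at e1
      have e2 := comp_alternating r _ (comp_mul_eq_zero r (toLoc θ S t') _ H)
      rw [e1] at e2
      -- The cleared numerator `G` is alternating only after localizing. It is replaced by an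
      -- alternating map with the same image, so that it can be the leading component of an element
      -- over `A`.
      obtain ⟨G', hG', e3⟩ := Multi.exists_alternating _ _ r G e2
      obtain ⟨h', hlt, hr⟩ := exists_comp_eq r G' hG'
      have e4 : toLoc θ S (t' * t) * F - toLoc θ S (t' * h + h') =
          toLoc θ S t' * (toLoc θ S t * F - toLoc θ S h) - toLoc θ S h' := by
        rw [map_add, map_mul, map_mul]
        noncomm_ring
      refine ⟨t' * t, t' * h + h', by rw [map_mul, ht, ht'],
        by rw [map_mul, hev]; exact S.mul_mem ha hS, fun n hn => ?_⟩
      have e5 := comp_map (locHom S) (locHom_der θ S) n h'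
      rw [e4, map_sub, show comp (locDerHom θ S) n (toLoc θ S h') = _ from e5]
      rcases Nat.lt_succ_iff_lt_or_eq.1 hn with hn | rfl
      · rw [comp_mul_eq_zero r _ _ H n hn, hlt n hn, map_zero, sub_zero]
      · rw [e1, hr, e3, sub_self]
  obtain ⟨t, h, h1, h2, h3⟩ := key (Module.finrank k (OddPart k 𝓖) + 1)
  exact ⟨t, h, h1, h2, sub_eq_zero.1 (eq_zero_of_comp_eq_zero_of_le fun n hn => h3 n (by omega))⟩

end Coind

end Localization

end SHCP

end

noncomputable section

namespace SHCP

/-! ### The homeomorphism of spectra and the identification of stalks -/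

section Stalks

variable {k A 𝔤 : Type u} [Field k] [CharZero k] [AddCommGroup 𝔤] [Module k 𝔤]
  {𝓖 : ZMod 2 → Submodule k 𝔤} [DirectSum.Decomposition 𝓖] [LieSuperalgebra k 𝓖]
  [CommRing A] [Algebra k A] (θ : EvenLie k 𝓖 →ₗ⁅k⁆ Derivation k A A)

namespace Coind

/-- The value at `1` of the even elements. -/
def evenOne : EvenPart (grading θ) →ₐ[k] A := (evalOne θ).comp (EvenPart.incl (grading θ))

variable {θ}

theorem parity_incl (t : EvenPart (grading θ)) :
    parity θ (EvenPart.incl (grading θ) t) = EvenPart.incl (grading θ) t :=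
  mem_grading_zero.1 (EvenPart.incl_mem _ t)

theorem exists_incl_eq {f : Coind θ} (hf : parity θ f = f) :
    ∃ t : EvenPart (grading θ), EvenPart.incl (grading θ) t = f :=
  ⟨(⟨f, mem_grading_zero.2 hf⟩ : ↥(grading θ 0)), rfl⟩

variable (θ) in
theorem evenOne_surjective : Function.Surjective (evenOne θ) := fun b => by
  obtain ⟨f, hf, h⟩ := exists_evalOne_eq (θ := θ) b
  obtain ⟨t, rfl⟩ := exists_incl_eq hf
  exact ⟨t, h⟩

variable (θ) in
theorem ker_evenOne_le [FiniteDimensional k 𝔤] :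
    RingHom.ker (evenOne θ).toRingHom ≤ nilradical (EvenPart (grading θ)) := fun t ht =>
  ⟨_, EvenPart.incl_injective (grading θ) (by
    rw [map_pow, map_zero]
    exact pow_eq_zero_of_evalOne ht)⟩

variable (θ) in
/-- The homeomorphism between the spectrum of `B` and that of the even part of
`Hom_{U(𝔤₀)} (U(𝔤), B)`. -/
def specHomeo [FiniteDimensional k 𝔤] : PrimeSpectrum A ≃ₜ PrimeSpectrum (EvenPart (grading θ)) :=
  -- Evaluation at 1 on the even part is surjective with nil kernel. The criterion only asks that
  -- some power of each element lie in the image, and exponent 1 suffices.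
  (PrimeSpectrum.isHomeomorph_comap (evenOne θ).toRingHom
    (fun x => ⟨1, one_pos, by
      rw [pow_one]
      exact evenOne_surjective θ x⟩) (ker_evenOne_le θ)).homeomorph

theorem mem_specHomeo_primeCompl [FiniteDimensional k 𝔤] (x : PrimeSpectrum A)
    (t : EvenPart (grading θ)) :
    t ∈ (specHomeo θ x).asIdeal.primeCompl ↔ evenOne θ t ∈ x.asIdeal.primeCompl := Iff.rfl

section

variable (θ) (S : Submonoid A)

/-- The structure of a module over the even part of `Hom_{U(𝔤₀)} (U(𝔤), A)`. -/
@[reducible] def locModule : Module (EvenPart (grading θ)) (Coind (locDerHom θ S)) :=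
  Module.compHom _ ((toLoc θ S).comp (EvenPart.incl (grading θ))).toRingHom

attribute [local instance] locModule

/-- The localization map as a linear map over the even part. -/
def toLocLin : Coind θ →ₗ[EvenPart (grading θ)] Coind (locDerHom θ S) where
  toFun := toLoc θ S
  map_add' := map_add _
  map_smul' t f := map_mul (toLoc θ S) (EvenPart.incl (grading θ) t) f

variable {θ S} {S' : Submonoid (EvenPart (grading θ))}

/-- The three conditions are the unit criterion by values at 1 and the two clearing-of-denominators
results. The multiplicative set consists of the even elements whose value at 1 lies in `S`. -/
theorem isLocalizedModule_toLocLin [FiniteDimensional k 𝔤] (h : ∀ t, t ∈ S' ↔ evenOne θ t ∈ S) :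
    IsLocalizedModule S' (toLocLin θ S) where
  map_units t := by
    obtain ⟨w, hw⟩ := isUnit_toLoc (S := S) ((h t).1 t.2)
    rw [Module.End.isUnit_iff]
    constructor
    · intro a b hab
      have hab : (w : Coind (locDerHom θ S)) * a = w * b := by rw [hw]; exact hab
      exact w.mul_right_inj.1 hab
    · intro b
      refine ⟨(w⁻¹ : (Coind (locDerHom θ S))ˣ) * b, ?_⟩
      show toLoc θ S (EvenPart.incl (grading θ) t) * ((w⁻¹ : (Coind (locDerHom θ S))ˣ) * b) = b
      rw [show toLoc θ S (EvenPart.incl (grading θ) t) = w from hw.symm, Units.mul_inv_cancel_left]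
  surj F := by
    obtain ⟨t, f, ht, hS, e⟩ := exists_even_mul_eq_toLoc F
    obtain ⟨t, rfl⟩ := exists_incl_eq ht
    exact ⟨(f, ⟨t, (h t).2 hS⟩), e⟩
  exists_of_eq {f g} hfg := by
    have h0 : toLoc θ S (f - g) = 0 := by
      rw [map_sub, sub_eq_zero]
      exact hfg
    obtain ⟨t, ht, hS, e⟩ := exists_even_mul_eq_zero h0
    obtain ⟨t, rfl⟩ := exists_incl_eq ht
    rw [mul_sub, sub_eq_zero] at e
    exact ⟨⟨t, (h t).2 hS⟩, e⟩

/-- The localization of `Hom_{U(𝔤₀)} (U(𝔤), A)` is `Hom_{U(𝔤₀)} (U(𝔤), S⁻¹ A)`. -/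
def stalkEquiv [FiniteDimensional k 𝔤] (h : ∀ t, t ∈ S' ↔ evenOne θ t ∈ S) :
    LocalizedModule S' (Coind θ) ≃+ Coind (locDerHom θ S) :=
  haveI := isLocalizedModule_toLocLin h
  (IsLocalizedModule.iso S' (toLocLin θ S)).toAddEquiv

theorem stalkEquiv_mk [FiniteDimensional k 𝔤] (h : ∀ t, t ∈ S' ↔ evenOne θ t ∈ S) (f : Coind θ)
    (t : S') : toLoc θ S (EvenPart.incl (grading θ) t) * stalkEquiv h (LocalizedModule.mk f t) =
      toLoc θ S f := by
  have := isLocalizedModule_toLocLin h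
  show (t : EvenPart (grading θ)) • IsLocalizedModule.iso S' (toLocLin θ S) _ = toLocLin θ S f
  rw [← map_smul, LocalizedModule.smul'_mk, ← Submonoid.smul_def, LocalizedModule.mk_cancel,
    IsLocalizedModule.iso_mk_one]

/-- Denominators become units, so a fraction is recognized by an equation without division;
comparisons of stalks below use this form. -/
theorem stalkEquiv_mk_eq_iff [FiniteDimensional k 𝔤] (h : ∀ t, t ∈ S' ↔ evenOne θ t ∈ S)
    (f : Coind θ) (t : S') (F : Coind (locDerHom θ S)) :
    stalkEquiv h (LocalizedModule.mk f t) = F ↔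
      toLoc θ S (EvenPart.incl (grading θ) t) * F = toLoc θ S f := by
  rw [← stalkEquiv_mk h f t, (isUnit_toLoc (S := S)
    (f := EvenPart.incl (grading θ) t) ((h t).1 t.2)).mul_right_inj]
  exact eq_comm

theorem stalkEquiv_mul [FiniteDimensional k 𝔤] (h : ∀ t, t ∈ S' ↔ evenOne θ t ∈ S)
    (z w : LocalizedModule S' (Coind θ)) :
    stalkEquiv h (z * w) = stalkEquiv h z * stalkEquiv h w := by
  induction z, w using LocalizedModule.induction_on₂ with
  | _ f g s t =>
    rw [LocalizedModule.mk_mul_mk, stalkEquiv_mk_eq_iff, Submonoid.coe_mul, map_mul, map_mul,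
      map_mul, ← stalkEquiv_mk h f s, ← stalkEquiv_mk h g t, mul_assoc, mul_assoc,
      ← mul_assoc (toLoc θ S (EvenPart.incl (grading θ) t)), ← mul_assoc (stalkEquiv h _)]
    congr 2
    -- Only the denominator has to be moved past a possibly odd factor, and it is even, hence
    -- central.
    exact even_mul_comm ((parity_map _ _ _).trans (congrArg _ (parity_incl _))) _

theorem stalkEquiv_mk_one [FiniteDimensional k 𝔤] (h : ∀ t, t ∈ S' ↔ evenOne θ t ∈ S)
    (f : Coind θ) : stalkEquiv h (LocalizedModule.mk f 1) = toLoc θ S f := by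
  rw [stalkEquiv_mk_eq_iff, Submonoid.coe_one, map_one, map_one, one_mul]

/-- The two parity involutions agree on homogeneous elements and fix denominators, so they
correspond on fractions. This makes the isomorphism of sections compatible with the gradings. -/
theorem stalkEquiv_parity [FiniteDimensional k 𝔤] (h : ∀ t, t ∈ S' ↔ evenOne θ t ∈ S)
    (z : LocalizedModule S' (Coind θ)) :
    stalkEquiv h (LocalizedModule.map S' (superParity (grading θ)).toLinearMap z) =
      parity (locDerHom θ S) (stalkEquiv h z) := by
  have hp : ∀ f : Coind θ, superParity (grading θ) f = parity θ f := by
    intro f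
    induction f using DirectSum.Decomposition.inductionOn (grading θ) with
    | zero => rw [map_zero, map_zero]
    | homogeneous f => exact (superSign_of_mem _ f.2).trans (mem_grading.1 f.2).symm
    | add f g hf hg => rw [map_add, map_add, hf, hg]
  induction z using LocalizedModule.induction_on with
  | _ f t =>
    rw [LocalizedModule.map_mk, stalkEquiv_mk_eq_iff, AlgHom.toLinearMap_apply, hp]
    have e := congrArg (parity (locDerHom θ S)) (stalkEquiv_mk h f t)
    rw [map_mul] at e
    refine Eq.trans ?_ e
    congr 1
    exact congrArg (toLoc θ S) (parity_incl (t : EvenPart (grading θ))).symm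

end

end Coind

end Stalks

end SHCP

end

noncomputable section

namespace SHCP

/-! ### Germs of coinduced sections -/

section Germs

variable {k A 𝔤 : Type u} [Field k] [CharZero k] [AddCommGroup 𝔤] [Module k 𝔤]
  {𝓖 : ZMod 2 → Submodule k 𝔤} [DirectSum.Decomposition 𝓖] [LieSuperalgebra k 𝓖]
  [CommRing A] [Algebra k A] (θ : EvenLie k 𝓖 →ₗ⁅k⁆ Derivation k A A)
  {V W : Opens (PrimeSpectrum A)}

/-- The germ of a function at a point. -/
def Sec.germ (x : V) : Sec A A V →ₐ[k] LocalizedModule x.1.asIdeal.primeCompl A where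
  toFun s := s.val x
  map_one' := rfl
  map_mul' _ _ := rfl
  map_zero' := rfl
  map_add' _ _ := rfl
  commutes' c := by
    show LocalizedModule.mk (algebraMap k A c) 1 = _
    rw [IsScalarTower.algebraMap_apply k A]
    rfl

theorem Sec.isUnit_ofAlg {a : A} (h : ∀ x ∈ V, a ∉ x.asIdeal) :
    IsUnit (Sec.ofAlg (k := k) (R := A) V a) := by
  refine IsUnit.of_mul_eq_one (Sec.mk (fun x => LocalizedModule.mk 1 ⟨a, h x.1 x.2⟩)
    fun x => ⟨V, le_rfl, x.2, 1, a, fun y hy => ⟨h y hy, rfl⟩⟩) (Sec.ext fun x => ?_)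
  rw [Sec.val_mul, Sec.ofAlg_val, Sec.val_mk, LocalizedModule.mk_mul_mk, mul_one, one_mul,
    Sec.val_one]
  refine (LocalizedModule.mk_eq.2 ⟨1, ?_⟩ :
    _ = LocalizedModule.mk (1 : A) (1 : x.1.asIdeal.primeCompl)).trans OreLocalization.one_def.symm
  rw [one_smul, one_smul, one_smul]
  exact (mul_one a).symm

theorem Sec.derHom_val (z : EvenLie k 𝓖) (s : Sec A A V) (x : V) :
    (Sec.derHom θ V z s).val x = locDerHom θ x.1.asIdeal.primeCompl z (s.val x) := rfl

namespace Coind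

/-- The germ of a section at a point. -/
def germ (x : V) : Coind (Sec.derHom θ V) →ₐ[k] Coind (locDerHom θ x.1.asIdeal.primeCompl) :=
  map (Sec.germ x) fun _ _ => rfl

/-- The restriction of sections. -/
def restrict (h : V ≤ W) : Coind (Sec.derHom θ W) →ₐ[k] Coind (Sec.derHom θ V) :=
  map (Sec.res h) fun x b => Sec.res_der h (θ x) b

/-- The section defined by an element of `Hom_{U(𝔤₀)} (U(𝔤), A)`. -/
def ofGlobal (V : Opens (PrimeSpectrum A)) : Coind θ →ₐ[k] Coind (Sec.derHom θ V) :=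
  map (Sec.ofAlg V) fun x b => Sec.ofAlg_der (θ x) b

variable {θ}

theorem germ_apply (x : V) (F : Coind (Sec.derHom θ V)) (u : Env k 𝓖) :
    toLin _ (germ θ x F) u = (toLin _ F u).val x := rfl

theorem ext_germ {F G : Coind (Sec.derHom θ V)} (h : ∀ x, germ θ x F = germ θ x G) : F = G :=
  ext fun u => Sec.ext fun x => by rw [← germ_apply, h, germ_apply]

theorem germ_restrict (h : V ≤ W) (x : V) (F : Coind (Sec.derHom θ W)) :
    germ θ x (restrict θ h F) = germ θ ⟨x.1, h x.2⟩ F := rfl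

theorem germ_ofGlobal (x : V) (f : Coind θ) :
    germ θ x (ofGlobal θ V f) = toLoc θ x.1.asIdeal.primeCompl f := rfl

theorem isUnit_ofGlobal [FiniteDimensional k 𝔤] {f : Coind θ}
    (h : ∀ x ∈ V, evalOne θ f ∉ x.asIdeal) : IsUnit (ofGlobal θ V f) :=
  isUnit_of_evalOne (Sec.isUnit_ofAlg (k := k) h)

/-- A section of the structure sheaf that vanishes at a point vanishes near it. -/
theorem exists_restrict_eq_zero_of_val (s : Sec A A V) (x : V) (h : s.val x = 0) :
    ∃ (W : Opens (PrimeSpectrum A)) (hW : W ≤ V), x.1 ∈ W ∧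
      Sec.res (k := k) hW s = 0 := by
  obtain ⟨W, hW, hx, m, r, e⟩ := s.locally_frac x
  obtain ⟨hr, e1⟩ := e x.1 hx
  rw [show s.val ⟨x.1, hW hx⟩ = s.val x from rfl, h, eq_comm, ← LocalizedModule.zero_mk 1,
    LocalizedModule.mk_eq] at e1
  obtain ⟨⟨c, hc⟩, e2⟩ := e1
  rw [one_smul, smul_zero, smul_zero] at e2
  refine ⟨W ⊓ PrimeSpectrum.basicOpen c, inf_le_left.trans hW, ⟨hx, hc⟩, Sec.ext fun y => ?_⟩
  obtain ⟨hr', e3⟩ := e y.1 y.2.1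
  show s.val ⟨y.1, hW y.2.1⟩ = 0
  rw [e3]
  rw [← LocalizedModule.zero_mk 1, LocalizedModule.mk_eq]
  refine ⟨⟨c, y.2.2⟩, ?_⟩
  rw [one_smul, smul_zero, smul_zero]
  exact e2

theorem comp_restrict (n : ℕ) (h : V ≤ W) (F : Coind (Sec.derHom θ W)) :
    comp _ n (restrict θ h F) = Multi.mapRange (OddPart k 𝓖)
      (derMod.hom (Sec.derHom θ W) (Sec.derHom θ V) (Sec.res h)) n (comp _ n F) :=
  comp_map _ _ n F

/-- A section that vanishes at a point vanishes near it. -/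
theorem exists_restrict_eq_zero [FiniteDimensional k 𝔤] (F : Coind (Sec.derHom θ V)) (x : V)
    (h : germ θ x F = 0) : ∃ (W : Opens (PrimeSpectrum A)) (hW : W ≤ V), x.1 ∈ W ∧
      restrict θ hW F = 0 := by
  let ι := {W : Opens (PrimeSpectrum A) // W ≤ V ∧ x.1 ∈ W}
  have : Nonempty ι := ⟨⟨V, le_rfl, x.2⟩⟩
  have key : ∀ r, ∃ i : ι, ∀ n < r, comp _ n (restrict θ i.2.1 F) = 0 := by
    intro r
    induction r with
    | zero => exact ⟨Classical.arbitrary ι, fun n hn => absurd hn (Nat.not_lt_zero n)⟩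
    | succ r ih =>
      obtain ⟨i, hi⟩ := ih
      obtain ⟨j, hj⟩ := Multi.exists_mapRange_eq_zero (ι := ι)
        (derMod.hom (Sec.derHom θ V) (locDerHom θ x.1.asIdeal.primeCompl) (Sec.germ x))
        (fun i => derMod (Sec.derHom θ i.1))
        (fun i => derMod.hom (Sec.derHom θ V) (Sec.derHom θ i.1) (Sec.res i.2.1))
        (fun i j => ⟨⟨i.1 ⊓ j.1, inf_le_left.trans i.2.1, ⟨i.2.2, j.2.2⟩⟩,
          fun (m : Sec A A V) (hm : Sec.res (k := k) i.2.1 m = 0) =>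
            congrArg (Sec.res (k := k) (inf_le_left : i.1 ⊓ j.1 ≤ i.1)) hm,
          fun (m : Sec A A V) (hm : Sec.res (k := k) j.2.1 m = 0) =>
            congrArg (Sec.res (k := k) (inf_le_right : i.1 ⊓ j.1 ≤ j.1)) hm⟩)
        (fun (m : Sec A A V) (hm : m.val x = 0) => by
          obtain ⟨W, hW, hx, e⟩ := exists_restrict_eq_zero_of_val (k := k) m x hm
          exact ⟨⟨W, hW, hx⟩, e⟩) r (comp _ r F) (by
            have e := comp_map (θ := Sec.derHom θ V) (θ' := locDerHom θ x.1.asIdeal.primeCompl)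
              (Sec.germ x) (fun _ _ => rfl) r F
            rw [← e, show map _ _ F = 0 from h, map_zero])
      -- One neighbourhood kills the components below r, the other the component of degree r. Only
      -- finitely many such intersections are needed.
      let l : ι := ⟨i.1 ⊓ j.1, inf_le_left.trans i.2.1, ⟨i.2.2, j.2.2⟩⟩
      refine ⟨l, fun n hn => ?_⟩
      rcases Nat.lt_succ_iff_lt_or_eq.1 hn with hn | rfl
      · have e : restrict θ l.2.1 F = restrict θ (inf_le_left : i.1 ⊓ j.1 ≤ i.1) (restrict θ i.2.1 F) :=
          rfl
        rw [e, comp_restrict, hi n hn, map_zero]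
      · have e : restrict θ l.2.1 F = restrict θ (inf_le_right : i.1 ⊓ j.1 ≤ j.1) (restrict θ j.2.1 F) :=
          rfl
        have e2 : comp _ n (restrict θ j.2.1 F) = 0 := by
          rw [comp_restrict, hj]
        rw [e, comp_restrict, e2, map_zero]
  obtain ⟨i, hi⟩ := key (Module.finrank k (OddPart k 𝓖) + 1)
  exact ⟨i.1, i.2.1, i.2.2, eq_zero_of_comp_eq_zero_of_le fun n hn => hi n (by omega)⟩

end Coind

end Germs

/-! ### Sections of the two structure sheaves -/

section Sections

variable {k A 𝔤 : Type u} [Field k] [CharZero k] [AddCommGroup 𝔤] [Module k 𝔤]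
  [FiniteDimensional k 𝔤]
  {𝓖 : ZMod 2 → Submodule k 𝔤} [DirectSum.Decomposition 𝓖] [LieSuperalgebra k 𝓖]
  [CommRing A] [Algebra k A] (θ : EvenLie k 𝓖 →ₗ⁅k⁆ Derivation k A A)

namespace Coind

/-- The preimage of an open set in the spectrum of `A`. -/
def preim (V : Opens (PrimeSpectrum (EvenPart (grading θ)))) : Opens (PrimeSpectrum A) :=
  Opens.comap (specHomeo θ : C(PrimeSpectrum A, PrimeSpectrum (EvenPart (grading θ)))) V

/-- The isomorphism of stalks at a point. -/
def stalkAt (x : PrimeSpectrum A) :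
    LocalizedModule (specHomeo θ x).asIdeal.primeCompl (Coind θ) ≃+
      Coind (locDerHom θ x.asIdeal.primeCompl) :=
  stalkEquiv (mem_specHomeo_primeCompl x)

variable {θ} {V : Opens (PrimeSpectrum (EvenPart (grading θ)))}

/-- Where `s` is a fraction f/t, the value of `t` at 1 is invertible on the open set, hence `t` is
invertible there and t⁻¹f has the required germs. -/
theorem exists_germ_eq (s : Sec (EvenPart (grading θ)) (Coind θ) V) (x : preim θ V) :
    ∃ (W : Opens (PrimeSpectrum A)) (hW : W ≤ preim θ V) (F : Coind (Sec.derHom θ W)),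
      x.1 ∈ W ∧ ∀ y : W, germ θ y F = stalkAt θ y.1 (s.val ⟨specHomeo θ y.1, hW y.2⟩) := by
  obtain ⟨W, hW, hx, f, t, e⟩ := s.locally_frac ⟨specHomeo θ x.1, x.2⟩
  have hu : IsUnit (ofGlobal θ (preim θ W) (EvenPart.incl (grading θ) t)) :=
    isUnit_ofGlobal fun y hy => (e (specHomeo θ y) hy).1
  obtain ⟨w, hw⟩ := hu
  refine ⟨preim θ W, fun y hy => hW hy,
    (w⁻¹ : (Coind (Sec.derHom θ (preim θ W)))ˣ) * ofGlobal θ (preim θ W) f, hx, fun y => ?_⟩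
  obtain ⟨ht, e'⟩ := e (specHomeo θ y.1) y.2
  rw [e', eq_comm, stalkAt, stalkEquiv_mk_eq_iff, ← germ_ofGlobal y, ← germ_ofGlobal y,
    ← map_mul]
  congr 1
  show ofGlobal θ (preim θ W) (EvenPart.incl (grading θ) t) * _ = _
  rw [← hw, Units.mul_inv_cancel_left]

/-- The section of the structure sheaf given by the values at `u`. -/
def toCoindFun (s : Sec (EvenPart (grading θ)) (Coind θ) V) (u : Env k 𝓖) : Sec A A (preim θ V) :=
  Sec.mk (fun x => toLin _ (stalkAt θ x.1 (s.val ⟨specHomeo θ x.1, x.2⟩)) u) fun x => by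
    obtain ⟨W, hW, F, hx, e⟩ := exists_germ_eq s x
    obtain ⟨W', hW', hx', m, r, e'⟩ := (toLin _ F u).locally_frac ⟨x.1, hx⟩
    refine ⟨W', hW'.trans hW, hx', m, r, fun y hy => ?_⟩
    obtain ⟨hr, e''⟩ := e' y hy
    refine ⟨hr, ?_⟩
    rw [← e'', ← germ_apply, e]

theorem toCoindFun_val (s : Sec (EvenPart (grading θ)) (Coind θ) V) (u : Env k 𝓖) (x : preim θ V) :
    (toCoindFun s u).val x = toLin _ (stalkAt θ x.1 (s.val ⟨specHomeo θ x.1, x.2⟩)) u := rfl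

/-- The section of `Hom_{U(𝔤₀)} (U(𝔤), 𝒪)` corresponding to a section of the structure sheaf of
the spectrum. -/
def toCoindSec (s : Sec (EvenPart (grading θ)) (Coind θ) V) : Coind (Sec.derHom θ (preim θ V)) :=
  ⟨{ toFun := toCoindFun s
     map_add' := fun u v => Sec.ext fun x => by
        rw [Sec.val_add, toCoindFun_val, toCoindFun_val, toCoindFun_val, map_add]
     map_smul' := fun c u => Sec.ext fun x => by
        rw [RingHom.id_apply, Sec.val_smul, toCoindFun_val, map_smul, toCoindFun_val,
          algebraMap_smul] },
    mem_coindSubmodule_iff.2 fun z u => Sec.ext fun x => by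
      rw [Sec.derHom_val]
      exact mem_coindSubmodule_iff.1 (toLin_mem (stalkAt θ x.1 _)) z u⟩

theorem germ_toCoindSec (s : Sec (EvenPart (grading θ)) (Coind θ) V) (x : preim θ V) :
    germ θ x (toCoindSec s) = stalkAt θ x.1 (s.val ⟨specHomeo θ x.1, x.2⟩) := rfl

theorem toCoindSec_ofAlg (f : Coind θ) :
    toCoindSec (Sec.ofAlg (k := k) (R := EvenPart (grading θ)) V f) = ofGlobal θ (preim θ V) f :=
  ext_germ fun x => by
    rw [germ_toCoindSec, germ_ofGlobal, Sec.ofAlg_val]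
    exact stalkEquiv_mk_one _ f

theorem toCoindSec_injective :
    Function.Injective (toCoindSec : Sec (EvenPart (grading θ)) (Coind θ) V → _) := fun s t h =>
  Sec.ext fun y => by
    obtain ⟨y, hy⟩ := y
    obtain ⟨x, rfl⟩ := (specHomeo θ).surjective y
    have := congrArg (germ θ (⟨x, hy⟩ : preim θ V)) h
    exact (stalkAt θ x).injective this

/-- The isomorphisms of stalks give the only possible values. They are locally fractions because an
identity tF = f of germs persists on a neighbourhood. -/
theorem toCoindSec_surjective :
    Function.Surjective (toCoindSec : Sec (EvenPart (grading θ)) (Coind θ) V → _) := fun F => by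
  -- The value is described over every point `x` above `y` together with the equality of points, so
  -- that a value can be chosen for each `y` and then used at `specHomeo θ x`.
  have key : ∀ y : V, ∃ z : LocalizedModule y.1.asIdeal.primeCompl (Coind θ),
      ∀ (x : preim θ V) (hx : specHomeo θ x.1 = y.1), stalkAt θ x.1 (hx ▸ z) = germ θ x F := by
    rintro ⟨y, hy⟩
    obtain ⟨x, rfl⟩ := (specHomeo θ).surjective y
    refine ⟨(stalkAt θ x).symm (germ θ (⟨x, hy⟩ : preim θ V) F), ?_⟩
    rintro ⟨x', hx'⟩ h
    obtain rfl := (specHomeo θ).injective h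
    exact (stalkAt θ x').apply_symm_apply _
  choose z hz using key
  refine ⟨Sec.mk z fun y => ?_, ext_germ fun x => hz ⟨specHomeo θ x.1, x.2⟩ x rfl⟩
  obtain ⟨y, hy⟩ := y
  obtain ⟨x, rfl⟩ := (specHomeo θ).surjective y
  obtain ⟨t, f, ht, hS, e⟩ := exists_even_mul_eq_toLoc (germ θ (⟨x, hy⟩ : preim θ V) F)
  obtain ⟨t, rfl⟩ := exists_incl_eq ht
  obtain ⟨W, hW, hx, e'⟩ := exists_restrict_eq_zero
    (ofGlobal θ _ (EvenPart.incl (grading θ) t) * F - ofGlobal θ _ f) (⟨x, hy⟩ : preim θ V) (by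
      rw [map_sub, map_mul, germ_ofGlobal, germ_ofGlobal, e, sub_self])
  -- The neighbourhood is the one where the identity of germs persists, transported by the
  -- homeomorphism and intersected with the locus where the denominator is invertible.
  refine ⟨Opens.comap ((specHomeo θ).symm : C(PrimeSpectrum (EvenPart (grading θ)),
    PrimeSpectrum A)) W ⊓ PrimeSpectrum.basicOpen t, ?_, ⟨?_, hS⟩, f, t, ?_⟩
  · rintro y ⟨hy, -⟩
    obtain ⟨x, rfl⟩ := (specHomeo θ).surjective y
    refine hW (?_ : x ∈ W)
    have hy : (specHomeo θ).symm (specHomeo θ x) ∈ W := hy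
    rwa [Homeomorph.symm_apply_apply] at hy
  · show (specHomeo θ).symm (specHomeo θ x) ∈ W
    rwa [Homeomorph.symm_apply_apply]
  · rintro y ⟨hy, ht⟩
    obtain ⟨x, rfl⟩ := (specHomeo θ).surjective y
    have hy : (specHomeo θ).symm (specHomeo θ x) ∈ W := hy
    rw [Homeomorph.symm_apply_apply] at hy
    refine ⟨ht, (stalkAt θ x).injective ?_⟩
    refine (hz ⟨specHomeo θ x, hW hy⟩ ⟨x, hW hy⟩ rfl).trans ?_
    rw [eq_comm, stalkAt, stalkEquiv_mk_eq_iff]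
    have := congrArg (germ θ (⟨x, hy⟩ : W)) e'
    rw [germ_restrict, map_sub, map_mul, map_zero, sub_eq_zero] at this
    exact this

variable (θ V) in
/-- The sections of the structure sheaf of the spectrum of `Hom_{U(𝔤₀)} (U(𝔤), A)`. -/
def secEquiv : Sec (EvenPart (grading θ)) (Coind θ) V ≃ₐ[k] Coind (Sec.derHom θ (preim θ V)) :=
  AlgEquiv.ofBijective
    { toFun := toCoindSec
      map_one' := by
        rw [← map_one (Sec.ofAlg (k := k) (R := EvenPart (grading θ)) (H := Coind θ) V), toCoindSec_ofAlg, map_one]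
      map_mul' := fun s t => ext_germ fun x => by
        rw [map_mul, germ_toCoindSec, germ_toCoindSec, germ_toCoindSec, Sec.val_mul]
        exact stalkEquiv_mul _ _ _
      map_zero' := by
        rw [← map_zero (Sec.ofAlg (k := k) (R := EvenPart (grading θ)) (H := Coind θ) V), toCoindSec_ofAlg, map_zero]
      map_add' := fun s t => ext_germ fun x => by
        rw [map_add, germ_toCoindSec, germ_toCoindSec, germ_toCoindSec, Sec.val_add, map_add]
      commutes' := fun c => by
        rw [← AlgHom.commutes (Sec.ofAlg (k := k) (R := EvenPart (grading θ)) (H := Coind θ) V), toCoindSec_ofAlg,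
          AlgHom.commutes] }
    ⟨toCoindSec_injective, toCoindSec_surjective⟩

theorem secEquiv_mem {i : ZMod 2} {s : Sec (EvenPart (grading θ)) (Coind θ) V}
    (hs : s ∈ parityGrading (Sec.mapAlg (k := k) (superParity (grading θ)) V).toLinearMap i) :
    secEquiv θ V s ∈ grading _ i := by
  have key : secEquiv θ V (Sec.mapAlg (k := k) (superParity (grading θ)) V s) =
      parity _ (secEquiv θ V s) := ext_germ fun x => stalkEquiv_parity _ _
  have hs : Sec.mapAlg (k := k) (superParity (grading θ)) V s = ((-1 : ℤˣ) ^ i) • s := hs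
  rw [mem_grading, ← key, hs, Units.smul_def, Units.smul_def, map_zsmul]

end Coind

variable {k A 𝔤 : Type u} [Field k] [CharZero k] [AddCommGroup 𝔤] [Module k 𝔤]
  [FiniteDimensional k 𝔤] [CommRing A] [HopfAlgebra k A]
  {𝓖 : ZMod 2 → Submodule k 𝔤} [DirectSum.Decomposition 𝓖] [LieSuperalgebra k 𝓖]

/-- The isomorphism between `(G₀, 𝒪_G)` and the spectrum of `𝒪(G)`. -/
def HarishChandraPair.spaceIso (P : HarishChandraPair k A 𝓖) :
    SuperRingedSpace.Iso P.space (superSpec (Coind.grading P.der)) where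
  base := Coind.specHomeo P.der
  sec V := Coind.secEquiv P.der V
  sec_mem _ _ _ hs := Coind.secEquiv_mem hs
  sec_res _ _ := rfl

end Sections

end SHCP

end

noncomputable section

namespace SHCP

/-! ### Separating families of linear maps after tensoring -/

section TensorFamilies

variable {k : Type u} [Field k] {W M : Type u} [AddCommGroup W] [Module k W] [AddCommGroup M]
  [Module k M]

theorem equivFinsupp_lTensor {ι : Type u} [DecidableEq ι] (b : Module.Basis ι k W) {M' : Type u}
    [AddCommGroup M'] [Module k M'] (φ : M →ₗ[k] M') (t : W ⊗[k] M) (i : ι) :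
    TensorProduct.equivFinsuppOfBasisLeft b (φ.lTensor W t) i =
      φ (TensorProduct.equivFinsuppOfBasisLeft b t i) := by
  induction t using TensorProduct.induction_on with
  | zero => simp
  | tmul w m =>
    rw [LinearMap.lTensor_tmul, TensorProduct.equivFinsuppOfBasisLeft_apply_tmul_apply,
      TensorProduct.equivFinsuppOfBasisLeft_apply_tmul_apply, map_smul]
  | add s t hs ht => rw [map_add, map_add, Finsupp.add_apply, hs, ht, map_add, Finsupp.add_apply, map_add]

/-- A jointly injective family of linear maps remains so after tensoring. -/
theorem lTensor_jointly_injective {ι : Type*} {M' : ι → Type u} [∀ i, AddCommGroup (M' i)]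
    [∀ i, Module k (M' i)] {φ : ∀ i, M →ₗ[k] M' i} (h : ∀ m, (∀ i, φ i m = 0) → m = 0)
    {t : W ⊗[k] M} (ht : ∀ i, (φ i).lTensor W t = 0) : t = 0 := by
  classical
  let b := Module.Basis.ofVectorSpace k W
  refine (TensorProduct.equivFinsuppOfBasisLeft b).injective (Finsupp.ext fun j => ?_)
  rw [map_zero, Finsupp.zero_apply]
  refine h _ fun i => ?_
  rw [← equivFinsupp_lTensor, ht, map_zero, Finsupp.zero_apply]

theorem rTensor_jointly_injective {ι : Type*} {M' : ι → Type u} [∀ i, AddCommGroup (M' i)]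
    [∀ i, Module k (M' i)] {φ : ∀ i, M →ₗ[k] M' i} (h : ∀ m, (∀ i, φ i m = 0) → m = 0)
    {t : M ⊗[k] W} (ht : ∀ i, (φ i).rTensor W t = 0) : t = 0 := by
  refine (TensorProduct.comm k M W).injective ?_
  rw [map_zero]
  refine lTensor_jointly_injective h fun i => ?_
  rw [← LinearMap.comm_comp_rTensor_comp_comm_eq]
  simp [ht i]

end TensorFamilies

/-! ### Elements determined by finitely many values, and the vanishing principle -/

section Evaluation

variable {k 𝔤 : Type u} [Field k] [CharZero k] [AddCommGroup 𝔤] [Module k 𝔤]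
  {𝓖 : ZMod 2 → Submodule k 𝔤} [DirectSum.Decomposition 𝓖] [LieSuperalgebra k 𝓖]
  {B : Type u} [CommRing B] [Algebra k B]
  {θ : EvenLie k 𝓖 →ₗ⁅k⁆ Derivation k B B}

namespace Coind

variable (θ) in
/-- Evaluation at an element of `U(𝔤)`. -/
def ev (u : Env k 𝓖) : Coind θ →ₗ[k] B := LinearMap.applyₗ u ∘ₗ toLin θ

theorem ev_comp_translate (w u : Env k 𝓖) : ev θ w ∘ₗ translate θ u = ev θ (w * u) := rfl

theorem ev_comp_parity (u : Env k 𝓖) :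
    ev θ u ∘ₗ (parity θ).toLinearMap = ev θ (Env.parity k 𝓖 u) := rfl

theorem ev_add (u w : Env k 𝓖) : ev θ (u + w) = ev θ u + ev θ w :=
  LinearMap.ext fun f => map_add (toLin θ f) u w

theorem ev_smul (c : k) (u : Env k 𝓖) : ev θ (c • u) = c • ev θ u :=
  LinearMap.ext fun f => map_smul (toLin θ f) c u

theorem eq_zero_of_ev {f : Coind θ} (h : ∀ u, ev θ u f = 0) : f = 0 := ext h

variable (θ) in
-- A component is determined by its values on tuples of basis vectors, that is, by the values of `f`
-- at finitely many products in U(𝔤).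
theorem exists_finset_comp_eq_zero [FiniteDimensional k 𝔤] (n : ℕ) : ∃ T : Finset (Env k 𝓖),
    ∀ f : Coind θ, (∀ u ∈ T, ev θ u f = 0) → comp θ n f = 0 := by
  classical
  induction n with
  | zero => exact ⟨{1}, fun f hf => hf 1 (Finset.mem_singleton_self _)⟩
  | succ n ih =>
    obtain ⟨T, hT⟩ := ih
    let e := Module.finBasis k (OddPart k 𝓖)
    refine ⟨Finset.univ.biUnion fun j => T.image fun u => u * Env.ι k 𝓖 (OddPart.incl k 𝓖 (e j)),
      fun f hf => Multi.app.injective (e.ext fun j => ?_)⟩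
    rw [map_zero, LinearMap.zero_apply, comp_succ_app]
    refine hT _ fun u hu => hf _ ?_
    exact Finset.mem_biUnion.2 ⟨j, Finset.mem_univ j, Finset.mem_image_of_mem _ hu⟩

variable (θ) in
/-- Elements of `Hom_{U(𝔤₀)} (U(𝔤), B)` are determined by finitely many values. -/
theorem exists_finset_eq_zero [FiniteDimensional k 𝔤] : ∃ T : Finset (Env k 𝓖),
    ∀ f : Coind θ, (∀ u ∈ T, ev θ u f = 0) → f = 0 := by
  classical
  choose T hT using exists_finset_comp_eq_zero (k := k) θ
  refine ⟨(Finset.range (Module.finrank k (OddPart k 𝓖) + 1)).biUnion T, fun f hf =>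
    eq_zero_of_comp_eq_zero_of_le fun n hn => hT n f fun u hu => hf u ?_⟩
  exact Finset.mem_biUnion.2 ⟨n, Finset.mem_range.2 (Nat.lt_succ_of_le hn), hu⟩

/-- `W ⊗ Hom_{U(𝔤₀)} (U(𝔤), B) = Hom_{U(𝔤₀)} (U(𝔤), W ⊗ B)`. -/
theorem exists_lTensor_ev [FiniteDimensional k 𝔤] {W : Type u} [AddCommGroup W] [Module k W]
    (G : Env k 𝓖 →ₗ[k] W ⊗[k] B)
    (hG : ∀ z u, G (Env.ι k 𝓖 (EvenLie.incl k 𝓖 z) * u) = (θ z : B →ₗ[k] B).lTensor W (G u)) :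
    ∃ t : W ⊗[k] Coind θ, ∀ u, (ev θ u).lTensor W t = G u := by
  classical
  let b := Module.Basis.ofVectorSpace k W
  let E := TensorProduct.equivFinsuppOfBasisLeft (N := B) b
  -- The coordinates of `G` in a basis of `W` are elements of `Coind`, because the derivations act
  -- only on the other tensor factor.
  let φ : _ → Coind θ := fun i => ⟨Finsupp.lapply i ∘ₗ E.toLinearMap ∘ₗ G,
    mem_coindSubmodule_iff.2 fun z u => by
      show E (G _) i = θ z (E (G u) i)
      rw [hG]
      exact equivFinsupp_lTensor b _ _ i⟩
  have hφ : ∀ u i, ev θ u (φ i) = E (G u) i := fun _ _ => rfl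
  obtain ⟨T, hT⟩ := exists_finset_eq_zero θ
  refine ⟨(TensorProduct.equivFinsuppOfBasisLeft b).symm
    (Finsupp.onFinset (T.biUnion fun u => (E (G u)).support) φ fun i hi => ?_), fun u => ?_⟩
  -- Only finitely many coordinates are nonzero: each is determined by its values on `T`, and every
  -- G(u) has finite support.
  · by_contra h
    refine hi (hT _ fun u hu => ?_)
    rw [hφ]
    by_contra hne
    exact h (Finset.mem_biUnion.2 ⟨u, hu, Finsupp.mem_support_iff.2 hne⟩)
  · refine E.injective (Finsupp.ext fun i => ?_)
    refine (equivFinsupp_lTensor b _ _ i).trans ?_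
    rw [LinearEquiv.apply_symm_apply]
    exact hφ u i

theorem exists_rTensor_ev [FiniteDimensional k 𝔤] {W : Type u} [AddCommGroup W] [Module k W]
    (G : Env k 𝓖 →ₗ[k] B ⊗[k] W)
    (hG : ∀ z u, G (Env.ι k 𝓖 (EvenLie.incl k 𝓖 z) * u) = (θ z : B →ₗ[k] B).rTensor W (G u)) :
    ∃ t : Coind θ ⊗[k] W, ∀ u, (ev θ u).rTensor W t = G u := by
  obtain ⟨t, ht⟩ := exists_lTensor_ev (θ := θ) ((TensorProduct.comm k B W).toLinearMap ∘ₗ G)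
    (fun z u => by
      rw [LinearMap.comp_apply, hG, LinearMap.comp_apply, ← LinearMap.comm_comp_rTensor_comp_comm_eq]
      simp)
  refine ⟨TensorProduct.comm k W _ t, fun u => ?_⟩
  refine (TensorProduct.comm k B W).injective ((Eq.trans ?_ (ht u)))
  rw [← LinearMap.comm_comp_rTensor_comp_comm_eq (ev θ u)]
  simp

/-- A linear endomorphism commuting with an action of `U(𝔤)` and preserving the kernel of `e`. -/
structure Preserves {T T' : Type u} [AddCommGroup T] [Module k T] [AddCommGroup T'] [Module k T']
    (D : Env k 𝓖 →ₐ[k] Module.End k T) (e : T →ₗ[k] T') (κ : Module.End k T) : Prop where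
  comm : ∀ u t, κ (D u t) = D u (κ t)
  ker : ∀ t, e t = 0 → e (κ t) = 0

/-- A family of elements killed by `e` vanishes as soon as it spans an invariant subspace. -/
theorem eq_zero_of_invariant {T T' X : Type u} [AddCommGroup T] [Module k T] [AddCommGroup T']
    [Module k T'] (D : Env k 𝓖 →ₐ[k] Module.End k T) (e : T →ₗ[k] T')
    (hinj : ∀ t, (∀ u, e (D u t) = 0) → t = 0) (R : X → T)
    (hR : ∀ {i : ZMod 2} {v : 𝔤}, v ∈ 𝓖 i → ∀ x, D (Env.ι k 𝓖 v) (R x) ∈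
      Submodule.span k {t | ∃ κ y, Preserves D e κ ∧ t = κ (R y)})
    (he : ∀ x, e (R x) = 0) (x : X) : R x = 0 := by
  set N := Submodule.span k {t | ∃ κ y, Preserves D e κ ∧ t = κ (R y)} with hN
  have stab : ∀ κ, Preserves D e κ → ∀ t ∈ N, κ t ∈ N := by
    intro κ hκ t ht
    induction ht using Submodule.span_induction with
    | mem t ht =>
      obtain ⟨κ', y, h', rfl⟩ := ht
      refine Submodule.subset_span ⟨κ * κ', y, ⟨fun u s => ?_, fun s hs => ?_⟩, rfl⟩
      · rw [Module.End.mul_apply, h'.comm, hκ.comm, Module.End.mul_apply]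
      · exact hκ.ker _ (h'.ker _ hs)
    | zero => rw [map_zero]; exact N.zero_mem
    | add a b _ _ ha hb => rw [map_add]; exact N.add_mem ha hb
    | smul c a _ ha => rw [map_smul]; exact N.smul_mem c ha
  -- Invariance is assumed only for the generators `R x`; the operators κ commute with U(𝔤), so it
  -- passes to their images and then to all of U(𝔤).
  have inv : ∀ u, ∀ t ∈ N, D u t ∈ N := by
    intro u
    induction u using Env.induction_left with
    | one => intro t ht; rw [map_one]; exact ht
    | add u v hu hv =>
      intro t ht
      rw [map_add, LinearMap.add_apply]; exact N.add_mem (hu t ht) (hv t ht)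
    | smul c u hu => intro t ht; rw [map_smul, LinearMap.smul_apply]; exact N.smul_mem c (hu t ht)
    | @mul i v u hv hu =>
      intro t ht
      rw [map_mul, Module.End.mul_apply]
      have ht := hu t ht
      generalize D u t = s at ht
      induction ht using Submodule.span_induction with
      | mem s hs =>
        obtain ⟨κ, y, hκ, rfl⟩ := hs
        rw [← hκ.comm]
        exact stab κ hκ _ (hR hv y)
      | zero => rw [map_zero]; exact N.zero_mem
      | add a b _ _ ha hb => rw [map_add]; exact N.add_mem ha hb
      | smul c a _ ha => rw [map_smul]; exact N.smul_mem c ha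
  have zero : ∀ t ∈ N, e t = 0 := by
    intro t ht
    induction ht using Submodule.span_induction with
    | mem t ht =>
      obtain ⟨κ, y, hκ, rfl⟩ := ht
      exact hκ.ker _ (he y)
    | zero => exact map_zero e
    | add a b _ _ ha hb => rw [map_add, ha, hb, add_zero]
    | smul c a _ ha => rw [map_smul, ha, smul_zero]
  exact hinj _ fun u => zero _ (inv u _ (Submodule.subset_span
    ⟨1, x, ⟨fun _ _ => rfl, fun _ h => h⟩, rfl⟩))

end Coind

end Evaluation

/-! ### The antipode of a commutative Hopf algebra -/

section Hopf

variable {k A : Type u} [Field k] [CommRing A] [HopfAlgebra k A]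

theorem antipode_antipode (a : A) : HopfAlgebra.antipode k (HopfAlgebra.antipode k a) = a :=
  congrArg (fun f : WithConv (A →ₐ[k] A) => f.ofConv a) (inv_inv (WithConv.toConv (AlgHom.id k A)))

/-- In the convolution group of algebra morphisms A → A ⊗ A, Δ is the product of the two inclusions.
Precomposition with the antipode is inversion, which reverses the product. -/
theorem comul_antipode (a : A) : Coalgebra.comul (R := k) (HopfAlgebra.antipode k a) =
    TensorProduct.map (HopfAlgebra.antipode k) (HopfAlgebra.antipode k)
      (TensorProduct.comm k A A (Coalgebra.comul a)) := by
  have h : WithConv.toConv (Bialgebra.comulAlgHom k A) =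
      WithConv.toConv (Algebra.TensorProduct.includeLeft : A →ₐ[k] A ⊗[k] A) *
        WithConv.toConv (Algebra.TensorProduct.includeRight : A →ₐ[k] A ⊗[k] A) := by
    refine WithConv.ofConv_injective (AlgHom.ext fun a => ?_)
    refine Eq.trans ?_ (AlgHom.convMul_apply _ _ _).symm
    show Coalgebra.comul a = _
    generalize Coalgebra.comul (R := k) a = t
    induction t using TensorProduct.induction_on with
    | zero => simp
    | tmul a b => simp
    | add a b ha hb => rw [map_add, ← ha, ← hb]
  have h := congrArg Inv.inv h
  replace h := h.trans (mul_inv_rev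
    (WithConv.toConv (Algebra.TensorProduct.includeLeft : A →ₐ[k] A ⊗[k] A))
    (WithConv.toConv (Algebra.TensorProduct.includeRight : A →ₐ[k] A ⊗[k] A)))
  refine (congrArg (fun f : WithConv (A →ₐ[k] A ⊗[k] A) => f.ofConv a) h).trans ?_
  refine (AlgHom.convMul_apply _ _ _).trans ?_
  generalize Coalgebra.comul (R := k) a = t
  induction t using TensorProduct.induction_on with
  | zero => simp
  | tmul a b =>
    rw [Algebra.TensorProduct.lift_tmul, TensorProduct.comm_tmul, TensorProduct.map_tmul]
    show (1 ⊗ₜ HopfAlgebra.antipode k a) * (HopfAlgebra.antipode k b ⊗ₜ 1) = _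
    rw [Algebra.TensorProduct.tmul_mul_tmul, one_mul, mul_one]
  | add a b ha hb => simp only [map_add, ha, hb]

end Hopf

end SHCP

end

noncomputable section

namespace SHCP

/-! ### Invariant derivations and tangent vectors in terms of convolution -/

section Convolution

variable {k A : Type u} [Field k] [CommRing A] [HopfAlgebra k A]

open WithConv in
theorem toConv_adjointFun (v : A →ₗ[k] k) : toConv (adjointFun v) =
    toConv LinearMap.id * (toConv (Algebra.linearMap k A ∘ₗ v) * toConv (HopfAlgebra.antipode k)) :=
  rfl

open WithConv in
theorem toConv_antipode_comp_mul (f g : A →ₗ[k] A) :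
    toConv (HopfAlgebra.antipode k ∘ₗ (toConv f * toConv g).ofConv) =
      toConv (HopfAlgebra.antipode k ∘ₗ f) * toConv (HopfAlgebra.antipode k ∘ₗ g) := by
  refine WithConv.ofConv_injective (LinearMap.ext fun a => ?_)
  show HopfAlgebra.antipode k (LinearMap.mul' k A (TensorProduct.map f g (Coalgebra.comul a))) =
    LinearMap.mul' k A (TensorProduct.map _ _ (Coalgebra.comul a))
  generalize Coalgebra.comul (R := k) a = t
  induction t using TensorProduct.induction_on with
  | zero => simp
  | tmul a b =>
    exact HopfAlgebra.antipode_mul_distrib (f a) (g b)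
  | add a b ha hb => simp only [map_add, ha, hb]

open WithConv in
-- The adjoint function is id * v * S. As `A` is commutative, the antipode distributes over
-- convolution products without reversal and squares to the identity, so S ∘ (id * v * S) = S * v *
-- id, and id * S cancels.
theorem id_mul_antipode_adjointFun (v : A →ₗ[k] k) :
    toConv LinearMap.id * toConv (HopfAlgebra.antipode k ∘ₗ adjointFun v) =
      toConv (Algebra.linearMap k A ∘ₗ v) * toConv LinearMap.id := by
  have e1 := toConv_antipode_comp_mul (k := k) (A := A) LinearMap.id
    (toConv (Algebra.linearMap k A ∘ₗ v) * toConv (HopfAlgebra.antipode k)).ofConv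
  have e2 := toConv_antipode_comp_mul (k := k) (A := A) (Algebra.linearMap k A ∘ₗ v)
    (HopfAlgebra.antipode k)
  have e3 : HopfAlgebra.antipode k ∘ₗ Algebra.linearMap k A ∘ₗ v = Algebra.linearMap k A ∘ₗ v :=
    LinearMap.ext fun a => (HopfAlgebra.antipodeAlgHom k A).commutes (v a)
  have e4 : HopfAlgebra.antipode k ∘ₗ HopfAlgebra.antipode k = (LinearMap.id : A →ₗ[k] A) :=
    LinearMap.ext antipode_antipode
  rw [e2, e3, e4] at e1
  refine (congrArg (toConv LinearMap.id * ·) e1).trans ?_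
  rw [LinearMap.comp_id]
  simp only [← mul_assoc]
  rw [LinearMap.id_mul_antipode, one_mul]

open WithConv in
theorem antipode_mul_adjointFun (v : A →ₗ[k] k) :
    toConv (HopfAlgebra.antipode k) * toConv (adjointFun v) =
      toConv (Algebra.linearMap k A ∘ₗ v) * toConv (HopfAlgebra.antipode k) := by
  rw [toConv_adjointFun]
  simp only [← mul_assoc]
  rw [LinearMap.antipode_mul_id, one_mul]

theorem tangentVector_apply (D : groupLie k A) (a : A) :
    tangentVector D a = Coalgebra.counit (R := k) ((D : Derivation k A A) a) := rfl

theorem tangentVector_mul (D : groupLie k A) (a b : A) : tangentVector D (a * b) =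
    Coalgebra.counit (R := k) a * tangentVector D b + Coalgebra.counit (R := k) b * tangentVector D a := by
  rw [tangentVector_apply, Derivation.leibniz, map_add, smul_eq_mul, smul_eq_mul,
    Bialgebra.counit_mul, Bialgebra.counit_mul]
  rfl

/-- A left invariant derivation is `a ↦ ∑ a₁ v(a₂)`, where `v` is its tangent vector. -/
theorem groupLie_apply (D : groupLie k A) (a : A) : (D : Derivation k A A) a =
    TensorProduct.rid k A ((tangentVector D).lTensor A (Coalgebra.comul a)) := by
  have h := congrArg (fun t => TensorProduct.rid k A
    ((Coalgebra.counit (R := k) (A := A)).lTensor A t)) (D.2 a)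
  simp only [Coalgebra.lTensor_counit_comul, TensorProduct.rid_tmul, one_smul] at h
  rw [h, ← LinearMap.lTensor_comp_apply]
  rfl

/-- Apply the tangent vector, a derivation at the identity, to the relation ∑ a₁ S(a₂) = ε(a); the
right-hand side is constant. -/
theorem tangentVector_antipode (D : groupLie k A) (a : A) :
    tangentVector D (HopfAlgebra.antipode k a) = -tangentVector D a := by
  have h := congrArg (tangentVector D) (HopfAlgebra.mul_antipode_lTensor_comul_apply (R := k) a)
  have h0 : tangentVector D (algebraMap k A (Coalgebra.counit a)) = 0 := by
    rw [tangentVector_apply, Derivation.map_algebraMap, map_zero]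
  rw [h0] at h
  have key : ∀ t : A ⊗[k] A, tangentVector D
      (LinearMap.mul' k A ((HopfAlgebra.antipode k).lTensor A t)) =
      tangentVector D (HopfAlgebra.antipode k (TensorProduct.lid k A
        ((Coalgebra.counit (R := k) (A := A)).rTensor A t))) +
      tangentVector D (TensorProduct.rid k A ((Coalgebra.counit (R := k) (A := A)).lTensor A t)) := by
    intro t
    induction t using TensorProduct.induction_on with
    | zero => simp
    | tmul a b => simp [tangentVector_mul]
    | add a b ha hb => simp only [map_add, ha, hb]; ring
  rw [key, Coalgebra.rTensor_counit_comul, Coalgebra.lTensor_counit_comul, TensorProduct.lid_tmul,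
    TensorProduct.rid_tmul, one_smul] at h
  exact eq_neg_of_add_eq_zero_left h

/-- The value of a left invariant derivation on `S b`. -/
theorem groupLie_antipode (D : groupLie k A) (b : A) :
    (D : Derivation k A A) (HopfAlgebra.antipode k b) =
      -(WithConv.toConv (Algebra.linearMap k A ∘ₗ tangentVector D) *
        WithConv.toConv (HopfAlgebra.antipode k)).ofConv b := by
  rw [groupLie_apply, comul_antipode]
  show _ = -LinearMap.mul' k A (TensorProduct.map _ _ (Coalgebra.comul b))
  generalize Coalgebra.comul (R := k) b = t
  induction t using TensorProduct.induction_on with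
  | zero => simp
  | tmul a b => simp [tangentVector_antipode, Algebra.smul_def]
  | add a b ha hb => simp only [map_add, ha, hb, neg_add]

/-- Differentiating F(gh) along a left invariant field in `g` equals differentiating along the
corresponding right invariant field in `h`: both are the derivative of F(g exp(tz) h). -/
theorem rTensor_groupLie_comul (D : groupLie k A) (a : A) :
    ((D : Derivation k A A) : A →ₗ[k] A).rTensor A (Coalgebra.comul a) =
      (WithConv.toConv (Algebra.linearMap k A ∘ₗ tangentVector D) *
        WithConv.toConv LinearMap.id).ofConv.lTensor A (Coalgebra.comul a) := by
  have h := Coalgebra.coassoc_apply (R := k) a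
  have e1 : ∀ t : A ⊗[k] A, ((D : Derivation k A A) : A →ₗ[k] A).rTensor A t =
      TensorProduct.map (LinearMap.id : A →ₗ[k] A)
        ((TensorProduct.lid k A).toLinearMap ∘ₗ (tangentVector D).rTensor A)
        (TensorProduct.assoc k A A A ((Coalgebra.comul (R := k) (A := A)).rTensor A t)) := by
    intro t
    induction t using TensorProduct.induction_on with
    | zero => simp
    | add a b ha hb => simp only [map_add, ha, hb]
    | tmul a b =>
      rw [LinearMap.rTensor_tmul, LinearMap.rTensor_tmul]
      show (D : Derivation k A A) a ⊗ₜ b = _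
      rw [groupLie_apply]
      generalize Coalgebra.comul (R := k) a = s
      induction s using TensorProduct.induction_on with
      | zero => simp
      | add a b ha hb => simp only [map_add, TensorProduct.add_tmul, ha, hb]
      | tmul a c => simp [TensorProduct.smul_tmul]
  rw [e1, h]
  refine (LinearMap.lTensor_comp_apply A _ _ _).symm.trans ?_
  congr 2
  refine LinearMap.ext fun b => ?_
  show _ = LinearMap.mul' k A (TensorProduct.map _ _ (Coalgebra.comul b))
  rw [LinearMap.comp_apply]
  generalize Coalgebra.comul (R := k) b = t
  induction t using TensorProduct.induction_on with
  | zero => simp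
  | tmul a b => simp [Algebra.smul_def]
  | add a b ha hb => simp only [map_add, ha, hb]

end Convolution

/-! ### Left and right invariant vector fields related by the adjoint action -/

namespace HarishChandraPair

variable {k A 𝔤 : Type u} [Field k] [CharZero k] [AddCommGroup 𝔤] [Module k 𝔤]
  [CommRing A] [HopfAlgebra k A]
  {𝓖 : ZMod 2 → Submodule k 𝔤} [DirectSum.Decomposition 𝓖] [LieSuperalgebra k 𝓖]
  (P : HarishChandraPair k A 𝓖)

/-- The tangent vector at the identity of the even part of an element of `𝔤`. -/
def tangent : 𝔤 →ₗ[k] A →ₗ[k] k :=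
  tangentVector ∘ₗ (P.lieEquiv : EvenLie k 𝓖 →ₗ[k] groupLie k A) ∘ₗ EvenLie.proj k 𝓖

/-- The left invariant derivation given by the even part of an element of `𝔤`. -/
def derProj : 𝔤 →ₗ[k] A →ₗ[k] A :=
  LinearMap.mk₂ k (fun x a => P.der (EvenLie.proj k 𝓖 x) a)
    (fun x y a => by rw [map_add, map_add]; rfl) (fun c x a => by rw [map_smul, map_smul]; rfl)
    (fun x a b => map_add _ a b) (fun c x a => Derivation.map_smul _ c a)

theorem derProj_apply (x : 𝔤) (a : A) : P.derProj x a =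
    TensorProduct.rid k A ((P.tangent x).lTensor A (Coalgebra.comul a)) :=
  groupLie_apply (P.lieEquiv (EvenLie.proj k 𝓖 x)) a

theorem derProj_incl (z : EvenLie k 𝓖) : P.derProj (EvenLie.incl k 𝓖 z) = (P.der z : A →ₗ[k] A) :=
  LinearMap.ext fun a => by
    show P.der (EvenLie.proj k 𝓖 (EvenLie.incl k 𝓖 z)) a = P.der z a
    rw [EvenLie.proj_incl]

theorem comul_derProj (x : 𝔤) (a : A) : Coalgebra.comul (R := k) (P.derProj x a) =
    (P.derProj x).lTensor A (Coalgebra.comul a) :=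
  (P.lieEquiv (EvenLie.proj k 𝓖 x)).2 a

/-- The map `x ⊗ a ↦ (f ↦ v_x(f) a)`. -/
def adjMap : 𝔤 ⊗[k] A →ₗ[k] A →ₗ[k] A :=
  (LinearMap.mk₂ k (fun f t => TensorProduct.lid k A ((P.tangent.flip f).rTensor A t))
    (fun f g t => by rw [map_add, LinearMap.rTensor_add, LinearMap.add_apply, map_add])
    (fun c f t => by rw [map_smul, LinearMap.rTensor_smul, LinearMap.smul_apply, map_smul])
    (fun f s t => by rw [map_add, map_add]) (fun c f t => by rw [map_smul, map_smul])).flip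

theorem adjMap_tmul (x : 𝔤) (a f : A) : P.adjMap (x ⊗ₜ a) f = P.tangent x f • a := by
  show TensorProduct.lid k A ((P.tangent.flip f).rTensor A (x ⊗ₜ a)) = _
  rw [LinearMap.rTensor_tmul, TensorProduct.lid_tmul, LinearMap.flip_apply]

theorem adjointFun_eq (z : EvenLie k 𝓖) :
    adjointFun (tangentVector (P.lieEquiv z)) = P.adjMap (P.coact (EvenLie.incl k 𝓖 z)) :=
  LinearMap.ext fun f => (P.coact_adjoint z f).symm

/-- The map `x ⊗ a ↦ (b ↦ θ_x(b) S(a))`. -/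
def derAntipode : 𝔤 ⊗[k] A →ₗ[k] A →ₗ[k] A :=
  TensorProduct.lift (LinearMap.mk₂ k
    (fun (x : 𝔤) (a : A) => LinearMap.mulRight k (HopfAlgebra.antipode k a) ∘ₗ P.derProj x)
    (fun x y a => by rw [map_add, LinearMap.comp_add]) (fun c x a => by rw [map_smul, LinearMap.comp_smul])
    (fun x a b => LinearMap.ext fun c => by simp [mul_add])
    (fun c x a => LinearMap.ext fun b => by simp))

theorem derAntipode_tmul (x : 𝔤) (a b : A) :
    P.derAntipode (x ⊗ₜ a) b = P.derProj x b * HopfAlgebra.antipode k a := rfl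

/-- `∑ θ_{z₀}(b) S(z₁)` is the value at `b` of the right invariant vector field of `z`. -/
theorem derAntipode_coact (z : EvenLie k 𝓖) :
    P.derAntipode (P.coact (EvenLie.incl k 𝓖 z)) =
    (WithConv.toConv (Algebra.linearMap k A ∘ₗ tangentVector (P.lieEquiv z)) *
        WithConv.toConv LinearMap.id).ofConv := by
  refine LinearMap.ext fun b => ?_
  rw [← id_mul_antipode_adjointFun, adjointFun_eq]
  show _ = LinearMap.mul' k A (TensorProduct.map _ _ (Coalgebra.comul b))
  generalize P.coact (EvenLie.incl k 𝓖 z) = t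
  induction t using TensorProduct.induction_on with
  | zero => simp
  | add s t hs ht =>
    rw [map_add, LinearMap.add_apply, hs, ht, map_add, LinearMap.comp_add,
      TensorProduct.map_add_right, LinearMap.add_apply, map_add]
  | tmul x a =>
    rw [derAntipode_tmul, derProj_apply]
    generalize Coalgebra.comul (R := k) b = s
    induction s using TensorProduct.induction_on with
    | zero => simp
    | add s t hs ht => rw [map_add, map_add, add_mul, hs, ht, map_add, map_add]
    | tmul b c => simp [adjMap_tmul]

/-- `∑ S(θ_{z₀}(b)) z₁ = -θ_z(S b)`. -/
theorem antipode_derProj_mul (z : EvenLie k 𝓖) (b : A) :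
    LinearMap.mul' k A (TensorProduct.map (HopfAlgebra.antipode k ∘ₗ P.derProj.flip b) LinearMap.id
      (P.coact (EvenLie.incl k 𝓖 z))) =
    -P.der z (HopfAlgebra.antipode k b) := by
  rw [show P.der z (HopfAlgebra.antipode k b) = _ from groupLie_antipode (P.lieEquiv z) b, neg_neg,
    ← antipode_mul_adjointFun, adjointFun_eq]
  show _ = LinearMap.mul' k A (TensorProduct.map _ _ (Coalgebra.comul b))
  generalize P.coact (EvenLie.incl k 𝓖 z) = t
  induction t using TensorProduct.induction_on with
  | zero => simp
  | add s t hs ht =>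
    rw [map_add, map_add, hs, ht, map_add, TensorProduct.map_add_right,
      LinearMap.add_apply, map_add]
  | tmul x a =>
    rw [TensorProduct.map_tmul, LinearMap.mul'_apply, LinearMap.comp_apply, LinearMap.flip_apply,
      derProj_apply]
    generalize Coalgebra.comul (R := k) b = s
    induction s using TensorProduct.induction_on with
    | zero => simp
    | add s t hs ht => rw [map_add, map_add, map_add, add_mul, hs, ht, map_add, map_add]
    | tmul b c => simp [adjMap_tmul]

/-- The map `x ⊗ b ↦ Δ(θ_x(a)) (1 ⊗ S(b))`. -/
def comulDer (a : A) : 𝔤 ⊗[k] A →ₗ[k] A ⊗[k] A :=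
  LinearMap.mul' k (A ⊗[k] A) ∘ₗ TensorProduct.map (Coalgebra.comul ∘ₗ P.derProj.flip a)
    (Algebra.TensorProduct.includeRight.toLinearMap ∘ₗ HopfAlgebra.antipode k)

theorem comulDer_tmul (a : A) (x : 𝔤) (b : A) : P.comulDer a (x ⊗ₜ b) =
    Coalgebra.comul (R := k) (P.derProj x a) * (1 ⊗ₜ[k] HopfAlgebra.antipode k b) := rfl

/-- `∑ Δ(θ_{z₀}(a)) (1 ⊗ S(z₁)) = (θ_z ⊗ 1) Δ(a)`. -/
theorem comulDer_coact (z : EvenLie k 𝓖) (a : A) : P.comulDer a (P.coact (EvenLie.incl k 𝓖 z)) =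
      (P.der z : A →ₗ[k] A).rTensor A (Coalgebra.comul a) := by
  rw [show (P.der z : A →ₗ[k] A).rTensor A (Coalgebra.comul a) = _ from
    rTensor_groupLie_comul (P.lieEquiv z) a]
  rw [← derAntipode_coact]
  generalize P.coact (EvenLie.incl k 𝓖 z) = t
  induction t using TensorProduct.induction_on with
  | zero => simp
  | add s t hs ht => rw [map_add, hs, ht, map_add, LinearMap.lTensor_add, LinearMap.add_apply]
  | tmul x b =>
    rw [comulDer_tmul, comul_derProj]
    generalize Coalgebra.comul (R := k) a = s
    induction s using TensorProduct.induction_on with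
    | zero => simp
    | add s t hs ht => rw [map_add, add_mul, hs, ht, map_add]
    | tmul a c => simp [derAntipode_tmul]

end HarishChandraPair

end SHCP

end

noncomputable section

namespace SHCP

section

variable {k 𝔤 : Type u} [Field k] [CharZero k] [AddCommGroup 𝔤] [Module k 𝔤]
  {𝓖 : ZMod 2 → Submodule k 𝔤} [DirectSum.Decomposition 𝓖] [LieSuperalgebra k 𝓖]

theorem Env.algHom_ext {R : Type*} [Semiring R] [Algebra k R] {f g : Env k 𝓖 →ₐ[k] R}
    (h : ∀ {i : ZMod 2} {x : 𝔤}, x ∈ 𝓖 i → f (Env.ι k 𝓖 x) = g (Env.ι k 𝓖 x)) : f = g :=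
  AlgHom.ext fun u => by
    induction u using Env.induction_left with
    | one => rw [map_one, map_one]
    | add u v hu hv => rw [map_add, map_add, hu, hv]
    | smul c u hu => rw [map_smul, map_smul, hu]
    | mul u hx hu => rw [map_mul, map_mul, h hx, hu]

end

/-! ### The action of the even group on the enveloping algebra -/

namespace HarishChandraPair

variable {k A 𝔤 : Type u} [Field k] [CharZero k] [AddCommGroup 𝔤] [Module k 𝔤]
  [CommRing A] [HopfAlgebra k A]
  {𝓖 : ZMod 2 → Submodule k 𝔤} [DirectSum.Decomposition 𝓖] [LieSuperalgebra k 𝓖]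
  (P : HarishChandraPair k A 𝓖)

theorem coactEnv_ι (x : 𝔤) : P.coactEnv (Env.ι k 𝓖 x) = (Env.ι k 𝓖).rTensor A (P.coact x) :=
  Env.lift_ι _ _ x

/-- Both sides are algebra morphisms in `u`, so the comodule axiom on 𝔤 is enough. The next three
compatibilities are obtained in the same way. -/
theorem coactEnv_coassoc (u : Env k 𝓖) :
    TensorProduct.assoc k (Env k 𝓖) A A (P.coactEnv.toLinearMap.rTensor A (P.coactEnv u)) =
      (Coalgebra.comul (R := k) (A := A)).lTensor (Env k 𝓖) (P.coactEnv u) := by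
  have h : ((Algebra.TensorProduct.assoc k k k (Env k 𝓖) A A).toAlgHom.comp
      (Algebra.TensorProduct.map P.coactEnv (AlgHom.id k A))).comp P.coactEnv =
      (Algebra.TensorProduct.map (AlgHom.id k (Env k 𝓖)) (Bialgebra.comulAlgHom k A)).comp
        P.coactEnv := by
    refine Env.algHom_ext fun {i x} _ => ?_
    show TensorProduct.assoc k (Env k 𝓖) A A (P.coactEnv.toLinearMap.rTensor A
      (P.coactEnv (Env.ι k 𝓖 x))) = (Coalgebra.comul (R := k) (A := A)).lTensor (Env k 𝓖)
        (P.coactEnv (Env.ι k 𝓖 x))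
    rw [coactEnv_ι]
    have e : ∀ t : 𝔤 ⊗[k] A, TensorProduct.assoc k (Env k 𝓖) A A
        (P.coactEnv.toLinearMap.rTensor A ((Env.ι k 𝓖).rTensor A t)) =
        (Env.ι k 𝓖).rTensor (A ⊗[k] A) (TensorProduct.assoc k 𝔤 A A (P.coact.rTensor A t)) := by
      intro t
      induction t using TensorProduct.induction_on with
      | zero => simp
      | add s t hs ht => simp only [map_add, hs, ht]
      | tmul y a =>
        rw [LinearMap.rTensor_tmul, LinearMap.rTensor_tmul, AlgHom.toLinearMap_apply, coactEnv_ι,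
          LinearMap.rTensor_tmul]
        generalize P.coact y = s
        induction s using TensorProduct.induction_on with
        | zero => simp
        | add s t hs ht => simp only [map_add, TensorProduct.add_tmul, hs, ht]
        | tmul y b => simp
    rw [e, show TensorProduct.assoc k 𝔤 A A (P.coact.rTensor A (P.coact x)) = _ from
      LinearMap.congr_fun P.coact_coassoc x]
    rw [LinearMap.comp_apply]
    generalize P.coact x = t
    induction t using TensorProduct.induction_on with
    | zero => simp
    | add s t hs ht => simp only [map_add, hs, ht]
    | tmul y a => simp
  exact congrArg (fun f : Env k 𝓖 →ₐ[k] Env k 𝓖 ⊗[k] (A ⊗[k] A) => f u) h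

theorem coactEnv_counit (u : Env k 𝓖) : TensorProduct.rid k (Env k 𝓖)
    ((Coalgebra.counit (R := k) (A := A)).lTensor (Env k 𝓖) (P.coactEnv u)) = u := by
  have h : ((Algebra.TensorProduct.rid k k (Env k 𝓖)).toAlgHom.comp
      (Algebra.TensorProduct.map (AlgHom.id k (Env k 𝓖)) (Bialgebra.counitAlgHom k A))).comp
        P.coactEnv = AlgHom.id k (Env k 𝓖) := by
    refine Env.algHom_ext fun {i x} _ => ?_
    show TensorProduct.rid k (Env k 𝓖) ((Coalgebra.counit (R := k) (A := A)).lTensor (Env k 𝓖)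
      (P.coactEnv (Env.ι k 𝓖 x))) = Env.ι k 𝓖 x
    have e := congrArg (Env.ι k 𝓖) (LinearMap.congr_fun P.coact_counit x)
    refine Eq.trans ?_ e
    rw [coactEnv_ι, LinearMap.comp_apply, LinearMap.comp_apply]
    generalize P.coact x = t
    induction t using TensorProduct.induction_on with
    | zero => simp
    | add s t hs ht => simp only [map_add, hs, ht]
    | tmul y a => simp
  exact congrArg (fun f : Env k 𝓖 →ₐ[k] Env k 𝓖 => f u) h

theorem coactEnv_env_counit (u : Env k 𝓖) : TensorProduct.lid k A
    ((Env.counit k 𝓖).toLinearMap.rTensor A (P.coactEnv u)) =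
      algebraMap k A (Env.counit k 𝓖 u) := by
  have h : ((Algebra.TensorProduct.lid k A).toAlgHom.comp
      (Algebra.TensorProduct.map (Env.counit k 𝓖) (AlgHom.id k A))).comp
        P.coactEnv = (Algebra.ofId k A).comp (Env.counit k 𝓖) := by
    refine Env.algHom_ext fun {i x} _ => ?_
    show TensorProduct.lid k A ((Env.counit k 𝓖).toLinearMap.rTensor A
      (P.coactEnv (Env.ι k 𝓖 x))) = algebraMap k A (Env.counit k 𝓖 (Env.ι k 𝓖 x))
    have e0 : ∀ y, Env.counit k 𝓖 (Env.ι k 𝓖 y) = 0 := fun y => Env.lift_ι _ _ y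
    rw [coactEnv_ι, e0, map_zero]
    generalize P.coact x = t
    induction t using TensorProduct.induction_on with
    | zero => simp
    | add s t hs ht => simp only [map_add, hs, ht, add_zero]
    | tmul y a => simp [e0]
  exact congrArg (fun f : Env k 𝓖 →ₐ[k] A => f u) h

theorem coactEnv_parity (u : Env k 𝓖) : P.coactEnv (Env.parity k 𝓖 u) =
    (Env.parity k 𝓖).toLinearMap.rTensor A (P.coactEnv u) := by
  have h : P.coactEnv.comp (Env.parity k 𝓖) =
      (Algebra.TensorProduct.map (Env.parity k 𝓖) (AlgHom.id k A)).comp P.coactEnv := by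
    refine Env.algHom_ext fun {i x} hx => ?_
    show P.coactEnv (Env.parity k 𝓖 (Env.ι k 𝓖 x)) =
      (Env.parity k 𝓖).toLinearMap.rTensor A (P.coactEnv (Env.ι k 𝓖 x))
    rw [Env.parity_ι hx, Units.smul_def, map_zsmul, coactEnv_ι]
    obtain ⟨t, ht⟩ := P.coact_mem i x hx
    rw [← ht]
    clear ht hx
    induction t using TensorProduct.induction_on with
    | zero => simp
    | add s t hs ht => simp only [map_add, smul_add, hs, ht]
    | tmul y a =>
      rw [LinearMap.rTensor_tmul, LinearMap.rTensor_tmul, LinearMap.rTensor_tmul,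
        AlgHom.toLinearMap_apply]
      rw [show (𝓖 i).subtype y = (y : 𝔤) from rfl, Env.parity_ι y.2, Units.smul_def,
        TensorProduct.smul_tmul']
  exact congrArg (fun f : Env k 𝓖 →ₐ[k] Env k 𝓖 ⊗[k] A => f u) h

/-- The differential of the action on `U(𝔤)` is the commutator. -/
theorem coactEnv_differential (z : EvenLie k 𝓖) (u : Env k 𝓖) : TensorProduct.rid k (Env k 𝓖)
    ((tangentVector (P.lieEquiv z)).lTensor (Env k 𝓖) (P.coactEnv u)) =
      Env.ι k 𝓖 (EvenLie.incl k 𝓖 z) * u - u * Env.ι k 𝓖 (EvenLie.incl k 𝓖 z) := by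
  have h1 : tangentVector (P.lieEquiv z) 1 = 0 := by
    rw [tangentVector_apply, Derivation.map_one_eq_zero, map_zero]
  induction u using Env.induction_left with
  | one =>
    rw [map_one, Algebra.TensorProduct.one_def, LinearMap.lTensor_tmul, h1, mul_one, one_mul,
      sub_self, TensorProduct.tmul_zero, map_zero]
  | add u v hu hv => rw [map_add, map_add, map_add, hu, hv, mul_add, add_mul]; abel
  | smul c u hu =>
    rw [map_smul, map_smul, map_smul, hu, mul_smul_comm, smul_mul_assoc, smul_sub]
  | @mul i x u hx hu =>
    -- A tangent vector obeys the Leibniz rule relative to the counit, so the differential of an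
    -- action by algebra automorphisms is a derivation, as is the commutator.
    have key : ∀ s t : Env k 𝓖 ⊗[k] A, TensorProduct.rid k (Env k 𝓖)
        ((tangentVector (P.lieEquiv z)).lTensor (Env k 𝓖) (s * t)) =
        TensorProduct.rid k (Env k 𝓖) ((tangentVector (P.lieEquiv z)).lTensor (Env k 𝓖) s) *
          TensorProduct.rid k (Env k 𝓖)
            ((Coalgebra.counit (R := k) (A := A)).lTensor (Env k 𝓖) t) +
        TensorProduct.rid k (Env k 𝓖)
            ((Coalgebra.counit (R := k) (A := A)).lTensor (Env k 𝓖) s) *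
          TensorProduct.rid k (Env k 𝓖)
            ((tangentVector (P.lieEquiv z)).lTensor (Env k 𝓖) t) := by
      intro s t
      induction s using TensorProduct.induction_on with
      | zero => simp
      | add s s' hs hs' => simp only [map_add, add_mul, hs, hs']; abel
      | tmul x a =>
        induction t using TensorProduct.induction_on with
        | zero => simp
        | add t t' ht ht' => simp only [map_add, mul_add, ht, ht']; abel
        | tmul y b =>
          simp only [Algebra.TensorProduct.tmul_mul_tmul, LinearMap.lTensor_tmul,
            TensorProduct.rid_tmul, tangentVector_mul, smul_mul_smul_comm, add_smul]
          rw [mul_comm (Coalgebra.counit (R := k) b), add_comm]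
    have hι : TensorProduct.rid k (Env k 𝓖) ((tangentVector (P.lieEquiv z)).lTensor (Env k 𝓖)
        (P.coactEnv (Env.ι k 𝓖 x))) = Env.ι k 𝓖 (LieSuperalgebra.bracket 𝓖 (EvenLie.incl k 𝓖 z) x) := by
      rw [← P.coact_differential, coactEnv_ι]
      generalize P.coact x = t
      induction t using TensorProduct.induction_on with
      | zero => simp
      | add s t hs ht => simp only [map_add, hs, ht]
      | tmul y a => simp
    have hb := Env.ι_mul_ι (EvenLie.incl_mem k 𝓖 z) hx
    rw [zero_mul, uzpow_zero, one_smul] at hb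
    rw [map_mul, key, hu, coactEnv_counit, coactEnv_counit, hι, eq_sub_of_add_eq' hb.symm]
    noncomm_ring

/-- This is the derivative of (h exp(tz)).u at t = 0. It is obtained by applying the tangent vector
of `z` to the last factor of coassociativity. -/
theorem coactEnv_comm (z : EvenLie k 𝓖) (u : Env k 𝓖) :
    P.coactEnv (Env.ι k 𝓖 (EvenLie.incl k 𝓖 z) * u - u * Env.ι k 𝓖 (EvenLie.incl k 𝓖 z)) =
      (P.der z : A →ₗ[k] A).lTensor (Env k 𝓖) (P.coactEnv u) := by
  have h := congrArg (TensorProduct.map (LinearMap.id : Env k 𝓖 →ₗ[k] Env k 𝓖)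
    ((TensorProduct.rid k A).toLinearMap ∘ₗ
      (tangentVector (k := k) (A := A) (P.lieEquiv z)).lTensor A)) (P.coactEnv_coassoc u)
  rw [← P.coactEnv_differential]
  refine Eq.trans ?_ (h.trans ?_)
  · generalize P.coactEnv u = t
    induction t using TensorProduct.induction_on with
    | zero => simp
    | add s t hs ht => simp only [map_add, hs, ht]
    | tmul y a =>
      rw [LinearMap.rTensor_tmul, AlgHom.toLinearMap_apply, LinearMap.lTensor_tmul,
        TensorProduct.rid_tmul, map_smul]
      generalize P.coactEnv y = s
      induction s using TensorProduct.induction_on with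
      | zero => simp
      | add s t hs ht => simp only [map_add, TensorProduct.add_tmul, smul_add, hs, ht]
      | tmul y b => simp
  · refine (LinearMap.lTensor_comp_apply (Env k 𝓖) _ _ _).symm.trans ?_
    congr 2
    exact LinearMap.ext fun a => (groupLie_apply (P.lieEquiv z) a).symm

end HarishChandraPair

end SHCP

end

noncomputable section

namespace SHCP

/-! ### The coaction of the even group by right translations -/

namespace Coind

variable {k 𝔤 : Type u} [Field k] [CharZero k] [AddCommGroup 𝔤] [Module k 𝔤]
  {𝓖 : ZMod 2 → Submodule k 𝔤} [DirectSum.Decomposition 𝓖] [LieSuperalgebra k 𝓖]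
  {B : Type u} [CommRing B] [Algebra k B] {θ : EvenLie k 𝓖 →ₗ⁅k⁆ Derivation k B B}
  {W X : Type u} [AddCommGroup W] [Module k W] [AddCommGroup X] [Module k X]

theorem eq_of_rTensor_ev {s t : Coind θ ⊗[k] W}
    (h : ∀ u, (ev θ u).rTensor W s = (ev θ u).rTensor W t) : s = t := by
  rw [← sub_eq_zero]
  exact rTensor_jointly_injective (φ := ev θ) (fun _ => eq_zero_of_ev) fun u => by
    rw [map_sub, h, sub_self]

theorem eq_of_lTensor_ev {s t : W ⊗[k] Coind θ}
    (h : ∀ u, (ev θ u).lTensor W s = (ev θ u).lTensor W t) : s = t := by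
  rw [← sub_eq_zero]
  exact lTensor_jointly_injective (φ := ev θ) (fun _ => eq_zero_of_ev) fun u => by
    rw [map_sub, h, sub_self]

/-- The tensor with given values is unique, so a choice made for each `x` is automatically linear.
-/
theorem exists_linear_rTensor_ev [FiniteDimensional k 𝔤] (G : X →ₗ[k] Env k 𝓖 →ₗ[k] B ⊗[k] W)
    (hG : ∀ x z u, G x (Env.ι k 𝓖 (EvenLie.incl k 𝓖 z) * u) =
      (θ z : B →ₗ[k] B).rTensor W (G x u)) :
    ∃ L : X →ₗ[k] Coind θ ⊗[k] W, ∀ x u, (ev θ u).rTensor W (L x) = G x u := by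
  choose L hL using fun x => exists_rTensor_ev (G x) (hG x)
  refine ⟨{ toFun := L, map_add' := fun x y => ?_, map_smul' := fun c x => ?_ }, hL⟩
  · exact eq_of_rTensor_ev fun u => by rw [map_add, hL, hL, hL, map_add, LinearMap.add_apply]
  · exact eq_of_rTensor_ev fun u => by
      rw [RingHom.id_apply, map_smul, hL, hL, map_smul, LinearMap.smul_apply]

theorem exists_linear_lTensor_ev [FiniteDimensional k 𝔤] (G : X →ₗ[k] Env k 𝓖 →ₗ[k] W ⊗[k] B)
    (hG : ∀ x z u, G x (Env.ι k 𝓖 (EvenLie.incl k 𝓖 z) * u) =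
      (θ z : B →ₗ[k] B).lTensor W (G x u)) :
    ∃ L : X →ₗ[k] W ⊗[k] Coind θ, ∀ x u, (ev θ u).lTensor W (L x) = G x u := by
  choose L hL using fun x => exists_lTensor_ev (G x) (hG x)
  refine ⟨{ toFun := L, map_add' := fun x y => ?_, map_smul' := fun c x => ?_ }, hL⟩
  · exact eq_of_lTensor_ev fun u => by rw [map_add, hL, hL, hL, map_add, LinearMap.add_apply]
  · exact eq_of_lTensor_ev fun u => by
      rw [RingHom.id_apply, map_smul, hL, hL, map_smul, LinearMap.smul_apply]

end Coind

namespace HarishChandraPair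

variable {k A 𝔤 : Type u} [Field k] [CharZero k] [AddCommGroup 𝔤] [Module k 𝔤]
  [CommRing A] [HopfAlgebra k A]
  {𝓖 : ZMod 2 → Submodule k 𝔤} [DirectSum.Decomposition 𝓖] [LieSuperalgebra k 𝓖]

/-- The map `x ⊗ a ↦ Δ(f(x)) (1 ⊗ S(a))`. -/
def twistedComul : (Env k 𝓖 →ₗ[k] A) →ₗ[k] Env k 𝓖 ⊗[k] A →ₗ[k] A ⊗[k] A where
  toFun f := LinearMap.mul' k (A ⊗[k] A) ∘ₗ TensorProduct.map (Coalgebra.comul ∘ₗ f)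
    (Algebra.TensorProduct.includeRight.toLinearMap ∘ₗ HopfAlgebra.antipode k)
  map_add' f g := by rw [LinearMap.comp_add, TensorProduct.map_add_left, LinearMap.comp_add]
  map_smul' c f := by
    rw [LinearMap.comp_smul, TensorProduct.map_smul_left, LinearMap.comp_smul, RingHom.id_apply]

theorem twistedComul_tmul (f : Env k 𝓖 →ₗ[k] A) (x : Env k 𝓖) (a : A) :
    twistedComul f (x ⊗ₜ a) =
      Coalgebra.comul (R := k) (f x) * (1 ⊗ₜ[k] HopfAlgebra.antipode k a) := rfl

variable (P : HarishChandraPair k A 𝓖)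

/-- At (g, h) the left side is the derivative of f(h⁻¹.u) at gh along the left invariant field of
Ad(h⁻¹)z. Since h exp(t Ad(h⁻¹)z) = exp(tz) h, this is the derivative in `g` along `z`. It supplies
the 𝔤₀-linearity required for the coaction to exist. -/
theorem twistedComul_coactEnv_even_mul (f : Coind P.der) (z : EvenLie k 𝓖) (u : Env k 𝓖) :
    twistedComul (Coind.toLin P.der f) (P.coactEnv (Env.ι k 𝓖 (EvenLie.incl k 𝓖 z) * u)) =
      (P.der z : A →ₗ[k] A).rTensor A (twistedComul (Coind.toLin P.der f) (P.coactEnv u)) := by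
  rw [map_mul, coactEnv_ι]
  generalize P.coactEnv u = t
  induction t using TensorProduct.induction_on with
  | zero => simp
  | add s t hs ht => rw [mul_add, map_add, map_add, map_add, hs, ht]
  | tmul x a =>
    have key : twistedComul (Coind.toLin P.der f)
        ((Env.ι k 𝓖).rTensor A (P.coact (EvenLie.incl k 𝓖 z)) * x ⊗ₜ a) =
        P.comulDer (Coind.toLin P.der f x) (P.coact (EvenLie.incl k 𝓖 z)) *
          (1 ⊗ₜ[k] HopfAlgebra.antipode k a) := by
      obtain ⟨c, hc⟩ := P.coact_mem 0 _ (EvenLie.incl_mem k 𝓖 z)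
      rw [← hc]
      clear hc
      induction c using TensorProduct.induction_on with
      | zero => simp
      | add s t hs ht => simp only [map_add, add_mul, hs, ht]
      | tmul y b =>
        have hy : Coind.toLin P.der f (Env.ι k 𝓖 y * x) = P.derProj y (Coind.toLin P.der f x) := by
          refine (Coind.even_of_ι (z := y) f x).trans ?_
          exact (LinearMap.congr_fun (P.derProj_incl y) _).symm
        rw [LinearMap.rTensor_tmul, LinearMap.rTensor_tmul, Algebra.TensorProduct.tmul_mul_tmul,
          twistedComul_tmul]
        rw [show (𝓖 0).subtype y = (y : 𝔤) from rfl, hy, comulDer_tmul, mul_assoc,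
          Algebra.TensorProduct.tmul_mul_tmul, one_mul, HopfAlgebra.antipode_mul_distrib]
    rw [key, comulDer_coact, twistedComul_tmul]
    generalize Coalgebra.comul (R := k) (Coind.toLin P.der f x) = t
    induction t using TensorProduct.induction_on with
    | zero => simp
    | add s t hs ht => simp only [map_add, add_mul, hs, ht]
    | tmul y b => simp

theorem exists_coaction [FiniteDimensional k 𝔤] : ∃ L : Coind P.der →ₗ[k] Coind P.der ⊗[k] A,
    ∀ f u, (Coind.ev P.der u).rTensor A (L f) =
      twistedComul (Coind.toLin P.der f) (P.coactEnv u) :=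
  Coind.exists_linear_rTensor_ev
    (LinearMap.lcomp k (A ⊗[k] A) P.coactEnv.toLinearMap ∘ₗ twistedComul ∘ₗ Coind.toLin P.der)
    P.twistedComul_coactEnv_even_mul

variable [FiniteDimensional k 𝔤]

/-- The coaction of `𝒪(G₀)` on `𝒪(G)` given by right translations. -/
def coaction : Coind P.der →ₗ[k] Coind P.der ⊗[k] A := P.exists_coaction.choose

theorem rTensor_ev_coaction (f : Coind P.der) (u : Env k 𝓖) :
    (Coind.ev P.der u).rTensor A (P.coaction f) =
      twistedComul (Coind.toLin P.der f) (P.coactEnv u) := P.exists_coaction.choose_spec f u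

/-- The map `x ⊗ a ↦ λ(f (· x)) (1 ⊗ S(a))`. -/
def twist : Coind P.der →ₗ[k] Env k 𝓖 ⊗[k] A →ₗ[k] Coind P.der ⊗[k] A where
  toFun f := LinearMap.mul' k (Coind P.der ⊗[k] A) ∘ₗ
    TensorProduct.map (P.coaction ∘ₗ (Coind.translate P.der).toLinearMap.flip f)
      (Algebra.TensorProduct.includeRight.toLinearMap ∘ₗ HopfAlgebra.antipode k)
  map_add' f g := by
    rw [map_add, LinearMap.comp_add, TensorProduct.map_add_left, LinearMap.comp_add]
  map_smul' c f := by
    rw [map_smul, LinearMap.comp_smul, TensorProduct.map_smul_left, LinearMap.comp_smul,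
      RingHom.id_apply]

theorem twist_tmul (f : Coind P.der) (x : Env k 𝓖) (a : A) : P.twist f (x ⊗ₜ a) =
    P.coaction (Coind.translate P.der x f) * (1 ⊗ₜ[k] HopfAlgebra.antipode k a) := rfl

theorem coaction_parity (f : Coind P.der) : P.coaction (Coind.parity P.der f) =
    (Coind.parity P.der).toLinearMap.rTensor A (P.coaction f) :=
  Coind.eq_of_rTensor_ev fun u => by
    rw [rTensor_ev_coaction, ← LinearMap.rTensor_comp_apply, Coind.ev_comp_parity,
      rTensor_ev_coaction, coactEnv_parity]
    generalize P.coactEnv u = t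
    induction t using TensorProduct.induction_on with
    | zero => simp
    | add s t hs ht => simp only [map_add, hs, ht]
    | tmul y b => rfl

theorem coaction_parityPow (i : ZMod 2) (f : Coind P.der) :
    P.coaction (Coind.parityPow P.der i f) =
      (Coind.parityPow P.der i).toLinearMap.rTensor A (P.coaction f) := by
  rcases zmod_two_cases i with rfl | rfl
  · rw [Coind.parityPow, if_pos rfl]
    exact (LinearMap.congr_fun (LinearMap.rTensor_id A (Coind P.der)) _).symm
  · rw [← Coind.parity_eq_parityPow]
    exact P.coaction_parity f

theorem rTensor_mul_one_tmul {H B C : Type u} [Ring H] [Algebra k H] [Ring B] [Algebra k B]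
    [CommRing C] [Algebra k C] (φ : H →ₗ[k] B) (t : H ⊗[k] C) (c : C) :
    φ.rTensor C (t * (1 ⊗ₜ c)) = φ.rTensor C t * (1 ⊗ₜ c) := by
  induction t using TensorProduct.induction_on with
  | zero => simp
  | add s t hs ht => simp only [map_add, add_mul, hs, ht]
  | tmul y b => simp

/-- The identity h⁻¹.(uw) = (h⁻¹.u)(h⁻¹.w) shows how translation in the first factor passes inside
λ. This rule supplies the invariance when the vanishing principle is applied to λ. -/
theorem rTensor_translate_coaction (w : Env k 𝓖) (f : Coind P.der) :
    (Coind.translate P.der w).rTensor A (P.coaction f) = P.twist f (P.coactEnv w) :=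
  Coind.eq_of_rTensor_ev fun u => by
    have key : ∀ t, (Coind.ev P.der u).rTensor A (P.twist f t) =
        twistedComul (Coind.toLin P.der f) (P.coactEnv u * t) := by
      intro t
      induction t using TensorProduct.induction_on with
      | zero => simp
      | add s t hs ht => simp only [map_add, mul_add, hs, ht]
      | tmul x a =>
        rw [twist_tmul, rTensor_mul_one_tmul, rTensor_ev_coaction]
        generalize P.coactEnv u = s
        induction s using TensorProduct.induction_on with
        | zero => simp
        | add s t hs ht => simp only [map_add, add_mul, hs, ht]
        | tmul y b =>
          rw [Algebra.TensorProduct.tmul_mul_tmul, twistedComul_tmul, twistedComul_tmul, mul_assoc,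
            Algebra.TensorProduct.tmul_mul_tmul, one_mul, HopfAlgebra.antipode_mul_distrib]
          rfl
    rw [key, ← LinearMap.rTensor_comp_apply, Coind.ev_comp_translate, rTensor_ev_coaction, map_mul]

/-- At 1 the action is trivial, so restricting the first variable to the even group leaves the
comultiplication of `A`. -/
theorem rTensor_ev_one_coaction (f : Coind P.der) :
    (Coind.ev P.der 1).rTensor A (P.coaction f) = Coalgebra.comul (Coind.evalOne P.der f) := by
  rw [rTensor_ev_coaction, map_one, Algebra.TensorProduct.one_def, twistedComul_tmul,
    HopfAlgebra.antipode_one, ← Algebra.TensorProduct.one_def, mul_one]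
  rfl

theorem coaction_counit (f : Coind P.der) : TensorProduct.rid k (Coind P.der)
    ((Coalgebra.counit (R := k) (A := A)).lTensor (Coind P.der) (P.coaction f)) = f := by
  refine Coind.ext fun u => ?_
  have e1 : ∀ t : Coind P.der ⊗[k] A, Coind.ev P.der u (TensorProduct.rid k (Coind P.der)
      ((Coalgebra.counit (R := k) (A := A)).lTensor (Coind P.der) t)) =
      TensorProduct.rid k A ((Coalgebra.counit (R := k) (A := A)).lTensor A
        ((Coind.ev P.der u).rTensor A t)) := by
    intro t
    induction t using TensorProduct.induction_on with
    | zero => simp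
    | add s t hs ht => simp only [map_add, hs, ht]
    | tmul y b => simp
  have e2 : ∀ t : Env k 𝓖 ⊗[k] A, TensorProduct.rid k A
      ((Coalgebra.counit (R := k) (A := A)).lTensor A (twistedComul (Coind.toLin P.der f) t)) =
      Coind.toLin P.der f (TensorProduct.rid k (Env k 𝓖)
        ((Coalgebra.counit (R := k) (A := A)).lTensor (Env k 𝓖) t)) := by
    intro t
    induction t using TensorProduct.induction_on with
    | zero => simp
    | add s t hs ht => simp only [map_add, hs, ht]
    | tmul x a =>
      rw [twistedComul_tmul, LinearMap.lTensor_tmul, TensorProduct.rid_tmul, map_smul]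
      have h := Coalgebra.lTensor_counit_comul (R := k) (Coind.toLin P.der f x)
      have h' := congrArg (TensorProduct.rid k A) h
      rw [TensorProduct.rid_tmul, one_smul] at h'
      refine Eq.trans ?_ (congrArg (Coalgebra.counit (R := k) a • ·) h')
      generalize Coalgebra.comul (R := k) (Coind.toLin P.der f x) = t
      induction t using TensorProduct.induction_on with
      | zero => simp
      | add s t hs ht => simp only [map_add, add_mul, smul_add, hs, ht]
      | tmul y b => simp [smul_smul, mul_comm]
  refine (e1 _).trans ?_
  rw [rTensor_ev_coaction, e2, coactEnv_counit]

theorem coaction_one : P.coaction 1 = 1 :=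
  Coind.eq_of_rTensor_ev fun u => by
    rw [rTensor_ev_coaction, Algebra.TensorProduct.one_def, LinearMap.rTensor_tmul]
    have e : ∀ t : Env k 𝓖 ⊗[k] A, twistedComul (Coind.toLin P.der 1) t =
        1 ⊗ₜ HopfAlgebra.antipode k (TensorProduct.lid k A
          ((Env.counit k 𝓖).toLinearMap.rTensor A t)) := by
      intro t
      induction t using TensorProduct.induction_on with
      | zero => simp
      | add s t hs ht => simp only [map_add, TensorProduct.tmul_add, hs, ht]
      | tmul x a =>
        rw [twistedComul_tmul, Coind.toLin_one]
        simp [convOne, Algebra.algebraMap_eq_smul_one, Algebra.TensorProduct.one_def]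
    rw [e, coactEnv_env_counit]
    show _ = algebraMap k A (Env.counit k 𝓖 u) ⊗ₜ 1
    rw [Algebra.algebraMap_eq_smul_one, map_smul, HopfAlgebra.antipode_one,
      TensorProduct.tmul_smul, TensorProduct.smul_tmul']

end HarishChandraPair

end SHCP

end

noncomputable section

namespace SHCP

/-! ### Coassociativity and multiplicativity of the coaction -/

namespace HarishChandraPair

variable {k A 𝔤 : Type u} [Field k] [CharZero k] [AddCommGroup 𝔤] [Module k 𝔤]
  [CommRing A] [HopfAlgebra k A]
  {𝓖 : ZMod 2 → Submodule k 𝔤} [DirectSum.Decomposition 𝓖] [LieSuperalgebra k 𝓖]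

theorem lTensor_comul_mul (s t : A ⊗[k] A) :
    (Coalgebra.comul (R := k) (A := A)).lTensor A (s * t) =
      (Coalgebra.comul (R := k) (A := A)).lTensor A s *
        (Coalgebra.comul (R := k) (A := A)).lTensor A t :=
  map_mul (Algebra.TensorProduct.map (AlgHom.id k A) (Bialgebra.comulAlgHom k A)) s t

/-- The map `y ⊗ (b ⊗ a) ↦ Δ²(f(y)) (1 ⊗ S(a) ⊗ S(b))`. -/
def twistedComul₂ (f : Env k 𝓖 →ₗ[k] A) : Env k 𝓖 ⊗[k] (A ⊗[k] A) →ₗ[k] A ⊗[k] (A ⊗[k] A) :=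
  LinearMap.mul' k (A ⊗[k] (A ⊗[k] A)) ∘ₗ TensorProduct.map
    ((Coalgebra.comul (R := k) (A := A)).lTensor A ∘ₗ Coalgebra.comul ∘ₗ f)
    (Algebra.TensorProduct.includeRight.toLinearMap ∘ₗ
      TensorProduct.map (HopfAlgebra.antipode k) (HopfAlgebra.antipode k) ∘ₗ
        (TensorProduct.comm k A A).toLinearMap)

theorem twistedComul₂_tmul (f : Env k 𝓖 →ₗ[k] A) (y : Env k 𝓖) (t : A ⊗[k] A) :
    twistedComul₂ f (y ⊗ₜ t) =
      (Coalgebra.comul (R := k) (A := A)).lTensor A (Coalgebra.comul (f y)) *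
        (1 ⊗ₜ[k] (TensorProduct.map (HopfAlgebra.antipode k) (HopfAlgebra.antipode k)
          (TensorProduct.comm k A A t))) := rfl

theorem lTensor_comul_twistedComul (f : Env k 𝓖 →ₗ[k] A) (t : Env k 𝓖 ⊗[k] A) :
    (Coalgebra.comul (R := k) (A := A)).lTensor A (twistedComul f t) =
      twistedComul₂ f ((Coalgebra.comul (R := k) (A := A)).lTensor (Env k 𝓖) t) := by
  induction t using TensorProduct.induction_on with
  | zero => simp
  | add s t hs ht => simp only [map_add, hs, ht]
  | tmul x a =>
    rw [twistedComul_tmul, lTensor_comul_mul, LinearMap.lTensor_tmul, LinearMap.lTensor_tmul,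
      comul_antipode, twistedComul₂_tmul]

variable (P : HarishChandraPair k A 𝓖) [FiniteDimensional k 𝔤]

/-- After evaluation at `u`, both sides send (g, h, l) to f((hl)⁻¹.u)(ghl). The inputs are
coassociativity of the action on U(𝔤) and the reversal of factors by the antipode. -/
theorem coaction_coassoc (f : Coind P.der) :
    TensorProduct.assoc k (Coind P.der) A A (P.coaction.rTensor A (P.coaction f)) =
      (Coalgebra.comul (R := k) (A := A)).lTensor (Coind P.der) (P.coaction f) := by
  refine Coind.eq_of_rTensor_ev fun u => ?_
  have e1 : ∀ s : Coind P.der ⊗[k] A, (Coind.ev P.der u).rTensor (A ⊗[k] A)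
      ((Coalgebra.comul (R := k) (A := A)).lTensor (Coind P.der) s) =
      (Coalgebra.comul (R := k) (A := A)).lTensor A ((Coind.ev P.der u).rTensor A s) := by
    intro s
    induction s using TensorProduct.induction_on with
    | zero => simp
    | add s t hs ht => simp only [map_add, hs, ht]
    | tmul y b => simp
  rw [e1, rTensor_ev_coaction, lTensor_comul_twistedComul, ← coactEnv_coassoc]
  have e2 : ∀ s : Coind P.der ⊗[k] A, (Coind.ev P.der u).rTensor (A ⊗[k] A)
      (TensorProduct.assoc k (Coind P.der) A A (P.coaction.rTensor A s)) =
      TensorProduct.assoc k A A A (((Coind.ev P.der u).rTensor A ∘ₗ P.coaction).rTensor A s) := by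
    intro s
    induction s using TensorProduct.induction_on with
    | zero => simp
    | add s t hs ht => simp only [map_add, hs, ht]
    | tmul y b =>
      rw [LinearMap.rTensor_tmul, LinearMap.rTensor_tmul, LinearMap.comp_apply]
      generalize P.coaction y = s
      induction s using TensorProduct.induction_on with
      | zero => simp
      | add s t hs ht => simp only [map_add, TensorProduct.add_tmul, hs, ht]
      | tmul y b => simp
  have e3 : ((Coind.ev P.der u).rTensor A ∘ₗ P.coaction) =
    (LinearMap.applyₗ (P.coactEnv u) ∘ₗ twistedComul ∘ₗ Coind.toLin P.der) :=
    LinearMap.ext fun g => P.rTensor_ev_coaction g u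
  rw [e2, e3]
  generalize P.coactEnv u = t
  induction t using TensorProduct.induction_on with
  | zero =>
    rw [map_zero, LinearMap.zero_comp, LinearMap.rTensor_zero, LinearMap.zero_apply, map_zero,
      map_zero, map_zero, map_zero]
  | add s t hs ht =>
    rw [map_add, LinearMap.add_comp, LinearMap.rTensor_add, LinearMap.add_apply, map_add, hs, ht,
      map_add, map_add, map_add]
  | tmul x a =>
    have e4 : ∀ s : Coind P.der ⊗[k] A, (LinearMap.applyₗ (x ⊗ₜ[k] a) ∘ₗ twistedComul ∘ₗ
        Coind.toLin P.der).rTensor A s = (Coalgebra.comul (R := k) (A := A)).rTensor A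
          ((Coind.ev P.der x).rTensor A s) * ((1 ⊗ₜ HopfAlgebra.antipode k a) ⊗ₜ 1) := by
      intro s
      induction s using TensorProduct.induction_on with
      | zero => simp
      | add s t hs ht => simp only [map_add, add_mul, hs, ht]
      | tmul g b =>
        rw [LinearMap.rTensor_tmul, LinearMap.rTensor_tmul, LinearMap.rTensor_tmul,
          Algebra.TensorProduct.tmul_mul_tmul, mul_one]
        rfl
    rw [e4, rTensor_ev_coaction, LinearMap.rTensor_tmul, AlgHom.toLinearMap_apply]
    generalize P.coactEnv x = r
    induction r using TensorProduct.induction_on with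
    | zero => simp
    | add s t hs ht => simp only [map_add, add_mul, TensorProduct.add_tmul, hs, ht]
    | tmul y b =>
      rw [twistedComul_tmul, rTensor_mul_one_tmul, TensorProduct.assoc_tmul, twistedComul₂_tmul,
        ← Coalgebra.coassoc_apply, TensorProduct.comm_tmul, TensorProduct.map_tmul]
      generalize (Coalgebra.comul (R := k) (A := A)).rTensor A
        (Coalgebra.comul (Coind.toLin P.der f y)) = q
      have h := map_mul (Algebra.TensorProduct.assoc k k k A A A)
      refine (h _ _).trans ?_
      rw [h, mul_assoc]
      refine congrArg (_ * ·) ?_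
      rw [Algebra.TensorProduct.one_def, Algebra.TensorProduct.assoc_tmul,
        Algebra.TensorProduct.assoc_tmul,
        Algebra.TensorProduct.tmul_mul_tmul, Algebra.TensorProduct.tmul_mul_tmul, one_mul, one_mul,
        mul_one]

/-- Companion of `coactEnv_comm`, for the derivative of (exp(tz) h).u: the bracket with `z` is taken
after the action, and a right invariant field appears. -/
theorem rTensor_comm_coactEnv (z : EvenLie k 𝓖) (u : Env k 𝓖) :
    (LinearMap.mulLeft k (Env.ι k 𝓖 (EvenLie.incl k 𝓖 z)) -
      LinearMap.mulRight k (Env.ι k 𝓖 (EvenLie.incl k 𝓖 z))).rTensor A (P.coactEnv u) =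
    (WithConv.toConv (Algebra.linearMap k A ∘ₗ tangentVector (P.lieEquiv z)) *
      WithConv.toConv LinearMap.id).ofConv.lTensor (Env k 𝓖) (P.coactEnv u) := by
  have e1 : ∀ t : Env k 𝓖 ⊗[k] A, (LinearMap.mulLeft k (Env.ι k 𝓖 (EvenLie.incl k 𝓖 z)) -
      LinearMap.mulRight k (Env.ι k 𝓖 (EvenLie.incl k 𝓖 z))).rTensor A t =
      TensorProduct.map (LinearMap.id : Env k 𝓖 →ₗ[k] Env k 𝓖) ((TensorProduct.lid k A).toLinearMap ∘ₗ
        (tangentVector (k := k) (A := A) (P.lieEquiv z)).rTensor A)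
          (TensorProduct.assoc k (Env k 𝓖) A A (P.coactEnv.toLinearMap.rTensor A t)) := by
    intro t
    induction t using TensorProduct.induction_on with
    | zero => simp
    | add s t hs ht => simp only [map_add, hs, ht]
    | tmul y b =>
      rw [LinearMap.rTensor_tmul, LinearMap.rTensor_tmul, LinearMap.sub_apply,
        LinearMap.mulLeft_apply, LinearMap.mulRight_apply, ← P.coactEnv_differential,
        AlgHom.toLinearMap_apply]
      generalize P.coactEnv y = s
      induction s using TensorProduct.induction_on with
      | zero => simp
      | add s t hs ht => simp only [map_add, TensorProduct.add_tmul, hs, ht]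
      | tmul y b => simp [TensorProduct.smul_tmul]
  rw [e1, coactEnv_coassoc]
  refine (LinearMap.lTensor_comp_apply (Env k 𝓖) _ _ _).symm.trans ?_
  congr 2
  refine LinearMap.ext fun a => ?_
  show _ = LinearMap.mul' k A (TensorProduct.map _ _ (Coalgebra.comul a))
  rw [LinearMap.comp_apply]
  generalize Coalgebra.comul (R := k) a = t
  induction t using TensorProduct.induction_on with
  | zero => simp
  | tmul a b => simp [Algebra.smul_def]
  | add a b ha hb => simp only [map_add, ha, hb]

/-- Differentiate f(h⁻¹.u)(gh) in `h` along `z`: the base point contributes f(z(h⁻¹.u)) and the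
action -f([z, h⁻¹.u]), and the sum is f((h⁻¹.u)z). -/
theorem coaction_translate_even (z : EvenLie k 𝓖) (f : Coind P.der) :
    P.coaction (Coind.translate P.der (Env.ι k 𝓖 (EvenLie.incl k 𝓖 z)) f) =
      (P.der z : A →ₗ[k] A).lTensor (Coind P.der) (P.coaction f) := by
  refine Coind.eq_of_rTensor_ev fun u => ?_
  have e1 : ∀ s : Coind P.der ⊗[k] A, (Coind.ev P.der u).rTensor A
      ((P.der z : A →ₗ[k] A).lTensor (Coind P.der) s) =
      (P.der z : A →ₗ[k] A).lTensor A ((Coind.ev P.der u).rTensor A s) := by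
    intro s
    induction s using TensorProduct.induction_on with
    | zero => simp
    | add s t hs ht => simp only [map_add, hs, ht]
    | tmul y b => simp
  rw [e1, rTensor_ev_coaction, rTensor_ev_coaction]
  have h := congrArg (twistedComul (Coind.toLin P.der f)) (P.rTensor_comm_coactEnv z u)
  -- Leibniz rule for Δ(f(x))(1 ⊗ S(a)), together with zx = xz + [z, x]. The last two terms cancel
  -- only once `t` is in the image of the action map.
  have e2 : ∀ t : Env k 𝓖 ⊗[k] A,
      (P.der z : A →ₗ[k] A).lTensor A (twistedComul (Coind.toLin P.der f) t) =
        twistedComul (Coind.toLin P.der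
          (Coind.translate P.der (Env.ι k 𝓖 (EvenLie.incl k 𝓖 z)) f)) t +
        twistedComul (Coind.toLin P.der f)
          ((LinearMap.mulLeft k (Env.ι k 𝓖 (EvenLie.incl k 𝓖 z)) -
            LinearMap.mulRight k (Env.ι k 𝓖 (EvenLie.incl k 𝓖 z))).rTensor A t) -
        twistedComul (Coind.toLin P.der f)
          ((WithConv.toConv (Algebra.linearMap k A ∘ₗ tangentVector (P.lieEquiv z)) *
            WithConv.toConv LinearMap.id).ofConv.lTensor (Env k 𝓖) t) := by
    intro t
    induction t using TensorProduct.induction_on with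
    | zero => simp
    | add s t hs ht => simp only [map_add, hs, ht]; abel
    | tmul x a =>
      rw [LinearMap.rTensor_tmul, LinearMap.lTensor_tmul, twistedComul_tmul, twistedComul_tmul,
        twistedComul_tmul, twistedComul_tmul, LinearMap.sub_apply, LinearMap.mulLeft_apply,
        LinearMap.mulRight_apply, map_sub, map_sub, sub_mul, Coind.translate_apply,
        add_sub_cancel, Coind.even_of_ι]
      have h1 : HopfAlgebra.antipode k
          ((WithConv.toConv (Algebra.linearMap k A ∘ₗ tangentVector (P.lieEquiv z)) *
            WithConv.toConv LinearMap.id).ofConv a) = -P.der z (HopfAlgebra.antipode k a) := by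
        rw [show P.der z (HopfAlgebra.antipode k a) = _ from groupLie_antipode (P.lieEquiv z) a,
          neg_neg]
        show HopfAlgebra.antipode k (LinearMap.mul' k A (TensorProduct.map _ _ (Coalgebra.comul a)))
          = LinearMap.mul' k A (TensorProduct.map _ _ (Coalgebra.comul a))
        generalize Coalgebra.comul (R := k) a = t
        induction t using TensorProduct.induction_on with
        | zero => simp
        | tmul a b =>
          simp [HopfAlgebra.antipode_mul_distrib,
            show ∀ c, HopfAlgebra.antipode k (algebraMap k A c) = algebraMap k A c from
              (HopfAlgebra.antipodeAlgHom k A).commutes]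
        | add a b ha hb => simp only [map_add, ha, hb]
      rw [h1, show Coalgebra.comul (R := k) (P.der z (Coind.toLin P.der f x)) = _ from
        (P.lieEquiv z).2 _, TensorProduct.tmul_neg, mul_neg, sub_neg_eq_add]
      show _ = (P.der z : A →ₗ[k] A).lTensor A _ * _ + _
      generalize Coalgebra.comul (R := k) (Coind.toLin P.der f x) = t
      induction t using TensorProduct.induction_on with
      | zero => simp
      | tmul b c => simp [TensorProduct.tmul_add, mul_comm, add_comm]
      | add a b ha hb => simp only [map_add, add_mul, ha, hb]; abel
  rw [e2, h, add_sub_cancel_right]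

variable (k) in
/-- The action of `U(𝔤)` on the first factor of `Hom_{U(𝔤₀)} (U(𝔤), A) ⊗ W`. -/
abbrev translateLeft (W : Type u) [AddCommGroup W] [Module k W] :
    Env k 𝓖 →ₐ[k] Module.End k (Coind P.der ⊗[k] W) :=
  (Module.End.rTensorAlgHom k (Coind P.der) W).comp (Coind.translate P.der)

/-- Vanishing principle for the defect of multiplicativity. Translations are superderivations and
differentiate λ with coefficients from the second factor, so they map a defect to a combination of
defects; at 1 the claim is multiplicativity of Δ on `A`. -/
theorem coaction_mul (f g : Coind P.der) : P.coaction (f * g) = P.coaction f * P.coaction g := by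
  let e : Coind P.der ⊗[k] A →ₐ[k] A ⊗[k] A :=
    Algebra.TensorProduct.map (Coind.evalOne P.der) (AlgHom.id k A)
  have he : e.toLinearMap = (Coind.ev P.der 1).rTensor A := rfl
  refine sub_eq_zero.1 (Coind.eq_zero_of_invariant (P.translateLeft k A) e.toLinearMap
    (fun t ht => ?_)
    (fun x : Coind P.der × Coind P.der => P.coaction (x.1 * x.2) - P.coaction x.1 * P.coaction x.2)
    (fun {i v} hv x => ?_) (fun x => ?_) (f, g))
  · refine Coind.eq_of_rTensor_ev fun u => ?_
    rw [map_zero]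
    refine Eq.trans ?_ (ht u)
    rw [he]
    refine Eq.trans ?_ (LinearMap.rTensor_comp_apply A _ _ _)
    show _ = (Coind.ev P.der (1 * u)).rTensor A t
    rw [one_mul]
  · obtain ⟨f, g⟩ := x
    dsimp only
    show (Coind.translate P.der (Env.ι k 𝓖 v)).rTensor A _ ∈ _
    have hd : ∀ s t : Coind P.der ⊗[k] A,
        (Coind.translate P.der (Env.ι k 𝓖 v)).rTensor A (s * t) =
          (Coind.translate P.der (Env.ι k 𝓖 v)).rTensor A s * t +
          (Coind.parityPow P.der i).toLinearMap.rTensor A s *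
            (Coind.translate P.der (Env.ι k 𝓖 v)).rTensor A t := by
      intro s t
      induction s using TensorProduct.induction_on with
      | zero => simp
      | add s s' hs ht => simp only [map_add, add_mul, hs, ht]; abel
      | tmul x a =>
        induction t using TensorProduct.induction_on with
        | zero => simp
        | add s s' hs ht => simp only [map_add, mul_add, hs, ht]; abel
        | tmul y b =>
          simp only [Algebra.TensorProduct.tmul_mul_tmul, LinearMap.rTensor_tmul,
            Coind.translate_mul hv, TensorProduct.add_tmul, AlgHom.toLinearMap_apply]
    rw [map_sub, hd, rTensor_translate_coaction, rTensor_translate_coaction,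
      rTensor_translate_coaction, ← coaction_parityPow, coactEnv_ι]
    obtain ⟨c, hc⟩ := P.coact_mem i v hv
    rw [← hc]
    clear hc
    induction c using TensorProduct.induction_on with
    | zero => simp
    | add s t hs ht =>
      simp only [map_add, add_mul, mul_add]
      convert Submodule.add_mem _ hs ht using 1
      abel
    | tmul y b =>
      rw [LinearMap.rTensor_tmul, LinearMap.rTensor_tmul, twist_tmul, twist_tmul, twist_tmul,
        show (𝓖 i).subtype y = (y : 𝔤) from rfl, Coind.translate_mul y.2]
      set f' := Coind.translate P.der (Env.ι k 𝓖 y) f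
      set g' := Coind.translate P.der (Env.ι k 𝓖 y) g
      let κ : Module.End k (Coind P.der ⊗[k] A) :=
        LinearMap.mulRight k (1 ⊗ₜ HopfAlgebra.antipode k b)
      have hκ : Coind.Preserves (P.translateLeft k A) e.toLinearMap κ := by
        refine ⟨fun u t => ?_, fun t ht => ?_⟩
        · exact (rTensor_mul_one_tmul _ _ _).symm
        · show e (t * _) = 0
          rw [map_mul, show e t = 0 from ht, zero_mul]
      -- The coefficient S(b) lies in the commutative even factor, so it can be moved to the far
      -- right and taken as the operator κ.
      have hcomm : ∀ t : Coind P.der ⊗[k] A, (1 ⊗ₜ[k] HopfAlgebra.antipode k b) * t =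
          t * (1 ⊗ₜ[k] HopfAlgebra.antipode k b) := by
        intro t
        induction t using TensorProduct.induction_on with
        | zero => simp
        | add s t hs ht => simp only [mul_add, add_mul, hs, ht]
        | tmul y b => simp [mul_comm]
      have e1 : κ (P.coaction (f' * g) - P.coaction f' * P.coaction g) +
          κ (P.coaction (Coind.parityPow P.der i f * g') -
            P.coaction (Coind.parityPow P.der i f) * P.coaction g') ∈
          Submodule.span k {t | ∃ κ, ∃ y : Coind P.der × Coind P.der,
            Coind.Preserves (P.translateLeft k A) e.toLinearMap κ ∧
              t = κ (P.coaction (y.1 * y.2) - P.coaction y.1 * P.coaction y.2)} :=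
        add_mem (Submodule.subset_span ⟨κ, (f', g), hκ, rfl⟩)
          (Submodule.subset_span ⟨κ, (Coind.parityPow P.der i f, g'), hκ, rfl⟩)
      convert e1 using 1
      simp only [κ, LinearMap.mulRight_apply, map_add]
      rw [mul_assoc (P.coaction f'), hcomm]
      simp only [sub_mul, add_mul, mul_assoc]
      abel
  · show e (P.coaction (x.1 * x.2) - P.coaction x.1 * P.coaction x.2) = 0
    have h1 : ∀ f, e (P.coaction f) = Coalgebra.comul (Coind.evalOne P.der f) :=
      P.rTensor_ev_one_coaction
    rw [map_sub, map_mul e, h1, h1, h1, map_mul, Bialgebra.comul_mul, sub_self]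

end HarishChandraPair

end SHCP

end

noncomputable section

namespace SHCP

/-! ### The comultiplication and counit of 𝒪(G) -/

section

variable {k 𝔤 : Type u} [Field k] [CharZero k] [AddCommGroup 𝔤] [Module k 𝔤]
  {𝓖 : ZMod 2 → Submodule k 𝔤} [DirectSum.Decomposition 𝓖] [LieSuperalgebra k 𝓖]
  {B : Type u} [CommRing B] [Algebra k B] {θ : EvenLie k 𝓖 →ₗ⁅k⁆ Derivation k B B}
  {W : Type u} [AddCommGroup W] [Module k W]

theorem Env.proj_of_mem {j : ZMod 2} {u : Env k 𝓖} (hu : u ∈ envGrading k 𝓖 j) (i : ZMod 2) :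
    Env.proj i u = if i = j then u else 0 := by
  have h : Env.parity k 𝓖 u = ((-1 : ℤˣ) ^ j) • u := hu
  rw [Env.proj, parityProj_apply, AlgHom.toLinearMap_apply, h, smul_smul, ← uzpow_add]
  split_ifs with hij
  · rw [hij, CharTwo.add_self_eq_zero, uzpow_zero, one_smul, ← two_smul k u, smul_smul,
      inv_mul_cancel₀ two_ne_zero, one_smul]
  · have : i + j = 1 := by clear * - hij; revert i j; decide
    rw [this, uzpow_one, Units.neg_smul, one_smul, add_neg_cancel, smul_zero]

theorem Env.one_mem : (1 : Env k 𝓖) ∈ envGrading k 𝓖 0 :=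
  SetLike.GradedOne.one_mem (A := envGrading k 𝓖)

namespace Coind

theorem eq_of_lTensor_ev_of_mem {s t : W ⊗[k] Coind θ}
    (h : ∀ (j : ZMod 2) (u : Env k 𝓖), u ∈ envGrading k 𝓖 j →
      (ev θ u).lTensor W s = (ev θ u).lTensor W t) : s = t :=
  eq_of_lTensor_ev fun u => by
    rw [← Env.sum_proj u, ev_add, LinearMap.lTensor_add, LinearMap.add_apply, LinearMap.add_apply,
      h 0 _ (Env.proj_mem 0 u), h 1 _ (Env.proj_mem 1 u)]

theorem parityPow_parityPow (i j : ZMod 2) (f : Coind θ) :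
    parityPow θ i (parityPow θ j f) = parityPow θ (i + j) f :=
  ext fun u => by
    rw [parityPow_apply, parityPow_apply, parityPow_apply, Env.parityPow_parityPow, add_comm j i]

theorem parityPow_zero : parityPow θ 0 = AlgHom.id k (Coind θ) := if_pos rfl

theorem ev_comp_parityPow (u : Env k 𝓖) (i : ZMod 2) :
    ev θ u ∘ₗ (parityPow θ i).toLinearMap = ev θ (Env.parityPow k 𝓖 i u) :=
  LinearMap.ext fun f => parityPow_apply i f u

theorem parityPow_comp (i j : ZMod 2) :
    (parityPow θ i).toLinearMap ∘ₗ (parityPow θ j).toLinearMap = (parityPow θ (i + j)).toLinearMap :=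
  LinearMap.ext fun f => parityPow_parityPow i j f

theorem parityPow_comp_self (i : ZMod 2) :
    (parityPow θ i).toLinearMap ∘ₗ (parityPow θ i).toLinearMap = LinearMap.id := by
  rw [parityPow_comp, CharTwo.add_self_eq_zero, parityPow_zero]
  rfl

theorem translate_one_fun (u : Env k 𝓖) : translate θ u 1 = Env.counit k 𝓖 u • (1 : Coind θ) :=
  ext fun w => by
    rw [translate_apply, map_smul, LinearMap.smul_apply, toLin_one]
    simp [convOne, Algebra.smul_def, mul_comm]

end Coind

end

namespace HarishChandraPair

variable {k A 𝔤 : Type u} [Field k] [CharZero k] [AddCommGroup 𝔤] [Module k 𝔤]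
  [CommRing A] [HopfAlgebra k A]
  {𝓖 : ZMod 2 → Submodule k 𝔤} [DirectSum.Decomposition 𝓖] [LieSuperalgebra k 𝓖]
  (P : HarishChandraPair k A 𝓖) [FiniteDimensional k 𝔤]

/-- The map `Y ↦ (P ^ |Y| ⊗ 1) λ(f (· Y))`. -/
def comulAux : Coind P.der →ₗ[k] Env k 𝓖 →ₗ[k] Coind P.der ⊗[k] A :=
  ∑ i : ZMod 2, ((Coind.translate P.der).toLinearMap.flip.compr₂
    ((Coind.parityPow P.der i).toLinearMap.rTensor A ∘ₗ P.coaction)).compl₂ (Env.proj i)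

theorem comulAux_apply (f : Coind P.der) (u : Env k 𝓖) : P.comulAux f u =
    ∑ i : ZMod 2, (Coind.parityPow P.der i).toLinearMap.rTensor A
      (P.coaction (Coind.translate P.der (Env.proj i u) f)) := by
  simp only [comulAux, LinearMap.sum_apply]
  rfl

/-- Linearity over 𝔤₀ in the second variable is the formula for λ of an even translate; the parity
twist acts on the other factor and commutes with it. -/
theorem exists_comul : ∃ L : Coind P.der →ₗ[k] Coind P.der ⊗[k] Coind P.der, ∀ f u,
    (Coind.ev P.der u).lTensor (Coind P.der) (L f) = P.comulAux f u :=
  Coind.exists_linear_lTensor_ev P.comulAux fun f z u => by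
    rw [comulAux_apply, comulAux_apply, map_sum]
    refine Finset.sum_congr rfl fun i _ => ?_
    rw [proj_zero_mul (EvenLie.incl_mem k 𝓖 z), map_mul, Module.End.mul_apply,
      coaction_translate_even]
    generalize P.coaction _ = t
    rw [← LinearMap.comp_apply, ← LinearMap.comp_apply, LinearMap.rTensor_comp_lTensor,
      LinearMap.lTensor_comp_rTensor]

/-- The comultiplication of `𝒪(G)`. -/
def comul : Coind P.der →ₗ[k] Coind P.der ⊗[k] Coind P.der := P.exists_comul.choose

theorem lTensor_ev_comul {j : ZMod 2} {u : Env k 𝓖} (hu : u ∈ envGrading k 𝓖 j)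
    (f : Coind P.der) : (Coind.ev P.der u).lTensor (Coind P.der) (P.comul f) =
      (Coind.parityPow P.der j).toLinearMap.rTensor A
        (P.coaction (Coind.translate P.der u f)) := by
  rw [show (Coind.ev P.der u).lTensor (Coind P.der) (P.comul f) = _ from
    P.exists_comul.choose_spec f u, comulAux_apply, Finset.sum_eq_single j]
  · rw [Env.proj_of_mem hu, if_pos rfl]
  · intro i _ hi
    rw [Env.proj_of_mem hu, if_neg hi, map_zero, LinearMap.zero_apply, map_zero, map_zero]
  · simp

theorem lTensor_ev_one_comul (f : Coind P.der) :
    (Coind.ev P.der 1).lTensor (Coind P.der) (P.comul f) = P.coaction f := by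
  rw [P.lTensor_ev_comul Env.one_mem, map_one, Module.End.one_apply, Coind.parityPow_zero]
  exact LinearMap.congr_fun (LinearMap.rTensor_id A (Coind P.der)) _

/-- Evaluating the second factor at `u` and at uv differs in parity by `i`, which the twist by P^i
compensates. So μ intertwines translations with the Koszul-signed action on the second factor. -/
theorem comul_translate {i : ZMod 2} {v : 𝔤} (hv : v ∈ 𝓖 i) (f : Coind P.der) :
    TensorProduct.map (Coind.parityPow P.der i).toLinearMap
      (Coind.translate P.der (Env.ι k 𝓖 v)) (P.comul f) =
    P.comul (Coind.translate P.der (Env.ι k 𝓖 v) f) := by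
  refine Coind.eq_of_lTensor_ev_of_mem fun j u hu => ?_
  rw [P.lTensor_ev_comul hu, ← LinearMap.comp_apply (LinearMap.lTensor _ _),
    LinearMap.lTensor_comp_map, Coind.ev_comp_translate, ← LinearMap.rTensor_comp_lTensor,
    LinearMap.comp_apply,
    P.lTensor_ev_comul (SetLike.mul_mem_graded hu (Env.ι_mem hv)), ← LinearMap.rTensor_comp_apply,
    Coind.parityPow_comp, add_comm j i, ← add_assoc, CharTwo.add_self_eq_zero, zero_add, map_mul]
  rfl

theorem lTensor_translate_comul {i : ZMod 2} {v : 𝔤} (hv : v ∈ 𝓖 i) (f : Coind P.der) :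
    (Coind.translate P.der (Env.ι k 𝓖 v)).lTensor (Coind P.der) (P.comul f) =
      (Coind.parityPow P.der i).toLinearMap.rTensor (Coind P.der)
        (P.comul (Coind.translate P.der (Env.ι k 𝓖 v) f)) := by
  rw [← P.comul_translate hv, ← LinearMap.comp_apply (LinearMap.rTensor _ _),
    LinearMap.rTensor_comp_map,
    Coind.parityPow_comp_self]
  rfl

theorem comul_parityPow (i : ZMod 2) (f : Coind P.der) :
    TensorProduct.map (Coind.parityPow P.der i).toLinearMap (Coind.parityPow P.der i).toLinearMap
      (P.comul f) = P.comul (Coind.parityPow P.der i f) := by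
  refine Coind.eq_of_lTensor_ev_of_mem fun j u hu => ?_
  rw [P.lTensor_ev_comul hu, ← LinearMap.comp_apply (LinearMap.lTensor _ _),
    LinearMap.lTensor_comp_map, Coind.ev_comp_parityPow, ← LinearMap.rTensor_comp_lTensor,
    LinearMap.comp_apply, Coind.translate_parityPow, Env.parityPow_of_mem hu, coaction_parityPow,
    ← LinearMap.rTensor_comp_apply, Coind.parityPow_comp]
  simp only [Units.smul_def]
  rw [← Int.cast_smul_eq_zsmul k, Coind.ev_smul, map_smul (Coind.translate P.der),
    LinearMap.lTensor_smul, LinearMap.smul_apply, LinearMap.smul_apply, map_smul, map_smul,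
    map_smul, P.lTensor_ev_comul hu, ← LinearMap.rTensor_comp_apply, Coind.parityPow_comp,
    add_comm i j]

/-- The counit of `𝒪(G)`. -/
def counit : Coind P.der →ₐ[k] k := (Bialgebra.counitAlgHom k A).comp (Coind.evalOne P.der)

theorem counit_comp_parityPow (i : ZMod 2) :
    P.counit.toLinearMap ∘ₗ (Coind.parityPow P.der i).toLinearMap = P.counit.toLinearMap :=
  LinearMap.ext fun f => congrArg (Coalgebra.counit (R := k) (A := A)) (Coind.evalOne_parityPow i f)

theorem lTensor_counit_comul (f : Coind P.der) :
    P.counit.toLinearMap.lTensor (Coind P.der) (P.comul f) = f ⊗ₜ 1 := by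
  have h := P.coaction_counit f
  rw [← lTensor_ev_one_comul, ← LinearMap.lTensor_comp_apply] at h
  exact (TensorProduct.rid k (Coind P.der)).injective
    (h.trans (by rw [TensorProduct.rid_tmul, one_smul]))

theorem rTensor_counit_comul (f : Coind P.der) :
    P.counit.toLinearMap.rTensor (Coind P.der) (P.comul f) = 1 ⊗ₜ f := by
  refine Coind.eq_of_lTensor_ev_of_mem fun j u hu => ?_
  rw [← LinearMap.comp_apply, LinearMap.lTensor_comp_rTensor, ← LinearMap.rTensor_comp_lTensor,
    LinearMap.comp_apply, P.lTensor_ev_comul hu, ← LinearMap.rTensor_comp_apply,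
    counit_comp_parityPow]
  have h := P.rTensor_ev_one_coaction (Coind.translate P.der u f)
  have h' := congrArg ((Coalgebra.counit (R := k) (A := A)).rTensor A) h
  rw [← LinearMap.rTensor_comp_apply, Coalgebra.rTensor_counit_comul, Coind.evalOne_apply,
    Coind.translate_apply, one_mul] at h'
  exact h'

theorem comul_one : P.comul 1 = 1 ⊗ₜ 1 := by
  refine Coind.eq_of_lTensor_ev_of_mem fun j u hu => ?_
  rw [P.lTensor_ev_comul hu, Coind.translate_one_fun, map_smul, map_smul, coaction_one,
    Algebra.TensorProduct.one_def, LinearMap.rTensor_tmul, LinearMap.lTensor_tmul,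
    AlgHom.toLinearMap_apply, map_one, ← TensorProduct.tmul_smul, ← Algebra.algebraMap_eq_smul_one]
  rfl

/-- The twist P^|Y| built into μ and the Koszul sign of the evaluation on X ⊗ Y are the same
involution, so they cancel. This is the formula for μ* before evaluation at points of G₀. -/
theorem koszulHom_comul (f : Coind P.der) (X Y : Env k 𝓖) :
    koszulHom k 𝓖 (TensorProduct.map (Coind.toLin P.der) (Coind.toLin P.der) (P.comul f))
      (X ⊗ₜ Y) = twistedComul (Coind.toLin P.der (Coind.translate P.der Y f)) (P.coactEnv X) := by
  have e : ∀ t : Coind P.der ⊗[k] Coind P.der,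
      koszulHom k 𝓖 (TensorProduct.map (Coind.toLin P.der) (Coind.toLin P.der) t) (X ⊗ₜ Y) =
      ∑ i, (Coind.ev P.der (Env.parityPow k 𝓖 i X)).rTensor A
        ((Coind.ev P.der (Env.proj i Y)).lTensor (Coind P.der) t) := by
    intro t
    induction t using TensorProduct.induction_on with
    | zero => simp
    | add s t hs ht => simp only [map_add, LinearMap.add_apply, hs, ht, Finset.sum_add_distrib]
    | tmul f g =>
      show koszulMap (Coind.toLin P.der f) (Coind.toLin P.der g) (X ⊗ₜ Y) = _
      simp only [koszulMap, LinearMap.sum_apply]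
      rfl
  have h : ∀ i, (Coind.ev P.der (Env.parityPow k 𝓖 i X)).rTensor A
        ((Coind.ev P.der (Env.proj i Y)).lTensor (Coind P.der) (P.comul f)) =
      twistedComul (Coind.toLin P.der (Coind.translate P.der (Env.proj i Y) f)) (P.coactEnv X) := by
    intro i
    rw [P.lTensor_ev_comul (Env.proj_mem i Y), ← LinearMap.rTensor_comp_apply,
      Coind.ev_comp_parityPow, Env.parityPow_parityPow, CharTwo.add_self_eq_zero,
      Env.parityPow_zero]
    exact P.rTensor_ev_coaction _ X
  rw [e, zmod_two_sum, h, h, ← LinearMap.add_apply, ← map_add, ← map_add, ← LinearMap.add_apply,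
    ← map_add, Env.sum_proj]

theorem lift_koszulHom_comul {R : Type u} [CommRing R] [Algebra k R] (g h : A →ₐ[k] R)
    (f : Coind P.der) (X Y : Env k 𝓖) :
    Algebra.TensorProduct.lift g h (fun _ _ => Commute.all _ _)
      (koszulHom k 𝓖 (TensorProduct.map (Coind.toLin P.der) (Coind.toLin P.der) (P.comul f))
        (X ⊗ₜ[k] Y)) =
    evalAt (ptMul g h) (Coind.toLin P.der f) (P.act (ptInv h) X * Y ⊗ₜ[k] 1) := by
  rw [koszulHom_comul]
  show _ = evalAt (ptMul g h) (Coind.toLin P.der f)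
    (Algebra.TensorProduct.map (AlgHom.id k (Env k 𝓖)) (ptInv h) (P.coactEnv X) * Y ⊗ₜ[k] 1)
  generalize P.coactEnv X = t
  induction t using TensorProduct.induction_on with
  | zero => simp
  | add s t hs ht => simp only [map_add, add_mul, hs, ht]
  | tmul x a =>
    rw [twistedComul_tmul, map_mul, Algebra.TensorProduct.lift_tmul, map_one, one_mul,
      Algebra.TensorProduct.map_tmul, Algebra.TensorProduct.tmul_mul_tmul, mul_one]
    rfl

end HarishChandraPair

section

variable {k H : Type u} [Field k] [CharZero k] [Ring H] [Algebra k H] {𝓗 : ZMod 2 → Submodule k H}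
  [GradedAlgebra 𝓗]

/-- Eigenvectors of `P ⊗ P` are homogeneous. -/
theorem mem_iSup_range_of_map_eq {p : H →ₗ[k] H}
    (hp : ∀ {j : ZMod 2} {x : H}, x ∈ 𝓗 j → p x = ((-1 : ℤˣ) ^ j) • x) {i : ZMod 2} {t : H ⊗[k] H}
    (ht : TensorProduct.map p p t = ((-1 : ℤˣ) ^ i) • t) :
    t ∈ ⨆ j : ZMod 2, LinearMap.range (TensorProduct.map (𝓗 j).subtype (𝓗 (i - j)).subtype) := by
  -- This expression is twice the projection of `t` to total parity `i`; on an eigenvector it equals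
  -- 2t.
  have key : ∀ t : H ⊗[k] H, t + ((-1 : ℤˣ) ^ i) • TensorProduct.map p p t ∈
      ⨆ j : ZMod 2, LinearMap.range (TensorProduct.map (𝓗 j).subtype (𝓗 (i - j)).subtype) := by
    intro t
    induction t using TensorProduct.induction_on with
    | zero => simp
    | add s t hs ht =>
      convert Submodule.add_mem _ hs ht using 1
      rw [map_add, smul_add]; abel
    | tmul x y =>
      induction x using DirectSum.Decomposition.inductionOn 𝓗 with
      | zero => simp
      | add x x' hx hx' =>
        convert Submodule.add_mem _ hx hx' using 1
        rw [TensorProduct.add_tmul, map_add, smul_add]; abel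
      | @homogeneous a x =>
        induction y using DirectSum.Decomposition.inductionOn 𝓗 with
        | zero => simp
        | add x x' hx hx' =>
          convert Submodule.add_mem _ hx hx' using 1
          rw [TensorProduct.tmul_add, map_add, smul_add]; abel
        | @homogeneous b y =>
          have e : TensorProduct.map p p ((x : H) ⊗ₜ[k] (y : H)) =
              ((-1 : ℤˣ) ^ (a + b)) • ((x : H) ⊗ₜ[k] (y : H)) := by
            rw [TensorProduct.map_tmul, hp x.2, hp y.2]
            simp only [Units.smul_def, ← TensorProduct.smul_tmul', TensorProduct.tmul_smul,
              smul_smul, uzpow_add, Units.val_mul]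
            rw [mul_comm]
          rw [e, smul_smul, ← uzpow_add]
          by_cases hab : a + b = i
          · obtain rfl : b = i - a := by rw [← hab]; abel
            rw [hab, CharTwo.add_self_eq_zero, uzpow_zero, one_smul]
            have : (x : H) ⊗ₜ[k] (y : H) ∈ ⨆ j : ZMod 2, LinearMap.range
                (TensorProduct.map (𝓗 j).subtype (𝓗 (i - j)).subtype) :=
              Submodule.mem_iSup_of_mem a ⟨x ⊗ₜ y, rfl⟩
            exact add_mem this this
          · have : i + (a + b) = 1 := by clear * - hab; revert i a b; decide
            rw [this, uzpow_one, Units.neg_smul, one_smul, add_neg_cancel]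
            exact zero_mem _
  have h := key t
  rw [ht, smul_smul, ← uzpow_add, CharTwo.add_self_eq_zero, uzpow_zero, one_smul,
    ← two_smul k t] at h
  have h2 := Submodule.smul_mem _ (2⁻¹ : k) h
  rwa [smul_smul, inv_mul_cancel₀ two_ne_zero, one_smul] at h2

end

theorem HarishChandraPair.comul_mem {k A 𝔤 : Type u} [Field k] [CharZero k] [AddCommGroup 𝔤]
    [Module k 𝔤] [CommRing A] [HopfAlgebra k A] {𝓖 : ZMod 2 → Submodule k 𝔤}
    [DirectSum.Decomposition 𝓖] [LieSuperalgebra k 𝓖]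
    (P : HarishChandraPair k A 𝓖) [FiniteDimensional k 𝔤] {i : ZMod 2} {f : Coind P.der}
    (hf : f ∈ Coind.grading P.der i) : P.comul f ∈ ⨆ j : ZMod 2, LinearMap.range
      (TensorProduct.map (Coind.grading P.der j).subtype (Coind.grading P.der (i - j)).subtype) := by
  refine mem_iSup_range_of_map_eq (p := (Coind.parityPow P.der 1).toLinearMap) (fun {j x} hx => ?_) ?_
  · rw [AlgHom.toLinearMap_apply, Coind.parityPow_of_mem hx, one_mul]
  · rw [comul_parityPow, Coind.parityPow_of_mem hf, one_mul, Units.smul_def, map_zsmul]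
    rfl

end SHCP

end

noncomputable section

namespace SHCP

/-! ### Coassociativity and multiplicativity of the comultiplication -/

section

variable {k : Type u} [Field k] {M N L W N' L' W' : Type u} [AddCommGroup M] [Module k M]
  [AddCommGroup N] [Module k N] [AddCommGroup L] [Module k L] [AddCommGroup W] [Module k W]
  [AddCommGroup N'] [Module k N'] [AddCommGroup L'] [Module k L'] [AddCommGroup W'] [Module k W']

theorem map_map_assoc_rTensor (f : N →ₗ[k] N') (g : L →ₗ[k] L') (h : W →ₗ[k] W')
    (c : M →ₗ[k] N ⊗[k] L) (s : M ⊗[k] W) :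
    TensorProduct.map f (TensorProduct.map g h) (TensorProduct.assoc k N L W (c.rTensor W s)) =
      TensorProduct.assoc k N' L' W' (TensorProduct.map (TensorProduct.map f g ∘ₗ c) h s) := by
  induction s using TensorProduct.induction_on with
  | zero => simp
  | add s t hs ht => simp only [map_add, hs, ht]
  | tmul x y =>
    rw [LinearMap.rTensor_tmul, TensorProduct.map_tmul, LinearMap.comp_apply]
    generalize c x = r
    induction r using TensorProduct.induction_on with
    | zero => simp
    | add s t hs ht => simp only [map_add, TensorProduct.add_tmul, hs, ht]
    | tmul x y => simp

theorem map_lTensor_rTensor (f : N →ₗ[k] N') (g : L' →ₗ[k] W') (c : L →ₗ[k] L')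
    (s : N ⊗[k] L) : TensorProduct.map f g (c.lTensor N s) = g.lTensor N' (c.lTensor N' (f.rTensor L s)) := by
  induction s using TensorProduct.induction_on with
  | zero => simp
  | add s t hs ht => simp only [map_add, hs, ht]
  | tmul x y => simp

theorem mul_one_tmul_eq {H C : Type u} [Ring H] [Algebra k H] [CommRing C] [Algebra k C]
    (t : H ⊗[k] C) (c : C) : t * (1 ⊗ₜ c) = (LinearMap.mulRight k c).lTensor H t := by
  induction t using TensorProduct.induction_on with
  | zero => simp
  | add s t hs ht => simp only [map_add, add_mul, hs, ht]
  | tmul y b => simp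

end

section

variable {k H : Type u} [Field k] [Ring H] [Algebra k H] (𝓗 : ZMod 2 → Submodule k H)
  [GradedAlgebra 𝓗]

/-- The multiplication of the super tensor product `H ⊗ H`. -/
def superMul : H ⊗[k] H →ₗ[k] H ⊗[k] H →ₗ[k] H ⊗[k] H :=
  ((LinearMap.mul k (𝓗 ᵍ⊗[k] 𝓗)).compl₁₂ (GradedTensorProduct.of k 𝓗 𝓗).toLinearMap
    (GradedTensorProduct.of k 𝓗 𝓗).toLinearMap).compr₂
      (GradedTensorProduct.of k 𝓗 𝓗).symm.toLinearMap

theorem of_superMul (s t : H ⊗[k] H) : GradedTensorProduct.of k 𝓗 𝓗 (superMul 𝓗 s t) =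
    GradedTensorProduct.of k 𝓗 𝓗 s * GradedTensorProduct.of k 𝓗 𝓗 t :=
  LinearEquiv.apply_symm_apply _ _

theorem superMul_tmul_tmul (x : H) {i j : ZMod 2} {y x' : H} (hy : y ∈ 𝓗 j) (hx : x' ∈ 𝓗 i)
    (y' : H) : superMul 𝓗 (x ⊗ₜ y) (x' ⊗ₜ y') = ((-1 : ℤˣ) ^ (j * i)) • ((x * x') ⊗ₜ (y * y')) := by
  have h := GradedTensorProduct.tmul_coe_mul_coe_tmul (R := k) 𝓗 𝓗 x ⟨y, hy⟩ ⟨x', hx⟩ y'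
  refine (congrArg (GradedTensorProduct.of k 𝓗 𝓗).symm h).trans ?_
  rw [Units.smul_def, map_zsmul]
  rfl

theorem superTensor_induction {p : H ⊗[k] H → H ⊗[k] H → Prop} (zero_left : ∀ t, p 0 t)
    (zero_right : ∀ t, p t 0) (add_left : ∀ s s' t, p s t → p s' t → p (s + s') t)
    (add_right : ∀ s t t', p s t → p s t' → p s (t + t'))
    (tmul : ∀ (i j : ZMod 2) (x y x' y' : H), y ∈ 𝓗 j → x' ∈ 𝓗 i → p (x ⊗ₜ y) (x' ⊗ₜ y'))
    (s t : H ⊗[k] H) : p s t := by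
  induction s using TensorProduct.induction_on with
  | zero => exact zero_left t
  | add s s' hs hs' => exact add_left s s' t hs hs'
  | tmul x y =>
    induction t using TensorProduct.induction_on with
    | zero => exact zero_right _
    | add s s' hs hs' => exact add_right _ s s' hs hs'
    | tmul x' y' =>
      induction y using DirectSum.Decomposition.inductionOn 𝓗 with
      | zero => rw [TensorProduct.tmul_zero]; exact zero_left _
      | add y z hy hz => rw [TensorProduct.tmul_add]; exact add_left _ _ _ hy hz
      | @homogeneous j y =>
        induction x' using DirectSum.Decomposition.inductionOn 𝓗 with
        | zero => rw [TensorProduct.zero_tmul]; exact zero_right _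
        | add y z hy hz => rw [TensorProduct.add_tmul]; exact add_right _ _ _ hy hz
        | @homogeneous i x' => exact tmul i j x y x' y' y.2 x'.2

end

namespace HarishChandraPair

variable {k A 𝔤 : Type u} [Field k] [CharZero k] [AddCommGroup 𝔤] [Module k 𝔤]
  [CommRing A] [HopfAlgebra k A]
  {𝓖 : ZMod 2 → Submodule k 𝔤} [DirectSum.Decomposition 𝓖] [LieSuperalgebra k 𝓖]
  (P : HarishChandraPair k A 𝓖)

variable (k) in
/-- The action of `U(𝔤)` on the second factor of `W ⊗ Hom_{U(𝔤₀)} (U(𝔤), A)`. -/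
abbrev translateRight (W : Type u) [AddCommGroup W] [Module k W] :
    Env k 𝓖 →ₐ[k] Module.End k (W ⊗[k] Coind P.der) :=
  (Module.End.lTensorAlgHom k (Coind P.der) W).comp (Coind.translate P.der)

variable [FiniteDimensional k 𝔤]

set_option synthInstance.maxHeartbeats 200000 in
-- Vanishing principle with translations on the middle factor. Restricting that factor to the even
-- group turns the claim into coassociativity of λ.
theorem rTensor_comul_coaction (f : Coind P.der) :
    TensorProduct.assoc k (Coind P.der) (Coind P.der) A (P.comul.rTensor A (P.coaction f)) =
      P.coaction.lTensor (Coind P.der) (P.comul f) := by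
  let D : Env k 𝓖 →ₐ[k] Module.End k (Coind P.der ⊗[k] (Coind P.der ⊗[k] A)) :=
    (Module.End.lTensorAlgHom k (Coind P.der ⊗[k] A) (Coind P.der)).comp (P.translateLeft k A)
  have hD : ∀ u t, D u t =
      ((Coind.translate P.der u).rTensor A).lTensor (Coind P.der) t := fun _ _ => rfl
  let e := ((Coind.ev P.der 1).rTensor A).lTensor (Coind P.der)
  refine sub_eq_zero.1 (Coind.eq_zero_of_invariant D e (fun t ht => ?_)
    (fun f => TensorProduct.assoc k (Coind P.der) (Coind P.der) A
      (P.comul.rTensor A (P.coaction f)) - P.coaction.lTensor (Coind P.der) (P.comul f))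
    (fun {i v} hv f => ?_) (fun f => ?_) f)
  · refine lTensor_jointly_injective (φ := fun u => (Coind.ev P.der u).rTensor A)
      (fun m hm => Coind.eq_of_rTensor_ev fun u => by rw [hm, map_zero]) fun u => ?_
    refine Eq.trans ?_ (ht u)
    rw [hD]
    refine Eq.trans ?_ (LinearMap.lTensor_comp_apply _ _ _ _)
    rw [← LinearMap.rTensor_comp, Coind.ev_comp_translate, one_mul]
  · have ha : ∀ s : Coind P.der ⊗[k] A, D (Env.ι k 𝓖 v)
        (TensorProduct.assoc k (Coind P.der) (Coind P.der) A (P.comul.rTensor A s)) =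
        (Coind.parityPow P.der i).toLinearMap.rTensor (Coind P.der ⊗[k] A)
          (TensorProduct.assoc k (Coind P.der) (Coind P.der) A
            (P.comul.rTensor A ((Coind.translate P.der (Env.ι k 𝓖 v)).rTensor A s))) := by
      intro s
      rw [hD]
      refine (map_map_assoc_rTensor _ _ _ _ _).trans ?_
      have h1 : TensorProduct.map LinearMap.id (Coind.translate P.der (Env.ι k 𝓖 v)) ∘ₗ P.comul =
          ((Coind.parityPow P.der i).toLinearMap.rTensor (Coind P.der) ∘ₗ P.comul) ∘ₗ
            Coind.translate P.der (Env.ι k 𝓖 v) :=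
        LinearMap.ext fun g => P.lTensor_translate_comul hv g
      have h2 := map_map_assoc_rTensor (Coind.parityPow P.der i).toLinearMap LinearMap.id
        LinearMap.id P.comul ((Coind.translate P.der (Env.ι k 𝓖 v)).rTensor A s)
      rw [TensorProduct.map_id] at h2
      refine Eq.trans ?_ h2.symm
      rw [h1]
      exact congrArg _ (LinearMap.rTensor_comp_apply A _ _ s)
    have hb : D (Env.ι k 𝓖 v) (P.coaction.lTensor (Coind P.der) (P.comul f)) =
        (P.twist.flip (P.coactEnv (Env.ι k 𝓖 v))).lTensor (Coind P.der) (P.comul f) := by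
      rw [hD, ← LinearMap.lTensor_comp_apply]
      congr 2
      exact LinearMap.ext fun g => P.rTensor_translate_coaction _ g
    rw [map_sub, ha, hb, rTensor_translate_coaction, coactEnv_ι]
    obtain ⟨c, hc⟩ := P.coact_mem i v hv
    rw [← hc]
    clear hc ha hb
    induction c using TensorProduct.induction_on with
    | zero => simp
    | add s t hs ht =>
      convert Submodule.add_mem _ hs ht using 1
      simp only [map_add, LinearMap.lTensor_add, LinearMap.add_apply]
      abel
    | tmul y b =>
      -- Translating the defect of `f` by `v` gives defects of translates of `f`, modified by the
      -- parity twist on the first factor and by multiplication by S(b) on the last; neither touches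
      -- the middle factor.
      let κ : Module.End k (Coind P.der ⊗[k] (Coind P.der ⊗[k] A)) :=
        TensorProduct.map (Coind.parityPow P.der i).toLinearMap
          ((LinearMap.mulRight k (HopfAlgebra.antipode k b)).lTensor (Coind P.der))
      refine Submodule.subset_span ⟨κ, Coind.translate P.der (Env.ι k 𝓖 y) f,
        ⟨fun u t => ?_, fun t ht => ?_⟩, ?_⟩
      · rw [hD, hD, ← LinearMap.comp_apply, ← LinearMap.comp_apply, LinearMap.map_comp_lTensor,
          LinearMap.lTensor_comp_map, LinearMap.rTensor_comp_lTensor,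
          LinearMap.lTensor_comp_rTensor]
      · have he : ∀ t, e (κ t) = TensorProduct.map (Coind.parityPow P.der i).toLinearMap
            ((LinearMap.mulRight k (HopfAlgebra.antipode k b)).lTensor A) (e t) := by
          intro t
          rw [← LinearMap.comp_apply, ← LinearMap.comp_apply, LinearMap.map_comp_lTensor,
            LinearMap.lTensor_comp_map, LinearMap.rTensor_comp_lTensor,
            LinearMap.lTensor_comp_rTensor]
        rw [he, ht, map_zero]
      · rw [LinearMap.rTensor_tmul, LinearMap.rTensor_tmul, twist_tmul, mul_one_tmul_eq,
          show (𝓖 i).subtype y = (y : 𝔤) from rfl, map_sub]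
        congr 1
        · have h2 := map_map_assoc_rTensor (Coind.parityPow P.der i).toLinearMap LinearMap.id
            LinearMap.id P.comul ((LinearMap.mulRight k (HopfAlgebra.antipode k b)).lTensor
              (Coind P.der) (P.coaction (Coind.translate P.der (Env.ι k 𝓖 y) f)))
          rw [TensorProduct.map_id] at h2
          refine h2.trans ?_
          refine Eq.trans ?_ (map_map_assoc_rTensor _ LinearMap.id _ _ _).symm
          rw [← LinearMap.comp_apply (TensorProduct.map _ _), LinearMap.map_comp_lTensor,
            LinearMap.id_comp]
        · have h1 : P.twist.flip (Env.ι k 𝓖 y ⊗ₜ[k] b) =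
              ((LinearMap.mulRight k (HopfAlgebra.antipode k b)).lTensor (Coind P.der) ∘ₗ
                P.coaction) ∘ₗ Coind.translate P.der (Env.ι k 𝓖 y) :=
            LinearMap.ext fun g => (P.twist_tmul g _ b).trans (mul_one_tmul_eq _ _)
          rw [h1, LinearMap.lTensor_comp_apply, LinearMap.lTensor_comp_apply,
            P.lTensor_translate_comul y.2]
          exact (map_lTensor_rTensor _ _ _ _).symm
  · have h1 : ∀ s : Coind P.der ⊗[k] A,
        e (TensorProduct.assoc k (Coind P.der) (Coind P.der) A (P.comul.rTensor A s)) =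
        TensorProduct.assoc k (Coind P.der) A A (P.coaction.rTensor A s) := by
      intro s
      refine (map_map_assoc_rTensor _ _ _ _ _).trans ?_
      rw [show TensorProduct.map LinearMap.id (Coind.ev P.der 1) ∘ₗ P.comul = P.coaction from
        LinearMap.ext fun g => P.lTensor_ev_one_comul g]
      rfl
    have h2 : e (P.coaction.lTensor (Coind P.der) (P.comul f)) =
        (Coalgebra.comul (R := k) (A := A)).lTensor (Coind P.der) (P.coaction f) := by
      rw [← lTensor_ev_one_comul, ← LinearMap.lTensor_comp_apply]
      refine Eq.trans ?_ (LinearMap.lTensor_comp_apply _ _ _ _)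
      congr 2
      exact LinearMap.ext fun g => P.rTensor_ev_one_coaction g
    rw [map_sub, h1, h2, coaction_coassoc, sub_self]

/-- Vanishing principle with translations on the third factor, where evaluation at 1 reduces the
claim to `rTensor_comul_coaction`. The parity twists on the first two factors are absorbed in κ. -/
theorem comul_coassoc (f : Coind P.der) :
    TensorProduct.assoc k (Coind P.der) (Coind P.der) (Coind P.der)
      (P.comul.rTensor (Coind P.der) (P.comul f)) =
        P.comul.lTensor (Coind P.der) (P.comul f) := by
  let D : Env k 𝓖 →ₐ[k] Module.End k (Coind P.der ⊗[k] (Coind P.der ⊗[k] Coind P.der)) :=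
    (Module.End.lTensorAlgHom k (Coind P.der ⊗[k] Coind P.der) (Coind P.der)).comp
      (P.translateRight k (Coind P.der))
  have hD : ∀ u t, D u t =
      ((Coind.translate P.der u).lTensor (Coind P.der)).lTensor (Coind P.der) t := fun _ _ => rfl
  let e := ((Coind.ev P.der 1).lTensor (Coind P.der)).lTensor (Coind P.der)
  refine sub_eq_zero.1 (Coind.eq_zero_of_invariant D e (fun t ht => ?_)
    (fun f => TensorProduct.assoc k (Coind P.der) (Coind P.der) (Coind P.der)
      (P.comul.rTensor (Coind P.der) (P.comul f)) - P.comul.lTensor (Coind P.der) (P.comul f))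
    (fun {i v} hv f => ?_) (fun f => ?_) f)
  · refine lTensor_jointly_injective (φ := fun u => (Coind.ev P.der u).lTensor (Coind P.der))
      (fun m hm => Coind.eq_of_lTensor_ev fun u => by rw [hm, map_zero]) fun u => ?_
    refine Eq.trans ?_ (ht u)
    rw [hD]
    refine Eq.trans ?_ (LinearMap.lTensor_comp_apply _ _ _ _)
    rw [← LinearMap.lTensor_comp, Coind.ev_comp_translate, one_mul]
  · let κ : Module.End k (Coind P.der ⊗[k] (Coind P.der ⊗[k] Coind P.der)) :=
      TensorProduct.map (Coind.parityPow P.der i).toLinearMap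
        ((Coind.parityPow P.der i).toLinearMap.rTensor (Coind P.der))
    refine Submodule.subset_span ⟨κ, Coind.translate P.der (Env.ι k 𝓖 v) f,
      ⟨fun u t => ?_, fun t ht => ?_⟩, ?_⟩
    · rw [hD, hD, ← LinearMap.comp_apply, ← LinearMap.comp_apply, LinearMap.map_comp_lTensor,
        LinearMap.lTensor_comp_map, LinearMap.rTensor_comp_lTensor, LinearMap.lTensor_comp_rTensor]
    · have he : ∀ t, e (κ t) = TensorProduct.map (Coind.parityPow P.der i).toLinearMap
          ((Coind.parityPow P.der i).toLinearMap.rTensor A) (e t) := by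
        intro t
        rw [← LinearMap.comp_apply, ← LinearMap.comp_apply, LinearMap.map_comp_lTensor,
          LinearMap.lTensor_comp_map, LinearMap.rTensor_comp_lTensor,
          LinearMap.lTensor_comp_rTensor]
      rw [he, ht, map_zero]
    · rw [map_sub, map_sub, hD, hD]
      congr 1
      · have h1 : ∀ t : Coind P.der ⊗[k] Coind P.der,
            ((Coind.translate P.der (Env.ι k 𝓖 v)).lTensor (Coind P.der)).lTensor (Coind P.der)
            (TensorProduct.assoc k (Coind P.der) (Coind P.der) (Coind P.der)
              (P.comul.rTensor (Coind P.der) t)) =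
            TensorProduct.assoc k (Coind P.der) (Coind P.der) (Coind P.der)
              (P.comul.rTensor (Coind P.der)
                ((Coind.translate P.der (Env.ι k 𝓖 v)).lTensor (Coind P.der) t)) := by
          intro t
          refine (map_map_assoc_rTensor _ _ _ _ _).trans ?_
          rw [TensorProduct.map_id, LinearMap.id_comp, ← LinearMap.comp_apply (P.comul.rTensor _),
            LinearMap.rTensor_comp_lTensor]
        rw [h1, P.lTensor_translate_comul hv]
        refine Eq.trans ?_ (map_map_assoc_rTensor _ _ LinearMap.id _ _).symm
        rw [show TensorProduct.map (Coind.parityPow P.der i).toLinearMap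
            (Coind.parityPow P.der i).toLinearMap ∘ₗ P.comul =
              P.comul ∘ₗ (Coind.parityPow P.der i).toLinearMap from
          LinearMap.ext fun g => P.comul_parityPow i g]
        exact congrArg _ (LinearMap.rTensor_comp_apply _ _ _ _).symm
      · rw [← LinearMap.lTensor_comp_apply,
          show (Coind.translate P.der (Env.ι k 𝓖 v)).lTensor (Coind P.der) ∘ₗ P.comul =
            ((Coind.parityPow P.der i).toLinearMap.rTensor (Coind P.der) ∘ₗ P.comul) ∘ₗ
              Coind.translate P.der (Env.ι k 𝓖 v) from
            LinearMap.ext fun g => P.lTensor_translate_comul hv g,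
          LinearMap.lTensor_comp_apply, LinearMap.lTensor_comp_apply, P.lTensor_translate_comul hv]
        exact (map_lTensor_rTensor _ _ _ _).symm
  · have h1 : ∀ s : Coind P.der ⊗[k] Coind P.der,
        e (TensorProduct.assoc k (Coind P.der) (Coind P.der) (Coind P.der)
          (P.comul.rTensor (Coind P.der) s)) =
        TensorProduct.assoc k (Coind P.der) (Coind P.der) A
          (P.comul.rTensor A ((Coind.ev P.der 1).lTensor (Coind P.der) s)) := by
      intro s
      refine (map_map_assoc_rTensor _ _ _ _ _).trans ?_
      rw [TensorProduct.map_id, LinearMap.id_comp, ← LinearMap.comp_apply (P.comul.rTensor _),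
        LinearMap.rTensor_comp_lTensor]
    have h2 : e (P.comul.lTensor (Coind P.der) (P.comul f)) =
        P.coaction.lTensor (Coind P.der) (P.comul f) := by
      refine (LinearMap.lTensor_comp_apply _ _ _ _).symm.trans ?_
      congr 2
      exact LinearMap.ext fun g => P.lTensor_ev_one_comul g
    rw [map_sub, h1, h2, lTensor_ev_one_comul, rTensor_comul_coaction, sub_self]

theorem map_superMul {i : ZMod 2} {v : 𝔤} (hv : v ∈ 𝓖 i) (s t : Coind P.der ⊗[k] Coind P.der) :
    TensorProduct.map (Coind.parityPow P.der i).toLinearMap (Coind.translate P.der (Env.ι k 𝓖 v))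
      (superMul (Coind.grading P.der) s t) =
    superMul (Coind.grading P.der) (TensorProduct.map (Coind.parityPow P.der i).toLinearMap
      (Coind.translate P.der (Env.ι k 𝓖 v)) s) t +
    superMul (Coind.grading P.der) (TensorProduct.map (Coind.parityPow P.der i).toLinearMap
      (Coind.parityPow P.der i).toLinearMap s)
      (TensorProduct.map (Coind.parityPow P.der i).toLinearMap
        (Coind.translate P.der (Env.ι k 𝓖 v)) t) := by
  induction s, t using superTensor_induction (Coind.grading P.der) with
  | zero_left t => simp only [map_zero, LinearMap.zero_apply, add_zero]
  | zero_right t => simp only [map_zero, add_zero]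
  | add_left s s' t hs hs' =>
    simp only [map_add, LinearMap.add_apply, hs, hs']
    abel
  | add_right s t t' ht ht' =>
    simp only [map_add, ht, ht']
    abel
  | tmul i' j x y x' y' hy hx =>
    simp only [TensorProduct.map_tmul, AlgHom.toLinearMap_apply]
    rw [superMul_tmul_tmul _ _ hy hx, superMul_tmul_tmul _ _ (Coind.translate_mem (Env.ι_mem hv) hy) hx,
      Coind.parityPow_of_mem hy, Coind.parityPow_of_mem hx]
    simp only [Units.smul_def, map_zsmul, TensorProduct.map_tmul, TensorProduct.tmul_smul,
      ← TensorProduct.smul_tmul', LinearMap.smul_apply]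
    rw [superMul_tmul_tmul _ _ hy hx, Coind.translate_mul hv, AlgHom.toLinearMap_apply, map_mul,
      Coind.parityPow_of_mem hy, Coind.parityPow_of_mem hx]
    simp only [Units.smul_def, TensorProduct.tmul_add, mul_smul_comm, smul_mul_assoc,
      TensorProduct.tmul_smul, ← TensorProduct.smul_tmul', smul_add, smul_smul, add_mul, uzpow_add,
      Units.val_mul]
    congr 2
    · ring
    · ring

/-- The sign of the super tensor product involves the parity of the left element's second factor,
and an odd one vanishes at 1. -/
theorem lTensor_ev_one_superMul (s t : Coind P.der ⊗[k] Coind P.der) :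
    (Coind.ev P.der 1).lTensor (Coind P.der) (superMul (Coind.grading P.der) s t) =
      (Coind.ev P.der 1).lTensor (Coind P.der) s * (Coind.ev P.der 1).lTensor (Coind P.der) t := by
  induction s, t using superTensor_induction (Coind.grading P.der) with
  | zero_left t => simp only [map_zero, LinearMap.zero_apply, zero_mul]
  | zero_right t => simp only [map_zero, mul_zero]
  | add_left s s' t hs hs' =>
    simp only [map_add, LinearMap.add_apply, hs, hs', add_mul]
  | add_right s t t' ht ht' =>
    simp only [map_add, ht, ht', mul_add]
  | tmul i' j x y x' y' hy hx =>
    have h : ∀ f, Coind.ev P.der 1 f = Coind.evalOne P.der f := fun f => rfl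
    rw [superMul_tmul_tmul _ _ hy hx, Units.smul_def, map_zsmul, LinearMap.lTensor_tmul,
      LinearMap.lTensor_tmul, LinearMap.lTensor_tmul, Algebra.TensorProduct.tmul_mul_tmul, h, h, h,
      map_mul]
    rcases zmod_two_cases j with rfl | rfl
    · rw [zero_mul, uzpow_zero, Units.val_one, one_smul]
    · rw [Coind.evalOne_odd hy, zero_mul, TensorProduct.tmul_zero, smul_zero]

/-- Same principle on the second factor: the signed translation is a superderivation of the super
tensor product intertwined by μ, and at 1 the claim is multiplicativity of λ. -/
theorem comul_mul (f g : Coind P.der) :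
    P.comul (f * g) = superMul (Coind.grading P.der) (P.comul f) (P.comul g) := by
  let e := (Coind.ev P.der 1).lTensor (Coind P.der)
  have hD : ∀ u t, P.translateRight k (Coind P.der) u t =
      (Coind.translate P.der u).lTensor (Coind P.der) t := fun _ _ => rfl
  refine sub_eq_zero.1 (Coind.eq_zero_of_invariant (P.translateRight k (Coind P.der)) e
    (fun t ht => ?_) (fun x : Coind P.der × Coind P.der => P.comul (x.1 * x.2) -
      superMul (Coind.grading P.der) (P.comul x.1) (P.comul x.2))
    (fun {i v} hv x => ?_) (fun x => ?_) (f, g))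
  · refine Coind.eq_of_lTensor_ev fun u => ?_
    rw [map_zero]
    refine Eq.trans ?_ (ht u)
    rw [hD]
    refine Eq.trans ?_ (LinearMap.lTensor_comp_apply _ _ _ _)
    rw [Coind.ev_comp_translate, one_mul]
  · obtain ⟨f, g⟩ := x
    dsimp only
    let κ : Module.End k (Coind P.der ⊗[k] Coind P.der) :=
      (Coind.parityPow P.der i).toLinearMap.rTensor (Coind P.der)
    have hκ : Coind.Preserves (P.translateRight k (Coind P.der)) e κ := by
      refine ⟨fun u t => ?_, fun t ht => ?_⟩
      · rw [hD, hD, ← LinearMap.comp_apply, ← LinearMap.comp_apply, LinearMap.rTensor_comp_lTensor,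
          LinearMap.lTensor_comp_rTensor]
      · have he : e (κ t) = (Coind.parityPow P.der i).toLinearMap.rTensor A (e t) := by
          rw [← LinearMap.comp_apply, ← LinearMap.comp_apply, LinearMap.rTensor_comp_lTensor,
            LinearMap.lTensor_comp_rTensor]
        rw [he, ht, map_zero]
    have hd : ∀ t : Coind P.der ⊗[k] Coind P.der,
        P.translateRight k (Coind P.der) (Env.ι k 𝓖 v) t =
        κ (TensorProduct.map (Coind.parityPow P.der i).toLinearMap
          (Coind.translate P.der (Env.ι k 𝓖 v)) t) := by
      intro t
      rw [hD, ← LinearMap.comp_apply, LinearMap.rTensor_comp_map, Coind.parityPow_comp_self]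
      rfl
    set f' := Coind.translate P.der (Env.ι k 𝓖 v) f with hf'
    set g' := Coind.translate P.der (Env.ι k 𝓖 v) g with hg'
    have e1 : κ (P.comul (f' * g) - superMul (Coind.grading P.der) (P.comul f') (P.comul g)) +
        κ (P.comul (Coind.parityPow P.der i f * g') - superMul (Coind.grading P.der)
          (P.comul (Coind.parityPow P.der i f)) (P.comul g')) ∈
        Submodule.span k {t | ∃ κ, ∃ y : Coind P.der × Coind P.der,
          Coind.Preserves (P.translateRight k (Coind P.der)) e κ ∧
            t = κ (P.comul (y.1 * y.2) -
              superMul (Coind.grading P.der) (P.comul y.1) (P.comul y.2))} :=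
      add_mem (Submodule.subset_span ⟨κ, (f', g), hκ, rfl⟩)
        (Submodule.subset_span ⟨κ, (Coind.parityPow P.der i f, g'), hκ, rfl⟩)
    convert e1 using 1
    rw [hd, map_sub, comul_translate P hv, map_superMul P hv, comul_translate P hv,
      comul_translate P hv, comul_parityPow, Coind.translate_mul hv, ← map_add, map_add P.comul]
    congr 1
    abel
  · show e (P.comul (x.1 * x.2) - superMul (Coind.grading P.der) (P.comul x.1) (P.comul x.2)) = 0
    rw [map_sub, lTensor_ev_one_superMul, lTensor_ev_one_comul, lTensor_ev_one_comul,
      lTensor_ev_one_comul, coaction_mul, sub_self]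

end HarishChandraPair

end SHCP

end

noncomputable section

namespace SHCP

/-! ### The antipodes of U(𝔤) and of 𝒪(G), and the Hopf superalgebra structure -/

section

variable {k 𝔤 : Type u} [Field k] [CharZero k] [AddCommGroup 𝔤] [Module k 𝔤]
  {𝓖 : ZMod 2 → Submodule k 𝔤} [DirectSum.Decomposition 𝓖] [LieSuperalgebra k 𝓖]

theorem Env.antipode_parity (u : Env k 𝓖) :
    Env.antipode k 𝓖 (Env.parity k 𝓖 u) = Env.parity k 𝓖 (Env.antipode k 𝓖 u) := by
  induction u using Env.induction_left with
  | one => rw [map_one, Env.antipode_one, map_one]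
  | add u v hu hv => simp only [map_add, hu, hv]
  | smul c u hu => simp only [map_smul, hu]
  | @mul i x u hx hu =>
    rw [map_mul, Env.parity_ι hx, Units.smul_def, smul_mul_assoc, map_zsmul,
      Env.antipode_ι_mul hx, Env.antipode_ι_mul hx, hu, map_neg, map_mul, Env.parity_ι hx,
      Env.parity_parityPow, Units.smul_def, mul_smul_comm, smul_neg]

theorem Env.antipode_proj (i : ZMod 2) (u : Env k 𝓖) :
    Env.antipode k 𝓖 (Env.proj i u) = Env.proj i (Env.antipode k 𝓖 u) := by
  simp only [Env.proj, parityProj_apply, map_smul, map_add, Units.smul_def, map_zsmul,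
    AlgHom.toLinearMap_apply, Env.antipode_parity]

theorem Env.counit_ι_mul (x : 𝔤) (u : Env k 𝓖) : Env.counit k 𝓖 (Env.ι k 𝓖 x * u) = 0 := by
  rw [map_mul, show Env.counit k 𝓖 (Env.ι k 𝓖 x) = 0 from Env.lift_ι _ _ x, zero_mul]

/-- For a product xu the two terms of the comultiplication cancel: the antipode moves `x` to the
middle with a minus sign. In the mirror statement below, what remains is the supercommutator of `x`
with a scalar. -/
theorem Env.mul_antipode_rTensor_comul (u : Env k 𝓖) : LinearMap.mul' k (Env k 𝓖)
    ((Env.antipode k 𝓖).rTensor (Env k 𝓖) (Env.comul k 𝓖 u)) =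
      algebraMap k (Env k 𝓖) (Env.counit k 𝓖 u) := by
  induction u using Env.induction_left with
  | one =>
    rw [Env.comul_one, LinearMap.rTensor_tmul, Env.antipode_one, LinearMap.mul'_apply, mul_one,
      map_one, map_one]
  | add u v hu hv => simp only [map_add, hu, hv]
  | smul c u hu => rw [map_smul, map_smul, map_smul, map_smul, hu, smul_eq_mul, map_mul,
      ← Algebra.smul_def]
  | @mul i x u hx hu =>
    rw [Env.comul_ι_mul hx, Env.counit_ι_mul, map_zero]
    have hP : ∀ a, Env.antipode k 𝓖 (Env.parityPow k 𝓖 i a) =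
        Env.parityPow k 𝓖 i (Env.antipode k 𝓖 a) := fun a => by
      rcases zmod_two_cases i with rfl | rfl
      · rw [Env.parityPow_zero]; rfl
      · rw [Env.parityPow_one]; exact Env.antipode_parity a
    generalize Env.comul k 𝓖 u = t
    induction t using TensorProduct.induction_on with
    | zero => simp
    | add s t hs ht =>
      simp only [map_add] at *
      rw [add_add_add_comm, hs, ht, add_zero]
    | tmul a b =>
      simp only [map_add, TensorProduct.map_tmul, LinearMap.rTensor_tmul, LinearMap.mulLeft_apply,
        LinearMap.id_apply, LinearMap.mul'_apply, Env.antipode_ι_mul hx, hP]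
      noncomm_ring

theorem Env.mul_antipode_lTensor_comul (u : Env k 𝓖) : LinearMap.mul' k (Env k 𝓖)
    ((Env.antipode k 𝓖).lTensor (Env k 𝓖) (Env.comul k 𝓖 u)) =
      algebraMap k (Env k 𝓖) (Env.counit k 𝓖 u) := by
  induction u using Env.induction_left with
  | one =>
    rw [Env.comul_one, LinearMap.lTensor_tmul, Env.antipode_one, LinearMap.mul'_apply, mul_one,
      map_one, map_one]
  | add u v hu hv => simp only [map_add, hu, hv]
  | smul c u hu => rw [map_smul, map_smul, map_smul, map_smul, hu, smul_eq_mul, map_mul,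
      ← Algebra.smul_def]
  | @mul i x u hx hu =>
    have key : ∀ t : Env k 𝓖 ⊗[k] Env k 𝓖, LinearMap.mul' k (Env k 𝓖)
        ((Env.antipode k 𝓖).lTensor (Env k 𝓖)
          (TensorProduct.map (LinearMap.mulLeft k (Env.ι k 𝓖 x)) LinearMap.id t +
            TensorProduct.map (Env.parityPow k 𝓖 i) (LinearMap.mulLeft k (Env.ι k 𝓖 x)) t)) =
        Env.ι k 𝓖 x * LinearMap.mul' k (Env k 𝓖) ((Env.antipode k 𝓖).lTensor (Env k 𝓖) t) -
          Env.parityPow k 𝓖 i (LinearMap.mul' k (Env k 𝓖)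
            ((Env.antipode k 𝓖).lTensor (Env k 𝓖) t)) * Env.ι k 𝓖 x := by
      intro t
      induction t using TensorProduct.induction_on with
      | zero => simp
      | add s t hs ht =>
        simp only [map_add] at *
        rw [add_add_add_comm, hs, ht, mul_add, add_mul]
        abel
      | tmul a b =>
        simp only [map_add, TensorProduct.map_tmul, LinearMap.lTensor_tmul, LinearMap.mulLeft_apply,
          LinearMap.id_apply, LinearMap.mul'_apply, Env.antipode_ι_mul hx, Env.parityPow_mul]
        noncomm_ring
    rw [Env.comul_ι_mul hx, Env.counit_ι_mul, map_zero, key, hu, Algebra.algebraMap_eq_smul_one,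
      map_smul, Env.parityPow_of_mem Env.one_mem, mul_zero, uzpow_zero, one_smul, mul_smul_comm,
      smul_mul_assoc, mul_one, one_mul, sub_self]

end

namespace HarishChandraPair

variable {k A 𝔤 : Type u} [Field k] [CharZero k] [AddCommGroup 𝔤] [Module k 𝔤]
  [CommRing A] [HopfAlgebra k A]
  {𝓖 : ZMod 2 → Submodule k 𝔤} [DirectSum.Decomposition 𝓖] [LieSuperalgebra k 𝓖]

/-- The map `x ⊗ a ↦ S(f(x)) a`. -/
def twistedAntipode : (Env k 𝓖 →ₗ[k] A) →ₗ[k] Env k 𝓖 ⊗[k] A →ₗ[k] A where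
  toFun f := LinearMap.mul' k A ∘ₗ TensorProduct.map (HopfAlgebra.antipode k ∘ₗ f) LinearMap.id
  map_add' f g := by rw [LinearMap.comp_add, TensorProduct.map_add_left, LinearMap.comp_add]
  map_smul' c f := by
    rw [LinearMap.comp_smul, TensorProduct.map_smul_left, LinearMap.comp_smul, RingHom.id_apply]

theorem twistedAntipode_tmul (f : Env k 𝓖 →ₗ[k] A) (x : Env k 𝓖) (a : A) :
    twistedAntipode f (x ⊗ₜ a) = HopfAlgebra.antipode k (f x) * a := rfl

variable (P : HarishChandraPair k A 𝓖)

theorem coactEnv_proj (i : ZMod 2) (u : Env k 𝓖) : P.coactEnv (Env.proj i u) =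
    (Env.proj i).rTensor A (P.coactEnv u) := by
  rw [Env.proj, parityProj_apply, map_smul, map_add, Units.smul_def, map_zsmul,
    AlgHom.toLinearMap_apply, coactEnv_parity]
  generalize P.coactEnv u = t
  induction t using TensorProduct.induction_on with
  | zero => simp
  | add s t hs ht =>
    rw [map_add, map_add, ← hs, ← ht]
    simp only [smul_add]
    abel
  | tmul x a =>
    rw [LinearMap.rTensor_tmul, LinearMap.rTensor_tmul, parityProj_apply, Units.smul_def,
      ← TensorProduct.smul_tmul', TensorProduct.add_tmul, ← TensorProduct.smul_tmul']

/-- Write the antipode of zu as [z, ū] - zū. The commutator differentiates the coefficients of the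
action, the other term differentiates S(f(x)), and the Leibniz rule combines them. This makes the
antipode formula U(𝔤₀)-linear. -/
theorem twistedAntipode_even_mul (f : Coind P.der) (z : EvenLie k 𝓖) (u : Env k 𝓖) :
    twistedAntipode (Coind.toLin P.der f)
      (P.coactEnv (Env.antipode k 𝓖 (Env.ι k 𝓖 (EvenLie.incl k 𝓖 z) * u))) =
    P.der z (twistedAntipode (Coind.toLin P.der f) (P.coactEnv (Env.antipode k 𝓖 u))) := by
  rw [Env.antipode_ι_mul (EvenLie.incl_mem k 𝓖 z), Env.parityPow_zero, LinearMap.id_apply]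
  generalize Env.antipode k 𝓖 u = w
  have e : -(w * Env.ι k 𝓖 (EvenLie.incl k 𝓖 z)) =
      (Env.ι k 𝓖 (EvenLie.incl k 𝓖 z) * w - w * Env.ι k 𝓖 (EvenLie.incl k 𝓖 z)) -
        Env.ι k 𝓖 (EvenLie.incl k 𝓖 z) * w := by abel
  rw [e, map_sub P.coactEnv, coactEnv_comm, map_mul, coactEnv_ι]
  generalize P.coactEnv w = t
  induction t using TensorProduct.induction_on with
  | zero => simp
  | add s t hs ht =>
    rw [map_add (twistedAntipode _) s t, map_add (P.der z), ← hs, ← ht, ← map_add]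
    congr 1
    rw [map_add, mul_add]
    abel
  | tmul x a =>
    have key : twistedAntipode (Coind.toLin P.der f)
        ((Env.ι k 𝓖).rTensor A (P.coact (EvenLie.incl k 𝓖 z)) * x ⊗ₜ a) =
        LinearMap.mul' k A (TensorProduct.map
          (HopfAlgebra.antipode k ∘ₗ P.derProj.flip (Coind.toLin P.der f x)) LinearMap.id
            (P.coact (EvenLie.incl k 𝓖 z))) * a := by
      obtain ⟨c, hc⟩ := P.coact_mem 0 _ (EvenLie.incl_mem k 𝓖 z)
      rw [← hc]
      clear hc
      induction c using TensorProduct.induction_on with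
      | zero => simp
      | add s t hs ht => simp only [map_add, add_mul, hs, ht]
      | tmul y b =>
        have hy : Coind.toLin P.der f (Env.ι k 𝓖 y * x) = P.derProj y (Coind.toLin P.der f x) := by
          refine (Coind.even_of_ι (z := y) f x).trans ?_
          exact (LinearMap.congr_fun (P.derProj_incl y) _).symm
        rw [LinearMap.rTensor_tmul, LinearMap.rTensor_tmul, Algebra.TensorProduct.tmul_mul_tmul,
          twistedAntipode_tmul, show (𝓖 0).subtype y = (y : 𝔤) from rfl, hy,
          TensorProduct.map_tmul, LinearMap.mul'_apply, mul_assoc]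
        rfl
    rw [map_sub, key, antipode_derProj_mul, LinearMap.lTensor_tmul, twistedAntipode_tmul,
      twistedAntipode_tmul, Derivation.leibniz, smul_eq_mul, smul_eq_mul, neg_mul, sub_neg_eq_add,
      mul_comm a]
    rfl

/-- The antipode of `𝒪(G)`. -/
def antipode : Coind P.der →ₗ[k] Coind P.der :=
  ((LinearMap.lcomp k A (P.coactEnv.toLinearMap ∘ₗ Env.antipode k 𝓖)) ∘ₗ twistedAntipode ∘ₗ
    Coind.toLin P.der).codRestrict (coindSubmodule P.der)
      fun f => mem_coindSubmodule_iff.2 (P.twistedAntipode_even_mul f)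

theorem antipode_apply (f : Coind P.der) (u : Env k 𝓖) : Coind.toLin P.der (P.antipode f) u =
    twistedAntipode (Coind.toLin P.der f) (P.coactEnv (Env.antipode k 𝓖 u)) := rfl

theorem antipode_parity (f : Coind P.der) :
    P.antipode (Coind.parity P.der f) = Coind.parity P.der (P.antipode f) := by
  refine Coind.ext fun u => ?_
  show _ = Coind.toLin P.der (P.antipode f) (Env.parity k 𝓖 u)
  rw [antipode_apply, antipode_apply, Env.antipode_parity, coactEnv_parity]
  generalize P.coactEnv _ = t
  induction t using TensorProduct.induction_on with
  | zero => simp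
  | add s t hs ht => simp only [map_add, hs, ht]
  | tmul x a => rfl

theorem antipode_mem {i : ZMod 2} {f : Coind P.der} (hf : f ∈ Coind.grading P.der i) :
    P.antipode f ∈ Coind.grading P.der i := by
  rw [Coind.mem_grading] at *
  rw [← antipode_parity, hf, Units.smul_def, map_zsmul, Units.smul_def]

theorem ptInv_antipode {R : Type u} [CommRing R] [Algebra k R] (g : A →ₐ[k] R) (f : Coind P.der)
    (X : Env k 𝓖) : ptInv g (Coind.toLin P.der (P.antipode f) X) =
      evalAt g (Coind.toLin P.der f) (P.act (ptInv g) (Env.antipode k 𝓖 X)) := by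
  rw [antipode_apply]
  show g (HopfAlgebra.antipode k _) = evalAt g (Coind.toLin P.der f)
    (Algebra.TensorProduct.map (AlgHom.id k (Env k 𝓖)) (ptInv g) (P.coactEnv _))
  generalize P.coactEnv _ = t
  induction t using TensorProduct.induction_on with
  | zero => simp
  | add s t hs ht => simp only [map_add, hs, ht]
  | tmul x a =>
    rw [twistedAntipode_tmul, HopfAlgebra.antipode_mul_distrib, antipode_antipode, map_mul]
    rfl

theorem toLin_mul' (t : Coind P.der ⊗[k] Coind P.der) (u : Env k 𝓖) :
    Coind.toLin P.der (LinearMap.mul' k (Coind P.der) t) u =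
      LinearMap.mul' k A (koszulHom k 𝓖
        (TensorProduct.map (Coind.toLin P.der) (Coind.toLin P.der) t) (Env.comul k 𝓖 u)) := by
  induction t using TensorProduct.induction_on with
  | zero => simp
  | add s t hs ht => simp only [map_add, LinearMap.add_apply, hs, ht]
  | tmul f g => rfl

theorem mul'_rTensor_antipode_comul (a : A) : LinearMap.mul' k A (TensorProduct.map
    (HopfAlgebra.antipode k) LinearMap.id (Coalgebra.comul (R := k) a)) =
      algebraMap k A (Coalgebra.counit a) :=
  HopfAlgebra.mul_antipode_rTensor_comul_apply (R := k) a

theorem mul'_lTensor_antipode_comul (a : A) : LinearMap.mul' k A (TensorProduct.map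
    LinearMap.id (HopfAlgebra.antipode k) (Coalgebra.comul (R := k) a)) =
      algebraMap k A (Coalgebra.counit a) :=
  HopfAlgebra.mul_antipode_lTensor_comul_apply (R := k) a

/-- The map `x ⊗ a ↦ m((S ⊗ 1)(F x)) a`. -/
def mulAntipodeLeft (F : Env k 𝓖 →ₗ[k] A ⊗[k] A) : Env k 𝓖 ⊗[k] A →ₗ[k] A :=
  LinearMap.mul' k A ∘ₗ TensorProduct.map (LinearMap.mul' k A ∘ₗ
    TensorProduct.map (HopfAlgebra.antipode k) LinearMap.id ∘ₗ F) LinearMap.id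

theorem mulAntipodeLeft_tmul (F : Env k 𝓖 →ₗ[k] A ⊗[k] A) (x : Env k 𝓖) (a : A) :
    mulAntipodeLeft F (x ⊗ₜ a) = LinearMap.mul' k A
      (TensorProduct.map (HopfAlgebra.antipode k) LinearMap.id (F x)) * a := rfl

/-- The map `x ⊗ a ↦ m((1 ⊗ S)(F x)) a`. -/
def mulAntipodeRight (F : Env k 𝓖 →ₗ[k] A ⊗[k] A) : Env k 𝓖 ⊗[k] A →ₗ[k] A :=
  LinearMap.mul' k A ∘ₗ TensorProduct.map (LinearMap.mul' k A ∘ₗ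
    TensorProduct.map LinearMap.id (HopfAlgebra.antipode k) ∘ₗ F) LinearMap.id

theorem mulAntipodeRight_tmul (F : Env k 𝓖 →ₗ[k] A ⊗[k] A) (x : Env k 𝓖) (a : A) :
    mulAntipodeRight F (x ⊗ₜ a) = LinearMap.mul' k A
      (TensorProduct.map LinearMap.id (HopfAlgebra.antipode k) (F x)) * a := rfl

theorem mulAntipodeLeft_add (F F' : Env k 𝓖 →ₗ[k] A ⊗[k] A) :
    mulAntipodeLeft (F + F') = mulAntipodeLeft F + mulAntipodeLeft F' := by
  simp only [mulAntipodeLeft, LinearMap.comp_add, TensorProduct.map_add_left]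

theorem mulAntipodeRight_add (F F' : Env k 𝓖 →ₗ[k] A ⊗[k] A) :
    mulAntipodeRight (F + F') = mulAntipodeRight F + mulAntipodeRight F' := by
  simp only [mulAntipodeRight, LinearMap.comp_add, TensorProduct.map_add_left]

theorem mul'_koszulHom_rTensor_antipode (t : Coind P.der ⊗[k] Coind P.der) (X Y : Env k 𝓖) :
    LinearMap.mul' k A (koszulHom k 𝓖 (TensorProduct.map (Coind.toLin P.der) (Coind.toLin P.der)
      (P.antipode.rTensor (Coind P.der) t)) (X ⊗ₜ Y)) =
    mulAntipodeLeft (koszulHom k 𝓖 (TensorProduct.map (Coind.toLin P.der) (Coind.toLin P.der) t) ∘ₗ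
      (TensorProduct.mk k (Env k 𝓖) (Env k 𝓖)).flip Y) (P.coactEnv (Env.antipode k 𝓖 X)) := by
  induction t using TensorProduct.induction_on with
  | zero => simp [mulAntipodeLeft]
  | add s t hs ht =>
    simp only [map_add, LinearMap.add_apply, hs, ht, LinearMap.add_comp, mulAntipodeLeft_add]
  | tmul f g =>
    have hP : ∀ i, P.coactEnv (Env.antipode k 𝓖 (Env.parityPow k 𝓖 i X)) =
        (Env.parityPow k 𝓖 i).rTensor A (P.coactEnv (Env.antipode k 𝓖 X)) := fun i => by
      rcases zmod_two_cases i with rfl | rfl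
      · rw [Env.parityPow_zero]; exact (LinearMap.congr_fun (LinearMap.rTensor_id A _) _).symm
      · rw [Env.parityPow_one, AlgHom.toLinearMap_apply, Env.antipode_parity, coactEnv_parity]
    show LinearMap.mul' k A (koszulMap (Coind.toLin P.der (P.antipode f)) (Coind.toLin P.der g)
      (X ⊗ₜ Y)) = mulAntipodeLeft (koszulMap (Coind.toLin P.der f) (Coind.toLin P.der g) ∘ₗ
        (TensorProduct.mk k (Env k 𝓖) (Env k 𝓖)).flip Y) _
    simp only [koszulMap, LinearMap.sum_apply, TensorProduct.map_tmul, LinearMap.comp_apply,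
      map_sum, LinearMap.mul'_apply, antipode_apply, hP]
    generalize P.coactEnv _ = r
    induction r using TensorProduct.induction_on with
    | zero => simp
    | add s t hs ht => simp only [map_add, add_mul, Finset.sum_add_distrib, hs, ht]
    | tmul x a =>
      rw [mulAntipodeLeft_tmul]
      simp only [LinearMap.comp_apply, LinearMap.flip_apply, TensorProduct.mk_apply,
        LinearMap.sum_apply, TensorProduct.map_tmul, map_sum, LinearMap.mul'_apply,
        LinearMap.rTensor_tmul, twistedAntipode_tmul, Finset.sum_mul, LinearMap.id_apply]
      exact Finset.sum_congr rfl fun i _ => by ring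

theorem mul'_koszulHom_lTensor_antipode (t : Coind P.der ⊗[k] Coind P.der) (X Y : Env k 𝓖) :
    LinearMap.mul' k A (koszulHom k 𝓖 (TensorProduct.map (Coind.toLin P.der) (Coind.toLin P.der)
      (P.antipode.lTensor (Coind P.der) t)) (X ⊗ₜ Y)) =
    mulAntipodeRight (koszulHom k 𝓖 (TensorProduct.map (Coind.toLin P.der) (Coind.toLin P.der) t) ∘ₗ
      TensorProduct.mk k (Env k 𝓖) (Env k 𝓖) X) (P.coactEnv (Env.antipode k 𝓖 Y)) := by
  induction t using TensorProduct.induction_on with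
  | zero => simp [mulAntipodeRight]
  | add s t hs ht =>
    simp only [map_add, LinearMap.add_apply, hs, ht, LinearMap.add_comp, mulAntipodeRight_add]
  | tmul f g =>
    show LinearMap.mul' k A (koszulMap (Coind.toLin P.der f) (Coind.toLin P.der (P.antipode g))
      (X ⊗ₜ Y)) = mulAntipodeRight (koszulMap (Coind.toLin P.der f) (Coind.toLin P.der g) ∘ₗ
        TensorProduct.mk k (Env k 𝓖) (Env k 𝓖) X) _
    simp only [koszulMap, LinearMap.sum_apply, TensorProduct.map_tmul, LinearMap.comp_apply,
      map_sum, LinearMap.mul'_apply, antipode_apply, Env.antipode_proj, coactEnv_proj]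
    generalize P.coactEnv _ = r
    induction r using TensorProduct.induction_on with
    | zero => simp
    | add s t hs ht => simp only [map_add, mul_add, Finset.sum_add_distrib, hs, ht]
    | tmul x a =>
      rw [mulAntipodeRight_tmul]
      simp only [LinearMap.comp_apply, TensorProduct.mk_apply,
        LinearMap.sum_apply, TensorProduct.map_tmul, map_sum, LinearMap.mul'_apply,
        LinearMap.rTensor_tmul, twistedAntipode_tmul, Finset.sum_mul, LinearMap.id_apply]
      exact Finset.sum_congr rfl fun i _ => by ring

variable [FiniteDimensional k 𝔤]

/-- At a point g, the formulas for the antipode and for μ give f((g⁻¹.(g.X̄))Y) evaluated at g⁻¹g =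
e. The group actions cancel and a constant function remains. -/
theorem mul'_koszulHom_antipode_left (f : Coind P.der) (X Y : Env k 𝓖) :
    LinearMap.mul' k A (koszulHom k 𝓖 (TensorProduct.map (Coind.toLin P.der) (Coind.toLin P.der)
      (P.antipode.rTensor (Coind P.der) (P.comul f))) (X ⊗ₜ Y)) =
    algebraMap k A (Coalgebra.counit
      (Coind.toLin P.der f (Env.antipode k 𝓖 X * Y))) := by
  rw [mul'_koszulHom_rTensor_antipode]
  generalize Env.antipode k 𝓖 X = w
  let φ : Env k 𝓖 →ₗ[k] k :=
    Coalgebra.counit ∘ₗ Coind.toLin P.der (Coind.translate P.der Y f)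
  let Ψ : Env k 𝓖 ⊗[k] (A ⊗[k] A) →ₗ[k] A := TensorProduct.lid k A ∘ₗ TensorProduct.map φ
    (LinearMap.mul' k A ∘ₗ (HopfAlgebra.antipode k).rTensor A)
  have e1 : ∀ t : Env k 𝓖 ⊗[k] A, mulAntipodeLeft (koszulHom k 𝓖
      (TensorProduct.map (Coind.toLin P.der) (Coind.toLin P.der) (P.comul f)) ∘ₗ
        (TensorProduct.mk k (Env k 𝓖) (Env k 𝓖)).flip Y) t =
      Ψ (TensorProduct.assoc k (Env k 𝓖) A A (P.coactEnv.toLinearMap.rTensor A t)) := by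
    intro t
    induction t using TensorProduct.induction_on with
    | zero => simp
    | add s t hs ht => simp only [map_add, hs, ht]
    | tmul x a =>
      rw [mulAntipodeLeft_tmul, LinearMap.comp_apply, LinearMap.flip_apply, TensorProduct.mk_apply,
        koszulHom_comul, LinearMap.rTensor_tmul, AlgHom.toLinearMap_apply]
      generalize P.coactEnv x = s
      induction s using TensorProduct.induction_on with
      | zero => simp
      | add s t hs ht => simp only [map_add, TensorProduct.add_tmul, add_mul, hs, ht]
      | tmul y b =>
        rw [twistedComul_tmul, TensorProduct.assoc_tmul]
        show _ = TensorProduct.lid k A (φ y ⊗ₜ (HopfAlgebra.antipode k b * a))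
        rw [TensorProduct.lid_tmul, Algebra.smul_def]
        refine Eq.trans ?_ (congrArg (· * _) (mul'_rTensor_antipode_comul
          (Coind.toLin P.der (Coind.translate P.der Y f) y)))
        generalize Coalgebra.comul (R := k) (Coind.toLin P.der (Coind.translate P.der Y f) y) = t
        induction t using TensorProduct.induction_on with
        | zero => simp
        | add s t hs ht => simp only [map_add, add_mul, hs, ht]
        | tmul c d => simp; ring
  have e2 : ∀ t : Env k 𝓖 ⊗[k] A,
      Ψ ((Coalgebra.comul (R := k) (A := A)).lTensor (Env k 𝓖) t) = algebraMap k A (φ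
        (TensorProduct.rid k (Env k 𝓖) ((Coalgebra.counit (R := k) (A := A)).lTensor (Env k 𝓖) t))) := by
    intro t
    induction t using TensorProduct.induction_on with
    | zero => simp
    | add s t hs ht => simp only [map_add, hs, ht]
    | tmul x a =>
      rw [LinearMap.lTensor_tmul]
      show TensorProduct.lid k A (φ x ⊗ₜ LinearMap.mul' k A
        ((HopfAlgebra.antipode k).rTensor A (Coalgebra.comul (R := k) a))) = _
      rw [HopfAlgebra.mul_antipode_rTensor_comul_apply, TensorProduct.lid_tmul,
        LinearMap.lTensor_tmul, TensorProduct.rid_tmul, map_smul, smul_eq_mul, map_mul,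
        Algebra.smul_def, mul_comm]
  rw [e1, coactEnv_coassoc, e2, coactEnv_counit]
  rfl

/-- On this side the value at `g` is f((g.X)(g.Ȳ)) = f(g.(XȲ)) at the identity. The action does not
cancel, but it becomes trivial once the sum over Δ(u) reduces XȲ to a scalar. -/
theorem mul'_koszulHom_antipode_right (f : Coind P.der) (X Y : Env k 𝓖) :
    LinearMap.mul' k A (koszulHom k 𝓖 (TensorProduct.map (Coind.toLin P.der) (Coind.toLin P.der)
      (P.antipode.lTensor (Coind P.der) (P.comul f))) (X ⊗ₜ Y)) =
    TensorProduct.lid k A ((Coalgebra.counit ∘ₗ Coind.toLin P.der f).rTensor A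
      (P.coactEnv (X * Env.antipode k 𝓖 Y))) := by
  rw [mul'_koszulHom_lTensor_antipode, map_mul]
  generalize P.coactEnv (Env.antipode k 𝓖 Y) = t
  induction t using TensorProduct.induction_on with
  | zero => simp
  | add s t hs ht => simp only [map_add, mul_add, hs, ht]
  | tmul y a =>
    rw [mulAntipodeRight_tmul, LinearMap.comp_apply, TensorProduct.mk_apply, koszulHom_comul]
    generalize P.coactEnv X = s
    induction s using TensorProduct.induction_on with
    | zero => simp
    | add s t hs ht => simp only [map_add, add_mul, hs, ht]
    | tmul x b =>
      rw [twistedComul_tmul, Algebra.TensorProduct.tmul_mul_tmul, LinearMap.rTensor_tmul,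
        TensorProduct.lid_tmul, Algebra.smul_def, LinearMap.comp_apply, ← Coind.translate_apply]
      refine Eq.trans ?_ (congrArg (· * _) (mul'_lTensor_antipode_comul
        (Coind.toLin P.der (Coind.translate P.der y f) x)))
      generalize Coalgebra.comul (R := k) (Coind.toLin P.der (Coind.translate P.der y f) x) = t
      induction t using TensorProduct.induction_on with
      | zero => simp
      | add s t hs ht => simp only [map_add, add_mul, hs, ht]
      | tmul c d =>
        simp only [Algebra.TensorProduct.tmul_mul_tmul, TensorProduct.map_tmul,
          LinearMap.mul'_apply, HopfAlgebra.antipode_mul_distrib, antipode_antipode,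
          LinearMap.id_apply]
        ring

theorem toLin_algebraMap (c : k) (u : Env k 𝓖) :
    Coind.toLin P.der (algebraMap k (Coind P.der) c) u =
      algebraMap k A (c * Env.counit k 𝓖 u) := by
  rw [Algebra.algebraMap_eq_smul_one, map_smul, LinearMap.smul_apply, Coind.toLin_one, map_mul,
    ← Algebra.smul_def]
  rfl

/-- The product in 𝒪(G) is evaluation on Δ(u), so the pointwise formula on X ⊗ Y turns the axiom
into the antipode axiom of U(𝔤). -/
theorem mul_antipode_rTensor_comul (f : Coind P.der) : LinearMap.mul' k (Coind P.der)
    (P.antipode.rTensor (Coind P.der) (P.comul f)) =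
      algebraMap k (Coind P.der) (P.counit f) := by
  refine Coind.ext fun u => ?_
  rw [toLin_mul', toLin_algebraMap]
  have e : ∀ t : Env k 𝓖 ⊗[k] Env k 𝓖, LinearMap.mul' k A (koszulHom k 𝓖
      (TensorProduct.map (Coind.toLin P.der) (Coind.toLin P.der)
        (P.antipode.rTensor (Coind P.der) (P.comul f))) t) =
      algebraMap k A (Coalgebra.counit (Coind.toLin P.der f
        (LinearMap.mul' k (Env k 𝓖) ((Env.antipode k 𝓖).rTensor (Env k 𝓖) t)))) := by
    intro t
    induction t using TensorProduct.induction_on with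
    | zero => simp
    | add s t hs ht => simp only [map_add, hs, ht]
    | tmul X Y => exact P.mul'_koszulHom_antipode_left f X Y
  rw [e, Env.mul_antipode_rTensor_comul, Algebra.algebraMap_eq_smul_one (A := Env k 𝓖), map_smul, map_smul,
    smul_eq_mul, mul_comm]
  rfl

theorem mul_antipode_lTensor_comul (f : Coind P.der) : LinearMap.mul' k (Coind P.der)
    (P.antipode.lTensor (Coind P.der) (P.comul f)) =
      algebraMap k (Coind P.der) (P.counit f) := by
  refine Coind.ext fun u => ?_
  rw [toLin_mul', toLin_algebraMap]
  have e : ∀ t : Env k 𝓖 ⊗[k] Env k 𝓖, LinearMap.mul' k A (koszulHom k 𝓖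
      (TensorProduct.map (Coind.toLin P.der) (Coind.toLin P.der)
        (P.antipode.lTensor (Coind P.der) (P.comul f))) t) =
      TensorProduct.lid k A ((Coalgebra.counit ∘ₗ Coind.toLin P.der f).rTensor A (P.coactEnv
        (LinearMap.mul' k (Env k 𝓖) ((Env.antipode k 𝓖).lTensor (Env k 𝓖) t)))) := by
    intro t
    induction t using TensorProduct.induction_on with
    | zero => simp
    | add s t hs ht => simp only [map_add, hs, ht]
    | tmul X Y => exact P.mul'_koszulHom_antipode_right f X Y
  rw [e, Env.mul_antipode_lTensor_comul, Algebra.algebraMap_eq_smul_one (A := Env k 𝓖), map_smul, map_smul,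
    map_smul, map_one, Algebra.TensorProduct.one_def, LinearMap.rTensor_tmul,
    TensorProduct.lid_tmul, map_mul, Algebra.smul_def, Algebra.smul_def, mul_one, mul_comm]
  rfl

/-- The Hopf superalgebra `𝒪(G)`. -/
def hopf : HopfSuperalgebra k (Coind.grading P.der) where
  comul := P.comul
  counit := P.counit.toLinearMap
  coassoc := LinearMap.ext P.comul_coassoc
  rTensor_counit_comp_comul := LinearMap.ext P.rTensor_counit_comul
  lTensor_counit_comp_comul := LinearMap.ext P.lTensor_counit_comul
  comul_one := P.comul_one
  comul_mul f g := (congrArg _ (P.comul_mul f g)).trans (of_superMul _ _ _)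
  comul_mem := P.comul_mem
  counit_one := map_one P.counit
  counit_mul := map_mul P.counit
  counit_odd {f} hf := by
    show Coalgebra.counit (R := k) (Coind.evalOne P.der f) = 0
    rw [Coind.evalOne_odd hf, map_zero]
  antipode := P.antipode
  antipode_mem := P.antipode_mem
  mul_antipode_rTensor_comul := LinearMap.ext P.mul_antipode_rTensor_comul
  mul_antipode_lTensor_comul := LinearMap.ext P.mul_antipode_lTensor_comul

end HarishChandraPair

end SHCP

end

/-! ### The theorem -/

theorem mainTheorem7 {k A 𝔤 : Type u} [Field k] [CharZero k] [IsAlgClosed k]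
    [CommRing A] [HopfAlgebra k A] [Algebra.FiniteType k A]
    [AddCommGroup 𝔤] [Module k 𝔤] [FiniteDimensional k 𝔤]
    (𝓖 : ZMod 2 → Submodule k 𝔤) [DirectSum.Decomposition 𝓖] [SHCP.LieSuperalgebra k 𝓖]
    (P : SHCP.HarishChandraPair k A 𝓖) :
    ∃ (_ : SHCP.SuperCommutative k (SHCP.Coind.grading P.der))
      (S : SHCP.HopfSuperalgebra k (SHCP.Coind.grading P.der)),
      (∀ (R : Type u) [CommRing R] [Algebra k R] (g h : A →ₐ[k] R) (f : SHCP.Coind P.der)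
        (X Y : SHCP.Env k 𝓖),
        Algebra.TensorProduct.lift g h (fun _ _ => Commute.all _ _)
          (SHCP.koszulHom k 𝓖 (TensorProduct.map (SHCP.Coind.toLin P.der)
            (SHCP.Coind.toLin P.der) (S.comul f)) (X ⊗ₜ[k] Y)) =
          SHCP.HarishChandraPair.evalAt (SHCP.ptMul g h) (SHCP.Coind.toLin P.der f)
            (P.act (SHCP.ptInv h) X * Y ⊗ₜ[k] 1)) ∧
      (∀ (R : Type u) [CommRing R] [Algebra k R] (g : A →ₐ[k] R) (f : SHCP.Coind P.der)
        (X : SHCP.Env k 𝓖),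
        SHCP.ptInv g (SHCP.Coind.toLin P.der (S.antipode f) X) =
          SHCP.HarishChandraPair.evalAt g (SHCP.Coind.toLin P.der f)
            (P.act (SHCP.ptInv g) (SHCP.Env.antipode k 𝓖 X))) ∧
      (∀ f : SHCP.Coind P.der,
        S.counit f = Coalgebra.counit (SHCP.Coind.toLin P.der f 1)) ∧
      ∃ Φ : SHCP.SuperRingedSpace.Iso P.space (SHCP.superSpec (SHCP.Coind.grading P.der)),
        (∀ (x : PrimeSpectrum A) (f : SHCP.EvenPart (SHCP.Coind.grading P.der)),
          f ∈ PrimeSpectrum.asIdeal (R := SHCP.EvenPart (SHCP.Coind.grading P.der)) (Φ.base x) ↔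
            SHCP.Coind.toLin P.der (SHCP.EvenPart.incl _ f) 1 ∈ x.asIdeal) ∧
        ∀ (V : TopologicalSpace.Opens (PrimeSpectrum (SHCP.EvenPart (SHCP.Coind.grading P.der))))
          (f : SHCP.Coind P.der),
          Φ.sec V (SHCP.Sec.ofAlg (k := k) V f) = P.toSec _ f :=
  ⟨inferInstance, P.hopf, fun _ _ _ g h f X Y => P.lift_koszulHom_comul g h f X Y,
    fun _ _ _ g f X => P.ptInv_antipode g f X, fun _ => rfl, P.spaceIso, fun _ _ => Iff.rfl,
    fun _ f => SHCP.Coind.toCoindSec_ofAlg f⟩
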